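/- **Setting.** Let $R$ be a PID with field of fractions $K$, let $V$ be a $K$-vector space with a bilinear form $\omega$, and let $e_1,\dots,e_n,e_{\bar 1},\dots,e_{\bar n}$ be a symplectic basis of $V$ (so $\omega(e_i,e_j)=\omega(e_{\bar i},e_{\bar j})=0$ and $\omega(e_i,e_{\bar j})=-\omega(e_{\bar j},e_i)=\delta_{ij}$); thus $(V,\omega)$ is symplectic of genus $n$. The group $\mathrm{Sp}_{2n}(R)$ acts on $V$ through this basis. A subspace $W\subseteq V$ is symplectic if $\omega|_W$ is non-degenerate. The symplectic Steinberg module is $\mathrm{St}^\omega(V)=\widetilde H_{n-1}(\mathbb T^\omega(V);\mathbb Z)$, where $\mathbb T^\omega(V)$ is the simplicial complex of chains of nonzero isotropic subspaces of $V$, ordered by inclusion. For a subspace $W$ and $k\ge 0$, $\mathrm{Sh}_k(W)$ is the quotient of the free abelian group on the ordered tuples of $\dim W+k$ distinct lines spanning $W$ by the relations $[L_1,\dots,L_r]=\mathrm{sgn}(\sigma)[L_{\sigma(1)},\dots,L_{\sigma(r)}]$ for all permutations $\sigma$. A symbol with a repeated entry, or with an entry that is $0$ instead of a line, is understood to be $0$.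 **Theorem.** There is a resolution $$\cdots\to C_2\to C_1\to C_0\to \mathrm{St}^\omega(V)\to 0$$ of $\mathrm{St}^\omega(V)$ by $\mathbb Z[\mathrm{Sp}_{2n}(R)]$-modules such that: 1. $C_d=\bigoplus \mathrm{Sh}_{k_1}(W_1)\otimes_{\mathbb Z}\cdots\otimes_{\mathbb Z}\mathrm{Sh}_{k_m}(W_m)$, the sum being over all ordered direct sum decompositions $V=W_1\oplus\cdots\oplus W_m$ into nonzero, pairwise perpendicular symplectic subspaces and all integers $k_1,\dots,k_m\ge 0$ with $d=k_1+\cdots+k_m+n-m$ (so $1\le m\le n$ if $n\ge1$); the group acts by moving subspaces and lines. 2. For $d\ge1$ the differential $C_d\to C_{d-1}$ sends a simple tensor $[v^1_0,\dots,v^1_{d_1}]\otimes\cdots\otimes[v^m_0,\dots,v^m_{d_m}]$, where the $v^j_i$ are lines and the $j$-th factor spans $W_j$, to the sum of all of the following terms. * *Omit-terms:* for every $j$ and $i$ such that $v^j_0,\dots,\widehat{v^j_i},\dots,v^j_{d_j}$ still span $W_j$, the term $$(-1)^{(d_1-1)+\cdots+(d_{j-1}-1)+i}\,[v^1_0,\dots,v^1_{d_1}]\otimes\cdots\otimes[v^j_0,\dots,\widehat{v^j_i},\dots,v^j_{d_j}]\otimes\cdots\otimes[v^m_0,\dots,v^m_{d_m}].$$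 * *Split-terms:* for every $j$ and $i_0<\cdots<i_p$ such that the $v^j_i$ with $i\notin\{i_0,\dots,i_p\}$ span a proper nonzero symplectic subspace $X$ of $W_j$, the term $$(-1)^{\nu}\,[v^1_0,\dots,v^1_{d_1}]\otimes\cdots\otimes[v^j_0,\dots,\widehat{v^j_{i_0}},\dots,\widehat{v^j_{i_p}},\dots,v^j_{d_j}]\otimes[w_0,\dots,w_p]\otimes\cdots\otimes[v^m_0,\dots,v^m_{d_m}],$$ where $w_l$ is the image of $v^j_{i_l}$ under the projection of $W_j=X\oplus(X^\perp\cap W_j)$ onto $X^\perp\cap W_j$, and $$\nu=(d_1-1)+\cdots+(d_{j-1}-1)+p\,d_j+s+(d_{j+1}+\cdots+d_m),$$ where $s$ is $0$ or $1$ according to whether the shuffle permutation moving $v^j_{i_0},\dots,v^j_{i_p}$ to the first $p+1$ positions of $[v^j_0,\dots,v^j_{d_j}]$ is even or odd. Moreover, if $R$ has finitely many units, then tensoring this resolution with $\mathbb Q$ over $\mathbb Z$ gives a resolution of $\mathrm{St}^\omega(V)\otimes\mathbb Q$ by projective $\mathbb Q[\mathrm{Sp}_{2n}(R)]$-modules.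 -/

import Mathlib

open scoped TensorProduct DirectSum

noncomputable section

namespace SymplecticSharbly

section OrderComplex

variable (P : Type*) [PartialOrder P]

/-- The strictly increasing chains `p₀ < p₁ < ⋯ < p_{k-1}` with `k` elements in a poset, i.e. the
`(k - 1)`-simplices of its geometric realization (the empty simplex for `k = 0`). -/
def Chain (k : ℕ) : Type _ := {s : Fin k → P // StrictMono s}

variable {P} in
/-- The `i`-th face of a chain, omitting its `i`-th element. -/
def Chain.face {k : ℕ} (s : Chain P (k + 1)) (i : Fin (k + 1)) : Chain P k :=
  ⟨s.1 ∘ i.succAbove, s.2.comp i.strictMono_succAbove⟩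

/-- The augmented simplicial chain complex of the geometric realization of `P`, indexed by the
number of vertices, so that `ChainGroup P k` sits in dimension `k - 1`. -/
abbrev ChainGroup (k : ℕ) : Type _ := Chain P k →₀ ℤ

/-- The simplicial boundary map. -/
def boundary (k : ℕ) : ChainGroup P (k + 1) →ₗ[ℤ] ChainGroup P k :=
  Finsupp.linearCombination ℤ fun s : Chain P (k + 1) =>
    ∑ i : Fin (k + 1), (-1 : ℤ) ^ (i : ℕ) • Finsupp.single (s.face i) (1 : ℤ)

/-- Cycles of the augmented complex. -/
def cycles : (k : ℕ) → Submodule ℤ (ChainGroup P k)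
  | 0 => ⊤
  | k + 1 => LinearMap.ker (boundary P k)

/-- Boundaries of the augmented complex. -/
def boundaries (k : ℕ) : Submodule ℤ (ChainGroup P k) := LinearMap.range (boundary P k)

/-- The reduced homology group of the geometric realization of `P` in dimension `k - 1`. -/
abbrev ReducedHomology (k : ℕ) : Type _ :=
  cycles P k ⧸ (boundaries P k).submoduleOf (cycles P k)

/-- The action of order automorphisms of `P` on chains of `P`. -/
def Chain.map {P : Type*} [PartialOrder P] {k : ℕ} (f : P ≃o P) (s : Chain P k) : Chain P k :=
  ⟨f ∘ s.1, f.strictMono.comp s.2⟩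

/-- The action of order automorphisms of `P` on simplicial chains. -/
def chainRep (k : ℕ) : Representation ℤ (P ≃o P) (ChainGroup P k) where
  toFun f := Finsupp.lmapDomain ℤ ℤ (Chain.map f)
  map_one' := by
    exact Finsupp.lmapDomain_id ℤ ℤ
  map_mul' f g := by
    exact Finsupp.lmapDomain_comp ℤ ℤ (Chain.map g) (Chain.map f)

theorem boundary_chainRep (k : ℕ) (f : P ≃o P) (c : ChainGroup P (k + 1)) :
    boundary P k (chainRep P (k + 1) f c) = chainRep P k f (boundary P k c) := by
  have : boundary P k ∘ₗ chainRep P (k + 1) f = chainRep P k f ∘ₗ boundary P k := by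
    ext s : 1
    ext : 1
    change Finsupp.linearCombination ℤ _ (Finsupp.mapDomain (Chain.map f) (Finsupp.single s 1)) =
      Finsupp.mapDomain (Chain.map f) (Finsupp.linearCombination ℤ _ (Finsupp.single s 1))
    simp only [Finsupp.mapDomain_single, Finsupp.linearCombination_single, one_smul,
      Finsupp.smul_single, Finsupp.mapDomain_finsetSum]
    rfl
  exact LinearMap.congr_fun this c

theorem cycles_le (k : ℕ) (f : P ≃o P) : cycles P k ≤ (cycles P k).comap (chainRep P k f) := by
  cases k with
  | zero => exact fun _ _ => Submodule.mem_top
  | succ k =>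
    intro c hc
    change boundary P k _ = 0
    rw [boundary_chainRep, show boundary P k c = 0 from hc, map_zero]

/-- The action of order automorphisms of `P` on the reduced homology of its realization. -/
def homologyRep (k : ℕ) : Representation ℤ (P ≃o P) (ReducedHomology P k) :=
  ((chainRep P k).subrepresentation (cycles P k) (cycles_le P k)).quotient
    ((boundaries P k).submoduleOf (cycles P k)) (by
      rintro f ⟨c, hc⟩ ⟨b, rfl⟩
      exact ⟨chainRep P (k + 1) f b, boundary_chainRep P k f b⟩)

end OrderComplex

variable {K V : Type*} [Field K] [AddCommGroup V] [Module K V]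

section Steinberg

variable (ω : LinearMap.BilinForm K V)

/-- The group of form-preserving linear automorphisms of `(V, ω)`. -/
def Sp : Subgroup (V ≃ₗ[K] V) where
  carrier := {g | ∀ v w, ω (g v) (g w) = ω v w}
  one_mem' := fun _ _ => rfl
  mul_mem' := fun {g h} hg hh v w => (hg (h v) (h w)).trans (hh v w)
  inv_mem' := fun {g} hg v w => by
    have h := hg (g⁻¹ v) (g⁻¹ w)
    rw [← LinearEquiv.mul_apply, ← LinearEquiv.mul_apply, mul_inv_cancel] at h
    exact h.symm

/-- The poset of nonzero isotropic subspaces of `(V, ω)`, ordered by inclusion; its geometric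
realization is the symplectic Tits building. -/
abbrev TitsPoset : Type _ :=
  {U : Submodule K V // U ≠ ⊥ ∧ ∀ v ∈ U, ∀ w ∈ U, ω v w = 0}

variable {ω} in
/-- The image of a subspace under an element of the symplectic group. -/
def moveSubspace (g : Sp ω) (U : Submodule K V) : Submodule K V :=
  U.map (g.1 : V →ₗ[K] V)

variable {ω} in
theorem moveSubspace_one (U : Submodule K V) : moveSubspace (1 : Sp ω) U = U :=
  Submodule.map_id U

variable {ω} in
theorem moveSubspace_mul (g h : Sp ω) (U : Submodule K V) :
    moveSubspace (g * h) U = moveSubspace g (moveSubspace h U) :=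
  Submodule.map_comp (h.1 : V →ₗ[K] V) (g.1 : V →ₗ[K] V) U

variable {ω} in
theorem moveSubspace_ne_bot (g : Sp ω) {U : Submodule K V} (hU : U ≠ ⊥) :
    moveSubspace g U ≠ ⊥ := fun h =>
  hU (Submodule.map_injective_of_injective (f := (g.1 : V →ₗ[K] V)) g.1.injective
    (h.trans (Submodule.map_bot _).symm))

/-- The action of the symplectic group on the poset of nonzero isotropic subspaces. -/
def titsHom : Sp ω →* (TitsPoset ω ≃o TitsPoset ω) where
  toFun g :=
    { toFun := fun U => ⟨moveSubspace g U.1, moveSubspace_ne_bot g U.2.1, by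
        rintro _ ⟨v, hv, rfl⟩ _ ⟨w, hw, rfl⟩
        exact (g.2 v w).trans (U.2.2 v hv w hw)⟩
      invFun := fun U => ⟨moveSubspace g⁻¹ U.1, moveSubspace_ne_bot g⁻¹ U.2.1, by
        rintro _ ⟨v, hv, rfl⟩ _ ⟨w, hw, rfl⟩
        exact ((g⁻¹).2 v w).trans (U.2.2 v hv w hw)⟩
      left_inv := fun U => Subtype.ext (by
        change moveSubspace g⁻¹ (moveSubspace g U.1) = U.1
        rw [← moveSubspace_mul, inv_mul_cancel, moveSubspace_one])
      right_inv := fun U => Subtype.ext (by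
        change moveSubspace g (moveSubspace g⁻¹ U.1) = U.1
        rw [← moveSubspace_mul, mul_inv_cancel, moveSubspace_one])
      map_rel_iff' := fun {U U'} =>
        Submodule.map_le_map_iff_of_injective g.1.injective U.1 U'.1 }
  map_one' := by
    refine RelIso.ext fun U => Subtype.ext ?_
    exact moveSubspace_one U.1
  map_mul' g h := by
    refine RelIso.ext fun U => Subtype.ext ?_
    exact moveSubspace_mul g h U.1

/-- For `(V, ω)` of genus `n`, the symplectic Steinberg module: the reduced homology group in
dimension `n - 1` of the symplectic Tits building. -/
abbrev Steinberg (n : ℕ) : Type _ := ReducedHomology (TitsPoset ω) n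

/-- The action of the symplectic group on the symplectic Steinberg module. -/
def steinbergRep (n : ℕ) : Representation ℤ (Sp ω) (Steinberg ω n) :=
  (homologyRep (TitsPoset ω) n).comp (titsHom ω)

end Steinberg

section Sharbly

/-- An ordered spanning set of lines of `W` of size `dim W + k`. -/
structure LineTuple (W : Submodule K V) (k : ℕ) where
  size : ℕ
  line : Fin size → Submodule K V
  isLine : ∀ i, Module.finrank K (line i) = 1
  injective : Function.Injective line
  span : ⨆ i, line i = W
  size_eq : size = Module.finrank K W + k

/-- Reordering by a permutation. -/
def LineTuple.perm {W : Submodule K V} {k : ℕ} (x : LineTuple W k)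
    (σ : Equiv.Perm (Fin x.size)) : LineTuple W k where
  size := x.size
  line := x.line ∘ σ
  isLine i := x.isLine (σ i)
  injective := x.injective.comp σ.injective
  span := (σ.iSup_comp (g := x.line)).trans x.span
  size_eq := x.size_eq

/-- The relations `[L₁, …, L_r] = sgn(σ) [L_{σ(1)}, …, L_{σ(r)}]`. -/
def sharblyRelations (W : Submodule K V) (k : ℕ) : Submodule ℤ (LineTuple W k →₀ ℤ) :=
  Submodule.span ℤ {r | ∃ (x : LineTuple W k) (σ : Equiv.Perm (Fin x.size)),
    r = Finsupp.single x 1 - (Equiv.Perm.sign σ : ℤ) • Finsupp.single (x.perm σ) 1}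

/-- The degree-`k` term `Sh_k(W)` of the Sharbly resolution of `W`. -/
def Sh (W : Submodule K V) (k : ℕ) : Type _ := (LineTuple W k →₀ ℤ) ⧸ sharblyRelations W k

instance (W : Submodule K V) (k : ℕ) : AddCommGroup (Sh W k) :=
  inferInstanceAs (AddCommGroup ((LineTuple W k →₀ ℤ) ⧸ sharblyRelations W k))

/-- The class `[L₁, …, L_r]` in `Sh_k(W)`. -/
def sharbly {W : Submodule K V} {k : ℕ} (x : LineTuple W k) : Sh W k :=
  Submodule.Quotient.mk (p := sharblyRelations W k) (Finsupp.single x 1)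

theorem Sh.hom_ext {W : Submodule K V} {k : ℕ} {M : Type*} [AddCommGroup M]
    {f f' : Sh W k →ₗ[ℤ] M} (h : ∀ x, f (sharbly x) = f' (sharbly x)) : f = f' := by
  have key : f.toAddMonoidHom.comp (sharblyRelations W k).mkQ.toAddMonoidHom =
      f'.toAddMonoidHom.comp (sharblyRelations W k).mkQ.toAddMonoidHom := by
    ext x
    exact h x
  ext y
  obtain ⟨c, rfl⟩ := Submodule.Quotient.mk_surjective _ y
  exact DFunLike.congr_fun key c

variable {ω : LinearMap.BilinForm K V}

/-- The image of an ordered spanning set of lines of `W` under `g`; here `W' = gW`. -/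
def LineTuple.move (g : Sp ω) {W W' : Submodule K V} (h : moveSubspace g W = W') {k : ℕ}
    (x : LineTuple W k) : LineTuple W' k where
  size := x.size
  line i := moveSubspace g (x.line i)
  isLine i := (LinearEquiv.finrank_map_eq g.1 (x.line i)).trans (x.isLine i)
  injective := (Submodule.map_injective_of_injective g.1.injective).comp x.injective
  span := by
    refine (Submodule.map_iSup (g.1 : V →ₗ[K] V) x.line).symm.trans ?_
    rw [x.span]
    exact h
  size_eq := by
    rw [x.size_eq, ← h]
    congr 1
    exact (LinearEquiv.finrank_map_eq g.1 W).symm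

/-- The map `Sh_k(W) → Sh_k(W')` induced by `g`; here `W' = gW`. -/
def moveSh (g : Sp ω) {W W' : Submodule K V} (h : moveSubspace g W = W') (k : ℕ) :
    Sh W k →ₗ[ℤ] Sh W' k :=
  AddMonoidHom.toIntLinearMap <| LinearMap.toAddMonoidHom <| Submodule.mapQ
    (sharblyRelations W k) (sharblyRelations W' k) (Finsupp.lmapDomain ℤ ℤ (LineTuple.move g h)) (by
    refine Submodule.span_le.2 ?_
    rintro _ ⟨x, σ, rfl⟩
    refine Submodule.subset_span ⟨x.move g h, σ, ?_⟩
    rw [map_sub, map_smul, Finsupp.lmapDomain_apply, Finsupp.lmapDomain_apply,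
      Finsupp.mapDomain_single, Finsupp.mapDomain_single]
    rfl)

theorem moveSh_sharbly (g : Sp ω) {W W' : Submodule K V} (h : moveSubspace g W = W') {k : ℕ}
    (x : LineTuple W k) : moveSh g h k (sharbly x) = sharbly (x.move g h) := by
  change Submodule.Quotient.mk (Finsupp.lmapDomain ℤ ℤ (LineTuple.move g h) _) = _
  rw [Finsupp.lmapDomain_apply, Finsupp.mapDomain_single]
  rfl

theorem moveSh_one {W : Submodule K V} (h : moveSubspace (1 : Sp ω) W = W) (k : ℕ) :
    moveSh (1 : Sp ω) h k = LinearMap.id := by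
  refine Sh.hom_ext fun x => ?_
  refine (moveSh_sharbly _ _ _).trans (congrArg sharbly ?_)
  simp [LineTuple.move, moveSubspace_one]

theorem moveSh_mul (g g' : Sp ω) {W W' W'' : Submodule K V} (h : moveSubspace g W' = W'')
    (h' : moveSubspace g' W = W') (h'' : moveSubspace (g * g') W = W'') (k : ℕ) :
    moveSh (g * g') h'' k = moveSh g h k ∘ₗ moveSh g' h' k := by
  refine Sh.hom_ext fun x => ?_
  refine (moveSh_sharbly _ _ _).trans ?_
  change _ = moveSh g h k (moveSh g' h' k (sharbly x))
  rw [moveSh_sharbly, moveSh_sharbly]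
  simp [LineTuple.move, moveSubspace_mul]

end Sharbly

section Resolution

variable (ω : LinearMap.BilinForm K V)

/-- The indices of the direct sum in degree `d`, for `(V, ω)` of genus `n`: an ordered
decomposition `V = W₁ ⊕ ⋯ ⊕ W_m` into nonzero pairwise perpendicular symplectic subspaces and
integers `k₁, …, k_m ≥ 0` with `d = k₁ + ⋯ + k_m + n - m`. -/
@[ext]
structure Index (n d : ℕ) where
  m : ℕ
  W : Fin m → Submodule K V
  k : Fin m → ℕ
  ne_bot : ∀ i, W i ≠ ⊥
  symplectic : ∀ i, (ω.restrict (W i)).Nondegenerate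
  perp : ∀ i j, i ≠ j → ∀ x ∈ W i, ∀ y ∈ W j, ω x y = 0
  indep : iSupIndep W
  iSup_eq : ⨆ i, W i = ⊤
  degree : d + m = ∑ i, k i + n

/-- The degree-`d` term `⨁ Sh_{k₁}(W₁) ⊗ ⋯ ⊗ Sh_{k_m}(W_m)`. -/
abbrev Term (n d : ℕ) : Type _ := ⨁ x : Index ω n d, ⨂[ℤ] i : Fin x.m, Sh (x.W i) (x.k i)

open Classical in
/-- The inclusion of a summand. -/
def inclusion {n d : ℕ} (x : Index ω n d) :
    (⨂[ℤ] i : Fin x.m, Sh (x.W i) (x.k i)) →ₗ[ℤ] Term ω n d :=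
  DirectSum.lof ℤ (Index ω n d) (fun x => ⨂[ℤ] i : Fin x.m, Sh (x.W i) (x.k i)) x

/-- The simple tensor `[v¹₀, …, v¹_{d₁}] ⊗ ⋯ ⊗ [vᵐ₀, …, vᵐ_{d_m}]` in the summand of index `x`. -/
def simpleTensor {n d : ℕ} (x : Index ω n d) (s : ∀ i, LineTuple (x.W i) (x.k i)) : Term ω n d :=
  inclusion ω x (PiTensorProduct.tprod ℤ fun i => sharbly (s i))

variable {ω} in
theorem nondegenerate_moveSubspace (g : Sp ω) {W : Submodule K V}
    (hW : (ω.restrict W).Nondegenerate) : (ω.restrict (moveSubspace g W)).Nondegenerate := by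
  constructor
  · rintro ⟨_, x, hx, rfl⟩ h
    have : (⟨x, hx⟩ : W) = 0 := hW.1 _ fun y =>
      (g.2 x y).symm.trans (h ⟨g.1 y, y, y.2, rfl⟩)
    ext
    change g.1 x = 0
    rw [show x = 0 from congrArg Subtype.val this, map_zero]
  · rintro ⟨_, x, hx, rfl⟩ h
    have : (⟨x, hx⟩ : W) = 0 := hW.2 _ fun y =>
      (g.2 y x).symm.trans (h ⟨g.1 y, y, y.2, rfl⟩)
    ext
    change g.1 x = 0
    rw [show x = 0 from congrArg Subtype.val this, map_zero]

variable {ω} in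
/-- The action of the symplectic group on indices. -/
abbrev Index.move {n d : ℕ} (g : Sp ω) (x : Index ω n d) : Index ω n d where
  m := x.m
  W i := moveSubspace g (x.W i)
  k := x.k
  ne_bot i := moveSubspace_ne_bot g (x.ne_bot i)
  symplectic i := nondegenerate_moveSubspace g (x.symplectic i)
  perp := by
    rintro i j hij _ ⟨v, hv, rfl⟩ _ ⟨w, hw, rfl⟩
    exact (g.2 v w).trans (x.perp i j hij v hv w hw)
  indep := x.indep.map_orderIso (Submodule.orderIsoMapComap g.1)
  iSup_eq := by
    refine (Submodule.map_iSup (g.1 : V →ₗ[K] V) x.W).symm.trans ?_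
    rw [x.iSup_eq, Submodule.map_top]
    exact LinearEquiv.range g.1
  degree := x.degree

open Classical in
/-- The map induced by `g` on the degree-`d` term. -/
def moveTerm {n d : ℕ} (g : Sp ω) : Term ω n d →ₗ[ℤ] Term ω n d :=
  DirectSum.toModule ℤ (Index ω n d) (Term ω n d) fun x =>
    inclusion ω (x.move g) ∘ₗ
      PiTensorProduct.map fun i => moveSh g (rfl : moveSubspace g (x.W i) = _) (x.k i)

theorem moveTerm_inclusion {n d : ℕ} (g : Sp ω) (x : Index ω n d)
    (t : ⨂[ℤ] i : Fin x.m, Sh (x.W i) (x.k i)) :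
    moveTerm ω g (inclusion ω x t) = inclusion ω (x.move g)
      (PiTensorProduct.map (fun i => moveSh g (rfl : moveSubspace g (x.W i) = _) (x.k i)) t) := by
  classical
  simp only [moveTerm, inclusion]
  exact DirectSum.toModule_lof ℤ (M := fun x : Index ω n d =>
    ⨂[ℤ] i : Fin x.m, Sh (x.W i) (x.k i)) x t

theorem inclusion_congr {n d : ℕ} (x : Index ω n d) (W : Fin x.m → Submodule K V)
    (h₁ h₂ h₃ h₄ h₅ h₆) (hW : ∀ i, W i = x.W i)
    (g : Sp ω) (W₀ : Fin x.m → Submodule K V) (hg : ∀ i, moveSubspace g (W₀ i) = W i)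
    (hg' : ∀ i, moveSubspace g (W₀ i) = x.W i) (t : ⨂[ℤ] i : Fin x.m, Sh (W₀ i) (x.k i)) :
    inclusion ω (⟨x.m, W, x.k, h₁, h₂, h₃, h₄, h₅, h₆⟩ : Index ω n d)
      (PiTensorProduct.map (fun i => moveSh g (hg i) (x.k i)) t) =
    inclusion ω x (PiTensorProduct.map (fun i => moveSh g (hg' i) (x.k i)) t) := by
  obtain rfl : W = x.W := funext hW
  rfl

/-- The action of the symplectic group on the degree-`d` term. -/
def termRep (n d : ℕ) : Representation ℤ (Sp ω) (Term ω n d) where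
  toFun g := moveTerm ω g
  map_one' := by
    classical
    refine DirectSum.linearMap_ext ℤ fun x => LinearMap.ext fun t => ?_
    refine (moveTerm_inclusion ω 1 x t).trans ?_
    refine (inclusion_congr ω x _ _ _ _ _ _ _ (fun i => moveSubspace_one _) 1 x.W (fun _ => rfl)
      (fun i => moveSubspace_one _) t).trans ?_
    simp only [moveSh_one, PiTensorProduct.map_id]
    rfl
  map_mul' g h := by
    classical
    refine DirectSum.linearMap_ext ℤ fun x => LinearMap.ext fun t => ?_
    refine (moveTerm_inclusion ω (g * h) x t).trans ?_
    refine Eq.trans ?_ ((congrArg (moveTerm ω g) (moveTerm_inclusion ω h x t)).trans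
      (moveTerm_inclusion ω g (x.move h) _)).symm
    refine (inclusion_congr ω ((x.move h).move g) _ _ _ _ _ _ _
      (fun i => moveSubspace_mul g h _) (g * h) x.W (fun _ => rfl)
      (fun i => moveSubspace_mul g h _) t).trans ?_
    rw [← LinearMap.comp_apply (PiTensorProduct.map _), ← PiTensorProduct.map_comp]
    congr 2
    refine congrArg PiTensorProduct.map (funext fun i => ?_)
    exact moveSh_mul _ _ _ _ _ _

theorem termRep_simpleTensor {n d : ℕ} (g : Sp ω) (x : Index ω n d)
    (s : ∀ i, LineTuple (x.W i) (x.k i)) :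
    termRep ω n d g (simpleTensor ω x s) =
      simpleTensor ω (x.move g) fun i => (s i).move g rfl := by
  refine (moveTerm_inclusion ω g x _).trans ?_
  refine (congrArg (inclusion ω (x.move g)) (PiTensorProduct.map_tprod _ _)).trans ?_
  simp only [moveSh_sharbly]
  rfl

/-- The underlying list of lists of lines of a simple tensor. -/
def lists {n d : ℕ} (p : Σ x : Index ω n d, ∀ i, LineTuple (x.W i) (x.k i)) :
    List (List (Submodule K V)) :=
  List.ofFn fun i => List.ofFn (p.2 i).line

open Classical in
/-- The simple tensor in degree `d` with the given entries. It is zero if the entries do not form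
a simple tensor of degree `d` (for instance because a line is repeated, or because an entry is
the zero subspace and hence not a line). -/
def symbol {n d : ℕ} (L : List (List (Submodule K V))) : Term ω n d :=
  if h : ∃ p : Σ x : Index ω n d, ∀ i, LineTuple (x.W i) (x.k i), lists ω p = L then
    simpleTensor ω h.choose.1 h.choose.2
  else 0

theorem lists_injective {n d : ℕ} : Function.Injective (lists ω (n := n) (d := d)) := by
  rintro ⟨⟨m, W, k, h₁, h₂, h₃, h₄, h₅, h₆⟩, s⟩ ⟨⟨m', W', k', h₁', h₂', h₃', h₄', h₅', h₆'⟩, s'⟩ h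
  simp only [lists] at h
  dsimp only at s s'
  obtain ⟨hm, h⟩ := Sigma.mk.inj_iff.1 (List.ofFn_inj'.1 h)
  subst hm
  have hs : ∀ i, (⟨(s i).size, (s i).line⟩ : Σ N, Fin N → Submodule K V) =
      ⟨(s' i).size, (s' i).line⟩ := fun i =>
    List.ofFn_inj'.1 (congrFun (eq_of_heq h) i)
  have hW : W = W' := funext fun i => by
    rw [← (s i).span, ← (s' i).span]
    exact congrArg (fun q : Σ N, Fin N → Submodule K V => ⨆ j, q.2 j) (hs i)
  subst hW
  have hk : k = k' := funext fun i => by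
    have h1 := (s i).size_eq
    have h2 := (s' i).size_eq
    have h3 : (s i).size = (s' i).size := congrArg Sigma.fst (hs i)
    omega
  subst hk
  have : s = s' := funext fun i => by
    have := hs i
    revert this
    generalize s i = x
    generalize s' i = y
    intro hxy
    obtain ⟨N, f, _, _, _, _⟩ := x
    obtain ⟨N', f', _, _, _, _⟩ := y
    cases hxy
    rfl
  subst this
  rfl

/-- `symbol` recovers every simple tensor from its entries. -/
theorem symbol_lists {n d : ℕ} (x : Index ω n d) (s : ∀ i, LineTuple (x.W i) (x.k i)) :
    symbol ω (lists ω ⟨x, s⟩) = simpleTensor ω x s := by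
  have h : ∃ p : Σ x : Index ω n d, ∀ i, LineTuple (x.W i) (x.k i),
    lists ω p = lists ω ⟨x, s⟩ := ⟨_, rfl⟩
  have hc : h.choose = ⟨x, s⟩ := lists_injective ω h.choose_spec
  rw [symbol, dif_pos h, hc]

/-- The span of a list of lines. -/
def spanOf (l : List (Submodule K V)) : Submodule K V := ⨆ L ∈ l, L

/-- The image of the subspace `L` under the projection onto `X^⊥` along the symplectic
subspace `X`. -/
def projPerp (X L : Submodule K V) : Submodule K V := (L ⊔ X) ⊓ ω.orthogonal X

theorem mem_projPerp (X L : Submodule K V) (w : V) :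
    w ∈ projPerp ω X L ↔ (∃ v ∈ L, v - w ∈ X) ∧ ∀ x ∈ X, ω x w = 0 := by
  refine and_congr ⟨fun h => ?_, ?_⟩ LinearMap.BilinForm.mem_orthogonal_iff
  · obtain ⟨v, hv, x, hx, rfl⟩ := Submodule.mem_sup.1 h
    exact ⟨v, hv, by simpa using X.neg_mem hx⟩
  · rintro ⟨v, hv, hx⟩
    exact Submodule.mem_sup.2 ⟨v, hv, w - v, by simpa using X.neg_mem hx, by simp⟩

/-- The entries of `l` with positions in `S`, in their original order. -/
def chosen (l : List (Submodule K V)) (S : Finset (Fin l.length)) : List (Submodule K V) :=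
  ((List.finRange l.length).filter fun i => i ∈ S).map l.get

/-- The entries of `l` with positions not in `S`, in their original order. -/
def remaining (l : List (Submodule K V)) (S : Finset (Fin l.length)) : List (Submodule K V) :=
  ((List.finRange l.length).filter fun i => i ∉ S).map l.get

/-- The number of inversions of the shuffle permutation moving the positions in `S` to the front
(preserving the order inside `S` and inside its complement). -/
def shuffleInversions {N : ℕ} (S : Finset (Fin N)) : ℕ :=
  ((Finset.univ : Finset (Fin N × Fin N)).filter fun a => a.1 ∉ S ∧ a.2 ∈ S ∧ a.1 < a.2).card

/-- The number `d_j`, for the `j`-th factor `[v₀, …, v_{d_j}]`. -/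
def topIndex (l : List (Submodule K V)) : ℕ := l.length - 1

/-- The exponent `(d₁ - 1) + ⋯ + (d_{j-1} - 1)`, up to even numbers, from the factors before the
`j`-th one. -/
def leftExponent (A : List (List (Submodule K V))) : ℕ := (A.map fun l => topIndex l + 1).sum

/-- The exponent `d_{j+1} + ⋯ + d_m` from the factors after the `j`-th one. -/
def rightExponent (B : List (List (Submodule K V))) : ℕ := (B.map topIndex).sum

open Classical in
/-- The sum of all omit-terms of the simple tensor with entries `L`. -/
def omitTerms {n d : ℕ} (L : List (List (Submodule K V))) : Term ω n d :=
  ∑ j : Fin L.length, ∑ i : Fin (L.get j).length,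
    if spanOf ((L.get j).eraseIdx (i : ℕ)) = spanOf (L.get j) then
      (-1 : ℤ) ^ (leftExponent (L.take (j : ℕ)) + (i : ℕ)) •
        symbol ω (L.take (j : ℕ) ++ [(L.get j).eraseIdx (i : ℕ)] ++ L.drop ((j : ℕ) + 1))
    else 0

open Classical in
/-- The sum of all split-terms of the simple tensor with entries `L`. In a split-term of the
`j`-th factor, the entries with positions in `S = {i₀ < ⋯ < i_p}` are split off; those that remain
span a proper nonzero symplectic subspace `X` of `W_j`. -/
def splitTerms {n d : ℕ} (L : List (List (Submodule K V))) : Term ω n d :=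
  ∑ j : Fin L.length, ∑ S : Finset (Fin (L.get j).length),
    if spanOf (remaining (L.get j) S) ≠ ⊥ ∧
        spanOf (remaining (L.get j) S) ≠ spanOf (L.get j) ∧
        (ω.restrict (spanOf (remaining (L.get j) S))).Nondegenerate then
      (-1 : ℤ) ^ (leftExponent (L.take (j : ℕ)) + (S.card - 1) * topIndex (L.get j) +
          shuffleInversions S + rightExponent (L.drop ((j : ℕ) + 1))) •
        symbol ω (L.take (j : ℕ) ++ [remaining (L.get j) S,
          (chosen (L.get j) S).map (projPerp ω (spanOf (remaining (L.get j) S)))] ++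
          L.drop ((j : ℕ) + 1))
    else 0

end Resolution

section Lattice

/-- `e₁, …, e_n` (`b (Sum.inl i)`) and `ē₁, …, ē_n` (`b (Sum.inr i)`) form a symplectic basis. -/
structure IsSymplecticBasis {n : ℕ} (ω : LinearMap.BilinForm K V)
    (b : Module.Basis (Fin n ⊕ Fin n) K V) : Prop where
  inl_inl : ∀ i j, ω (b (Sum.inl i)) (b (Sum.inl j)) = 0
  inr_inr : ∀ i j, ω (b (Sum.inr i)) (b (Sum.inr j)) = 0
  inl_inr : ∀ i j, ω (b (Sum.inl i)) (b (Sum.inr j)) = if i = j then 1 else 0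
  inr_inl : ∀ i j, ω (b (Sum.inr i)) (b (Sum.inl j)) = if i = j then -1 else 0

variable {R : Type*} [CommRing R] [Algebra R K] {n : ℕ}

/-- The action of a symplectic matrix over `R` on `V` through the coordinates of `b`. -/
def matrixHom (R : Type*) [CommRing R] [Algebra R K] (b : Module.Basis (Fin n ⊕ Fin n) K V) :
    Matrix.symplecticGroup (Fin n) R →* (V ≃ₗ[K] V) :=
  (LinearMap.GeneralLinearGroup.generalLinearEquiv K V).toMonoidHom.comp <|
    MonoidHom.toHomUnits
      { toFun := fun A => Matrix.toLin b b (A.1.map (algebraMap R K))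
        map_one' := by simp [Matrix.map_one]; rfl
        map_mul' := fun A B => by
          simp [Matrix.map_mul, Matrix.toLin_mul b b b]; rfl }

theorem matrixHom_apply (b : Module.Basis (Fin n ⊕ Fin n) K V)
    (A : Matrix.symplecticGroup (Fin n) R) (v : V) :
    matrixHom R b A v = Matrix.toLin b b (A.1.map (algebraMap R K)) v := rfl

theorem matrixHom_mem {ω : LinearMap.BilinForm K V} {b : Module.Basis (Fin n ⊕ Fin n) K V}
    (hb : IsSymplecticBasis ω b) (A : Matrix.symplecticGroup (Fin n) R) :
    matrixHom R b A ∈ Sp ω := by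
  have hJ : LinearMap.BilinForm.toMatrix b ω = -Matrix.J (Fin n) K := by
    ext (i | i) (j | j) <;>
      simp [Matrix.J, hb.inl_inl, hb.inr_inr, hb.inl_inr, hb.inr_inl, Matrix.one_apply]
    split_ifs <;> simp
  have hA := SymplecticGroup.mem_iff'.1 (SymplecticGroup.map_mem A.2 (algebraMap R K))
  have key : ω.comp (Matrix.toLin b b (A.1.map (algebraMap R K)))
      (Matrix.toLin b b (A.1.map (algebraMap R K))) = ω := by
    apply (LinearMap.BilinForm.toMatrix b).injective
    rw [LinearMap.BilinForm.toMatrix_comp b b, LinearMap.toMatrix_toLin, hJ]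
    simp [hA]
  intro v w
  exact LinearMap.congr_fun (LinearMap.congr_fun key v) w

/-- The action of `Sp_{2n}(R)` on `(V, ω)` determined by a symplectic basis `b`, that is, the
action of the automorphism group of the symplectic `R`-module spanned by `b`. -/
def spHom (R : Type*) [CommRing R] [Algebra R K] {ω : LinearMap.BilinForm K V}
    {b : Module.Basis (Fin n ⊕ Fin n) K V} (hb : IsSymplecticBasis ω b) :
    Matrix.symplecticGroup (Fin n) R →* Sp ω :=
  (matrixHom R b).codRestrict (Sp ω) (matrixHom_mem hb)

/-- The extension of scalars `ℚ ⊗ M` of a representation over `ℤ`. -/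
def ratRep {G M : Type*} [Group G] [AddCommGroup M] (ρ : Representation ℤ G M) :
    Representation ℚ G (ℚ ⊗[ℤ] M) :=
  (Module.End.baseChangeHom ℤ ℚ M : Module.End ℤ M →* Module.End ℚ (ℚ ⊗[ℤ] M)).comp ρ

end Lattice

end SymplecticSharbly

end

/-!
The resolution and the symplectic Tits building are compared inside a larger complex.

All complexes consist of words `A₁ | ⋯ | A_m` whose factors are finite sets of subspaces of `V`.
A finite set of subspaces stands for the exterior product of its members, in an arbitrary but fixed
order, so that words form a basis of the tensor algebra of an exterior algebra. On words there is
the odd derivation `diff`, whose value on a single factor is the sum of two parts: the part of the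
simplicial boundary that does not change the span of the factor (`omitPart`), and the sum over all
proper nonzero symplectic spans `X` of subsets of the coproduct that sends the members contained in
`X` to the left, and the projections of the others to `X^⊥` to the right (`splitPart`). Its square
is zero (`diff_diff`), because the simplicial boundary has square zero, splitting is a chain map
(`splitPart_omitPart`), and splitting is coassociative (`splitPart_splitPart`); the latter holds
since projecting along `X` and then along `Z ≤ X^⊥` is projecting along `X ⊔ Z`.

The terms of the resolution are spanned by `totalWords`, the words of sets of lines with symplectic,
pairwise perpendicular spans whose sum is `V`: the embedding `toWords` takes a tensor product of
symbols to the product of the exterior products, up to the sign `twist`, which converts the signs of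
the omit-terms and split-terms into those of a derivation (`toWords_omitTerms_add_splitTerms`). A
chain `U₁ < ⋯ < U_m` of isotropic subspaces corresponds to the word with the single factor
`{V, U₁, …, U_m}`: the set `{U₁, …, U_m}` has no nonzero symplectic span, so nothing is split, and
only the `U_i` can be omitted without changing the span, so `diff` is the simplicial boundary up to
sign (`diff_chainToWords`).

Both complexes are contained in the one spanned by `starWords`, `totalWords` and `mixedWords`, and
both inclusions are equivalences (`relAcyclic_union_totalWords`, `relAcyclic_union_chainWords`). This
follows from four matchings of basis vectors (`relAcyclic_of_matching`), each of which adds an entry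
to a factor or splits a factor:
* adding a line of `(tot L)^⊥` to the last factor of `L | {(tot L)^⊥} ∪ B` cancels all `starWords`
  against each other, which leaves `totalWords`;
* in the order of the span `Y` of all lines of a word, a line in the radical of `Y` can be added if
  `Y` is degenerate, and if `Y` is symplectic and nonzero, then `L | {(tot L)^⊥} ∪ B` cancels against
  `L | B | {Y^⊥}`, or against `L | B` if `Y = V`; this leaves `isoWords`, the words with the single
  factor `{V} ∪ B` for a set `B` of lines with isotropic span;
* for sets that consist of a chain of isotropic subspaces and of lines contained in its members,
  adding a line of the smallest member of the chain leaves `isoWords`;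
* for the same sets, adding the span of the lines leaves the chains.

A factor with `r` members has degree `r - 1`. The words of the resolution have degree at least `n`,
since a symplectic subspace has dimension at least `2`, and those of chains have degree at most `n`,
since an isotropic subspace has dimension at most `n`. Hence all homology is in degree `n`, where it
is the cokernel of `C₁ → C₀` on one side, and the group of top-dimensional cycles of the building,
which is the Steinberg module, on the other (`ComparisonData`, `exists_augmentation`). The symplectic
group acts on all words and commutes with `diff`, so the identification is equivariant.

The words also form, up to sign, a basis of the terms of the resolution, and the group permutes them
up to sign. An element of `Sp_{2n}(R)` that fixes each line of a spanning set is determined by its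
eigenvalues on these lines. They are integral over `R` together with their inverses, hence units of
`R`. If there are only finitely many units, then stabilizers are finite (`finite_setOf_imageWord_eq`),
and averaging over them splits a free cover over `ℚ` (`projective_of_signed_permutation`). Exactness
is preserved because `ℚ` is flat over `ℤ`.
-/

noncomputable section

namespace SymplecticSharbly

/-! ### The exterior algebra of a free module on a linearly ordered set -/

section ExteriorCalculus

variable {k : Type*} [CommRing k] {α : Type*} [LinearOrder α]

variable (k α) in
/-- The exterior algebra of the free `k`-module on `α`, described through its basis of finite
subsets of `α`: the subset `{a₁ < ⋯ < a_r}` stands for `a₁ ∧ ⋯ ∧ a_r`. -/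
abbrev Ext : Type _ := Finset α →₀ k

/-- Exterior multiplication by `a` from the left. -/
def wedgeLeft (a : α) : Ext k α →ₗ[k] Ext k α :=
  Finsupp.linearCombination k fun A =>
    if a ∈ A then 0 else (-1 : k) ^ (A.filter (· < a)).card • Finsupp.single (insert a A) (1 : k)

theorem wedgeLeft_single_of_mem {a : α} {A : Finset α} (h : a ∈ A) :
    wedgeLeft a (Finsupp.single A (1 : k)) = 0 := by
  simp [wedgeLeft, h]

theorem wedgeLeft_single_of_notMem {a : α} {A : Finset α} (h : a ∉ A) :
    wedgeLeft a (Finsupp.single A (1 : k)) =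
      (-1 : k) ^ (A.filter (· < a)).card • Finsupp.single (insert a A) (1 : k) := by
  simp [wedgeLeft, h]

theorem wedgeLeft_single_of_lt {a : α} {A : Finset α} (h : ∀ b ∈ A, a < b) :
    wedgeLeft a (Finsupp.single A (1 : k)) = Finsupp.single (insert a A) (1 : k) := by
  rw [wedgeLeft_single_of_notMem fun ha => (h a ha).ne rfl,
    Finset.filter_false_of_mem fun b hb => (h b hb).not_gt]
  simp

theorem wedgeLeft_wedgeLeft_self (a : α) (x : Ext k α) : wedgeLeft a (wedgeLeft a x) = 0 := by
  have : wedgeLeft a ∘ₗ wedgeLeft a = (0 : Ext k α →ₗ[k] Ext k α) := by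
    refine Finsupp.lhom_ext' fun A => LinearMap.ext_ring ?_
    change wedgeLeft a (wedgeLeft a (Finsupp.single A (1 : k))) = 0
    by_cases h : a ∈ A
    · rw [wedgeLeft_single_of_mem h, map_zero]
    · rw [wedgeLeft_single_of_notMem h, map_smul,
        wedgeLeft_single_of_mem (Finset.mem_insert_self a A), smul_zero]
  exact LinearMap.congr_fun this x

theorem wedgeLeft_comm (a b : α) (x : Ext k α) :
    wedgeLeft a (wedgeLeft b x) = -wedgeLeft b (wedgeLeft a x) := by
  wlog hab : a < b generalizing a b
  · rcases lt_trichotomy a b with h | h | h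
    · exact this a b h
    · rw [h, wedgeLeft_wedgeLeft_self, neg_zero]
    · rw [this b a h, neg_neg]
  have : wedgeLeft a ∘ₗ wedgeLeft b = -(wedgeLeft b ∘ₗ wedgeLeft a : Ext k α →ₗ[k] Ext k α) := by
    refine Finsupp.lhom_ext' fun A => LinearMap.ext_ring ?_
    change wedgeLeft a (wedgeLeft b (Finsupp.single A (1 : k))) =
      -wedgeLeft b (wedgeLeft a (Finsupp.single A (1 : k)))
    by_cases ha : a ∈ A
    · rw [wedgeLeft_single_of_mem ha, map_zero, neg_zero]
      by_cases hb : b ∈ A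
      · rw [wedgeLeft_single_of_mem hb, map_zero]
      · rw [wedgeLeft_single_of_notMem hb, map_smul,
          wedgeLeft_single_of_mem (Finset.mem_insert_of_mem ha), smul_zero]
    · by_cases hb : b ∈ A
      · rw [wedgeLeft_single_of_mem hb, map_zero, wedgeLeft_single_of_notMem ha, map_smul,
          wedgeLeft_single_of_mem (Finset.mem_insert_of_mem hb), smul_zero, neg_zero]
      · rw [wedgeLeft_single_of_notMem ha, wedgeLeft_single_of_notMem hb, map_smul, map_smul,
          wedgeLeft_single_of_notMem (by simp [hab.ne, ha]),
          wedgeLeft_single_of_notMem (by simp [hab.ne', hb]),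
          Finset.filter_insert, Finset.filter_insert, if_neg hab.not_gt, if_pos hab,
          Finset.card_insert_of_notMem (by simp [ha]), Finset.insert_comm, smul_smul, smul_smul,
          ← neg_smul]
        congr 1
        ring
  exact LinearMap.congr_fun this x

/-- The exterior product `a₁ ∧ ⋯ ∧ a_r` of a list. -/
def wedge (l : List α) : Ext k α := l.foldr (fun a x => wedgeLeft a x) (Finsupp.single ∅ (1 : k))

@[simp] theorem wedge_nil : (wedge [] : Ext k α) = Finsupp.single ∅ (1 : k) := rfl

@[simp] theorem wedge_cons (a : α) (l : List α) : (wedge (a :: l) : Ext k α) = wedgeLeft a (wedge l) := rfl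

theorem wedge_sort (A : Finset α) : wedge (A.sort (· ≤ ·)) = Finsupp.single A (1 : k) := by
  induction A using Finset.induction_on_min with
  | empty => simp
  | insert a s h ih =>
    rw [Finset.sort_insert (· ≤ ·) (fun b hb => (h b hb).le) fun ha => (h a ha).ne rfl, wedge_cons,
      ih, wedgeLeft_single_of_lt h]

theorem Ext.induction {p : Ext k α → Prop} (x : Ext k α) (vac : p (Finsupp.single ∅ (1 : k)))
    (wedgeLeft : ∀ a x, p x → p (wedgeLeft a x)) (add : ∀ x y, p x → p y → p (x + y))
    (smul : ∀ (c : k) x, p x → p (c • x)) : p x := by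
  have h1 : ∀ A : Finset α, p (Finsupp.single A (1 : k)) := fun A => by
    induction A using Finset.induction_on_min with
    | empty => exact vac
    | insert a s h ih => rw [← wedgeLeft_single_of_lt h]; exact wedgeLeft _ _ ih
  induction x using Finsupp.induction_linear with
  | zero => simpa using smul 0 _ vac
  | add x y hx hy => exact add x y hx hy
  | single A c => simpa using smul c _ (h1 A)

/-- The exterior algebra is generated by `1` under the operators `wedgeLeft a`. -/
theorem Ext.hom_ext {M : Type*} [AddCommGroup M] [Module k M] {f g : Ext k α →ₗ[k] M}
    (vac : f (Finsupp.single ∅ (1 : k)) = g (Finsupp.single ∅ (1 : k)))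
    (step : ∀ a x, f x = g x → f (wedgeLeft a x) = g (wedgeLeft a x)) : f = g := by
  refine LinearMap.ext fun x => ?_
  induction x using Ext.induction with
  | vac => exact vac
  | wedgeLeft a x h => exact step a x h
  | add x y hx hy => rw [map_add, map_add, hx, hy]
  | smul c x h => rw [map_smul, map_smul, h]

section Lift

variable {M : Type*} [AddCommGroup M] [Module k M] (T : α → M →ₗ[k] M) (m₀ : M)

/-- The linear map out of the exterior algebra determined by pairwise anticommuting operators
`T a` of square zero and by the image `m₀` of `1`: exterior multiplication by `a` goes
to `T a`. -/
def Ext.lift : Ext k α →ₗ[k] M :=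
  Finsupp.linearCombination k fun A => (A.sort (· ≤ ·)).foldr (fun a m => T a m) m₀

@[simp] theorem Ext.lift_vac : Ext.lift T m₀ (Finsupp.single ∅ (1 : k)) = m₀ := by simp [Ext.lift]

variable {T}

theorem Ext.lift_wedgeLeft (hT : ∀ a b m, T a (T b m) = -T b (T a m)) (hT' : ∀ a m, T a (T a m) = 0)
    (a : α) (x : Ext k α) : Ext.lift T m₀ (wedgeLeft a x) = T a (Ext.lift T m₀ x) := by
  have h0 : ∀ (a : α) (A : Finset α), (∀ b ∈ A, a < b) →
      Ext.lift T m₀ (Finsupp.single (insert a A) (1 : k)) = T a (Ext.lift T m₀ (Finsupp.single A (1 : k))) := by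
    intro a A h
    rw [Ext.lift, Finsupp.linearCombination_single, Finsupp.linearCombination_single,
      Finset.sort_insert (· ≤ ·) (fun b hb => (h b hb).le) fun ha => (h a ha).ne rfl]
    simp
  have h1 : ∀ (A : Finset α) (a : α),
      Ext.lift T m₀ (wedgeLeft a (Finsupp.single A (1 : k))) =
        T a (Ext.lift T m₀ (Finsupp.single A (1 : k))) := fun A => by
    induction A using Finset.induction_on_min with
    | empty =>
      intro a
      rw [wedgeLeft_single_of_lt (by simp), h0 a ∅ (by simp)]
    | insert b s h ih =>
      intro a
      rcases lt_trichotomy a b with hab | rfl | hab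
      · have : ∀ c ∈ insert b s, a < c := by
          intro c hc
          rcases Finset.mem_insert.1 hc with rfl | hc
          · exact hab
          · exact hab.trans (h c hc)
        rw [wedgeLeft_single_of_lt this, h0 a _ this]
      · rw [wedgeLeft_single_of_mem (Finset.mem_insert_self _ _), map_zero, h0 _ _ h, hT']
      · have h2 : Ext.lift T m₀ (wedgeLeft b (wedgeLeft a (Finsupp.single s (1 : k)))) =
            T b (Ext.lift T m₀ (wedgeLeft a (Finsupp.single s (1 : k)))) := by
          by_cases ha : a ∈ s
          · rw [wedgeLeft_single_of_mem ha]; simp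
          · have : ∀ c ∈ insert a s, b < c := by
              intro c hc
              rcases Finset.mem_insert.1 hc with rfl | hc
              · exact hab
              · exact h c hc
            rw [wedgeLeft_single_of_notMem ha, map_smul, map_smul, map_smul, map_smul,
              wedgeLeft_single_of_lt this, h0 b _ this]
        rw [h0 _ _ h, ← wedgeLeft_single_of_lt h, wedgeLeft_comm, map_neg, h2, ih, hT a b]
  have : Ext.lift T m₀ ∘ₗ wedgeLeft a = T a ∘ₗ Ext.lift T m₀ :=
    Finsupp.lhom_ext' fun A => LinearMap.ext_ring (h1 A a)
  exact LinearMap.congr_fun this x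

end Lift

/-- The parity involution of the exterior algebra. -/
def parity : Ext k α →ₗ[k] Ext k α :=
  Finsupp.linearCombination k fun A => (-1 : k) ^ A.card • Finsupp.single A (1 : k)

omit [LinearOrder α] in
theorem parity_single (A : Finset α) :
    parity (Finsupp.single A (1 : k)) = (-1 : k) ^ A.card • Finsupp.single A (1 : k) := by
  simp [parity]

omit [LinearOrder α] in
@[simp] theorem parity_vac : parity (Finsupp.single (∅ : Finset α) (1 : k)) = Finsupp.single ∅ (1 : k) := by
  simp [parity]

theorem parity_wedgeLeft (a : α) (x : Ext k α) : parity (wedgeLeft a x) = -wedgeLeft a (parity x) := by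
  have : parity ∘ₗ wedgeLeft a = -(wedgeLeft a ∘ₗ parity : Ext k α →ₗ[k] Ext k α) := by
    refine Finsupp.lhom_ext' fun A => LinearMap.ext_ring ?_
    change parity (wedgeLeft a (Finsupp.single A (1 : k))) = -wedgeLeft a (parity (Finsupp.single A (1 : k)))
    by_cases ha : a ∈ A
    · rw [parity_single, map_smul, wedgeLeft_single_of_mem ha, map_zero, smul_zero, neg_zero]
    · rw [parity_single, map_smul, wedgeLeft_single_of_notMem ha, map_smul, parity_single,
        Finset.card_insert_of_notMem ha, smul_smul, smul_smul, ← neg_smul]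
      congr 1
      ring
  exact LinearMap.congr_fun this x

@[simp] theorem parity_parity (x : Ext k α) : parity (parity x) = x := by
  have : parity ∘ₗ parity = (LinearMap.id : Ext k α →ₗ[k] Ext k α) :=
    Ext.hom_ext (by simp) fun a x h => by
      simp only [LinearMap.comp_apply, LinearMap.id_apply] at h ⊢
      rw [parity_wedgeLeft, map_neg, parity_wedgeLeft, h, neg_neg]
  exact LinearMap.congr_fun this x

/-- Contraction with the functional that takes the value `1` on every `a`, i.e. the simplicial
boundary map. -/
def contract : Ext k α →ₗ[k] Ext k α :=
  LinearMap.snd k (Ext k α) (Ext k α) ∘ₗ Ext.lift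
    (fun a => (wedgeLeft a ∘ₗ LinearMap.fst k _ _).prod
      (LinearMap.fst k _ _ - wedgeLeft a ∘ₗ LinearMap.snd k _ _)) (Finsupp.single ∅ (1 : k), 0)

@[simp] theorem contract_vac : contract (Finsupp.single (∅ : Finset α) (1 : k)) = 0 := by
  simp [contract]

theorem contract_wedgeLeft (a : α) (x : Ext k α) :
    contract (wedgeLeft a x) = x - wedgeLeft a (contract x) := by
  obtain ⟨T, hc, hTa⟩ : ∃ T : α → (Ext k α × Ext k α) →ₗ[k] (Ext k α × Ext k α),
      (∀ y, contract y = (Ext.lift T (Finsupp.single ∅ (1 : k), 0) y).2) ∧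
      ∀ a m, T a m = (wedgeLeft a m.1, m.1 - wedgeLeft a m.2) :=
    ⟨_, fun _ => rfl, fun _ _ => rfl⟩
  have hT : ∀ a b m, T a (T b m) = -T b (T a m) := by
    rintro a b ⟨y, z⟩
    refine Prod.ext ?_ ?_
    · simp only [hTa, Prod.neg_mk]
      exact wedgeLeft_comm a b y
    · simp only [hTa, Prod.neg_mk, map_sub, wedgeLeft_comm b a]
      abel
  have hT' : ∀ a m, T a (T a m) = 0 := by
    rintro a ⟨y, z⟩
    simp [hTa, wedgeLeft_wedgeLeft_self]
  have h1 : ∀ y, (Ext.lift T (Finsupp.single ∅ (1 : k), 0) y).1 = y := fun y => by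
    have : LinearMap.fst k _ _ ∘ₗ Ext.lift T (Finsupp.single ∅ (1 : k), 0) =
        (LinearMap.id : Ext k α →ₗ[k] Ext k α) := by
      refine Ext.hom_ext (by simp) fun a x h => ?_
      simp only [LinearMap.comp_apply, LinearMap.id_apply, LinearMap.fst_apply] at h ⊢
      rw [Ext.lift_wedgeLeft _ hT hT', hTa, h]
    exact LinearMap.congr_fun this y
  rw [hc, Ext.lift_wedgeLeft _ hT hT', hc, hTa, h1]

theorem contract_contract (x : Ext k α) : contract (contract x) = 0 := by
  have : contract ∘ₗ contract = (0 : Ext k α →ₗ[k] Ext k α) :=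
    Ext.hom_ext (by simp) fun a x h => by
      simp only [LinearMap.comp_apply, LinearMap.zero_apply] at h ⊢
      rw [contract_wedgeLeft, map_sub, contract_wedgeLeft, h]
      simp
  exact LinearMap.congr_fun this x

theorem contract_parity (x : Ext k α) : contract (parity x) = -parity (contract x) := by
  have : contract ∘ₗ parity = -(parity ∘ₗ contract : Ext k α →ₗ[k] Ext k α) :=
    Ext.hom_ext (by simp) fun a x h => by
      simp only [LinearMap.comp_apply, LinearMap.neg_apply] at h ⊢
      rw [parity_wedgeLeft, map_neg, contract_wedgeLeft, contract_wedgeLeft, map_sub,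
        parity_wedgeLeft, h, map_neg]
  exact LinearMap.congr_fun this x

theorem contract_wedge (l : List α) :
    contract (wedge l : Ext k α) =
      ∑ i : Fin l.length, (-1 : k) ^ (i : ℕ) • wedge (l.eraseIdx (i : ℕ)) := by
  induction l with
  | nil => simp
  | cons a l ih =>
    rw [wedge_cons, contract_wedgeLeft, ih]
    simp only [List.length_cons, Fin.sum_univ_succ, Fin.val_zero, pow_zero, one_smul,
      List.eraseIdx_cons_zero, Fin.val_succ, List.eraseIdx_cons_succ, wedge_cons, map_sum, map_smul,
      sub_eq_add_neg, ← Finset.sum_neg_distrib]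
    congr 1
    refine Finset.sum_congr rfl fun i _ => ?_
    rw [pow_succ, mul_neg_one, neg_smul]

end ExteriorCalculus

/-! ### Coproducts of exterior algebras -/

section ExteriorCalculus

variable {k : Type*} [CommRing k] {α : Type*} [LinearOrder α]

theorem wedge_eq_zero_or {l : List α} :
    (¬l.Nodup ∧ (wedge l : Ext k α) = 0) ∨
      l.Nodup ∧ ∃ c : ℕ, (wedge l : Ext k α) = (-1 : k) ^ c • Finsupp.single l.toFinset (1 : k) := by
  induction l with
  | nil => exact Or.inr ⟨List.nodup_nil, 0, by simp⟩
  | cons a l ih =>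
    rcases ih with ⟨h, h'⟩ | ⟨h, c, h'⟩
    · exact Or.inl ⟨fun h2 => h (List.nodup_cons.1 h2).2, by rw [wedge_cons, h', map_zero]⟩
    · by_cases ha : a ∈ l
      · refine Or.inl ⟨fun h2 => (List.nodup_cons.1 h2).1 ha, ?_⟩
        rw [wedge_cons, h', map_smul, wedgeLeft_single_of_mem (List.mem_toFinset.2 ha), smul_zero]
      · refine Or.inr ⟨List.nodup_cons.2 ⟨ha, h⟩, c + (l.toFinset.filter (· < a)).card, ?_⟩
        rw [wedge_cons, h', map_smul, wedgeLeft_single_of_notMem (by simpa using ha), smul_smul,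
          List.toFinset_cons, pow_add]

theorem wedge_eq_zero {l : List α} (h : ¬l.Nodup) : (wedge l : Ext k α) = 0 := by
  rcases wedge_eq_zero_or (k := k) (l := l) with h' | h'
  · exact h'.2
  · exact absurd h'.1 h

theorem exists_wedge_eq {l : List α} (h : l.Nodup) :
    ∃ c : ℕ, (wedge l : Ext k α) = (-1 : k) ^ c • Finsupp.single l.toFinset (1 : k) := by
  rcases wedge_eq_zero_or (k := k) (l := l) with h' | h'
  · exact absurd h h'.1
  · exact h'.2

theorem parity_wedge (l : List α) : parity (wedge l : Ext k α) = (-1 : k) ^ l.length • wedge l := by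
  induction l with
  | nil => simp
  | cons a l ih =>
    rw [wedge_cons, parity_wedgeLeft, ih, map_smul, ← neg_smul, List.length_cons]
    congr 1
    ring

/-- The alternating behaviour of exterior products under all permutations follows from the
universal property of Mathlib's exterior algebra, which acts through the operators `wedgeLeft`. -/
theorem wedge_ofFn_comp_perm {r : ℕ} (v : Fin r → α) (σ : Equiv.Perm (Fin r)) :
    (wedge (List.ofFn (v ∘ σ)) : Ext k α) = ((Equiv.Perm.sign σ : ℤ) : k) • wedge (List.ofFn v) := by
  let φ : (α →₀ k) →ₗ[k] Module.End k (Ext k α) :=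
    Finsupp.linearCombination k fun a => wedgeLeft a
  have hφ : ∀ m, φ m * φ m = 0 := by
    intro m
    induction m using Finsupp.induction_linear with
    | zero => simp
    | single a c =>
      refine LinearMap.ext fun x => ?_
      simp [φ, wedgeLeft_wedgeLeft_self]
    | add x y hx hy =>
      have hxy : φ x * φ y + φ y * φ x = 0 := by
        clear hx hy
        induction x using Finsupp.induction_linear with
        | zero => simp
        | add x x' hx hx' =>
          rw [map_add, add_mul, mul_add, add_add_add_comm, hx, hx', add_zero]
        | single a c =>
          induction y using Finsupp.induction_linear with
          | zero => simp
          | add x x' hx hx' =>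
            rw [map_add, add_mul, mul_add, add_add_add_comm, hx, hx', add_zero]
          | single b c' =>
            refine LinearMap.ext fun x => ?_
            simp [φ, wedgeLeft_comm a b, smul_smul, mul_comm c c']
      rw [map_add, add_mul, mul_add, mul_add, hx, hy, zero_add, add_zero, hxy]
  let Φ := ExteriorAlgebra.lift k ⟨φ, hφ⟩
  have key : ∀ l : List α, Φ ((l.map fun a => ExteriorAlgebra.ι k (Finsupp.single a (1 : k))).prod)
      (Finsupp.single ∅ (1 : k)) = wedge l := by
    intro l
    induction l with
    | nil => simp
    | cons a l ih =>
      rw [List.map_cons, List.prod_cons, map_mul, Module.End.mul_apply, ih, wedge_cons]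
      simp [Φ, φ]
  have key' : ∀ w : Fin r → α, wedge (List.ofFn w) =
      Φ (ExteriorAlgebra.ιMulti k r fun i => Finsupp.single (w i) (1 : k)) (Finsupp.single ∅ (1 : k)) := by
    intro w
    rw [← key, ExteriorAlgebra.ιMulti_apply, List.map_ofFn]
    rfl
  rw [key', key']
  have := (ExteriorAlgebra.ιMulti k r).map_perm (fun i => Finsupp.single (v i) (1 : k)) σ
  refine (congrArg (fun z => Φ z (Finsupp.single ∅ (1 : k))) this).trans ?_
  rw [Units.smul_def, map_zsmul, ← Int.cast_smul_eq_zsmul k]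
  rfl

variable {β γ : Type*} [LinearOrder β] [LinearOrder γ]

/-- The homomorphism of exterior algebras induced by a map of bases. -/
def Ext.map (f : α → β) : Ext k α →ₗ[k] Ext k β :=
  Ext.lift (fun a => wedgeLeft (f a)) (Finsupp.single ∅ (1 : k))

theorem Ext.map_wedge (f : α → β) (l : List α) : Ext.map f (wedge l : Ext k α) = wedge (l.map f) := by
  induction l with
  | nil => simp [Ext.map]
  | cons a l ih =>
    rw [wedge_cons, Ext.map, Ext.lift_wedgeLeft _ (fun a b m => wedgeLeft_comm _ _ m)
      (fun a m => wedgeLeft_wedgeLeft_self _ m), ← Ext.map, ih, List.map_cons, wedge_cons]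

section Coproduct

instance : AddCommGroup (Ext k α ⊗[k] Ext k β) := TensorProduct.addCommGroup

variable (p : α → Prop) [DecidablePred p] (f : α → β)

/-- The coproduct of the exterior algebra induced by splitting the basis: the generators
satisfying `p` go to the left factor, the others are moved by `f` to the right factor. -/
def coprod : Ext k α →ₗ[k] Ext k α ⊗[k] Ext k β :=
  Ext.lift (fun a => if p a then TensorProduct.map (wedgeLeft a) LinearMap.id
    else TensorProduct.map parity (wedgeLeft (f a))) (Finsupp.single ∅ (1 : k) ⊗ₜ Finsupp.single ∅ (1 : k))

@[simp] theorem coprod_vac :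
    coprod p f (Finsupp.single ∅ (1 : k)) = Finsupp.single ∅ (1 : k) ⊗ₜ Finsupp.single ∅ (1 : k) := by
  simp [coprod]

theorem coprod_wedgeLeft (a : α) (x : Ext k α) :
    coprod p f (wedgeLeft a x) = if p a then
      TensorProduct.map (wedgeLeft a) LinearMap.id (coprod p f x)
    else TensorProduct.map parity (wedgeLeft (f a)) (coprod p f x) := by
  obtain ⟨T, hT0⟩ : ∃ T : α → Ext k α ⊗[k] Ext k β →ₗ[k] Ext k α ⊗[k] Ext k β, T = fun a =>
      if p a then TensorProduct.map (wedgeLeft a) LinearMap.id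
      else TensorProduct.map parity (wedgeLeft (f a)) := ⟨_, rfl⟩
  have hpos : ∀ a, p a → ∀ x y, T a (x ⊗ₜ y) = wedgeLeft a x ⊗ₜ y := by
    intro a ha x y
    simp [hT0, ha]
  have hneg : ∀ a, ¬p a → ∀ x y, T a (x ⊗ₜ y) = parity x ⊗ₜ wedgeLeft (f a) y := by
    intro a ha x y
    simp [hT0, ha]
  have hT : ∀ a b m, T a (T b m) = -T b (T a m) := by
    intro a b m
    induction m with
    | zero => simp
    | add x y hx hy => simp only [map_add, hx, hy, neg_add]
    | tmul x y =>
      by_cases ha : p a <;> by_cases hb : p b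
      · rw [hpos b hb, hpos a ha, hpos a ha, hpos b hb, wedgeLeft_comm a b,
          TensorProduct.neg_tmul]
      · rw [hneg b hb, hpos a ha, hpos a ha, hneg b hb, parity_wedgeLeft,
          TensorProduct.neg_tmul, neg_neg]
      · rw [hpos b hb, hneg a ha, hneg a ha, hpos b hb, parity_wedgeLeft,
          TensorProduct.neg_tmul]
      · rw [hneg b hb, hneg a ha, hneg a ha, hneg b hb, wedgeLeft_comm (f a) (f b),
          TensorProduct.tmul_neg]
  have hT' : ∀ a m, T a (T a m) = 0 := by
    intro a m
    induction m with
    | zero => simp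
    | add x y hx hy => simp only [map_add, hx, hy, add_zero]
    | tmul x y =>
      by_cases ha : p a
      · rw [hpos a ha, hpos a ha, wedgeLeft_wedgeLeft_self, TensorProduct.zero_tmul]
      · rw [hneg a ha, hneg a ha, wedgeLeft_wedgeLeft_self, TensorProduct.tmul_zero]
  rw [coprod, ← hT0, Ext.lift_wedgeLeft _ hT hT', hT0]
  split_ifs with h
  · simp only [h, if_true]
  · simp only [h, if_false]

theorem coprod_wedgeLeft_of_pos {a : α} (h : p a) (x : Ext k α) : coprod p f (wedgeLeft a x) =
    TensorProduct.map (wedgeLeft a) LinearMap.id (coprod p f x) := by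
  rw [coprod_wedgeLeft, if_pos h]

theorem coprod_wedgeLeft_of_neg {a : α} (h : ¬p a) (x : Ext k α) : coprod p f (wedgeLeft a x) =
    TensorProduct.map parity (wedgeLeft (f a)) (coprod p f x) := by
  rw [coprod_wedgeLeft, if_neg h]

/-- The number of pairs of positions in `l` such that the entry at the second position, but not
the entry at the first one, satisfies `p`. -/
def inversions : List α → ℕ
  | [] => 0
  | a :: l => inversions l + if p a then 0 else (l.filter p).length

theorem coprod_wedge (l : List α) : coprod p f (wedge l : Ext k α) =
    (-1 : k) ^ inversions p l •
      wedge (l.filter p) ⊗ₜ[k] wedge ((l.filter fun a => ¬p a).map f) := by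
  induction l with
  | nil => simp [inversions]
  | cons a l ih =>
    rw [wedge_cons]
    by_cases h : p a
    · rw [coprod_wedgeLeft_of_pos p f h, ih, map_smul, TensorProduct.map_tmul]
      simp [h, inversions]
    · rw [coprod_wedgeLeft_of_neg p f h, ih, map_smul, TensorProduct.map_tmul, parity_wedge]
      simp [h, inversions, pow_add, TensorProduct.smul_tmul', smul_smul]

theorem coprod_parity (x : Ext k α) :
    coprod p f (parity x) = TensorProduct.map parity parity (coprod p f x) := by
  induction x using Ext.induction with
  | vac => simp
  | add x y hx hy => simp only [map_add, hx, hy]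
  | smul c x h => simp only [map_smul, h]
  | wedgeLeft a x h =>
    rw [parity_wedgeLeft, map_neg]
    by_cases hp : p a
    · rw [coprod_wedgeLeft_of_pos p f hp, coprod_wedgeLeft_of_pos p f hp, h]
      generalize coprod p f x = m
      induction m with
      | zero => simp
      | add x y hx hy => simp only [map_add, neg_add, hx, hy]
      | tmul x y => simp [parity_wedgeLeft, TensorProduct.neg_tmul]
    · rw [coprod_wedgeLeft_of_neg p f hp, coprod_wedgeLeft_of_neg p f hp, h]
      generalize coprod p f x = m
      induction m with
      | zero => simp
      | add x y hx hy => simp only [map_add, neg_add, hx, hy]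
      | tmul x y => simp [parity_wedgeLeft, TensorProduct.tmul_neg]

/-- The coproduct is a chain map for the simplicial boundary map. -/
theorem coprod_contract (x : Ext k α) : coprod p f (contract x) =
    TensorProduct.map contract LinearMap.id (coprod p f x) +
      TensorProduct.map parity contract (coprod p f x) := by
  induction x using Ext.induction with
  | vac => simp
  | add x y hx hy => simp only [map_add, hx, hy]; abel
  | smul c x h => simp only [map_smul, h, smul_add]
  | wedgeLeft a x h =>
    rw [contract_wedgeLeft, map_sub]
    by_cases hp : p a
    · rw [coprod_wedgeLeft_of_pos p f hp, coprod_wedgeLeft_of_pos p f hp, h]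
      generalize coprod p f x = m
      refine LinearMap.congr_fun (f := LinearMap.id -
        TensorProduct.map (wedgeLeft a) LinearMap.id ∘ₗ
          (TensorProduct.map contract LinearMap.id + TensorProduct.map parity contract))
        (g := (TensorProduct.map contract LinearMap.id + TensorProduct.map parity contract) ∘ₗ
          TensorProduct.map (wedgeLeft a) LinearMap.id) (TensorProduct.ext' fun x y => ?_) m
      simp only [LinearMap.sub_apply, LinearMap.comp_apply, LinearMap.add_apply,
        TensorProduct.map_tmul, LinearMap.id_apply, parity_wedgeLeft, map_add, contract_wedgeLeft,
        TensorProduct.neg_tmul, TensorProduct.sub_tmul]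
      abel
    · rw [coprod_wedgeLeft_of_neg p f hp, coprod_wedgeLeft_of_neg p f hp, h]
      generalize coprod p f x = m
      refine LinearMap.congr_fun (f := LinearMap.id -
        TensorProduct.map parity (wedgeLeft (f a)) ∘ₗ
          (TensorProduct.map contract LinearMap.id + TensorProduct.map parity contract))
        (g := (TensorProduct.map contract LinearMap.id + TensorProduct.map parity contract) ∘ₗ
          TensorProduct.map parity (wedgeLeft (f a))) (TensorProduct.ext' fun x y => ?_) m
      simp only [LinearMap.sub_apply, LinearMap.comp_apply, LinearMap.add_apply,
        TensorProduct.map_tmul, LinearMap.id_apply, map_add, contract_wedgeLeft, contract_parity,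
        parity_parity, TensorProduct.neg_tmul, TensorProduct.tmul_sub]
      abel

/-- Coassociativity: splitting off the generators satisfying `q` and then those among them
satisfying `p` is the same as splitting off those satisfying `p` first, and those satisfying `q`
afterwards. -/
theorem coprod_coassoc (q : α → Prop) [DecidablePred q] (g : α → γ) (r : β → Prop)
    [DecidablePred r] (h : β → γ) (hpq : ∀ a, p a → q a) (hr : ∀ a, ¬p a → (r (f a) ↔ q a))
    (hh : ∀ a, ¬q a → h (f a) = g a) (x : Ext k α) :
    TensorProduct.assoc k _ _ _
        (TensorProduct.map (coprod p f) LinearMap.id (coprod q g x)) =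
      TensorProduct.map LinearMap.id (coprod r h) (coprod p f x) := by
  induction x using Ext.induction with
  | vac => simp
  | add x y hx hy => simp only [map_add, hx, hy]
  | smul c x h => simp only [map_smul, h]
  | wedgeLeft a x ih =>
    by_cases hp : p a
    · rw [coprod_wedgeLeft_of_pos p f hp, coprod_wedgeLeft_of_pos q g (hpq a hp)]
      trans TensorProduct.map (wedgeLeft a) LinearMap.id
        (TensorProduct.map LinearMap.id (coprod r h) (coprod p f x))
      · rw [← ih]
        generalize coprod q g x = m
        induction m with
        | zero => simp
        | add x y hx hy => simp only [map_add, hx, hy]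
        | tmul x y =>
          simp only [TensorProduct.map_tmul, LinearMap.id_apply, coprod_wedgeLeft_of_pos p f hp]
          generalize coprod p f x = m
          induction m with
          | zero => simp
          | add x y hx hy => simp only [map_add, TensorProduct.add_tmul, hx, hy]
          | tmul x y => simp
      · generalize coprod p f x = m
        induction m with
        | zero => simp
        | add x y hx hy => simp only [map_add, hx, hy]
        | tmul x y => simp
    · rw [coprod_wedgeLeft_of_neg p f hp]
      by_cases hq : q a
      · rw [coprod_wedgeLeft_of_pos q g hq]
        trans TensorProduct.map parity (TensorProduct.map (wedgeLeft (f a)) LinearMap.id)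
          (TensorProduct.map LinearMap.id (coprod r h) (coprod p f x))
        · rw [← ih]
          generalize coprod q g x = m
          induction m with
          | zero => simp
          | add x y hx hy => simp only [map_add, hx, hy]
          | tmul x y =>
            simp only [TensorProduct.map_tmul, LinearMap.id_apply, coprod_wedgeLeft_of_neg p f hp]
            generalize coprod p f x = m
            induction m with
            | zero => simp
            | add x y hx hy => simp only [map_add, TensorProduct.add_tmul, hx, hy]
            | tmul x y => simp
        · generalize coprod p f x = m
          induction m with
          | zero => simp
          | add x y hx hy => simp only [map_add, hx, hy]
          | tmul x y => simp [coprod_wedgeLeft_of_pos r h ((hr a hp).2 hq)]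
      · rw [coprod_wedgeLeft_of_neg q g hq]
        trans TensorProduct.map parity (TensorProduct.map parity (wedgeLeft (g a)))
          (TensorProduct.map LinearMap.id (coprod r h) (coprod p f x))
        · rw [← ih]
          generalize coprod q g x = m
          induction m with
          | zero => simp
          | add x y hx hy => simp only [map_add, hx, hy]
          | tmul x y =>
            simp only [TensorProduct.map_tmul, LinearMap.id_apply, coprod_parity]
            generalize coprod p f x = m
            induction m with
            | zero => simp
            | add x y hx hy => simp only [map_add, TensorProduct.add_tmul, hx, hy]
            | tmul x y => simp
        · generalize coprod p f x = m
          induction m with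
          | zero => simp
          | add x y hx hy => simp only [map_add, hx, hy]
          | tmul x y =>
            simp [coprod_wedgeLeft_of_neg r h (fun h' => hq ((hr a hp).1 h')), hh a hq]

end Coproduct

end ExteriorCalculus

/-! ### Orthogonal projections along symplectic subspaces -/

section Projection

variable {K V : Type*} [Field K] [AddCommGroup V] [Module K V] [FiniteDimensional K V]
  {ω : LinearMap.BilinForm K V}

omit [FiniteDimensional K V] in
theorem orthogonal_sup (X Z : Submodule K V) :
    ω.orthogonal (X ⊔ Z) = ω.orthogonal X ⊓ ω.orthogonal Z := by
  refine le_antisymm (le_inf (LinearMap.BilinForm.orthogonal_le le_sup_left)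
    (LinearMap.BilinForm.orthogonal_le le_sup_right)) fun v hv w hw => ?_
  obtain ⟨x, hx, z, hz, rfl⟩ := Submodule.mem_sup.1 hw
  have h1 : ω x v = 0 := hv.1 x hx
  have h2 : ω z v = 0 := hv.2 z hz
  change ω (x + z) v = 0
  rw [map_add, LinearMap.add_apply, h1, h2, add_zero]

omit [FiniteDimensional K V] in
theorem le_orthogonal_comm (hω : ω.IsRefl) {X Z : Submodule K V} :
    X ≤ ω.orthogonal Z ↔ Z ≤ ω.orthogonal X :=
  ⟨fun h _ hz _ hx => hω _ _ (h hx _ hz), fun h _ hx _ hz => hω _ _ (h hz _ hx)⟩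

variable {X Z W a : Submodule K V}

theorem isCompl_orthogonal (hω : ω.IsRefl) (hX : (ω.restrict X).Nondegenerate) :
    IsCompl X (ω.orthogonal X) :=
  LinearMap.BilinForm.isCompl_orthogonal_of_restrict_nondegenerate hω hX

theorem sup_inf_orthogonal (hω : ω.IsRefl) (hX : (ω.restrict X).Nondegenerate)
    (hZ : Z ≤ ω.orthogonal X) : (X ⊔ Z) ⊓ ω.orthogonal X = Z := by
  rw [sup_comm, sup_inf_assoc_of_le X hZ, (isCompl_orthogonal hω hX).inf_eq_bot, sup_bot_eq]

theorem sup_orthogonal_inf (hω : ω.IsRefl) (hX : (ω.restrict X).Nondegenerate) (hXW : X ≤ W) :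
    X ⊔ ω.orthogonal X ⊓ W = W := by
  rw [← sup_inf_assoc_of_le _ hXW, (isCompl_orthogonal hω hX).sup_eq_top, top_inf_eq]

theorem eq_orthogonal_inf_iff (hω : ω.IsRefl) (hX : (ω.restrict X).Nondegenerate) (hXW : X ≤ W)
    (hZ : Z ≤ ω.orthogonal X) : Z = ω.orthogonal X ⊓ W ↔ X ⊔ Z = W := by
  constructor
  · rintro rfl
    exact sup_orthogonal_inf hω hX hXW
  · rintro rfl
    rw [inf_comm, sup_inf_orthogonal hω hX hZ]

theorem nondegenerate_sup (hω : ω.IsRefl) (hX : (ω.restrict X).Nondegenerate)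
    (hZ : (ω.restrict Z).Nondegenerate) (hXZ : Z ≤ ω.orthogonal X) :
    (ω.restrict (X ⊔ Z)).Nondegenerate := by
  rw [LinearMap.BilinForm.restrict_nondegenerate_iff_isCompl_orthogonal hω,
    LinearMap.BilinForm.isCompl_orthogonal_iff_disjoint hω, disjoint_iff, orthogonal_sup,
    ← inf_assoc, sup_inf_orthogonal hω hX hXZ, (isCompl_orthogonal hω hZ).inf_eq_bot]

theorem nondegenerate_of_sup (hω : ω.IsRefl) (hXZ : Z ≤ ω.orthogonal X)
    (h : (ω.restrict (X ⊔ Z)).Nondegenerate) : (ω.restrict Z).Nondegenerate := by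
  rw [LinearMap.BilinForm.restrict_nondegenerate_iff_isCompl_orthogonal hω,
    LinearMap.BilinForm.isCompl_orthogonal_iff_disjoint hω, disjoint_iff, eq_bot_iff] at h ⊢
  refine le_trans ?_ h
  rw [orthogonal_sup]
  exact le_inf (inf_le_left.trans le_sup_right) (le_inf (inf_le_left.trans hXZ) inf_le_right)

theorem nondegenerate_orthogonal_inf (hω : ω.IsRefl) (hX : (ω.restrict X).Nondegenerate)
    (hW : (ω.restrict W).Nondegenerate) (hXW : X ≤ W) :
    (ω.restrict (ω.orthogonal X ⊓ W)).Nondegenerate :=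
  nondegenerate_of_sup (X := X) hω inf_le_left (by rwa [sup_orthogonal_inf hω hX hXW])

omit [FiniteDimensional K V] in
theorem projPerp_le_orthogonal (X a : Submodule K V) : projPerp ω X a ≤ ω.orthogonal X :=
  inf_le_right

theorem sup_projPerp (hω : ω.IsRefl) (hX : (ω.restrict X).Nondegenerate) (a : Submodule K V) :
    X ⊔ projPerp ω X a = X ⊔ a := by
  rw [projPerp, inf_comm, sup_orthogonal_inf hω hX le_sup_right, sup_comm]

/-- The projection of `a` along `X` is characterized by having the same span with `X`. -/
theorem eq_projPerp_iff (hω : ω.IsRefl) (hX : (ω.restrict X).Nondegenerate)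
    (hZ : Z ≤ ω.orthogonal X) : Z = projPerp ω X a ↔ X ⊔ Z = X ⊔ a := by
  constructor
  · rintro rfl
    exact sup_projPerp hω hX a
  · intro h
    rw [← sup_inf_orthogonal hω hX hZ, h, projPerp, sup_comm]

theorem projPerp_le_iff (hω : ω.IsRefl) (hX : (ω.restrict X).Nondegenerate)
    (hZ : Z ≤ ω.orthogonal X) : projPerp ω X a ≤ Z ↔ a ≤ X ⊔ Z := by
  constructor
  · intro h
    exact le_sup_right.trans ((sup_projPerp hω hX a).symm.le.trans (sup_le_sup_left h X))
  · intro h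
    rw [← sup_inf_orthogonal hω hX hZ, projPerp]
    exact inf_le_inf_right _ (sup_le h le_sup_left)

theorem projPerp_eq_bot_iff (hω : ω.IsRefl) (hX : (ω.restrict X).Nondegenerate) :
    projPerp ω X a = ⊥ ↔ a ≤ X := by
  rw [eq_bot_iff, projPerp_le_iff hω hX bot_le, sup_bot_eq]

theorem projPerp_of_le_orthogonal (hω : ω.IsRefl) (hX : (ω.restrict X).Nondegenerate)
    (ha : a ≤ ω.orthogonal X) : projPerp ω X a = a :=
  ((eq_projPerp_iff hω hX ha).2 rfl).symm

/-- Orthogonal projections along perpendicular symplectic subspaces compose to the projection along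
their sum. -/
theorem projPerp_projPerp (hω : ω.IsRefl) (hX : (ω.restrict X).Nondegenerate)
    (hZ : (ω.restrict Z).Nondegenerate) (hXZ : Z ≤ ω.orthogonal X) (a : Submodule K V) :
    projPerp ω Z (projPerp ω X a) = projPerp ω (X ⊔ Z) a := by
  have h : projPerp ω Z (projPerp ω X a) ≤ ω.orthogonal (X ⊔ Z) := by
    rw [orthogonal_sup]
    exact le_inf (inf_le_left.trans (sup_le (projPerp_le_orthogonal X a) hXZ))
      (projPerp_le_orthogonal _ _)
  rw [eq_projPerp_iff hω (nondegenerate_sup hω hX hZ hXZ) h, sup_assoc, sup_projPerp hω hZ,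
    sup_left_comm, sup_projPerp hω hX]
  ac_rfl

omit [FiniteDimensional K V] in
theorem projPerp_eq_orthogonal_inf (hXW : X ≤ W) :
    projPerp ω X W = ω.orthogonal X ⊓ W := by
  rw [projPerp, sup_eq_left.2 hXW, inf_comm]

theorem finrank_projPerp (hω : ω.IsRefl) (hX : (ω.restrict X).Nondegenerate)
    (ha : Module.finrank K a = 1) (haX : ¬a ≤ X) : Module.finrank K (projPerp ω X a) = 1 := by
  have h1 := Submodule.finrank_sup_add_finrank_inf_eq X (projPerp ω X a)
  have h2 := Submodule.finrank_sup_add_finrank_inf_eq X a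
  have h3 : X ⊓ projPerp ω X a = ⊥ :=
    ((isCompl_orthogonal hω hX).disjoint.mono_right (projPerp_le_orthogonal X a)).eq_bot
  have h4 : X ⊓ a = ⊥ := by
    by_contra h
    have h5 : Module.finrank K (X ⊓ a : Submodule K V) ≠ 0 :=
      fun h' => h (Submodule.finrank_eq_zero.1 h')
    have h6 : X ⊓ a = a := Submodule.eq_of_le_of_finrank_le inf_le_right (by omega)
    exact haX (inf_eq_right.1 h6)
  rw [sup_projPerp hω hX, h3, finrank_bot] at h1
  rw [h4, finrank_bot] at h2
  omega

end Projection

/-! ### Words of exterior products -/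

section Words

variable {k : Type*} [CommRing k] {α : Type*} [LinearOrder α]

variable (k α) in
/-- The free module on the words of finite subsets of `α`, i.e. the tensor algebra of the exterior
algebra. -/
abbrev Words : Type _ := List (Finset α) →₀ k

/-- Concatenation of words. -/
def cat : Words k α →ₗ[k] Words k α →ₗ[k] Words k α :=
  Finsupp.linearCombination k fun u => Finsupp.lmapDomain k k (u ++ ·)

omit [LinearOrder α] in
@[simp] theorem cat_single (u v : List (Finset α)) :
    cat (Finsupp.single u (1 : k)) (Finsupp.single v (1 : k)) = Finsupp.single (u ++ v) (1 : k) := by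
  simp [cat]

omit [LinearOrder α] in
@[simp] theorem nil_cat (x : Words k α) : cat (Finsupp.single [] (1 : k)) x = x := by
  simp [cat, show (fun u : List (Finset α) => u) = id from rfl]

omit [LinearOrder α] in
theorem Words.induction {p : Words k α → Prop} (x : Words k α)
    (single : ∀ u, p (Finsupp.single u 1)) (add : ∀ x y, p x → p y → p (x + y))
    (smul : ∀ (c : k) x, p x → p (c • x)) : p x := by
  induction x using Finsupp.induction_linear with
  | zero => simpa using smul 0 _ (single [])
  | add x y hx hy => exact add x y hx hy
  | single A c => simpa using smul c _ (single A)

omit [LinearOrder α] in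
theorem cat_assoc (x y z : Words k α) : cat (cat x y) z = cat x (cat y z) := by
  induction x using Words.induction with
  | add x x' hx hx' => simp only [map_add, LinearMap.add_apply, hx, hx']
  | smul c x hx => simp only [map_smul, LinearMap.smul_apply, hx]
  | single u =>
    induction y using Words.induction with
    | add x x' hx hx' => simp only [map_add, LinearMap.add_apply, hx, hx']
    | smul c x hx => simp only [map_smul, LinearMap.smul_apply, hx]
    | single v =>
      induction z using Words.induction with
      | add x x' hx hx' => simp only [map_add, hx, hx']
      | smul c x hx => simp only [map_smul, hx]
      | single w => simp

/-- The word with the single factor `x`. -/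
def letter : Ext k α →ₗ[k] Words k α := Finsupp.lmapDomain k k fun A => [A]

omit [LinearOrder α] in
@[simp] theorem letter_single (A : Finset α) :
    letter (Finsupp.single A (1 : k)) = Finsupp.single [A] (1 : k) := by
  simp [letter]

/-- The word with the two factors `x` and `y`. -/
def letters₂ : Ext k α ⊗[k] Ext k α →ₗ[k] Words k α :=
  TensorProduct.lift ((cat.compl₂ letter).comp letter)

omit [LinearOrder α] in
@[simp] theorem letters₂_tmul (x y : Ext k α) : letters₂ (x ⊗ₜ y) = cat (letter x) (letter y) := rfl

/-- The sign of a word, in which a factor `a₁ ∧ ⋯ ∧ a_r` has degree `r - 1`. -/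
def wordSign (u : List (Finset α)) : k := (u.map fun A => (-1 : k) ^ (A.card + 1)).prod

/-- The parity involution of words. -/
def wordParity : Words k α →ₗ[k] Words k α :=
  Finsupp.linearCombination k fun u => (wordSign u : k) • Finsupp.single u (1 : k)

omit [LinearOrder α] in
@[simp] theorem wordParity_single (u : List (Finset α)) :
    wordParity (Finsupp.single u (1 : k)) = (wordSign u : k) • Finsupp.single u (1 : k) := by
  simp [wordParity]

omit [LinearOrder α] in
theorem wordSign_append (u v : List (Finset α)) :
    (wordSign (u ++ v) : k) = wordSign u * wordSign v := by
  simp [wordSign]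

omit [LinearOrder α] in
theorem wordParity_cat (x y : Words k α) :
    wordParity (cat x y) = cat (wordParity x) (wordParity y) := by
  induction x using Words.induction with
  | add x x' hx hx' => simp only [map_add, LinearMap.add_apply, hx, hx']
  | smul c x hx => simp only [map_smul, LinearMap.smul_apply, hx]
  | single u =>
    induction y using Words.induction with
    | add x x' hx hx' => simp only [map_add, hx, hx']
    | smul c x hx => simp only [map_smul, hx]
    | single v =>
      rw [cat_single, wordParity_single, wordParity_single, wordParity_single, wordSign_append,
        map_smul, map_smul, LinearMap.smul_apply, cat_single, smul_smul, mul_comm]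

omit [LinearOrder α] in
theorem wordParity_letter (x : Ext k α) : wordParity (letter x) = -letter (parity x) := by
  have : wordParity ∘ₗ letter = -(letter ∘ₗ parity : Ext k α →ₗ[k] Words k α) := by
    refine Finsupp.lhom_ext' fun A => LinearMap.ext_ring ?_
    change wordParity (letter (Finsupp.single A 1)) = -letter (parity (Finsupp.single A 1))
    rw [letter_single, wordParity_single, parity_single, map_smul, letter_single, ← neg_smul]
    congr 1
    simp [wordSign, pow_succ]
  exact LinearMap.congr_fun this x

section Derivation

variable (δ : Ext k α →ₗ[k] Words k α)

/-- The values on words of the odd derivation extending `δ`. -/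
def derivWord : List (Finset α) → Words k α
  | [] => 0
  | A :: u => cat (δ (Finsupp.single A 1)) (Finsupp.single u 1) +
      cat (wordParity (Finsupp.single [A] 1)) (derivWord u)

/-- The odd derivation of the algebra of words extending `δ`. -/
def deriv : Words k α →ₗ[k] Words k α := Finsupp.linearCombination k (derivWord δ)

omit [LinearOrder α] in
theorem deriv_single (u : List (Finset α)) :
    deriv δ (Finsupp.single u (1 : k)) = derivWord δ u := by
  simp [deriv]

omit [LinearOrder α] in
theorem deriv_nil : deriv δ (Finsupp.single [] (1 : k)) = 0 := by
  rw [deriv_single, derivWord]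

omit [LinearOrder α] in
theorem deriv_letter (x : Ext k α) : deriv δ (letter x) = δ x := by
  have : deriv δ ∘ₗ letter = δ := by
    refine Finsupp.lhom_ext' fun A => LinearMap.ext_ring ?_
    change deriv δ (letter (Finsupp.single A 1)) = δ (Finsupp.single A 1)
    rw [letter_single, deriv_single, derivWord, derivWord, map_zero, add_zero]
    generalize δ (Finsupp.single A 1) = x
    induction x using Words.induction with
    | add x x' hx hx' => simp only [map_add, LinearMap.add_apply, hx, hx']
    | smul c x hx => simp only [map_smul, LinearMap.smul_apply, hx]
    | single u => simp
  exact LinearMap.congr_fun this x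

omit [LinearOrder α] in
theorem deriv_cat (x y : Words k α) :
    deriv δ (cat x y) = cat (deriv δ x) y + cat (wordParity x) (deriv δ y) := by
  induction x using Words.induction with
  | add x x' hx hx' => simp only [map_add, LinearMap.add_apply, hx, hx']; abel
  | smul c x hx => simp only [map_smul, LinearMap.smul_apply, hx, smul_add]
  | single u =>
    induction y using Words.induction with
    | add x x' hx hx' => simp only [map_add, hx, hx']; abel
    | smul c x hx => simp only [map_smul, hx, smul_add]
    | single v =>
      induction u with
      | nil => simp [deriv_nil, wordSign]
      | cons A u ih =>
        have h1 : Finsupp.single (A :: u) (1 : k) =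
          cat (Finsupp.single [A] 1) (Finsupp.single u 1) := by simp
        rw [cat_single] at ih
        rw [cat_single, List.cons_append, deriv_single, derivWord, deriv_single _ (A :: u),
          derivWord, ← deriv_single, ih, h1, wordParity_cat, ← cat_single u v, ← deriv_single,
          map_add, map_add, LinearMap.add_apply, cat_assoc, cat_assoc, cat_assoc, add_assoc]

omit [LinearOrder α] in
theorem deriv_wordParity (h : ∀ x, wordParity (δ x) = δ (parity x)) (x : Words k α) :
    deriv δ (wordParity x) = -wordParity (deriv δ x) := by
  induction x using Words.induction with
  | add x x' hx hx' => simp only [map_add, hx, hx']; abel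
  | smul c x hx => simp only [map_smul, hx, smul_neg]
  | single u =>
    induction u with
    | nil => rw [wordParity_single, map_smul, deriv_nil, smul_zero, map_zero, neg_zero]
    | cons A u ih =>
      have h1 : Finsupp.single (A :: u) (1 : k) =
        cat (letter (Finsupp.single A 1)) (Finsupp.single u 1) := by simp
      rw [h1, wordParity_cat, deriv_cat, deriv_cat, wordParity_letter, map_neg (deriv δ),
        deriv_letter, deriv_letter, ih, map_add, wordParity_cat, wordParity_cat, h]
      simp only [map_neg, LinearMap.neg_apply, neg_neg, neg_add]

omit [LinearOrder α] in
/-- The square of an odd derivation is an even derivation, so it vanishes if it does on words with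
one factor. -/
theorem deriv_deriv (h : ∀ x, wordParity (δ x) = δ (parity x))
    (h' : ∀ x, deriv δ (δ x) = 0) (x : Words k α) : deriv δ (deriv δ x) = 0 := by
  induction x using Words.induction with
  | add x x' hx hx' => simp only [map_add, hx, hx', add_zero]
  | smul c x hx => simp only [map_smul, hx, smul_zero]
  | single u =>
    induction u with
    | nil => simp [deriv_nil]
    | cons A u ih =>
      have h1 : Finsupp.single (A :: u) (1 : k) =
        cat (letter (Finsupp.single A 1)) (Finsupp.single u 1) := by simp
      rw [h1, deriv_cat, map_add, deriv_cat, deriv_cat, deriv_letter, h', ih,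
        deriv_wordParity δ h, deriv_letter]
      simp

end Derivation

end Words

/-! ### The differential on words of subspaces -/

section ExteriorCalculus

variable {k : Type*} [CommRing k] {α : Type*} [LinearOrder α]

theorem contract_single (A : Finset α) : contract (Finsupp.single A (1 : k)) =
    ∑ a ∈ A, (-1 : k) ^ (A.filter (· < a)).card • Finsupp.single (A.erase a) (1 : k) := by
  induction A using Finset.induction_on_min with
  | empty => simp
  | insert b s h ih =>
    have hb : b ∉ s := fun hb => (h b hb).ne rfl
    rw [← wedgeLeft_single_of_lt h, contract_wedgeLeft, ih, Finset.sum_insert hb, map_sum,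
      sub_eq_add_neg, ← Finset.sum_neg_distrib]
    congr 1
    · rw [Finset.erase_insert hb, Finset.filter_false_of_mem]
      · simp
      · intro a ha
        rcases Finset.mem_insert.1 ha with rfl | ha
        · exact lt_irrefl _
        · exact (h a ha).not_gt
    · refine Finset.sum_congr rfl fun a ha => ?_
      have hab : b ≠ a := fun hab => hb (hab ▸ ha)
      rw [map_smul, wedgeLeft_single_of_lt fun c hc => h c (Finset.mem_of_mem_erase hc),
        Finset.erase_insert_of_ne hab, Finset.filter_insert, if_pos (h a ha),
        Finset.card_insert_of_notMem (by simp [hb]), pow_succ, mul_neg_one, neg_smul]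

variable {β : Type*} [LinearOrder β] (p : α → Prop) [DecidablePred p] (f : α → β)

/-- The coproduct of a basis vector is zero if two generators in the right factor become equal, and
is a basis vector up to sign otherwise. -/
theorem coprod_single_eq_zero_or (A : Finset α) :
    (¬Set.InjOn f (A.filter fun a => ¬p a) ∧ coprod p f (Finsupp.single A (1 : k)) = 0) ∨
    Set.InjOn f (A.filter fun a => ¬p a) ∧ ∃ c : ℕ, coprod p f (Finsupp.single A (1 : k)) =
      (-1 : k) ^ c • Finsupp.single (A.filter p) (1 : k) ⊗ₜ[k]
        Finsupp.single ((A.filter fun a => ¬p a).image f) (1 : k) := by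
  have h1 : (A.sort (· ≤ ·)).Nodup := A.sort_nodup _
  have h2 : (((A.sort (· ≤ ·)).filter fun a => ¬p a).map f).Nodup ↔
      Set.InjOn f (A.filter fun a => ¬p a) := by
    rw [List.nodup_map_iff_inj_on (h1.filter _)]
    simp only [List.mem_filter, Finset.mem_sort, decide_eq_true_eq, Set.InjOn, Finset.coe_filter,
      Set.mem_ofPred_eq]
  rw [← wedge_sort, coprod_wedge]
  by_cases h : Set.InjOn f (A.filter fun a => ¬p a)
  · right
    obtain ⟨c, hc⟩ := exists_wedge_eq (k := k) (h1.filter p)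
    obtain ⟨c', hc'⟩ := exists_wedge_eq (k := k) (h2.2 h)
    refine ⟨h, inversions p (A.sort (· ≤ ·)) + c + c', ?_⟩
    have : ∀ l : List α, (l.map f).toFinset = l.toFinset.image f := fun l => by ext; simp
    rw [hc, hc', List.toFinset_filter, Finset.sort_toFinset, this,
      List.toFinset_filter, Finset.sort_toFinset, TensorProduct.smul_tmul',
      TensorProduct.smul_tmul', TensorProduct.tmul_smul, TensorProduct.smul_tmul', smul_smul,
      smul_smul, pow_add, pow_add]
    simp only [decide_eq_true_eq, mul_comm, mul_left_comm]
  · left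
    refine ⟨h, ?_⟩
    rw [wedge_eq_zero (fun h' => h (h2.1 h')), TensorProduct.tmul_zero, smul_zero]

end ExteriorCalculus

section Entries

variable {K V : Type*} [Field K] [AddCommGroup V] [Module K V]

variable (K V) in
/-- The subspaces of `V`, as the generators of the exterior algebra; the type carries an
arbitrary linear order that has nothing to do with inclusion. -/
@[ext]
structure Entry where
  /-- The underlying subspace. -/
  sub : Submodule K V

open Classical in
instance : LinearOrder (Entry K V) := linearOrderOfSTO WellOrderingRel

/-- The span of a set of subspaces. -/
def spanF (A : Finset (Entry K V)) : Submodule K V := A.sup Entry.sub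

theorem le_spanF {A : Finset (Entry K V)} {a : Entry K V} (h : a ∈ A) : a.sub ≤ spanF A :=
  Finset.le_sup (f := Entry.sub) h

theorem spanF_le {A : Finset (Entry K V)} {X : Submodule K V} :
    spanF A ≤ X ↔ ∀ a ∈ A, a.sub ≤ X := Finset.sup_le_iff

theorem spanF_mono {A B : Finset (Entry K V)} (h : A ⊆ B) : spanF A ≤ spanF B := Finset.sup_mono h

@[simp] theorem spanF_empty : spanF (∅ : Finset (Entry K V)) = ⊥ := Finset.sup_empty

@[simp] theorem spanF_insert (a : Entry K V) (A : Finset (Entry K V)) :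
    spanF (insert a A) = a.sub ⊔ spanF A := Finset.sup_insert

@[simp] theorem spanF_union (A B : Finset (Entry K V)) : spanF (A ∪ B) = spanF A ⊔ spanF B :=
  Finset.sup_union

open Classical in
/-- The entries of `A` contained in the subspace `X`. -/
def inside (X : Submodule K V) (A : Finset (Entry K V)) : Finset (Entry K V) :=
  A.filter fun a => a.sub ≤ X

open Classical in
/-- The entries of `A` not contained in the subspace `X`. -/
def outside (X : Submodule K V) (A : Finset (Entry K V)) : Finset (Entry K V) :=
  A.filter fun a => ¬a.sub ≤ X

theorem mem_inside {X : Submodule K V} {A : Finset (Entry K V)} {a : Entry K V} :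
    a ∈ inside X A ↔ a ∈ A ∧ a.sub ≤ X := by simp [inside]

theorem mem_outside {X : Submodule K V} {A : Finset (Entry K V)} {a : Entry K V} :
    a ∈ outside X A ↔ a ∈ A ∧ ¬a.sub ≤ X := by simp [outside]

theorem inside_union_outside (X : Submodule K V) (A : Finset (Entry K V)) :
    inside X A ∪ outside X A = A := by
  ext a
  rw [Finset.mem_union, mem_inside, mem_outside]
  tauto

theorem spanF_inside_le (X : Submodule K V) (A : Finset (Entry K V)) : spanF (inside X A) ≤ X :=
  spanF_le.2 fun _ ha => (mem_inside.1 ha).2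

open Classical in
/-- The subspaces spanned by subsets of `A`. -/
def spans (A : Finset (Entry K V)) : Finset (Submodule K V) := A.powerset.image spanF

theorem mem_spans {A : Finset (Entry K V)} {X : Submodule K V} :
    X ∈ spans A ↔ spanF (inside X A) = X := by
  simp only [spans, Finset.mem_image, Finset.mem_powerset]
  constructor
  · rintro ⟨B, hB, rfl⟩
    exact le_antisymm (spanF_inside_le _ _)
      (spanF_mono fun b hb => mem_inside.2 ⟨hB hb, le_spanF hb⟩)
  · intro h
    exact ⟨_, fun a ha => (mem_inside.1 ha).1, h⟩

variable (ω : LinearMap.BilinForm K V)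

/-- The image of an entry under the projection to `X^⊥` along `X`. -/
def Entry.proj (X : Submodule K V) (a : Entry K V) : Entry K V := ⟨projPerp ω X a.sub⟩

/-- The images of the entries of `A` outside `X` under the projection to `X^⊥` along `X`. -/
def projOutside (X : Submodule K V) (A : Finset (Entry K V)) : Finset (Entry K V) :=
  (outside X A).image (Entry.proj ω X)

/-- The spans of subsets of `A` at which `A` can be split: the proper nonzero symplectic ones. -/
def splitSpans (A : Finset (Entry K V)) : Finset (Submodule K V) :=
  @Finset.filter _ (fun X => X ≠ ⊥ ∧ X ≠ spanF A ∧ (ω.restrict X).Nondegenerate)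
    (Classical.decPred _) (spans A)

variable {ω}

theorem mem_splitSpans {A : Finset (Entry K V)} {X : Submodule K V} : X ∈ splitSpans ω A ↔
    spanF (inside X A) = X ∧ X ≠ ⊥ ∧ X ≠ spanF A ∧ (ω.restrict X).Nondegenerate := by
  exact (@Finset.mem_filter _ _ (Classical.decPred _) _ _).trans (and_congr_left' mem_spans)

theorem lt_of_mem_splitSpans {A : Finset (Entry K V)} {X : Submodule K V}
    (h : X ∈ splitSpans ω A) : X < spanF A := by
  rw [mem_splitSpans] at h
  refine lt_of_le_of_ne ?_ h.2.2.1
  rw [← h.1]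
  exact spanF_mono fun a ha => (mem_inside.1 ha).1

theorem sup_spanF_outside {A : Finset (Entry K V)} {X : Submodule K V} :
    X ⊔ spanF (outside X A) = X ⊔ spanF A := by
  refine le_antisymm (sup_le_sup_left (spanF_mono fun a ha => (mem_outside.1 ha).1) _)
    (sup_le le_sup_left ?_)
  rw [← inside_union_outside X A, spanF_union]
  refine sup_le ((spanF_inside_le X A).trans le_sup_left) ?_
  rw [inside_union_outside X A]
  exact le_sup_right

variable [FiniteDimensional K V]

theorem sup_spanF_image_proj (hω : ω.IsRefl) {X : Submodule K V}
    (hX : (ω.restrict X).Nondegenerate) (A : Finset (Entry K V)) :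
    X ⊔ spanF (A.image (Entry.proj ω X)) = X ⊔ spanF A := by
  induction A using Finset.induction_on with
  | empty => simp
  | insert a s _ ih =>
    rw [Finset.image_insert, spanF_insert, spanF_insert, ← sup_assoc, Entry.proj,
      sup_projPerp hω hX, sup_right_comm, ih, sup_right_comm, sup_assoc]

theorem sup_spanF_projOutside (hω : ω.IsRefl) {X : Submodule K V}
    (hX : (ω.restrict X).Nondegenerate) (A : Finset (Entry K V)) :
    X ⊔ spanF (projOutside ω X A) = X ⊔ spanF A := by
  rw [projOutside, sup_spanF_image_proj hω hX, sup_spanF_outside]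

omit [FiniteDimensional K V] in
theorem spanF_projOutside_le (X : Submodule K V) (A : Finset (Entry K V)) :
    spanF (projOutside ω X A) ≤ ω.orthogonal X := by
  refine spanF_le.2 fun a ha => ?_
  obtain ⟨b, _, rfl⟩ := Finset.mem_image.1 ha
  exact projPerp_le_orthogonal _ _

theorem spanF_projOutside (hω : ω.IsRefl) {X : Submodule K V}
    (hX : (ω.restrict X).Nondegenerate) {A : Finset (Entry K V)} (hXA : X ≤ spanF A) :
    spanF (projOutside ω X A) = ω.orthogonal X ⊓ spanF A := by
  rw [eq_orthogonal_inf_iff hω hX hXA (spanF_projOutside_le X A), sup_spanF_projOutside hω hX,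
    sup_eq_right.2 hXA]

end Entries

/-! ### The two parts of the differential -/

section Differential

variable {k : Type*} [CommRing k] {K V : Type*} [Field K] [AddCommGroup V] [Module K V]

open Classical in
/-- The projection of the exterior algebra to the part spanned by the sets of subspaces with
span `W`. -/
def spanPart (W : Submodule K V) : Ext k (Entry K V) →ₗ[k] Ext k (Entry K V) :=
  Finsupp.linearCombination k fun A => if spanF A = W then Finsupp.single A 1 else 0

theorem spanPart_of_eq {W : Submodule K V} {A : Finset (Entry K V)} (h : spanF A = W) :
    spanPart W (Finsupp.single A (1 : k)) = Finsupp.single A 1 := by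
  simp [spanPart, h]

theorem spanPart_of_ne {W : Submodule K V} {A : Finset (Entry K V)} (h : spanF A ≠ W) :
    spanPart W (Finsupp.single A (1 : k)) = 0 := by
  simp [spanPart, h]

theorem spanPart_contract {W : Submodule K V} {A : Finset (Entry K V)} (h : spanF A ≤ W) :
    spanPart W (contract (spanPart W (Finsupp.single A (1 : k)))) =
      spanPart W (contract (Finsupp.single A 1)) := by
  rcases h.eq_or_lt with h | h
  · rw [spanPart_of_eq h]
  · rw [spanPart_of_ne h.ne, map_zero, map_zero, contract_single, map_sum]
    refine (Finset.sum_eq_zero fun a _ => ?_).symm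
    rw [map_smul, spanPart_of_ne ((spanF_mono (Finset.erase_subset _ _)).trans_lt h).ne, smul_zero]

/-- The part of the simplicial boundary that preserves the span. -/
def omitPart : Ext k (Entry K V) →ₗ[k] Ext k (Entry K V) :=
  Finsupp.linearCombination k fun A => spanPart (spanF A) (contract (Finsupp.single A 1))

theorem omitPart_single (A : Finset (Entry K V)) :
    omitPart (Finsupp.single A (1 : k)) = spanPart (spanF A) (contract (Finsupp.single A 1)) := by
  simp [omitPart]

open Classical in
theorem omitPart_single_eq_sum (A : Finset (Entry K V)) : omitPart (Finsupp.single A (1 : k)) =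
    ∑ a ∈ A, if spanF (A.erase a) = spanF A then
      (-1 : k) ^ (A.filter (· < a)).card • Finsupp.single (A.erase a) (1 : k) else 0 := by
  rw [omitPart_single, contract_single, map_sum]
  refine Finset.sum_congr rfl fun a _ => ?_
  rw [map_smul]
  split_ifs with h
  · rw [spanPart_of_eq h]
  · rw [spanPart_of_ne h, smul_zero]

theorem omitPart_spanPart (W : Submodule K V) (x : Ext k (Entry K V)) :
    omitPart (spanPart W x) = spanPart W (contract (spanPart W x)) := by
  have : omitPart ∘ₗ spanPart W = (spanPart W ∘ₗ contract ∘ₗ spanPart W :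
      Ext k (Entry K V) →ₗ[k] Ext k (Entry K V)) := by
    refine Finsupp.lhom_ext' fun A => LinearMap.ext_ring ?_
    change omitPart (spanPart W (Finsupp.single A 1)) =
      spanPart W (contract (spanPart W (Finsupp.single A 1)))
    by_cases h : spanF A = W
    · rw [spanPart_of_eq h, omitPart_single, h]
    · rw [spanPart_of_ne h, map_zero, map_zero, map_zero]
  exact LinearMap.congr_fun this x

theorem omitPart_omitPart (x : Ext k (Entry K V)) : omitPart (omitPart x) = 0 := by
  have : omitPart ∘ₗ omitPart = (0 : Ext k (Entry K V) →ₗ[k] Ext k (Entry K V)) := by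
    refine Finsupp.lhom_ext' fun A => LinearMap.ext_ring ?_
    change omitPart (omitPart (Finsupp.single A 1)) = 0
    rw [omitPart_single, omitPart_spanPart]
    have : spanPart (spanF A) (contract (spanPart (spanF A) (contract (Finsupp.single A (1 : k))))) =
        spanPart (spanF A) (contract (contract (Finsupp.single A (1 : k)))) := by
      rw [contract_single, map_sum, map_sum, map_sum, map_sum, map_sum]
      refine Finset.sum_congr rfl fun a _ => ?_
      simp only [map_smul, spanPart_contract (spanF_mono (Finset.erase_subset a A))]
    rw [this, contract_contract, map_zero]
  exact LinearMap.congr_fun this x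

theorem omitPart_parity (x : Ext k (Entry K V)) : omitPart (parity x) = -parity (omitPart x) := by
  have : omitPart ∘ₗ parity =
      -(parity ∘ₗ omitPart : Ext k (Entry K V) →ₗ[k] Ext k (Entry K V)) := by
    refine Finsupp.lhom_ext' fun A => LinearMap.ext_ring ?_
    change omitPart (parity (Finsupp.single A (1 : k))) =
      -parity (omitPart (Finsupp.single A (1 : k)))
    rw [parity_single, map_smul, omitPart_single_eq_sum, Finset.smul_sum, map_sum,
      ← Finset.sum_neg_distrib]
    refine Finset.sum_congr rfl fun a ha => ?_
    split_ifs
    · rw [map_smul, parity_single, ← Finset.card_erase_add_one ha, smul_comm, pow_succ,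
        mul_neg_one, neg_smul, smul_neg]
    · simp
  exact LinearMap.congr_fun this x

variable (ω : LinearMap.BilinForm K V)

open Classical in
/-- The coproduct of the exterior algebra that splits entries according to whether they are
contained in `X`, and projects those that are not to `X^⊥`. -/
def splitAt (X : Submodule K V) :
    Ext k (Entry K V) →ₗ[k] Ext k (Entry K V) ⊗[k] Ext k (Entry K V) :=
  coprod (fun a => a.sub ≤ X) (Entry.proj ω X)

theorem splitAt_single_eq_zero_or (X : Submodule K V) (A : Finset (Entry K V)) :
    (¬Set.InjOn (Entry.proj ω X) (outside X A) ∧ splitAt ω X (Finsupp.single A (1 : k)) = 0) ∨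
    Set.InjOn (Entry.proj ω X) (outside X A) ∧ ∃ c : ℕ,
      splitAt ω X (Finsupp.single A (1 : k)) =
      (-1 : k) ^ c • Finsupp.single (inside X A) (1 : k) ⊗ₜ[k]
        Finsupp.single (projOutside ω X A) (1 : k) := by
  classical
  exact coprod_single_eq_zero_or _ _ _

theorem splitAt_parity (X : Submodule K V) (x : Ext k (Entry K V)) :
    splitAt ω X (parity x) = TensorProduct.map parity parity (splitAt ω X x) := by
  classical exact coprod_parity _ _ x

theorem splitAt_contract (X : Submodule K V) (x : Ext k (Entry K V)) :
    splitAt ω X (contract x) = TensorProduct.map contract LinearMap.id (splitAt ω X x) +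
      TensorProduct.map parity contract (splitAt ω X x) := by
  classical exact coprod_contract _ _ x

theorem exists_splitAt_single (X : Submodule K V) (A : Finset (Entry K V)) : ∃ c : k,
    splitAt ω X (Finsupp.single A (1 : k)) = c • Finsupp.single (inside X A) (1 : k) ⊗ₜ[k]
        Finsupp.single (projOutside ω X A) (1 : k) := by
  rcases splitAt_single_eq_zero_or (k := k) ω X A with h | ⟨_, c, h⟩
  · exact ⟨0, by rw [h.2, zero_smul]⟩
  · exact ⟨_, h⟩

/-- The sum of all splittings of an exterior product, with the sign `(-1) ^ r` if the left factor
has `r` entries. -/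
def splitPart : Ext k (Entry K V) →ₗ[k] Ext k (Entry K V) ⊗[k] Ext k (Entry K V) :=
  Finsupp.linearCombination k fun A => ∑ X ∈ splitSpans ω A,
    TensorProduct.map parity LinearMap.id (splitAt ω X (Finsupp.single A 1))

theorem splitPart_single (A : Finset (Entry K V)) : splitPart ω (Finsupp.single A (1 : k)) =
    ∑ X ∈ splitSpans ω A,
      TensorProduct.map parity LinearMap.id (splitAt ω X (Finsupp.single A 1)) := by
  simp [splitPart]

/-- The differential on words with one factor. -/
def letterDiff : Ext k (Entry K V) →ₗ[k] Words k (Entry K V) :=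
  letter ∘ₗ omitPart + letters₂ ∘ₗ splitPart ω

theorem letterDiff_apply (x : Ext k (Entry K V)) :
    letterDiff ω x = letter (omitPart x) + letters₂ (splitPart ω x) := rfl

/-- The differential on words. -/
def diff : Words k (Entry K V) →ₗ[k] Words k (Entry K V) := deriv (letterDiff ω)

variable {ω}

/-- Splitting along `X` sends the part with span `W` to the part whose second factor has the
complementary span. -/
theorem spanPart_splitAt_spanPart [FiniteDimensional K V] (hω : ω.IsRefl) {X W : Submodule K V}
    (hX : (ω.restrict X).Nondegenerate) (hXW : X ≤ W) (x : Ext k (Entry K V)) :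
    TensorProduct.map (spanPart X) LinearMap.id (splitAt ω X (spanPart W x)) =
      TensorProduct.map (spanPart X) (spanPart (ω.orthogonal X ⊓ W)) (splitAt ω X x) := by
  have : TensorProduct.map (spanPart X) LinearMap.id ∘ₗ splitAt ω X ∘ₗ spanPart W =
      (TensorProduct.map (spanPart X) (spanPart (ω.orthogonal X ⊓ W)) ∘ₗ splitAt ω X :
        Ext k (Entry K V) →ₗ[k] _) := by
    refine Finsupp.lhom_ext' fun A => LinearMap.ext_ring ?_
    change TensorProduct.map (spanPart X) LinearMap.id (splitAt ω X (spanPart W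
      (Finsupp.single A 1))) = TensorProduct.map (spanPart X) (spanPart (ω.orthogonal X ⊓ W))
        (splitAt ω X (Finsupp.single A 1))
    obtain ⟨c, hc⟩ := exists_splitAt_single (k := k) ω X A
    by_cases h : spanF (inside X A) = X
    · have hXA : X ≤ spanF A := by
        conv_lhs => rw [← h]
        exact spanF_mono fun a ha => (mem_inside.1 ha).1
      have h2 : spanF (projOutside ω X A) = ω.orthogonal X ⊓ W ↔ spanF A = W := by
        rw [eq_orthogonal_inf_iff hω hX hXW (spanF_projOutside_le X A),
          sup_spanF_projOutside hω hX, sup_eq_right.2 hXA]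
      rw [hc, map_smul, TensorProduct.map_tmul, spanPart_of_eq h]
      by_cases h3 : spanF A = W
      · rw [spanPart_of_eq h3, spanPart_of_eq (h2.2 h3), hc, map_smul, TensorProduct.map_tmul,
          spanPart_of_eq h, LinearMap.id_apply]
      · rw [spanPart_of_ne h3, spanPart_of_ne fun h' => h3 (h2.1 h'), TensorProduct.tmul_zero,
          smul_zero, map_zero, map_zero]
    · rw [hc, map_smul, TensorProduct.map_tmul, spanPart_of_ne h, TensorProduct.zero_tmul,
        smul_zero]
      by_cases h3 : spanF A = W
      · rw [spanPart_of_eq h3, hc, map_smul, TensorProduct.map_tmul, spanPart_of_ne h,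
          TensorProduct.zero_tmul, smul_zero]
      · rw [spanPart_of_ne h3, map_zero, map_zero]
  exact LinearMap.congr_fun this x

/-- The sum defining `splitPart` may be extended to more subspaces, if only the terms whose left
factor spans the subspace are kept. -/
theorem splitPart_single_eq_sum {A B : Finset (Entry K V)} (hB : B ⊆ A)
    (h : spanF B = spanF A) : splitPart ω (Finsupp.single B (1 : k)) =
    ∑ X ∈ splitSpans ω A, TensorProduct.map parity LinearMap.id
      (TensorProduct.map (spanPart X) LinearMap.id (splitAt ω X (Finsupp.single B 1))) := by
  have h1 : splitSpans ω B ⊆ splitSpans ω A := fun X hX => by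
    rw [mem_splitSpans] at hX ⊢
    refine ⟨le_antisymm (spanF_inside_le _ _) ?_, hX.2.1, h ▸ hX.2.2.1, hX.2.2.2⟩
    conv_lhs => rw [← hX.1]
    exact spanF_mono fun a ha => mem_inside.2 ⟨hB (mem_inside.1 ha).1, (mem_inside.1 ha).2⟩
  rw [splitPart_single, ← Finset.sum_subset h1]
  · refine Finset.sum_congr rfl fun X hX => ?_
    obtain ⟨c, hc⟩ := exists_splitAt_single (k := k) ω X B
    rw [hc, map_smul (TensorProduct.map (spanPart X) LinearMap.id), TensorProduct.map_tmul,
      spanPart_of_eq (mem_splitSpans.1 hX).1, LinearMap.id_apply]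
  · intro X hXA hXB
    obtain ⟨c, hc⟩ := exists_splitAt_single (k := k) ω X B
    rw [hc, map_smul, TensorProduct.map_tmul, spanPart_of_ne, TensorProduct.zero_tmul, smul_zero,
      map_zero]
    intro h'
    rw [mem_splitSpans] at hXA hXB
    exact hXB ⟨h', hXA.2.1, h ▸ hXA.2.2.1, hXA.2.2.2⟩

theorem splitPart_parity (x : Ext k (Entry K V)) :
    splitPart ω (parity x) = TensorProduct.map parity parity (splitPart ω x) := by
  have : splitPart ω ∘ₗ parity = (TensorProduct.map parity parity ∘ₗ splitPart ω :
      Ext k (Entry K V) →ₗ[k] _) := by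
    refine Finsupp.lhom_ext' fun A => LinearMap.ext_ring ?_
    change splitPart ω (parity (Finsupp.single A (1 : k))) =
      TensorProduct.map parity parity (splitPart ω (Finsupp.single A 1))
    rw [parity_single, map_smul, splitPart_single, Finset.smul_sum, map_sum]
    refine Finset.sum_congr rfl fun X _ => ?_
    rw [← map_smul, ← map_smul, ← parity_single, splitAt_parity]
    generalize splitAt ω X (Finsupp.single A (1 : k)) = m
    induction m with
    | zero => simp
    | add x y hx hy => simp only [map_add, hx, hy]
    | tmul x y => simp
  exact LinearMap.congr_fun this x

/-- Splitting anticommutes with the span-preserving boundary. -/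
theorem splitPart_omitPart [FiniteDimensional K V] (hω : ω.IsRefl) (x : Ext k (Entry K V)) :
    splitPart ω (omitPart x) = -(TensorProduct.map omitPart LinearMap.id (splitPart ω x)) +
      TensorProduct.map parity omitPart (splitPart ω x) := by
  have : splitPart ω ∘ₗ omitPart = -(TensorProduct.map omitPart LinearMap.id ∘ₗ splitPart ω) +
      (TensorProduct.map parity omitPart ∘ₗ splitPart ω : Ext k (Entry K V) →ₗ[k] _) := by
    refine Finsupp.lhom_ext' fun A => LinearMap.ext_ring ?_
    change splitPart ω (omitPart (Finsupp.single A (1 : k))) =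
      -(TensorProduct.map omitPart LinearMap.id (splitPart ω (Finsupp.single A 1))) +
        TensorProduct.map parity omitPart (splitPart ω (Finsupp.single A 1))
    -- Once restricted to left factors that span `X`, the sum can be taken over the same index set for all
    -- the faces of `A`.
    have h1 : splitPart ω (omitPart (Finsupp.single A (1 : k))) =
        ∑ X ∈ splitSpans ω A, TensorProduct.map parity LinearMap.id
          (TensorProduct.map (spanPart X) LinearMap.id
            (splitAt ω X (omitPart (Finsupp.single A 1)))) := by
      classical
      rw [omitPart_single_eq_sum]
      simp only [map_sum]
      rw [Finset.sum_comm]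
      refine Finset.sum_congr rfl fun a _ => ?_
      split_ifs with h
      · simp only [map_smul]
        rw [splitPart_single_eq_sum (Finset.erase_subset a A) h, Finset.smul_sum]
      · simp
    rw [h1, splitPart_single, map_sum, map_sum, ← Finset.sum_neg_distrib, ← Finset.sum_add_distrib]
    refine Finset.sum_congr rfl fun X hX => ?_
    have hlt := (lt_of_mem_splitSpans hX).le
    rw [mem_splitSpans] at hX
    obtain ⟨c, hc⟩ := exists_splitAt_single (k := k) ω X A
    rw [omitPart_single, spanPart_splitAt_spanPart hω hX.2.2.2 hlt, splitAt_contract, hc,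
      ← spanF_projOutside hω hX.2.2.2 hlt]
    simp only [map_smul, map_add, TensorProduct.map_tmul, LinearMap.id_apply]
    have h2 := omitPart_single (k := k) (inside X A)
    rw [hX.1] at h2
    have h3 : spanPart X (parity (Finsupp.single (inside X A) (1 : k))) =
        parity (Finsupp.single (inside X A) (1 : k)) := by
      rw [parity_single, map_smul, spanPart_of_eq hX.1]
    rw [← h2, ← omitPart_single, spanPart_of_eq rfl, h3, omitPart_parity, TensorProduct.neg_tmul,
      smul_neg, neg_neg]
  exact LinearMap.congr_fun this x

/-- The projections contained in `Z` are those of the entries contained in `X ⊔ Z`. -/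
theorem inside_projOutside [FiniteDimensional K V] (hω : ω.IsRefl) {X Z : Submodule K V}
    (hX : (ω.restrict X).Nondegenerate) (hZ : Z ≤ ω.orthogonal X) (A : Finset (Entry K V)) :
    inside Z (projOutside ω X A) = projOutside ω X (inside (X ⊔ Z) A) := by
  ext a
  simp only [mem_inside, projOutside, Finset.mem_image, mem_outside]
  constructor
  · rintro ⟨⟨b, hb, rfl⟩, h⟩
    exact ⟨b, ⟨⟨hb.1, (projPerp_le_iff hω hX hZ).1 h⟩, hb.2⟩, rfl⟩
  · rintro ⟨b, hb, rfl⟩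
    exact ⟨⟨b, ⟨hb.1.1, hb.2⟩, rfl⟩, (projPerp_le_iff hω hX hZ).2 hb.1.2⟩

theorem inside_inside {X Y : Submodule K V} (h : X ≤ Y) (A : Finset (Entry K V)) :
    inside X (inside Y A) = inside X A := by
  ext a
  simp only [mem_inside]
  exact ⟨fun h' => ⟨h'.1.1, h'.2⟩, fun h' => ⟨⟨h'.1, h'.2.trans h⟩, h'.2⟩⟩

open Classical in
/-- Splitting along `X ⊔ Z` and then along `X` is the same as splitting along `X` and then
along `Z`. -/
theorem splitAt_coassoc [FiniteDimensional K V] (hω : ω.IsRefl) {X Z : Submodule K V}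
    (hX : (ω.restrict X).Nondegenerate) (hZ : (ω.restrict Z).Nondegenerate)
    (hZX : Z ≤ ω.orthogonal X) (x : Ext k (Entry K V)) :
    TensorProduct.assoc k _ _ _
        (TensorProduct.map (splitAt ω X) LinearMap.id (splitAt ω (X ⊔ Z) x)) =
      TensorProduct.map LinearMap.id (splitAt ω Z) (splitAt ω X x) := by
  simp only [splitAt]
  exact coprod_coassoc (fun a : Entry K V => a.sub ≤ X) (Entry.proj ω X)
    (fun a => a.sub ≤ X ⊔ Z) (Entry.proj ω (X ⊔ Z)) (fun a => a.sub ≤ Z) (Entry.proj ω Z)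
    (fun a ha => ha.trans le_sup_left)
    (fun a _ => projPerp_le_iff hω hX hZX)
    (fun a _ => Entry.ext (projPerp_projPerp hω hX hZ hZX a.sub)) x

/-- Coassociativity of the sum of all splittings. -/
theorem splitPart_splitPart [FiniteDimensional K V] (hω : ω.IsRefl) (x : Ext k (Entry K V)) :
    TensorProduct.assoc k _ _ _
        (TensorProduct.map (splitPart ω) LinearMap.id (splitPart ω x)) =
      TensorProduct.map parity (splitPart ω) (splitPart ω x) := by
  have : (TensorProduct.assoc k _ _ _).toLinearMap ∘ₗ
      TensorProduct.map (splitPart ω) LinearMap.id ∘ₗ splitPart ω =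
      (TensorProduct.map parity (splitPart ω) ∘ₗ splitPart ω : Ext k (Entry K V) →ₗ[k] _) := by
    refine Finsupp.lhom_ext' fun A => LinearMap.ext_ring ?_
    change TensorProduct.assoc k _ _ _
        (TensorProduct.map (splitPart ω) LinearMap.id (splitPart ω (Finsupp.single A (1 : k)))) =
      TensorProduct.map parity (splitPart ω) (splitPart ω (Finsupp.single A (1 : k)))
    let P : Ext k (Entry K V) ⊗[k] (Ext k (Entry K V) ⊗[k] Ext k (Entry K V)) →ₗ[k]
        Ext k (Entry K V) ⊗[k] (Ext k (Entry K V) ⊗[k] Ext k (Entry K V)) :=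
      TensorProduct.map LinearMap.id (TensorProduct.map parity LinearMap.id)
    have hl : ∀ Y ∈ splitSpans ω A, TensorProduct.assoc k _ _ _
        (TensorProduct.map (splitPart ω) LinearMap.id (TensorProduct.map parity LinearMap.id
          (splitAt ω Y (Finsupp.single A (1 : k))))) =
        ∑ X ∈ splitSpans ω (inside Y A), P (TensorProduct.assoc k _ _ _
          (TensorProduct.map (splitAt ω X) LinearMap.id
            (splitAt ω Y (Finsupp.single A (1 : k))))) := by
      intro Y _
      obtain ⟨c, hc⟩ := exists_splitAt_single (k := k) ω Y A
      rw [hc]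
      simp only [map_smul, TensorProduct.map_tmul, LinearMap.id_apply, splitPart_parity,
        splitPart_single, map_sum, TensorProduct.sum_tmul]
      rw [Finset.smul_sum]
      refine Finset.sum_congr rfl fun X _ => ?_
      congr 1
      generalize splitAt ω X (Finsupp.single (inside Y A) (1 : k)) = m
      induction m with
      | zero => simp
      | add x y hx hy => simp only [map_add, TensorProduct.add_tmul, hx, hy]
      | tmul x y => simp [P]
    have hr : ∀ X ∈ splitSpans ω A, TensorProduct.map parity (splitPart ω)
        (TensorProduct.map parity LinearMap.id (splitAt ω X (Finsupp.single A (1 : k)))) =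
        ∑ Z ∈ splitSpans ω (projOutside ω X A), P (TensorProduct.map LinearMap.id (splitAt ω Z)
          (splitAt ω X (Finsupp.single A (1 : k)))) := by
      intro X _
      obtain ⟨c, hc⟩ := exists_splitAt_single (k := k) ω X A
      rw [hc]
      simp only [map_smul, TensorProduct.map_tmul, LinearMap.id_apply, parity_parity,
        splitPart_single, TensorProduct.tmul_sum, P]
      rw [Finset.smul_sum]
    rw [splitPart_single, map_sum, map_sum, map_sum, Finset.sum_congr rfl hl,
      Finset.sum_congr rfl hr, Finset.sum_sigma', Finset.sum_sigma']
    -- Pairs `X < Y` correspond to pairs `X`, `Z ≤ X^⊥`, where `Z = X^⊥ ∩ Y` and `Y = X ⊔ Z`.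
    refine Finset.sum_nbij' (fun q => ⟨q.2, ω.orthogonal q.2 ⊓ q.1⟩) (fun q => ⟨q.1 ⊔ q.2, q.1⟩)
      ?_ ?_ ?_ ?_ ?_
    · rintro ⟨Y, X⟩ h
      simp only [Finset.mem_sigma] at h ⊢
      obtain ⟨hY, hX⟩ := h
      have hYA := lt_of_mem_splitSpans hY
      have hXY := lt_of_mem_splitSpans hX
      rw [mem_splitSpans] at hY hX ⊢
      rw [hY.1] at hXY hX
      rw [inside_inside hXY.le] at hX
      have hs := sup_orthogonal_inf hω hX.2.2.2 hXY.le
      refine ⟨⟨hX.1, hX.2.1, (hXY.trans hYA).ne, hX.2.2.2⟩, ?_⟩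
      rw [mem_splitSpans, inside_projOutside hω hX.2.2.2 inf_le_left, hs,
        spanF_projOutside hω hX.2.2.2 (by rw [hY.1]; exact hXY.le), hY.1,
        spanF_projOutside hω hX.2.2.2 (hXY.trans hYA).le]
      refine ⟨rfl, fun h => ?_, fun h => ?_,
        nondegenerate_orthogonal_inf hω hX.2.2.2 hY.2.2.2 hXY.le⟩
      · rw [h, sup_bot_eq] at hs
        exact hXY.ne hs
      · rw [h, sup_orthogonal_inf hω hX.2.2.2 (hXY.trans hYA).le] at hs
        exact hYA.ne hs.symm
    · rintro ⟨X, Z⟩ h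
      simp only [Finset.mem_sigma] at h ⊢
      obtain ⟨hX, hZ⟩ := h
      have hXA := lt_of_mem_splitSpans hX
      have hZA := lt_of_mem_splitSpans hZ
      rw [mem_splitSpans] at hX hZ
      have hZX : Z ≤ ω.orthogonal X := hZA.le.trans (spanF_projOutside_le X A)
      rw [inside_projOutside hω hX.2.2.2 hZX] at hZ
      have hY : spanF (inside (X ⊔ Z) A) = X ⊔ Z := by
        have h1 : X ≤ spanF (inside (X ⊔ Z) A) := by
          conv_lhs => rw [← hX.1]
          exact spanF_mono fun a ha => mem_inside.2 ⟨(mem_inside.1 ha).1,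
            (mem_inside.1 ha).2.trans le_sup_left⟩
        rw [← sup_eq_right.2 h1, ← sup_spanF_projOutside hω hX.2.2.2, hZ.1]
      have hne : X ≠ X ⊔ Z := fun h => hZ.2.1 (by
        have h3 : Z ≤ X := le_sup_right.trans h.symm.le
        exact eq_bot_iff.2 ((isCompl_orthogonal hω hX.2.2.2).inf_eq_bot ▸ le_inf h3 hZX))
      refine ⟨mem_splitSpans.2 ⟨hY, fun h => hX.2.1 (sup_eq_bot_iff.1 h).1, fun h => ?_,
        nondegenerate_sup hω hX.2.2.2 hZ.2.2.2 hZX⟩, mem_splitSpans.2 ⟨?_, hX.2.1, ?_, hX.2.2.2⟩⟩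
      · refine hZ.2.2.1 ?_
        rw [spanF_projOutside hω hX.2.2.2 hXA.le, eq_orthogonal_inf_iff hω hX.2.2.2 hXA.le hZX]
        exact h
      · rw [inside_inside le_sup_left, hX.1]
      · rw [hY]
        exact hne
    · rintro ⟨Y, X⟩ h
      simp only [Finset.mem_sigma] at h
      have hXY := lt_of_mem_splitSpans h.2
      rw [(mem_splitSpans.1 h.1).1] at hXY
      simp only [sup_orthogonal_inf hω (mem_splitSpans.1 h.2).2.2.2 hXY.le]
    · rintro ⟨X, Z⟩ h
      simp only [Finset.mem_sigma] at h
      have hZX : Z ≤ ω.orthogonal X :=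
        (lt_of_mem_splitSpans h.2).le.trans (spanF_projOutside_le X A)
      simp only [inf_comm (ω.orthogonal X),
        sup_inf_orthogonal hω (mem_splitSpans.1 h.1).2.2.2 hZX]
    · rintro ⟨Y, X⟩ h
      simp only [Finset.mem_sigma] at h
      have hXY := lt_of_mem_splitSpans h.2
      rw [(mem_splitSpans.1 h.1).1] at hXY
      have hXn := (mem_splitSpans.1 h.2).2.2.2
      have h1 := splitAt_coassoc (k := k) hω hXn
        (nondegenerate_orthogonal_inf hω hXn (mem_splitSpans.1 h.1).2.2.2 hXY.le) inf_le_left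
        (Finsupp.single A 1)
      rw [sup_orthogonal_inf hω hXn hXY.le] at h1
      exact congrArg P h1
  exact LinearMap.congr_fun this x

/-- The word with three factors, the first one being given by an element of the exterior algebra
and the last two by an element of its tensor square. -/
def letters₃ : Ext k (Entry K V) ⊗[k] (Ext k (Entry K V) ⊗[k] Ext k (Entry K V)) →ₗ[k]
    Words k (Entry K V) :=
  TensorProduct.lift ((cat ∘ₗ letter).compl₂ letters₂)

theorem wordParity_letterDiff (x : Ext k (Entry K V)) :
    wordParity (letterDiff ω x) = letterDiff ω (parity x) := by
  rw [letterDiff_apply, letterDiff_apply, map_add, wordParity_letter, omitPart_parity, map_neg,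
    splitPart_parity]
  congr 1
  generalize splitPart ω x = m
  induction m with
  | zero => simp
  | add x y hx hy => simp only [map_add, hx, hy]
  | tmul x y => simp [wordParity_cat, wordParity_letter]

theorem diff_letters₂ (z : Ext k (Entry K V) ⊗[k] Ext k (Entry K V)) :
    diff ω (letters₂ z) = letters₂ (TensorProduct.map omitPart LinearMap.id z) -
      letters₂ (TensorProduct.map parity omitPart z) +
      (letters₃ (TensorProduct.assoc k _ _ _ (TensorProduct.map (splitPart ω) LinearMap.id z)) -
        letters₃ (TensorProduct.map parity (splitPart ω) z)) := by
  induction z with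
  | zero => simp
  | add x y hx hy => simp only [map_add, hx, hy]; abel
  | tmul x y =>
    have h : ∀ m : Ext k (Entry K V) ⊗[k] Ext k (Entry K V),
        cat (letters₂ m) (letter y) = letters₃ (TensorProduct.assoc k _ _ _ (m ⊗ₜ y)) := by
      intro m
      induction m with
      | zero => simp
      | add x y hx hy => simp only [map_add, LinearMap.add_apply, TensorProduct.add_tmul, hx, hy]
      | tmul x z => simp [letters₃, cat_assoc]
    rw [letters₂_tmul, diff, deriv_cat, deriv_letter, deriv_letter, wordParity_letter,
      letterDiff_apply, letterDiff_apply, map_add, LinearMap.add_apply, h, map_neg,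
      LinearMap.neg_apply, map_add]
    simp only [TensorProduct.map_tmul, LinearMap.id_apply, letters₂_tmul]
    rw [show letters₃ (parity x ⊗ₜ[k] splitPart ω y) =
      cat (letter (parity x)) (letters₂ (splitPart ω y)) from rfl]
    abel

/-- The terms of the square of the differential on a single factor cancel in pairs: omit-terms since
the simplicial boundary has square zero, mixed terms since splitting anticommutes with omission, and
split-terms since splitting is coassociative. -/
theorem diff_diff [FiniteDimensional K V] (hω : ω.IsRefl) (x : Words k (Entry K V)) :
    diff ω (diff ω x) = 0 := by
  refine deriv_deriv _ wordParity_letterDiff (fun x => ?_) x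
  change diff ω (letterDiff ω x) = 0
  rw [letterDiff_apply, map_add, diff_letters₂, diff, deriv_letter, letterDiff_apply,
    omitPart_omitPart, splitPart_omitPart hω, splitPart_splitPart hω, map_add, map_neg]
  simp

end Differential

/-! ### Good words -/

section Support

variable {k : Type*} [CommRing k] {K V : Type*} [Field K] [AddCommGroup V] [Module K V]

theorem single_mem_supported {ι : Type*} {S : Set ι} {i : ι} (h : i ∈ S) :
    Finsupp.single i (1 : k) ∈ Finsupp.supported k k S :=
  Finsupp.single_mem_supported k _ h

/-- A linear map takes a supported element into a submodule, if it does so for basis vectors. -/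
theorem map_mem_of_supported {ι M : Type*} [AddCommGroup M] [Module k M] {S : Set ι}
    {N : Submodule k M} (T : (ι →₀ k) →ₗ[k] M) (h : ∀ i ∈ S, T (Finsupp.single i 1) ∈ N)
    {x : ι →₀ k} (hx : x ∈ Finsupp.supported k k S) : T x ∈ N := by
  have hle : Finsupp.supported k k S ≤ N.comap T := by
    rw [Finsupp.supported_eq_span_single, Submodule.span_le]
    rintro _ ⟨i, hi, rfl⟩
    exact h i hi
  exact hle hx

theorem cat_mem_supported {α : Type*} {S S' T : Set (List (Finset α))} {x y : Words k α}
    (hx : x ∈ Finsupp.supported k k S) (hy : y ∈ Finsupp.supported k k S')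
    (h : ∀ u ∈ S, ∀ v ∈ S', u ++ v ∈ T) : cat x y ∈ Finsupp.supported k k T := by
  refine map_mem_of_supported (N := Finsupp.supported k k T) (cat.flip y) (fun u hu => ?_) hx
  refine map_mem_of_supported (cat (Finsupp.single u (1 : k))) (fun v hv => ?_) hy
  rw [cat_single]
  exact single_mem_supported (h u hu v hv)

variable (ω : LinearMap.BilinForm K V)

open Classical in
/-- The differential of a word with one factor, as a sum of words. -/
theorem exists_letterDiff_single (A : Finset (Entry K V)) : ∃ (c : Entry K V → ℕ)
    (c' : Submodule K V → k),
    (∀ X, Set.InjOn (Entry.proj ω X) (outside X A) → ∃ e : ℕ, c' X = (-1) ^ e) ∧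
    (∀ X, ¬Set.InjOn (Entry.proj ω X) (outside X A) → c' X = 0) ∧
    letterDiff ω (Finsupp.single A (1 : k)) =
      (∑ a ∈ A, if spanF (A.erase a) = spanF A then
        (-1 : k) ^ c a • Finsupp.single [A.erase a] (1 : k) else 0) +
      ∑ X ∈ splitSpans ω A, c' X • Finsupp.single [inside X A, projOutside ω X A] (1 : k) := by
  have h : ∀ X, ∃ c : k, (Set.InjOn (Entry.proj ω X) (outside X A) → ∃ e : ℕ, c = (-1) ^ e) ∧
      (¬Set.InjOn (Entry.proj ω X) (outside X A) → c = 0) ∧ letters₂ (TensorProduct.map parity LinearMap.id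
        (splitAt ω X (Finsupp.single A (1 : k)))) =
      c • Finsupp.single [inside X A, projOutside ω X A] (1 : k) := by
    intro X
    rcases splitAt_single_eq_zero_or (k := k) ω X A with h | ⟨hi, e, h⟩
    · exact ⟨0, fun h' => absurd h' h.1, fun _ => rfl, by rw [h.2, map_zero, map_zero, zero_smul]⟩
    · refine ⟨(-1) ^ (e + (inside X A).card), fun _ => ⟨_, rfl⟩, fun h' => absurd hi h', ?_⟩
      rw [h, map_smul, map_smul, TensorProduct.map_tmul, parity_single, LinearMap.id_apply,
        letters₂_tmul, map_smul, letter_single, letter_single, map_smul, LinearMap.smul_apply,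
        cat_single, smul_smul, pow_add]
      rfl
  choose c' hc' hc0 hc using h
  refine ⟨fun a => (A.filter (· < a)).card, c', hc', hc0, ?_⟩
  rw [letterDiff_apply, omitPart_single_eq_sum, splitPart_single, map_sum, map_sum]
  congr 1
  · refine Finset.sum_congr rfl fun a _ => ?_
    split_ifs
    · rw [map_smul, letter_single]
    · rw [map_zero]
  · exact Finset.sum_congr rfl fun X _ => hc X

theorem letterDiff_mem {A : Finset (Entry K V)} {S : Set (List (Finset (Entry K V)))}
    (h1 : ∀ a ∈ A, spanF (A.erase a) = spanF A → [A.erase a] ∈ S)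
    (h2 : ∀ X ∈ splitSpans ω A, Set.InjOn (Entry.proj ω X) (outside X A) →
      [inside X A, projOutside ω X A] ∈ S) :
    letterDiff ω (Finsupp.single A (1 : k)) ∈ Finsupp.supported k k S := by
  classical
  obtain ⟨c, c', -, hc, h⟩ := exists_letterDiff_single (k := k) ω A
  rw [h]
  refine add_mem (sum_mem fun a ha => ?_) (sum_mem fun X hX => ?_)
  · split_ifs with hs
    · exact Submodule.smul_mem _ _ (single_mem_supported (h1 a ha hs))
    · exact zero_mem _
  · by_cases hi : Set.InjOn (Entry.proj ω X) (outside X A)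
    · exact Submodule.smul_mem _ _ (single_mem_supported (h2 X hX hi))
    · rw [hc X hi, zero_smul]
      exact zero_mem _

theorem diff_cons (A : Finset (Entry K V)) (L : List (Finset (Entry K V))) :
    diff ω (Finsupp.single (A :: L) (1 : k)) =
      cat (letterDiff ω (Finsupp.single A 1)) (Finsupp.single L 1) +
      (-1 : k) ^ (A.card + 1) • cat (Finsupp.single [A] 1) (diff ω (Finsupp.single L 1)) := by
  rw [diff, deriv_single, derivWord, ← deriv_single, wordParity_single, map_smul,
    LinearMap.smul_apply]
  simp [wordSign]

theorem diff_append_singleton (L : List (Finset (Entry K V))) (A : Finset (Entry K V)) :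
    diff ω (Finsupp.single (L ++ [A]) (1 : k)) =
      cat (diff ω (Finsupp.single L 1)) (Finsupp.single [A] 1) +
      (wordSign L : k) • cat (Finsupp.single L 1) (letterDiff ω (Finsupp.single A 1)) := by
  rw [← cat_single, diff, deriv_cat, wordParity_single, map_smul, LinearMap.smul_apply,
    ← letter_single A, deriv_letter]

theorem exists_wordSign_eq {α : Type*} (L : List (Finset α)) :
    ∃ e : ℕ, (wordSign L : k) = (-1) ^ e := by
  induction L with
  | nil => exact ⟨0, by simp [wordSign]⟩
  | cons A L ih =>
    obtain ⟨e, he⟩ := ih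
    exact ⟨A.card + 1 + e, by rw [pow_add, ← he]; simp [wordSign]⟩

variable {ω}

/-- The sum of the spans of the factors of a word. -/
def tot : List (Finset (Entry K V)) → Submodule K V
  | [] => ⊥
  | A :: L => spanF A ⊔ tot L

@[simp] theorem tot_nil : tot ([] : List (Finset (Entry K V))) = ⊥ := rfl

@[simp] theorem tot_cons (A : Finset (Entry K V)) (L : List (Finset (Entry K V))) :
    tot (A :: L) = spanF A ⊔ tot L := rfl

@[simp] theorem tot_append (L L' : List (Finset (Entry K V))) :
    tot (L ++ L') = tot L ⊔ tot L' := by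
  induction L with
  | nil => simp
  | cons A L ih => simp [ih, sup_assoc]

/-- The entry is a line. -/
def Entry.IsLine (a : Entry K V) : Prop := Module.finrank K a.sub = 1

variable (ω) in
/-- A nonempty set of lines whose span is symplectic. -/
structure IsBlock (A : Finset (Entry K V)) : Prop where
  isLine : ∀ a ∈ A, a.IsLine
  nonempty : A.Nonempty
  nondegenerate : (ω.restrict (spanF A)).Nondegenerate

variable (ω) in
/-- A word whose factors are nonempty sets of lines with symplectic, pairwise perpendicular
spans. -/
def Good : List (Finset (Entry K V)) → Prop
  | [] => True
  | A :: L => IsBlock ω A ∧ tot L ≤ ω.orthogonal (spanF A) ∧ Good L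

theorem good_cons {A : Finset (Entry K V)} {L : List (Finset (Entry K V))} :
    Good ω (A :: L) ↔ IsBlock ω A ∧ tot L ≤ ω.orthogonal (spanF A) ∧ Good ω L := Iff.rfl

theorem orthogonal_bot : ω.orthogonal (⊥ : Submodule K V) = ⊤ := by
  refine eq_top_iff.2 fun v _ w hw => ?_
  rw [Submodule.mem_bot] at hw
  simp [hw]

theorem good_append {L L' : List (Finset (Entry K V))} :
    Good ω (L ++ L') ↔ Good ω L ∧ Good ω L' ∧ tot L' ≤ ω.orthogonal (tot L) := by
  induction L with
  | nil => simp [Good]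
  | cons A L ih =>
    rw [List.cons_append, good_cons, good_cons, ih, tot_append, tot_cons, orthogonal_sup, sup_le_iff,
      le_inf_iff]
    tauto

theorem good_singleton {A : Finset (Entry K V)} : Good ω [A] ↔ IsBlock ω A := by
  simp [Good]

theorem Entry.IsLine.ne_bot {a : Entry K V} (h : a.IsLine) : a.sub ≠ ⊥ := by
  intro h'
  rw [Entry.IsLine, h', finrank_bot] at h
  exact zero_ne_one h

theorem spanF_ne_bot {A : Finset (Entry K V)} (h : ∀ a ∈ A, a.IsLine) (h' : A.Nonempty) :
    spanF A ≠ ⊥ := by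
  obtain ⟨a, ha⟩ := h'
  exact fun h0 => (h a ha).ne_bot (eq_bot_iff.2 (h0 ▸ le_spanF ha))

theorem nonempty_of_spanF_ne_bot {A : Finset (Entry K V)} (h : spanF A ≠ ⊥) : A.Nonempty := by
  rw [Finset.nonempty_iff_ne_empty]
  rintro rfl
  exact h spanF_empty

theorem IsBlock.spanF_ne_bot {A : Finset (Entry K V)} (h : IsBlock ω A) : spanF A ≠ ⊥ :=
  SymplecticSharbly.spanF_ne_bot h.isLine h.nonempty

theorem nondegenerate_bot : (ω.restrict (⊥ : Submodule K V)).Nondegenerate :=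
  ⟨fun _ _ => Subsingleton.elim _ _, fun _ _ => Subsingleton.elim _ _⟩

variable [FiniteDimensional K V]

theorem nondegenerate_tot (hω : ω.IsRefl) {L : List (Finset (Entry K V))} (h : Good ω L) :
    (ω.restrict (tot L)).Nondegenerate := by
  induction L with
  | nil => exact nondegenerate_bot
  | cons A L ih => exact nondegenerate_sup hω h.1.nondegenerate (ih h.2.2) h.2.1

theorem isLine_of_mem_projOutside (hω : ω.IsRefl) {X : Submodule K V}
    (hX : (ω.restrict X).Nondegenerate) {A : Finset (Entry K V)} (hA : ∀ a ∈ A, a.IsLine)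
    {a : Entry K V} (h : a ∈ projOutside ω X A) : a.IsLine := by
  obtain ⟨b, hb, rfl⟩ := Finset.mem_image.1 h
  rw [mem_outside] at hb
  exact finrank_projPerp hω hX (hA b hb.1) hb.2

theorem orthogonal_inf_ne_bot (hω : ω.IsRefl) {X W : Submodule K V}
    (hX : (ω.restrict X).Nondegenerate) (h : X < W) : ω.orthogonal X ⊓ W ≠ ⊥ := fun h0 => by
  have h1 := sup_orthogonal_inf hω hX h.le
  rw [h0, sup_bot_eq] at h1
  exact h.ne h1

/-- Splitting a nonempty set of lines with symplectic span yields a good word. -/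
theorem good_split (hω : ω.IsRefl) {A : Finset (Entry K V)} (hA : IsBlock ω A)
    {X : Submodule K V} (hX : X ∈ splitSpans ω A) :
    Good ω [inside X A, projOutside ω X A] ∧ tot [inside X A, projOutside ω X A] = spanF A := by
  have hlt := lt_of_mem_splitSpans hX
  rw [mem_splitSpans] at hX
  have hs := spanF_projOutside hω hX.2.2.2 hlt.le
  refine ⟨⟨⟨fun a ha => hA.isLine a (mem_inside.1 ha).1,
    nonempty_of_spanF_ne_bot (hX.1.symm ▸ hX.2.1), hX.1.symm ▸ hX.2.2.2⟩, ?_,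
    good_singleton.2 ⟨fun a => isLine_of_mem_projOutside hω hX.2.2.2 hA.isLine,
      nonempty_of_spanF_ne_bot ?_, ?_⟩⟩, ?_⟩
  · rw [hX.1, tot_cons, tot_nil, sup_bot_eq]
    exact spanF_projOutside_le X A
  · rw [hs]
    exact orthogonal_inf_ne_bot hω hX.2.2.2 hlt
  · rw [hs]
    exact nondegenerate_orthogonal_inf hω hX.2.2.2 hA.nondegenerate hlt.le
  · rw [tot_cons, tot_cons, tot_nil, sup_bot_eq, hX.1, hs, sup_orthogonal_inf hω hX.2.2.2 hlt.le]

/-- The differential of a good word involves only good words with the same total span. -/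
theorem diff_mem_of_good (hω : ω.IsRefl) {L : List (Finset (Entry K V))} (h : Good ω L) :
    diff ω (Finsupp.single L (1 : k)) ∈
      Finsupp.supported k k {L' | Good ω L' ∧ tot L' = tot L} := by
  induction L with
  | nil =>
    rw [diff, deriv_nil]
    exact zero_mem _
  | cons A L ih =>
    rw [diff_cons]
    refine add_mem ?_ (Submodule.smul_mem _ _ ?_)
    · refine cat_mem_supported (S := {L' | Good ω L' ∧ tot L' = spanF A}) (S' := {L})
        (letterDiff_mem ω (fun a ha hs => ?_) fun X hX _ => good_split hω h.1 hX)
        (single_mem_supported rfl) ?_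
      · refine ⟨good_singleton.2 ⟨fun b hb => h.1.isLine b (Finset.mem_of_mem_erase hb),
          nonempty_of_spanF_ne_bot (hs.symm ▸ h.1.spanF_ne_bot), hs.symm ▸ h.1.nondegenerate⟩, ?_⟩
        rw [tot_cons, tot_nil, sup_bot_eq, hs]
      · rintro u ⟨hu, hu'⟩ v rfl
        exact ⟨good_append.2 ⟨hu, h.2.2, hu'.symm ▸ h.2.1⟩, by rw [tot_append, tot_cons, hu']⟩
    · refine cat_mem_supported (S := {[A]}) (single_mem_supported rfl) (ih h.2.2) ?_
      rintro u rfl v ⟨hv, hv'⟩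
      exact ⟨⟨h.1, hv'.symm ▸ h.2.1, hv⟩, by simp [hv']⟩

omit [FiniteDimensional K V] in
open Classical in
/-- The differential of a word whose last factor contains an entry that contains all others,
as a sum of words. -/
theorem exists_diff_append_insert (L : List (Finset (Entry K V)))
    {s : Entry K V} {B : Finset (Entry K V)} (hB : ∀ b ∈ B, b.sub < s.sub) :
    ∃ (c : Entry K V → ℕ) (c' : ℕ) (c'' : Submodule K V → k),
    (spanF B ∈ splitSpans ω (insert s B) → ∃ e : ℕ, c'' (spanF B) = (-1) ^ e) ∧
    diff ω (Finsupp.single (L ++ [insert s B]) (1 : k)) =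
      cat (diff ω (Finsupp.single L 1)) (Finsupp.single [insert s B] 1) +
      ((∑ b ∈ B, (-1 : k) ^ c b • Finsupp.single (L ++ [insert s (B.erase b)]) (1 : k)) +
      (if spanF B = s.sub then (-1 : k) ^ c' • Finsupp.single (L ++ [B]) (1 : k) else 0) +
      ∑ X ∈ splitSpans ω (insert s B), c'' X • Finsupp.single
        (L ++ [inside X B, insert (⟨ω.orthogonal X ⊓ s.sub⟩) (projOutside ω X B)]) (1 : k)) := by
  have hsB : s ∉ B := fun h => lt_irrefl _ (hB s h)
  have hspan : ∀ B' ⊆ B, spanF (insert s B') = s.sub := fun B' h => by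
    rw [spanF_insert, sup_eq_left, spanF_le]
    exact fun b hb => (hB b (h hb)).le
  have hlt : ∀ X ∈ splitSpans ω (insert s B), X < s.sub := fun X hX => by
    have := lt_of_mem_splitSpans hX
    rwa [hspan B subset_rfl] at this
  obtain ⟨c, c', hc', -, h⟩ := exists_letterDiff_single (k := k) ω (insert s B)
  obtain ⟨e, he⟩ := exists_wordSign_eq (k := k) L
  refine ⟨fun b => e + c b, e + c s, fun X => (-1) ^ e * c' X, fun hB' => ?_, ?_⟩
  · obtain ⟨e', he'⟩ := hc' (spanF B) (by
      have : ∀ b, b ∈ outside (spanF B) (insert s B) → b = s := fun b hb => by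
        rw [mem_outside, Finset.mem_insert] at hb
        rcases hb.1 with h | h
        · exact h
        · exact absurd (le_spanF h) hb.2
      intro a ha b hb _
      rw [this a ha, this b hb])
    exact ⟨e + e', by simp only [he', pow_add]⟩
  · rw [diff_append_singleton, h, he, map_add, smul_add, map_sum, map_sum]
    congr 2
    · rw [Finset.sum_insert hsB, Finset.erase_insert hsB, hspan B subset_rfl,
        smul_add, add_comm]
      congr 1
      · rw [Finset.smul_sum]
        refine Finset.sum_congr rfl fun b hb => ?_
        have hbs : b ≠ s := fun h => hsB (h ▸ hb)
        rw [Finset.erase_insert_of_ne hbs.symm, hspan _ (Finset.erase_subset _ _), if_pos rfl,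
          map_smul, cat_single, smul_smul, pow_add]
      · split_ifs
        · rw [map_smul, cat_single, smul_smul, pow_add]
        · rw [map_zero, smul_zero]
    · rw [Finset.smul_sum]
      refine Finset.sum_congr rfl fun X hX => ?_
      have hsX := not_le_of_gt (hlt X hX)
      have h1 : inside X (insert s B) = inside X B := by
        ext a
        simp only [mem_inside, Finset.mem_insert]
        refine ⟨fun h => ⟨h.1.resolve_left ?_, h.2⟩, fun h => ⟨Or.inr h.1, h.2⟩⟩
        rintro rfl
        exact hsX h.2
      have h2 : projOutside ω X (insert s B) =
          insert ⟨ω.orthogonal X ⊓ s.sub⟩ (projOutside ω X B) := by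
        have : outside X (insert s B) = insert s (outside X B) := by
          ext a
          simp only [mem_outside, Finset.mem_insert]
          refine ⟨fun h => h.1.imp_right fun h' => ⟨h', h.2⟩, ?_⟩
          rintro (rfl | h)
          · exact ⟨Or.inl rfl, hsX⟩
          · exact ⟨Or.inr h.1, h.2⟩
        rw [projOutside, this, Finset.image_insert, projOutside, Entry.proj,
          projPerp_eq_orthogonal_inf (hlt X hX).le]
      rw [h1, h2, map_smul, cat_single, smul_smul]

end Support

/-! ### Relative acyclicity from matchings of basis vectors -/

section Matching

variable {k : Type*} [CommRing k] {ι : Type*} (D : (ι →₀ k) →ₗ[k] (ι →₀ k))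

/-- The span of the basis vectors indexed by `P` is mapped to itself by `D`. -/
def IsClosedUnder (P : Set ι) : Prop :=
  ∀ i ∈ P, D (Finsupp.single i 1) ∈ Finsupp.supported k k P

/-- The complex of basis vectors in `P` is acyclic relative to the one of those in `Q`: the
quotient of `P ∪ Q` by `Q` has no homology. -/
def RelAcyclic (P Q : Set ι) : Prop :=
  ∀ x ∈ Finsupp.supported k k P, D x ∈ Finsupp.supported k k Q →
    ∃ y ∈ Finsupp.supported k k P, x - D y ∈ Finsupp.supported k k Q

variable {D}

theorem IsClosedUnder.map_mem {P : Set ι} (h : IsClosedUnder D P) {x : ι →₀ k}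
    (hx : x ∈ Finsupp.supported k k P) : D x ∈ Finsupp.supported k k P :=
  map_mem_of_supported D h hx

theorem IsClosedUnder.union {P Q : Set ι} (hP : IsClosedUnder D P) (hQ : IsClosedUnder D Q) :
    IsClosedUnder D (P ∪ Q) := by
  rintro i (hi | hi)
  · exact Finsupp.supported_mono Set.subset_union_left (hP i hi)
  · exact Finsupp.supported_mono Set.subset_union_right (hQ i hi)

theorem supported_union_eq {P Q : Set ι} {x : ι →₀ k} (h : x ∈ Finsupp.supported k k (P ∪ Q)) :
    ∃ y ∈ Finsupp.supported k k P, ∃ z ∈ Finsupp.supported k k Q, y + z = x := by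
  rw [Finsupp.supported_union] at h
  exact Submodule.mem_sup.1 h

theorem mem_supported_inter {P Q : Set ι} {x : ι →₀ k} (h : x ∈ Finsupp.supported k k P)
    (h' : x ∈ Finsupp.supported k k Q) : x ∈ Finsupp.supported k k (P ∩ Q) := by
  rw [Finsupp.supported_inter]
  exact ⟨h, h'⟩

theorem apply_eq_zero_of_supported {P : Set ι} {x : ι →₀ k} (h : x ∈ Finsupp.supported k k P)
    {i : ι} (hi : i ∉ P) : x i = 0 := by
  by_contra h'
  exact hi ((Finsupp.mem_supported k x).1 h (Finsupp.mem_support_iff.2 h'))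

/-- Relative acyclicity from a matching `μ : I₁ → I₀` of basis vectors, such that the differential
of a vector in `I₁` has coefficient `±1` at its partner, and otherwise involves only vectors in
`I₁`, vectors in `I₀` of lower filtration, and vectors in `Q`. -/
theorem relAcyclic_of_matching {I₀ I₁ Q : Set ι} (μ : ι → ι) (f : ι → ℕ)
    (hQ : IsClosedUnder D Q) (h01 : Disjoint I₀ I₁) (h0Q : Disjoint I₀ Q)
    (hμ : Set.BijOn μ I₁ I₀)
    (h : ∀ i ∈ I₁, ∃ e : ℕ, D (Finsupp.single i 1) - (-1 : k) ^ e • Finsupp.single (μ i) 1 ∈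
      Finsupp.supported k k (I₁ ∪ {j | j ∈ I₀ ∧ f j < f (μ i)} ∪ Q))
    (hD : ∀ x, D (D x) = 0) : RelAcyclic D (I₀ ∪ I₁ ∪ Q) Q := by
  -- Basis vectors in `I₀` can be removed by boundaries, by induction on the filtration.
  have h1 : ∀ N, ∀ j ∈ I₀, f j < N → ∃ y ∈ Finsupp.supported k k I₁,
      Finsupp.single j (1 : k) - D y ∈ Finsupp.supported k k (I₁ ∪ Q) := by
    intro N
    induction N with
    | zero => exact fun j _ hj => absurd hj (Nat.not_lt_zero _)
    | succ N ih =>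
      intro j hj hN
      obtain ⟨i, hi, rfl⟩ := hμ.surjOn hj
      obtain ⟨e, he⟩ := h i hi
      obtain ⟨z, hz, q, hq, hzq⟩ := supported_union_eq he
      obtain ⟨z1, hz1, z0, hz0, hz10⟩ := supported_union_eq hz
      have hlow : ∃ y ∈ Finsupp.supported k k I₁,
          z0 - D y ∈ Finsupp.supported k k (I₁ ∪ Q) := by
        rw [Finsupp.supported_eq_span_single] at hz0
        refine Submodule.span_induction ?_ ?_ ?_ ?_ hz0
        · rintro _ ⟨j, hj, rfl⟩
          exact ih j hj.1 (hj.2.trans_le (Nat.lt_succ_iff.1 hN))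
        · exact ⟨0, zero_mem _, by simp⟩
        · rintro x x' _ _ ⟨y, hy, hxy⟩ ⟨y', hy', hxy'⟩
          refine ⟨y + y', add_mem hy hy', ?_⟩
          rw [map_add, add_sub_add_comm]
          exact add_mem hxy hxy'
        · rintro c x _ ⟨y, hy, hxy⟩
          refine ⟨c • y, Submodule.smul_mem _ c hy, ?_⟩
          rw [map_smul, ← smul_sub]
          exact Submodule.smul_mem _ c hxy
      obtain ⟨y, hy, hzy⟩ := hlow
      refine ⟨(-1 : k) ^ e • (Finsupp.single i 1 - y), Submodule.smul_mem _ _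
        (sub_mem (single_mem_supported hi) hy), ?_⟩
      have hsq : (-1 : k) ^ e * (-1) ^ e = 1 := by
        rw [← mul_pow]
        simp
      have h2 : Finsupp.single (μ i) (1 : k) =
          (-1 : k) ^ e • ((-1 : k) ^ e • Finsupp.single (μ i) (1 : k)) := by
        rw [smul_smul, hsq, one_smul]
      rw [h2, map_smul, ← smul_sub, map_sub]
      refine Submodule.smul_mem _ _ ?_
      have h3 : (-1 : k) ^ e • Finsupp.single (μ i) (1 : k) - (D (Finsupp.single i 1) - D y) =
          -((z0 - D y) + (z1 + q)) := by
        have : D (Finsupp.single i 1) = (-1 : k) ^ e • Finsupp.single (μ i) (1 : k) +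
            ((z1 + z0) + q) := by rw [hz10, hzq]; abel
        rw [this]
        abel
      rw [h3]
      exact neg_mem (add_mem hzy (add_mem (Finsupp.supported_mono Set.subset_union_left hz1)
        (Finsupp.supported_mono Set.subset_union_right hq)))
  -- A relative cycle in `I₁ ∪ Q` lies in `Q`: among its basis vectors in `I₁`, take one whose partner
  -- has maximal filtration; nothing cancels this partner in the boundary.
  have h2 : ∀ x ∈ Finsupp.supported k k (I₁ ∪ Q), D x ∈ Finsupp.supported k k Q →
      x ∈ Finsupp.supported k k Q := by
    intro x hx hDx
    obtain ⟨y, hy, q, hq, rfl⟩ := supported_union_eq hx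
    refine add_mem ?_ hq
    have hDy : D y ∈ Finsupp.supported k k Q := by
      have := sub_mem hDx (hQ.map_mem hq)
      rwa [map_add, add_sub_cancel_right] at this
    by_contra hne
    have hy0 : y.support.Nonempty := by
      rw [Finset.nonempty_iff_ne_empty, Ne, Finsupp.support_eq_empty]
      rintro rfl
      exact hne (zero_mem _)
    obtain ⟨i, hi, hmax⟩ := Finset.exists_max_image y.support (fun i => f (μ i)) hy0
    have hsub := (Finsupp.mem_supported k y).1 hy
    have hiI := hsub hi
    have hc : D y (μ i) = ∑ i' ∈ y.support, y i' * D (Finsupp.single i' 1) (μ i) := by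
      conv_lhs => rw [← Finsupp.sum_single y, Finsupp.sum, map_sum, Finsupp.finsetSum_apply]
      refine Finset.sum_congr rfl fun i' _ => ?_
      rw [← mul_one (y i'), ← smul_eq_mul, ← Finsupp.smul_single, map_smul, Finsupp.smul_apply,
        smul_eq_mul, smul_eq_mul, mul_one]
    have hrest : ∀ i' ∈ y.support, ∀ e : ℕ, D (Finsupp.single i' 1) - (-1 : k) ^ e •
        Finsupp.single (μ i') 1 ∈ Finsupp.supported k k
          (I₁ ∪ {j | j ∈ I₀ ∧ f j < f (μ i')} ∪ Q) →
        D (Finsupp.single i' 1) (μ i) = (-1 : k) ^ e * Finsupp.single (μ i') (1 : k) (μ i) := by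
      intro i' hi' e he
      have : μ i ∉ I₁ ∪ {j | j ∈ I₀ ∧ f j < f (μ i')} ∪ Q := by
        rintro ((h' | h') | h')
        · exact Set.disjoint_left.1 h01 (hμ.mapsTo hiI) h'
        · exact absurd (hmax i' hi') (not_le_of_gt h'.2)
        · exact Set.disjoint_left.1 h0Q (hμ.mapsTo hiI) h'
      have h4 := apply_eq_zero_of_supported he this
      rw [Finsupp.sub_apply, Finsupp.smul_apply, smul_eq_mul, sub_eq_zero] at h4
      exact h4
    rw [apply_eq_zero_of_supported hDy (Set.disjoint_left.1 h0Q (hμ.mapsTo hiI)),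
      Finset.sum_eq_single i] at hc
    · obtain ⟨e, he⟩ := h i hiI
      rw [hrest i hi e he, Finsupp.single_eq_same, mul_one] at hc
      have : y i = y i * (-1 : k) ^ e * (-1 : k) ^ e := by
        rw [mul_assoc, ← mul_pow]
        simp
      rw [← hc, zero_mul] at this
      exact (Finsupp.mem_support_iff.1 hi) this
    · intro i' hi' hne
      obtain ⟨e, he⟩ := h i' (hsub hi')
      rw [hrest i' hi' e he, Finsupp.single_eq_of_ne, mul_zero, mul_zero]
      exact fun h' => hne (hμ.injOn (hsub hi') hiI h'.symm)
    · exact fun h' => absurd hi h'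
  intro x hx hDx
  rw [Set.union_assoc] at hx
  obtain ⟨x0, hx0, x1, hx1, rfl⟩ := supported_union_eq hx
  have h3 : ∃ y ∈ Finsupp.supported k k I₁, x0 - D y ∈ Finsupp.supported k k (I₁ ∪ Q) := by
    rw [Finsupp.supported_eq_span_single] at hx0
    refine Submodule.span_induction ?_ ?_ ?_ ?_ hx0
    · rintro _ ⟨j, hj, rfl⟩
      exact h1 _ j hj (Nat.lt_succ_self _)
    · exact ⟨0, zero_mem _, by simp⟩
    · rintro x x' _ _ ⟨y, hy, hxy⟩ ⟨y', hy', hxy'⟩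
      refine ⟨y + y', add_mem hy hy', ?_⟩
      rw [map_add, add_sub_add_comm]
      exact add_mem hxy hxy'
    · rintro c x _ ⟨y, hy, hxy⟩
      refine ⟨c • y, Submodule.smul_mem _ c hy, ?_⟩
      rw [map_smul, ← smul_sub]
      exact Submodule.smul_mem _ c hxy
  obtain ⟨y, hy, hxy⟩ := h3
  refine ⟨y, Finsupp.supported_mono (fun i hi => Or.inl (Or.inr hi)) hy, h2 _ ?_ ?_⟩
  · rw [add_sub_right_comm]
    exact add_mem hxy hx1
  · rwa [map_sub, hD, sub_zero]

/-- Relative acyclicity is transitive. -/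
theorem RelAcyclic.trans {P Q Q' : Set ι} (h : RelAcyclic D P Q) (h' : RelAcyclic D Q Q')
    (hQP : Q ⊆ P) (hQ : Q' ⊆ Q) (hD : ∀ x, D (D x) = 0) : RelAcyclic D P Q' := by
  intro x hx hDx
  obtain ⟨y, hy, hxy⟩ := h x hx (Finsupp.supported_mono hQ hDx)
  obtain ⟨z, hz, hxz⟩ := h' _ hxy (by rwa [map_sub, hD, sub_zero])
  refine ⟨y + z, add_mem hy (Finsupp.supported_mono hQP hz), ?_⟩
  rwa [map_add, ← sub_sub]

/-- If `P` and `Q` are both acyclic relative to `Q'`, then `P` is acyclic relative to `Q`. -/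
theorem RelAcyclic.cancel {P Q Q' : Set ι} (h : RelAcyclic D P Q') (h' : RelAcyclic D Q Q')
    (hQP : Q ⊆ P) (hQ : Q' ⊆ Q) (hD : ∀ x, D (D x) = 0) : RelAcyclic D P Q := by
  intro x hx hDx
  obtain ⟨y, hy, hxy⟩ := h' _ hDx (by rw [hD]; exact zero_mem _)
  obtain ⟨z, hz, hxz⟩ := h (x - y) (sub_mem hx (Finsupp.supported_mono hQP hy))
    (by rwa [map_sub])
  refine ⟨z, hz, ?_⟩
  have := add_mem (Finsupp.supported_mono hQ hxz) hy
  rwa [sub_right_comm, sub_add_cancel] at this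

/-- Excision. -/
theorem RelAcyclic.excision {P Q N : Set ι} (h : RelAcyclic D P N) (hN : P ∩ Q = N)
    (hP : IsClosedUnder D P) (hQ : IsClosedUnder D Q) : RelAcyclic D (P ∪ Q) Q := by
  intro x hx hDx
  obtain ⟨p, hp, q, hq, rfl⟩ := supported_union_eq hx
  have hDp : D p ∈ Finsupp.supported k k N := by
    have := sub_mem hDx (hQ.map_mem hq)
    rw [map_add, add_sub_cancel_right] at this
    rw [← hN]
    exact mem_supported_inter (hP.map_mem hp) this
  obtain ⟨y, hy, hpy⟩ := h p hp hDp
  refine ⟨y, Finsupp.supported_mono Set.subset_union_left hy, ?_⟩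
  rw [add_sub_right_comm]
  exact add_mem (Finsupp.supported_mono (hN ▸ Set.inter_subset_right) hpy) hq

/-- Relative acyclicity can be checked on the graded pieces of a filtration by the order ideals of
a ranked partial order, where for each graded piece acyclicity below it may be assumed. -/
theorem relAcyclic_of_filtration {α : Type*} [PartialOrder α] (ρ : α → ℕ) (hρ : StrictMono ρ)
    (y : ι → α) {P Q : Set ι} (hy : ∀ i ∈ P, D (Finsupp.single i 1) ∈
      Finsupp.supported k k {j | j ∈ P ∧ y j ≤ y i}) (hQ : IsClosedUnder D Q)
    (hD : ∀ x, D (D x) = 0)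
    (h : ∀ Y, RelAcyclic D ({i | i ∈ P ∧ y i < Y} ∪ Q) Q →
      RelAcyclic D ({i | i ∈ P ∧ y i ≤ Y} ∪ Q) ({i | i ∈ P ∧ y i < Y} ∪ Q)) {r : ℕ}
    {I : Set α} (hI : IsLowerSet I) (hr : ∀ Y ∈ I, ρ Y < r) :
    RelAcyclic D ({i | i ∈ P ∧ y i ∈ I} ∪ Q) Q := by
  classical
  -- In each step, the elements of the highest rank `r` of the order ideal are removed. They are
  -- pairwise incomparable, so the parts of a relative cycle over them can be treated separately.
  induction r generalizing I with
  | zero =>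
    have : {i | i ∈ P ∧ y i ∈ I} ∪ Q = Q := by
      refine Set.union_eq_right.2 fun i hi => absurd (hr _ hi.2) (Nat.not_lt_zero _)
    rw [this]
    exact fun x hx _ => ⟨0, zero_mem _, by simpa using hx⟩
  | succ r ih =>
    set J : Set α := {Y | Y ∈ I ∧ ρ Y < r} with hJ
    have hJl : IsLowerSet J := fun a b hab ha =>
      ⟨hI hab ha.1, (hρ.monotone hab).trans_lt ha.2⟩
    refine RelAcyclic.trans (Q := {i | i ∈ P ∧ y i ∈ J} ∪ Q) ?_ (ih hJl fun Y hY => hY.2)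
      (Set.union_subset_union_left _ fun i hi => ⟨hi.1, hi.2.1⟩) Set.subset_union_right hD
    have hlt : ∀ Y ∈ I, {i | i ∈ P ∧ y i < Y} ∪ Q ⊆ {i | i ∈ P ∧ y i ∈ J} ∪ Q := fun Y hY =>
      Set.union_subset_union_left _ fun i hi => ⟨hi.1, hI hi.2.le hY,
        (hρ hi.2).trans_le (Nat.lt_succ_iff.1 (hr Y hY))⟩
    intro x hx hDx
    -- the part of `x` over the elements of rank `r`
    set s : Finset ι := x.support.filter fun i => i ∉ {i | i ∈ P ∧ y i ∈ J} ∪ Q with hs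
    have hxI : ∀ i ∈ s, i ∈ P ∧ y i ∈ I ∧ ρ (y i) = r := by
      intro i hi
      rw [hs, Finset.mem_filter] at hi
      rcases (Finsupp.mem_supported k x).1 hx hi.1 with h' | h'
      · refine ⟨h'.1, h'.2, le_antisymm (Nat.lt_succ_iff.1 (hr _ h'.2)) ?_⟩
        by_contra hlt
        exact hi.2 (Or.inl ⟨h'.1, h'.2, not_le.1 hlt⟩)
      · exact absurd (Or.inr h') hi.2
    let xY : α → ι →₀ k := fun Y => x.filter fun i => i ∈ s ∧ y i = Y
    have hxY : ∀ Y, xY Y ∈ Finsupp.supported k k {i | i ∈ P ∧ y i = Y} := by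
      intro Y
      rw [Finsupp.mem_supported]
      intro i hi
      rw [Finset.mem_coe, Finsupp.support_filter, Finset.mem_filter] at hi
      exact ⟨(hxI i hi.2.1).1, hi.2.2⟩
    have hsum : x - ∑ Y ∈ s.image y, xY Y ∈
        Finsupp.supported k k ({i | i ∈ P ∧ y i ∈ J} ∪ Q) := by
      rw [Finsupp.mem_supported']
      intro i hi
      rw [Finsupp.sub_apply, Finsupp.finsetSum_apply, sub_eq_zero]
      by_cases his : i ∈ s
      · rw [Finset.sum_eq_single (y i)]
        · exact (Finsupp.filter_apply_pos (fun j => j ∈ s ∧ y j = y i) x ⟨his, rfl⟩).symm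
        · exact fun Y _ hY => Finsupp.filter_apply_neg _ x fun h' => hY h'.2.symm
        · exact fun h' => absurd (Finset.mem_image_of_mem y his) h'
      · rw [Finset.sum_eq_zero fun Y _ => Finsupp.filter_apply_neg _ x fun h' => his h'.1]
        by_contra h'
        exact his (Finset.mem_filter.2 ⟨Finsupp.mem_support_iff.2 h', hi⟩)
    have hDle : ∀ Y, D (xY Y) ∈ Finsupp.supported k k {i | i ∈ P ∧ y i ≤ Y} := fun Y => by
      refine map_mem_of_supported D (fun i hi => ?_) (hxY Y)
      have := hy i hi.1
      rwa [hi.2] at this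
    have hDJ : ∀ z ∈ Finsupp.supported k k ({i | i ∈ P ∧ y i ∈ J} ∪ Q),
        D z ∈ Finsupp.supported k k ({i | i ∈ P ∧ y i ∈ J} ∪ Q) := fun z hz => by
      refine map_mem_of_supported D ?_ hz
      rintro i (hi | hi)
      · exact Finsupp.supported_mono (fun j hj => Or.inl ⟨hj.1, hJl hj.2 hi.2⟩) (hy i hi.1)
      · exact Finsupp.supported_mono Set.subset_union_right (hQ i hi)
    have hDY : ∀ Y ∈ s.image y, D (xY Y) ∈
        Finsupp.supported k k ({i | i ∈ P ∧ y i < Y} ∪ Q) := by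
      intro Y hY
      have hYr : ρ Y = r := by
        obtain ⟨i, hi, rfl⟩ := Finset.mem_image.1 hY
        exact (hxI i hi).2.2
      rw [Finsupp.mem_supported']
      intro i hi
      by_contra hne
      have hiY : i ∈ P ∧ y i ≤ Y := by
        by_contra h'
        exact hne (apply_eq_zero_of_supported (hDle Y) h')
      have hiY' : y i = Y := by
        by_contra h'
        exact hi (Or.inl ⟨hiY.1, lt_of_le_of_ne hiY.2 h'⟩)
      have hiJ : i ∉ {i | i ∈ P ∧ y i ∈ J} ∪ Q := by
        rintro (h' | h')
        · exact absurd h'.2.2 (by rw [hiY', hYr]; exact lt_irrefl r)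
        · exact hi (Or.inr h')
      have h1 := apply_eq_zero_of_supported (hDJ _ hsum) hiJ
      rw [map_sub, Finsupp.sub_apply, apply_eq_zero_of_supported hDx hiJ, zero_sub, neg_eq_zero,
        map_sum, Finsupp.finsetSum_apply, Finset.sum_eq_single Y] at h1
      · exact hne h1
      · intro Y' hY' hne'
        refine apply_eq_zero_of_supported (hDle Y') fun h' => hne' ?_
        have hYr' : ρ Y' = r := by
          obtain ⟨i, hi, rfl⟩ := Finset.mem_image.1 hY'
          exact (hxI i hi).2.2
        rcases h'.2.eq_or_lt with h'' | h''
        · rw [← h'', hiY']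
        · exact absurd (hρ h'') (by rw [hiY', hYr, hYr']; exact lt_irrefl r)
      · exact fun h' => absurd hY h'
    have hex : ∀ Y, ∃ z ∈ Finsupp.supported k k ({i | i ∈ P ∧ y i ∈ I} ∪ Q),
        Y ∈ s.image y → xY Y - D z ∈ Finsupp.supported k k ({i | i ∈ P ∧ y i ∈ J} ∪ Q) := by
      intro Y
      by_cases hY : Y ∈ s.image y
      · have hYI : Y ∈ I ∧ ρ Y = r := by
          obtain ⟨i, hi, rfl⟩ := Finset.mem_image.1 hY
          exact (hxI i hi).2
        have hIio : RelAcyclic D ({i | i ∈ P ∧ y i < Y} ∪ Q) Q :=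
          ih (I := Set.Iio Y) (isLowerSet_Iio Y) fun Z hZ => hYI.2 ▸ hρ hZ
        obtain ⟨z, hz, hxz⟩ := h Y hIio (xY Y) (Finsupp.supported_mono
          (fun i hi => Or.inl ⟨hi.1, hi.2.le⟩) (hxY Y)) (hDY Y hY)
        have hle : {i | i ∈ P ∧ y i ≤ Y} ⊆ {i | i ∈ P ∧ y i ∈ I} :=
          fun i hi => ⟨hi.1, hI hi.2 hYI.1⟩
        exact ⟨z, Finsupp.supported_mono (Set.union_subset_union_left Q hle) hz,
          fun _ => Finsupp.supported_mono (hlt Y hYI.1) hxz⟩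
      · exact ⟨0, zero_mem _, fun h' => absurd h' hY⟩
    choose z hz hxz using hex
    refine ⟨∑ Y ∈ s.image y, z Y, sum_mem fun Y _ => hz Y, ?_⟩
    have h2 : x - D (∑ Y ∈ s.image y, z Y) =
        (x - ∑ Y ∈ s.image y, xY Y) + ∑ Y ∈ s.image y, (xY Y - D (z Y)) := by
      rw [Finset.sum_sub_distrib, map_sum]
      abel
    rw [h2]
    exact add_mem hsum (sum_mem fun Y hY => hxz Y hY)

/-- Relative acyclicity from a pairing of the basis vectors outside `Q`, given by two families
`i₀` and `i₁` of basis vectors, such that the differential of `i₁ t` has coefficient `±1` at `i₀ t`,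
and otherwise involves only vectors in the second family, vectors in the first family of lower
filtration, and vectors in `Q`. -/
theorem relAcyclic_of_pairing {τ : Type*} {T : Set τ} {i₀ i₁ : τ → ι} (f : τ → ℕ) {P Q : Set ι}
    (hP : ∀ i ∈ P, i ∈ Q ∨ i ∈ i₀ '' T ∨ i ∈ i₁ '' T) (hQP : Q ⊆ P) (h₀ : ∀ t ∈ T, i₀ t ∈ P)
    (h₁ : ∀ t ∈ T, i₁ t ∈ P) (hQ : IsClosedUnder D Q) (hi₀ : Set.InjOn i₀ T)
    (hi₁ : Set.InjOn i₁ T) (h01 : ∀ t ∈ T, ∀ t' ∈ T, i₀ t ≠ i₁ t') (h0Q : ∀ t ∈ T, i₀ t ∉ Q)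
    (h : ∀ t ∈ T, ∃ e : ℕ, D (Finsupp.single (i₁ t) 1) - (-1 : k) ^ e •
      Finsupp.single (i₀ t) 1 ∈ Finsupp.supported k k
        {i | i ∈ Q ∨ (∃ t' ∈ T, i₁ t' = i) ∨ ∃ t' ∈ T, f t' < f t ∧ i₀ t' = i})
    (hD : ∀ x, D (D x) = 0) : RelAcyclic D P Q := by
  rcases T.eq_empty_or_nonempty with rfl | ⟨t₀, _⟩
  · have : P = Q := Set.Subset.antisymm (fun i hi => by simpa using hP i hi) hQP
    rw [this]
    exact fun x hx _ => ⟨0, zero_mem _, by simpa using hx⟩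
  have : Nonempty τ := ⟨t₀⟩
  have hinv₀ : ∀ t ∈ T, Function.invFunOn i₀ T (i₀ t) = t := fun t ht =>
    hi₀.leftInvOn_invFunOn ht
  have hinv₁ : ∀ t ∈ T, Function.invFunOn i₁ T (i₁ t) = t := fun t ht =>
    hi₁.leftInvOn_invFunOn ht
  have hPeq : P = i₀ '' T ∪ i₁ '' T ∪ Q := by
    ext i
    constructor
    · intro hi
      rcases hP i hi with h' | h' | h'
      · exact Or.inr h'
      · exact Or.inl (Or.inl h')
      · exact Or.inl (Or.inr h')
    · rintro ((⟨t, ht, rfl⟩ | ⟨t, ht, rfl⟩) | hi)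
      · exact h₀ t ht
      · exact h₁ t ht
      · exact hQP hi
  rw [hPeq]
  refine relAcyclic_of_matching (fun i => i₀ (Function.invFunOn i₁ T i))
    (fun i => f (Function.invFunOn i₀ T i)) hQ ?_ ?_ ⟨?_, ?_, ?_⟩ ?_ hD
  · rw [Set.disjoint_left]
    rintro _ ⟨t, ht, rfl⟩ ⟨t', ht', h'⟩
    exact h01 t ht t' ht' h'.symm
  · rw [Set.disjoint_left]
    rintro _ ⟨t, ht, rfl⟩
    exact h0Q t ht
  · rintro _ ⟨t, ht, rfl⟩
    exact ⟨t, ht, by simp only [hinv₁ t ht]⟩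
  · rintro _ ⟨t, ht, rfl⟩ _ ⟨t', ht', rfl⟩ h'
    simp only [hinv₁ t ht, hinv₁ t' ht'] at h'
    rw [hi₀ ht ht' h']
  · rintro _ ⟨t, ht, rfl⟩
    exact ⟨i₁ t, ⟨t, ht, rfl⟩, by simp only [hinv₁ t ht]⟩
  · rintro _ ⟨t, ht, rfl⟩
    obtain ⟨e, he⟩ := h t ht
    refine ⟨e, ?_⟩
    simp only [hinv₁ t ht, hinv₀ t ht]
    refine Finsupp.supported_mono ?_ he
    rintro i (h' | ⟨t', ht', rfl⟩ | ⟨t', ht', hlt, rfl⟩)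
    · exact Or.inr h'
    · exact Or.inl (Or.inl ⟨t', ht', rfl⟩)
    · exact Or.inl (Or.inr ⟨⟨t', ht', rfl⟩, by simpa only [hinv₀ t' ht'] using hlt⟩)

end Matching

/-! ### The differential of a word with an entry that contains all others -/

section StarWords

variable {k : Type*} [CommRing k] {K V : Type*} [Field K] [AddCommGroup V] [Module K V]
  {ω : LinearMap.BilinForm K V}

theorem sum_sub_mem {ι κ : Type*} {s : Finset κ} {a : κ} (ha : a ∈ s) (c : κ → k) (w : κ → ι)
    {S : Set ι} (h : ∀ b ∈ s, b ≠ a → w b ∈ S) :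
    (∑ b ∈ s, c b • Finsupp.single (w b) (1 : k)) - c a • Finsupp.single (w a) (1 : k) ∈
      Finsupp.supported k k S := by
  classical
  rw [← Finset.add_sum_erase s _ ha, add_sub_cancel_left]
  refine sum_mem fun b hb => Submodule.smul_mem _ _ (single_mem_supported (h b ?_ ?_))
  · exact Finset.mem_of_mem_erase hb
  · exact Finset.ne_of_mem_erase hb

theorem sum_mem_supported {ι κ : Type*} {s : Finset κ} (c : κ → k) (w : κ → ι)
    {S : Set ι} (h : ∀ b ∈ s, w b ∈ S) :
    (∑ b ∈ s, c b • Finsupp.single (w b) (1 : k)) ∈ Finsupp.supported k k S :=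
  sum_mem fun b hb => Submodule.smul_mem _ _ (single_mem_supported (h b hb))

variable [FiniteDimensional K V] (hω : ω.IsRefl) {L : List (Finset (Entry K V))} (hL : Good ω L)
  {s : Entry K V} {B : Finset (Entry K V)} (hB : ∀ b ∈ B, b.sub < s.sub)
  {S : Set (List (Finset (Entry K V)))}

include hB

omit [FiniteDimensional K V] in
theorem mem_splitSpans_insert {X : Submodule K V} (h : X ∈ splitSpans ω (insert s B)) :
    spanF (inside X B) = X ∧ X ≠ ⊥ ∧ X < s.sub ∧ (ω.restrict X).Nondegenerate := by
  have hlt := lt_of_mem_splitSpans h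
  rw [spanF_insert, sup_eq_left.2 (spanF_le.2 fun b hb => (hB b hb).le)] at hlt
  have h1 : inside X (insert s B) = inside X B := by
    ext a
    simp only [mem_inside, Finset.mem_insert]
    refine ⟨fun h => ⟨h.1.resolve_left ?_, h.2⟩, fun h => ⟨Or.inr h.1, h.2⟩⟩
    rintro rfl
    exact not_le_of_gt hlt h.2
  rw [mem_splitSpans, h1] at h
  exact ⟨h.1, h.2.1, hlt, h.2.2.2⟩

include hω hL

/-- The words in the differential of a word whose last factor contains an entry that contains all
others. -/
theorem diff_append_insert_mem
    (h0 : ∀ L', Good ω L' → tot L' = tot L → L' ++ [insert s B] ∈ S)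
    (h1 : ∀ b ∈ B, L ++ [insert s (B.erase b)] ∈ S)
    (h2 : spanF B = s.sub → L ++ [B] ∈ S)
    (h3 : ∀ X, spanF (inside X B) = X → X ≠ ⊥ → X < s.sub → (ω.restrict X).Nondegenerate →
      L ++ [inside X B, insert ⟨ω.orthogonal X ⊓ s.sub⟩ (projOutside ω X B)] ∈ S) :
    diff ω (Finsupp.single (L ++ [insert s B]) (1 : k)) ∈ Finsupp.supported k k S := by
  classical
  obtain ⟨c, c', c'', -, h⟩ := exists_diff_append_insert (k := k) (ω := ω) L hB
  rw [h]
  refine add_mem ?_ (add_mem (add_mem (sum_mem_supported _ _ h1) ?_)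
    (sum_mem_supported _ _ fun X hX => ?_))
  · exact cat_mem_supported (diff_mem_of_good hω hL) (single_mem_supported (Set.mem_singleton _))
      (by rintro u hu _ rfl; exact h0 u hu.1 hu.2)
  · split_ifs with h'
    · exact Submodule.smul_mem _ _ (single_mem_supported (h2 h'))
    · exact zero_mem _
  · obtain ⟨hX1, hX2, hX3, hX4⟩ := mem_splitSpans_insert hB hX
    exact h3 X hX1 hX2 hX3 hX4

/-- The coefficient of the word in which a given entry `a` has been omitted from the last factor
is a sign. -/
theorem diff_append_insert_erase
    (h0 : ∀ L', Good ω L' → tot L' = tot L → L' ++ [insert s B] ∈ S) {a : Entry K V} (ha : a ∈ B)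
    (h1 : ∀ b ∈ B, b ≠ a → L ++ [insert s (B.erase b)] ∈ S)
    (h2 : spanF B = s.sub → L ++ [B] ∈ S)
    (h3 : ∀ X, spanF (inside X B) = X → X ≠ ⊥ → X < s.sub → (ω.restrict X).Nondegenerate →
      L ++ [inside X B, insert ⟨ω.orthogonal X ⊓ s.sub⟩ (projOutside ω X B)] ∈ S) :
    ∃ e : ℕ, diff ω (Finsupp.single (L ++ [insert s B]) (1 : k)) -
      (-1 : k) ^ e • Finsupp.single (L ++ [insert s (B.erase a)]) 1 ∈ Finsupp.supported k k S := by
  classical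
  obtain ⟨c, c', c'', -, h⟩ := exists_diff_append_insert (k := k) (ω := ω) L hB
  refine ⟨c a, ?_⟩
  rw [h, add_sub_assoc, add_assoc, add_sub_right_comm]
  refine add_mem ?_ (add_mem (sum_sub_mem ha _ _ h1) (add_mem ?_
    (sum_mem_supported _ _ fun X hX => ?_)))
  · exact cat_mem_supported (diff_mem_of_good hω hL) (single_mem_supported (Set.mem_singleton _))
      (by rintro u hu _ rfl; exact h0 u hu.1 hu.2)
  · split_ifs with h'
    · exact Submodule.smul_mem _ _ (single_mem_supported (h2 h'))
    · exact zero_mem _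
  · obtain ⟨hX1, hX2, hX3, hX4⟩ := mem_splitSpans_insert hB hX
    exact h3 X hX1 hX2 hX3 hX4

/-- The coefficient of the word in which the largest entry has been omitted from the last factor is a
sign, if the other entries have the same span. -/
theorem diff_append_insert_omit
    (h0 : ∀ L', Good ω L' → tot L' = tot L → L' ++ [insert s B] ∈ S)
    (h1 : ∀ b ∈ B, L ++ [insert s (B.erase b)] ∈ S)
    (h2 : spanF B = s.sub)
    (h3 : ∀ X, spanF (inside X B) = X → X ≠ ⊥ → X < s.sub → (ω.restrict X).Nondegenerate →
      L ++ [inside X B, insert ⟨ω.orthogonal X ⊓ s.sub⟩ (projOutside ω X B)] ∈ S) :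
    ∃ e : ℕ, diff ω (Finsupp.single (L ++ [insert s B]) (1 : k)) -
      (-1 : k) ^ e • Finsupp.single (L ++ [B]) 1 ∈ Finsupp.supported k k S := by
  classical
  obtain ⟨c, c', c'', -, h⟩ := exists_diff_append_insert (k := k) (ω := ω) L hB
  refine ⟨c', ?_⟩
  rw [h, if_pos h2, add_sub_assoc, add_sub_right_comm, add_sub_cancel_right]
  refine add_mem ?_ (add_mem (sum_mem_supported _ _ h1) (sum_mem_supported _ _ fun X hX => ?_))
  · exact cat_mem_supported (diff_mem_of_good hω hL) (single_mem_supported (Set.mem_singleton _))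
      (by rintro u hu _ rfl; exact h0 u hu.1 hu.2)
  · obtain ⟨hX1, hX2, hX3, hX4⟩ := mem_splitSpans_insert hB hX
    exact h3 X hX1 hX2 hX3 hX4

/-- The coefficient of the word in which all entries of the last factor but the largest one have been
split off is a sign, if their span is symplectic. -/
theorem diff_append_insert_split
    (h0 : ∀ L', Good ω L' → tot L' = tot L → L' ++ [insert s B] ∈ S)
    (h1 : ∀ b ∈ B, L ++ [insert s (B.erase b)] ∈ S)
    (h2 : spanF B ≠ s.sub) (h2' : spanF B ≠ ⊥) (h2'' : (ω.restrict (spanF B)).Nondegenerate)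
    (h3 : ∀ X, spanF (inside X B) = X → X ≠ ⊥ → X < s.sub → (ω.restrict X).Nondegenerate →
      X ≠ spanF B →
      L ++ [inside X B, insert ⟨ω.orthogonal X ⊓ s.sub⟩ (projOutside ω X B)] ∈ S) :
    ∃ e : ℕ, diff ω (Finsupp.single (L ++ [insert s B]) (1 : k)) -
      (-1 : k) ^ e • Finsupp.single (L ++ [B, {⟨ω.orthogonal (spanF B) ⊓ s.sub⟩}]) 1 ∈
        Finsupp.supported k k S := by
  classical
  obtain ⟨c, c', c'', hc, h⟩ := exists_diff_append_insert (k := k) (ω := ω) L hB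
  have hin : inside (spanF B) B = B := by
    ext a
    rw [mem_inside]
    exact ⟨fun h => h.1, fun h => ⟨h, le_spanF h⟩⟩
  have hout : projOutside ω (spanF B) B = ∅ := by
    have : outside (spanF B) B = ∅ := by
      rw [Finset.eq_empty_iff_forall_notMem]
      intro a ha
      rw [mem_outside] at ha
      exact ha.2 (le_spanF ha.1)
    rw [projOutside, this, Finset.image_empty]
  have hspan : spanF (insert s B) = s.sub := by
    rw [spanF_insert, sup_eq_left, spanF_le]
    exact fun b hb => (hB b hb).le
  have hin' : inside (spanF B) (insert s B) = B := by
    ext a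
    rw [mem_inside, Finset.mem_insert]
    refine ⟨?_, fun h => ⟨Or.inr h, le_spanF h⟩⟩
    rintro ⟨rfl | h, h'⟩
    · exact absurd (le_antisymm (spanF_le.2 fun b hb => (hB b hb).le) h') h2
    · exact h
  have hmem : spanF B ∈ splitSpans ω (insert s B) := by
    rw [mem_splitSpans, hin', hspan]
    exact ⟨rfl, h2', h2, h2''⟩
  obtain ⟨e, he⟩ := hc hmem
  refine ⟨e, ?_⟩
  have h4 := sum_sub_mem hmem c'' (fun X => L ++ [inside X B,
    insert ⟨ω.orthogonal X ⊓ s.sub⟩ (projOutside ω X B)]) (S := S) (fun X hX hne => by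
      obtain ⟨hX1, hX2, hX3, hX4⟩ := mem_splitSpans_insert hB hX
      exact h3 X hX1 hX2 hX3 hX4 hne)
  simp only [hin, hout, insert_empty_eq, he] at h4
  rw [h, if_neg h2, add_zero, add_sub_assoc, add_sub_assoc]
  refine add_mem ?_ (add_mem (sum_mem_supported _ _ h1) h4)
  exact cat_mem_supported (diff_mem_of_good hω hL) (single_mem_supported (Set.mem_singleton _))
      (by rintro u hu _ rfl; exact h0 u hu.1 hu.2)

end StarWords

/-! ### Words completed by an orthogonal complement -/

section Comparison

variable {k : Type*} [CommRing k] {K V : Type*} [Field K] [AddCommGroup V] [Module K V]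
  (ω : LinearMap.BilinForm K V)

/-- The good words with total span `V`: the basis of the resolution. -/
def totalWords : Set (List (Finset (Entry K V))) := {L | Good ω L ∧ tot L = ⊤}

/-- The orthogonal complement of the total span of a word. -/
def star (L : List (Finset (Entry K V))) : Entry K V := ⟨ω.orthogonal (tot L)⟩

/-- The word obtained from `L` by adding a factor that consists of `(tot L)^⊥` and `B`. -/
def starWord (L : List (Finset (Entry K V))) (B : Finset (Entry K V)) :
    List (Finset (Entry K V)) := L ++ [insert (star ω L) B]

/-- A good word with total span smaller than `V`, together with a set of lines in the orthogonal
complement. -/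
structure StarData (L : List (Finset (Entry K V))) (B : Finset (Entry K V)) : Prop where
  good : Good ω L
  ne_top : tot L ≠ ⊤
  isLine : ∀ b ∈ B, b.IsLine
  le : ∀ b ∈ B, b.sub ≤ ω.orthogonal (tot L)

/-- The words `starWord ω L B`. -/
def starWords : Set (List (Finset (Entry K V))) := {w | ∃ L B, StarData ω L B ∧ starWord ω L B = w}

/-- The subspace is isotropic. -/
def Isotropic (U : Submodule K V) : Prop := U ≤ ω.orthogonal U

/-- The words with a single factor that consists of `V` and lines with isotropic span. -/
def isoWords : Set (List (Finset (Entry K V))) :=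
  {w | ∃ B : Finset (Entry K V), (∀ b ∈ B, b.IsLine) ∧ Isotropic ω (spanF B) ∧
    starWord ω [] B = w}

variable {ω}

theorem Isotropic.mono {U U' : Submodule K V} (h : Isotropic ω U) (h' : U' ≤ U) :
    Isotropic ω U' := h'.trans (h.trans (LinearMap.BilinForm.orthogonal_le h'))

theorem Isotropic.eq_bot (hω : ω.IsRefl) [FiniteDimensional K V] {U : Submodule K V}
    (h : Isotropic ω U) (h' : (ω.restrict U).Nondegenerate) : U = ⊥ := by
  have := (isCompl_orthogonal hω h').inf_eq_bot
  rwa [inf_eq_left.2 h] at this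

theorem isotropic_of_finrank_eq_one (hω : ω.IsAlt) {U : Submodule K V}
    (h : Module.finrank K U = 1) : Isotropic ω U := by
  obtain ⟨v, -, hv⟩ := finrank_eq_one_iff'.1 h
  intro x hx y hy
  obtain ⟨c, hc⟩ := hv ⟨x, hx⟩
  obtain ⟨d, hd⟩ := hv ⟨y, hy⟩
  have hc' : c • (v : V) = x := congrArg Subtype.val hc
  have hd' : d • (v : V) = y := congrArg Subtype.val hd
  rw [← hc', ← hd']
  simp [hω.self_eq_zero]

theorem Entry.IsLine.isotropic (hω : ω.IsAlt) {a : Entry K V} (h : a.IsLine) :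
    Isotropic ω a.sub := isotropic_of_finrank_eq_one hω h

theorem StarData.mono {L : List (Finset (Entry K V))} {B B' : Finset (Entry K V)}
    (h : StarData ω L B) (hB : B' ⊆ B) : StarData ω L B' :=
  ⟨h.good, h.ne_top, fun b hb => h.isLine b (hB hb), fun b hb => h.le b (hB hb)⟩

theorem starWord_congr {L L' : List (Finset (Entry K V))} (h : tot L' = tot L)
    (B : Finset (Entry K V)) : L' ++ [insert (star ω L) B] = starWord ω L' B := by
  rw [starWord, star, star, h]

theorem StarData.congr {L L' : List (Finset (Entry K V))} {B : Finset (Entry K V)}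
    (h : StarData ω L B) (hL' : Good ω L') (h' : tot L' = tot L) : StarData ω L' B :=
  ⟨hL', h' ▸ h.ne_top, h.isLine, h' ▸ h.le⟩

/-- Splitting the last factor of a word `starWord ω L B` gives a word of the same form. -/
theorem starWord_split (L : List (Finset (Entry K V))) {B : Finset (Entry K V)}
    {X : Submodule K V} (hX : spanF (inside X B) = X) :
    L ++ [inside X B, insert ⟨ω.orthogonal X ⊓ (star ω L).sub⟩ (projOutside ω X B)] =
      starWord ω (L ++ [inside X B]) (projOutside ω X B) := by
  rw [starWord, star, star, tot_append, tot_cons, tot_nil, sup_bot_eq, hX, orthogonal_sup, inf_comm]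
  simp

theorem good_snoc {L : List (Finset (Entry K V))} {A : Finset (Entry K V)} :
    Good ω (L ++ [A]) ↔ Good ω L ∧ IsBlock ω A ∧ spanF A ≤ ω.orthogonal (tot L) := by
  rw [good_append, good_singleton, tot_cons, tot_nil, sup_bot_eq]

theorem tot_snoc {L : List (Finset (Entry K V))} {A : Finset (Entry K V)} :
    tot (L ++ [A]) = tot L ⊔ spanF A := by
  rw [tot_append, tot_cons, tot_nil, sup_bot_eq]

theorem StarData.spanF_le {L : List (Finset (Entry K V))} {B : Finset (Entry K V)}
    (h : StarData ω L B) : spanF B ≤ ω.orthogonal (tot L) := SymplecticSharbly.spanF_le.2 h.le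

theorem StarData.good_inside {L : List (Finset (Entry K V))} {B : Finset (Entry K V)}
    (h : StarData ω L B) {X : Submodule K V} (hX : spanF (inside X B) = X) (hX0 : X ≠ ⊥)
    (hXn : (ω.restrict X).Nondegenerate) : Good ω (L ++ [inside X B]) := by
  refine good_snoc.2 ⟨h.good, ⟨fun a ha => h.isLine a (mem_inside.1 ha).1,
    nonempty_of_spanF_ne_bot (hX.symm ▸ hX0), hX.symm ▸ hXn⟩, ?_⟩
  exact (spanF_mono fun a ha => (mem_inside.1 ha).1).trans h.spanF_le

theorem exists_isLine_le {X : Submodule K V} (hX : X ≠ ⊥) : ∃ a : Entry K V, a.IsLine ∧ a.sub ≤ X := by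
  obtain ⟨v, hv, hv0⟩ := Submodule.exists_mem_ne_zero_of_ne_bot hX
  exact ⟨⟨K ∙ v⟩, finrank_span_singleton hv0, (Submodule.span_singleton_le_iff_mem v X).2 hv⟩

open Classical in
/-- An arbitrary choice of a line in a nonzero subspace. -/
def lineIn (X : Submodule K V) : Entry K V :=
  if h : X ≠ ⊥ then (exists_isLine_le h).choose else ⟨⊥⟩

theorem isLine_lineIn {X : Submodule K V} (h : X ≠ ⊥) : (lineIn X).IsLine := by
  rw [lineIn, dif_pos h]
  exact (exists_isLine_le h).choose_spec.1

theorem lineIn_le {X : Submodule K V} (h : X ≠ ⊥) : (lineIn X).sub ≤ X := by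
  rw [lineIn, dif_pos h]
  exact (exists_isLine_le h).choose_spec.2

variable [FiniteDimensional K V] (hω : ω.IsAlt) (hn : (ω.restrict ⊤).Nondegenerate)

section

include hω hn

theorem nondegenerate_orthogonal {X : Submodule K V} (hX : (ω.restrict X).Nondegenerate) :
    (ω.restrict (ω.orthogonal X)).Nondegenerate := by
  have := nondegenerate_orthogonal_inf hω.isRefl hX hn le_top
  rwa [inf_top_eq] at this

theorem nondegenerate_star {L : List (Finset (Entry K V))} (hL : Good ω L) :
    (ω.restrict (star ω L).sub).Nondegenerate :=
  nondegenerate_orthogonal hω hn (nondegenerate_tot hω.isRefl hL)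

omit hn in
theorem star_ne_bot {L : List (Finset (Entry K V))} (hL : Good ω L) (h : tot L ≠ ⊤) :
    (star ω L).sub ≠ ⊥ := by
  have := orthogonal_inf_ne_bot hω.isRefl (nondegenerate_tot hω.isRefl hL) (lt_top_iff_ne_top.2 h)
  rwa [inf_top_eq] at this

theorem StarData.lt {L : List (Finset (Entry K V))} {B : Finset (Entry K V)}
    (h : StarData ω L B) {b : Entry K V} (hb : b ∈ B) : b.sub < (star ω L).sub := by
  refine lt_of_le_of_ne (h.le b hb) fun h' => star_ne_bot hω h.good h.ne_top ?_
  have h1 := (h.isLine b hb).isotropic hω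
  rw [h'] at h1
  exact h1.eq_bot hω.isRefl (nondegenerate_star hω hn h.good)

theorem StarData.not_isLine {L : List (Finset (Entry K V))} {B : Finset (Entry K V)}
    (h : StarData ω L B) : ¬(star ω L).IsLine := fun h' =>
  star_ne_bot hω h.good h.ne_top
    ((h'.isotropic hω).eq_bot hω.isRefl (nondegenerate_star hω hn h.good))

theorem StarData.notMem {L : List (Finset (Entry K V))} {B : Finset (Entry K V)}
    (h : StarData ω L B) : star ω L ∉ B := fun h' => lt_irrefl _ (h.lt hω hn h')

theorem StarData.starWord_inj {L L' : List (Finset (Entry K V))} {B B' : Finset (Entry K V)}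
    (h : StarData ω L B) (h' : StarData ω L' B') (heq : starWord ω L B = starWord ω L' B') :
    L = L' ∧ B = B' := by
  obtain ⟨h1, h2⟩ := List.append_inj' heq rfl
  subst h1
  refine ⟨rfl, ?_⟩
  rw [← Finset.erase_insert (h.notMem hω hn), ← Finset.erase_insert (h'.notMem hω hn),
    List.singleton_inj.1 h2]

theorem StarData.starWord_notMem {L : List (Finset (Entry K V))} {B : Finset (Entry K V)}
    (h : StarData ω L B) : ¬Good ω (starWord ω L B) := fun h' =>
  h.not_isLine hω hn ((good_append.1 h').2.1.1.isLine _ (Finset.mem_insert_self _ _))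

end

section

include hω

theorem StarData.split {L : List (Finset (Entry K V))} {B : Finset (Entry K V)}
    (h : StarData ω L B) {X : Submodule K V} (hX : spanF (inside X B) = X) (hX0 : X ≠ ⊥)
    (hXs : X < (star ω L).sub) (hXn : (ω.restrict X).Nondegenerate) :
    StarData ω (L ++ [inside X B]) (projOutside ω X B) := by
  have hXB : X ≤ spanF B := by
    conv_lhs => rw [← hX]
    exact spanF_mono fun a ha => (mem_inside.1 ha).1
  refine ⟨h.good_inside hX hX0 hXn, fun ht => ?_,
    fun a => isLine_of_mem_projOutside hω.isRefl hXn h.isLine, SymplecticSharbly.spanF_le.1 ?_⟩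
  · rw [tot_snoc, hX] at ht
    have := sup_inf_orthogonal hω.isRefl (nondegenerate_tot hω.isRefl h.good)
      (hXB.trans h.spanF_le)
    rw [ht, top_inf_eq] at this
    exact hXs.ne this.symm
  · rw [tot_snoc, hX, orthogonal_sup, le_inf_iff]
    refine ⟨?_, spanF_projOutside_le X B⟩
    rw [spanF_projOutside hω.isRefl hXn hXB]
    exact inf_le_right.trans h.spanF_le

/-- Two words whose last factors are split have the same span of lines. -/
theorem StarData.span_split {B : Finset (Entry K V)} {X : Submodule K V}
    (hX : spanF (inside X B) = X) (hXn : (ω.restrict X).Nondegenerate) :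
    X ⊔ spanF (projOutside ω X B) = spanF B := by
  rw [sup_spanF_projOutside hω.isRefl hXn, sup_eq_right]
  conv_lhs => rw [← hX]
  exact spanF_mono fun a ha => (mem_inside.1 ha).1

end

section Adding

include hω hn

omit hn in
theorem isClosedUnder_totalWords : IsClosedUnder (diff ω : Words k (Entry K V) →ₗ[k] _)
    (totalWords ω) := fun L hL => by
  have hle : {L' | Good ω L' ∧ tot L' = tot L} ⊆ totalWords ω := fun L' h => ⟨h.1, h.2.trans hL.2⟩
  exact Finsupp.supported_mono hle (diff_mem_of_good hω.isRefl hL.1)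

theorem StarData.omit_mem {L : List (Finset (Entry K V))} {B : Finset (Entry K V)}
    (h : StarData ω L B) (h2 : spanF B = (star ω L).sub) : L ++ [B] ∈ totalWords ω := by
  refine ⟨good_snoc.2 ⟨h.good, ⟨h.isLine, nonempty_of_spanF_ne_bot
    (h2.symm ▸ star_ne_bot hω h.good h.ne_top), h2.symm ▸ nondegenerate_star hω hn h.good⟩,
    h2.le⟩, ?_⟩
  rw [tot_snoc, h2]
  exact (isCompl_orthogonal hω.isRefl (nondegenerate_tot hω.isRefl h.good)).sup_eq_top

theorem isClosedUnder_starWords : IsClosedUnder (diff ω : Words k (Entry K V) →ₗ[k] _)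
    (starWords ω ∪ totalWords ω) := by
  rintro w (⟨L, B, h, rfl⟩ | hw)
  · refine diff_append_insert_mem hω.isRefl h.good (fun b hb => h.lt hω hn hb) ?_ ?_ ?_ ?_
    · exact fun L' hL' hL => Or.inl ⟨L', B, h.congr hL' hL, (starWord_congr hL B).symm⟩
    · exact fun b _ => Or.inl ⟨L, B.erase b, h.mono (Finset.erase_subset b B), rfl⟩
    · exact fun h2 => Or.inr (h.omit_mem hω hn h2)
    · intro X hX hX0 hXs hXn
      exact Or.inl ⟨_, _, h.split hω hX hX0 hXs hXn, (starWord_split L hX).symm⟩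
  · exact Finsupp.supported_mono Set.subset_union_right (isClosedUnder_totalWords hω w hw)

/-- Adding to the last factor a line in the orthogonal complement of the total span shows that
the words `starWord ω L B` contribute nothing. -/
theorem relAcyclic_totalWords : RelAcyclic (diff ω : Words k (Entry K V) →ₗ[k] _)
    (starWords ω ∪ totalWords ω) (totalWords ω) := by
  classical
  -- The line depends only on the total span of `L`, so that the differential of `L` does not
  -- affect it. Splitting changes it, but makes the complement of the total span smaller, which is the
  -- filtration.
  let ℓ : List (Finset (Entry K V)) → Entry K V := fun L => lineIn (ω.orthogonal (tot L))
  have hℓ : ∀ L B, StarData ω L B → StarData ω L (insert (ℓ L) B) := fun L B h =>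
    ⟨h.good, h.ne_top, by
      intro b hb
      rcases Finset.mem_insert.1 hb with rfl | hb
      · exact isLine_lineIn (star_ne_bot hω h.good h.ne_top)
      · exact h.isLine b hb, by
      intro b hb
      rcases Finset.mem_insert.1 hb with rfl | hb
      · exact lineIn_le (star_ne_bot hω h.good h.ne_top)
      · exact h.le b hb⟩
  refine relAcyclic_of_pairing (T := {t : List (Finset (Entry K V)) × Finset (Entry K V) |
      StarData ω t.1 t.2 ∧ ℓ t.1 ∉ t.2})
    (i₀ := fun t => starWord ω t.1 t.2) (i₁ := fun t => starWord ω t.1 (insert (ℓ t.1) t.2))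
    (fun t => Module.finrank K (star ω t.1).sub) ?_ Set.subset_union_right ?_ ?_
    (isClosedUnder_totalWords hω) ?_ ?_ ?_ ?_ ?_ (diff_diff hω.isRefl)
  · rintro w (⟨L, B, h, rfl⟩ | hw)
    · by_cases hB : ℓ L ∈ B
      · exact Or.inr (Or.inr ⟨(L, B.erase (ℓ L)), ⟨h.mono (Finset.erase_subset _ _),
          Finset.notMem_erase _ _⟩, by simp only [Finset.insert_erase hB]⟩)
      · exact Or.inr (Or.inl ⟨(L, B), ⟨h, hB⟩, rfl⟩)
    · exact Or.inl hw
  · exact fun t ht => Or.inl ⟨_, _, ht.1, rfl⟩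
  · exact fun t ht => Or.inl ⟨_, _, hℓ _ _ ht.1, rfl⟩
  · rintro ⟨L, B⟩ ⟨h, _⟩ ⟨L', B'⟩ ⟨h', _⟩ heq
    obtain ⟨h1, h2⟩ := h.starWord_inj hω hn h' heq
    exact Prod.ext h1 h2
  · rintro ⟨L, B⟩ ⟨h, hB⟩ ⟨L', B'⟩ ⟨h', hB'⟩ heq
    obtain ⟨h1, h2⟩ := (hℓ _ _ h).starWord_inj hω hn (hℓ _ _ h') heq
    dsimp only at h1 h2 hB hB'
    subst h1
    exact Prod.ext rfl (by rw [← Finset.erase_insert hB, h2, Finset.erase_insert hB'])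
  · rintro ⟨L, B⟩ ⟨h, hB⟩ ⟨L', B'⟩ ⟨h', hB'⟩ heq
    obtain ⟨h1, h2⟩ := h.starWord_inj hω hn (hℓ _ _ h') heq
    dsimp only at h1 h2 hB hB'
    subst h1
    exact hB (h2 ▸ Finset.mem_insert_self _ _)
  · exact fun t ht h' => ht.1.starWord_notMem hω hn h'.1
  · rintro ⟨L, B⟩ ⟨h, hB⟩
    dsimp only at hB
    have h' := hℓ _ _ h
    have key := diff_append_insert_erase (k := k) hω.isRefl h'.good
      (fun b hb => h'.lt hω hn hb) (S := {i | i ∈ totalWords ω ∨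
        (∃ t' ∈ {t : List (Finset (Entry K V)) × Finset (Entry K V) |
          StarData ω t.1 t.2 ∧ ℓ t.1 ∉ t.2}, starWord ω t'.1 (insert (ℓ t'.1) t'.2) = i) ∨
        ∃ t' ∈ {t : List (Finset (Entry K V)) × Finset (Entry K V) |
          StarData ω t.1 t.2 ∧ ℓ t.1 ∉ t.2}, Module.finrank K (star ω t'.1).sub <
            Module.finrank K (star ω L).sub ∧ starWord ω t'.1 t'.2 = i})
      ?_ (Finset.mem_insert_self (ℓ L) B) ?_ ?_ ?_
    · rw [Finset.erase_insert hB] at key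
      exact key
    · intro L' hL' hL
      have hℓL : ℓ L' = ℓ L := by simp only [ℓ, hL]
      refine Or.inr (Or.inl ⟨(L', B), ⟨h.congr hL' hL, ?_⟩, ?_⟩)
      · simpa only [hℓL] using hB
      · simp only [hℓL, starWord_congr hL]
    · intro b hb hne
      refine Or.inr (Or.inl ⟨(L, B.erase b), ⟨h.mono (Finset.erase_subset _ _),
        fun h' => hB (Finset.mem_of_mem_erase h')⟩, ?_⟩)
      simp only [starWord, Finset.erase_insert_of_ne hne.symm]
    · exact fun h2 => Or.inl (h'.omit_mem hω hn h2)
    · intro X hX hX0 hXs hXn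
      have h3 := h'.split hω hX hX0 hXs hXn
      rw [starWord_split L hX]
      by_cases hmem : ℓ (L ++ [inside X (insert (ℓ L) B)]) ∈ projOutside ω X (insert (ℓ L) B)
      · refine Or.inr (Or.inl ⟨(_, (projOutside ω X (insert (ℓ L) B)).erase
          (ℓ (L ++ [inside X (insert (ℓ L) B)]))), ⟨h3.mono (Finset.erase_subset _ _),
            Finset.notMem_erase _ _⟩, ?_⟩)
        simp only [Finset.insert_erase hmem]
      · refine Or.inr (Or.inr ⟨(_, _), ⟨h3, hmem⟩, ?_, rfl⟩)
        refine Submodule.finrank_lt_finrank_of_lt (lt_of_le_of_ne ?_ fun heq => hX0 ?_)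
        · simp only [star, tot_snoc, orthogonal_sup]
          exact inf_le_left
        · simp only [star, tot_snoc, hX, orthogonal_sup, inf_eq_left] at heq
          have h4 := (isCompl_orthogonal hω.isRefl hXn).inf_eq_bot
          rwa [inf_eq_left.2 (hXs.le.trans heq)] at h4

end Adding

end Comparison

/-! ### Reduction to lines with isotropic span -/

section LineSpan

variable {k : Type*} [CommRing k] {K V : Type*} [Field K] [AddCommGroup V] [Module K V]
  {ω : LinearMap.BilinForm K V}

open Classical in
/-- The span of all lines among the entries of a word. -/
def lineSpan : List (Finset (Entry K V)) → Submodule K V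
  | [] => ⊥
  | A :: L => spanF (A.filter Entry.IsLine) ⊔ lineSpan L

theorem lineSpan_append (L L' : List (Finset (Entry K V))) :
    lineSpan (L ++ L') = lineSpan L ⊔ lineSpan L' := by
  induction L with
  | nil => simp [lineSpan]
  | cons A L ih => simp [lineSpan, ih, sup_assoc]

open Classical in
theorem lineSpan_of_good {L : List (Finset (Entry K V))} (h : Good ω L) : lineSpan L = tot L := by
  induction L with
  | nil => rfl
  | cons A L ih =>
    rw [lineSpan, tot_cons, ih h.2.2, Finset.filter_true_of_mem h.1.isLine]

theorem eq_nil_of_tot_eq_bot {L : List (Finset (Entry K V))} (h : Good ω L) (h' : tot L = ⊥) :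
    L = [] := by
  cases L with
  | nil => rfl
  | cons A L => exact absurd (sup_eq_bot_iff.1 h').1 h.1.spanF_ne_bot

variable [FiniteDimensional K V] (hω : ω.IsAlt) (hn : (ω.restrict ⊤).Nondegenerate)
  [Nontrivial V]

include hω hn

omit [Nontrivial V] in
open Classical in
theorem lineSpan_starWord {L : List (Finset (Entry K V))} {B : Finset (Entry K V)}
    (h : StarData ω L B) : lineSpan (starWord ω L B) = tot L ⊔ spanF B := by
  rw [starWord, lineSpan_append, lineSpan_of_good h.good, lineSpan, lineSpan, sup_bot_eq,
    Finset.filter_insert, if_neg (h.not_isLine hω hn), Finset.filter_true_of_mem h.isLine]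

omit hω hn [FiniteDimensional K V] in
theorem starData_nil {B : Finset (Entry K V)} (hB : ∀ b ∈ B, b.IsLine) : StarData ω [] B :=
  ⟨trivial, bot_ne_top, hB, fun _ _ => by rw [tot_nil, orthogonal_bot]; exact le_top⟩

theorem starWord_mem_isoWords {L : List (Finset (Entry K V))} {B : Finset (Entry K V)}
    (h : StarData ω L B) :
    starWord ω L B ∈ isoWords ω ↔ L = [] ∧ Isotropic ω (spanF B) := by
  constructor
  · rintro ⟨B', hB', hi, heq⟩
    obtain ⟨h1, h2⟩ := (starData_nil hB').starWord_inj hω hn h heq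
    exact ⟨h1.symm, h2 ▸ hi⟩
  · rintro ⟨rfl, hi⟩
    exact ⟨B, h.isLine, hi, rfl⟩

omit hω hn [FiniteDimensional K V] in
theorem isoWords_subset : isoWords ω ⊆ starWords ω ∪ totalWords ω := by
  rintro _ ⟨B, hB, _, rfl⟩
  exact Or.inl ⟨[], B, starData_nil hB, rfl⟩

theorem isClosedUnder_isoWords :
    IsClosedUnder (diff ω : Words k (Entry K V) →ₗ[k] _) (isoWords ω) := by
  rintro _ ⟨B, hB, hi, rfl⟩
  have h := starData_nil (ω := ω) hB
  refine diff_append_insert_mem hω.isRefl h.good (fun b hb => h.lt hω hn hb) ?_ ?_ ?_ ?_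
  · intro L' hL' hL
    obtain rfl := eq_nil_of_tot_eq_bot hL' hL
    exact ⟨B, hB, hi, rfl⟩
  · exact fun b _ => ⟨B.erase b, fun a ha => hB a (Finset.mem_of_mem_erase ha),
      hi.mono (spanF_mono (Finset.erase_subset b B)), rfl⟩
  · intro h2
    exfalso
    rw [h2] at hi
    exact star_ne_bot hω h.good h.ne_top (hi.eq_bot hω.isRefl (nondegenerate_star hω hn h.good))
  · intro X hX hX0 _ hXn
    refine absurd ((hi.mono ?_).eq_bot hω.isRefl hXn) hX0
    rw [← hX]
    exact spanF_mono fun a ha => (mem_inside.1 ha).1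

omit [Nontrivial V] in
/-- The span of the lines of a word does not increase under the differential. -/
theorem diff_mem_lineSpan_le {w : List (Finset (Entry K V))}
    (hw : w ∈ starWords ω ∪ totalWords ω) : diff ω (Finsupp.single w (1 : k)) ∈
      Finsupp.supported k k
        {j | j ∈ starWords ω ∪ totalWords ω ∧ lineSpan j ≤ lineSpan w} := by
  rcases hw with ⟨L, B, h, rfl⟩ | hw
  · rw [lineSpan_starWord hω hn h]
    refine diff_append_insert_mem hω.isRefl h.good (fun b hb => h.lt hω hn hb) ?_ ?_ ?_ ?_
    · intro L' hL' hL
      have h' := h.congr hL' hL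
      rw [starWord_congr hL]
      exact ⟨Or.inl ⟨L', B, h', rfl⟩, by rw [lineSpan_starWord hω hn h', hL]⟩
    · intro b _
      have h' := h.mono (Finset.erase_subset b B)
      exact ⟨Or.inl ⟨L, B.erase b, h', rfl⟩, (lineSpan_starWord hω hn h').le.trans
        (sup_le_sup_left (spanF_mono (Finset.erase_subset b B)) _)⟩
    · intro h2
      have h' := h.omit_mem hω hn h2
      exact ⟨Or.inr h', by rw [lineSpan_of_good h'.1, tot_snoc]⟩
    · intro X hX hX0 hXs hXn
      have h' := h.split hω hX hX0 hXs hXn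
      rw [starWord_split L hX]
      refine ⟨Or.inl ⟨_, _, h', rfl⟩, ?_⟩
      rw [lineSpan_starWord hω hn h', tot_snoc, hX, sup_assoc, StarData.span_split hω hX hXn]
  · refine Finsupp.supported_mono ?_ (isClosedUnder_totalWords hω w hw)
    intro j hj
    exact ⟨Or.inr hj, by rw [lineSpan_of_good hj.1, hj.2, lineSpan_of_good hw.1, hw.2]⟩

/-- The words whose lines are contained in a subspace with nonzero radical contribute nothing
besides those with isotropic span: a line in the radical may be added to the last factor. -/
theorem relAcyclic_of_degenerate {Y : Submodule K V} (hY : ¬(ω.restrict Y).Nondegenerate) :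
    RelAcyclic (diff ω : Words k (Entry K V) →ₗ[k] _)
      ({w | w ∈ starWords ω ∪ totalWords ω ∧ lineSpan w ≤ Y} ∪ isoWords ω) (isoWords ω) := by
  have hr : Y ⊓ ω.orthogonal Y ≠ ⊥ := fun h => hY (by
    rwa [LinearMap.BilinForm.restrict_nondegenerate_iff_isCompl_orthogonal hω.isRefl,
      LinearMap.BilinForm.isCompl_orthogonal_iff_disjoint hω.isRefl, disjoint_iff])
  -- The line is perpendicular to all lines of the words under consideration and is not contained in any
  -- symplectic span of such lines, so it always remains in the last factor and is unaffected by
  -- projections. No filtration is needed.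
  obtain ⟨ℓ, hℓ, hℓr⟩ := exists_isLine_le hr
  obtain ⟨hℓY, hℓY'⟩ := le_inf_iff.1 hℓr
  have hYtop : Y ≠ ⊤ := by
    rintro rfl
    exact hY hn
  have hperp : ∀ U ≤ Y, ℓ.sub ≤ ω.orthogonal U := fun U hU =>
    hℓY'.trans (LinearMap.BilinForm.orthogonal_le hU)
  have hnot : ∀ U ≤ Y, (ω.restrict U).Nondegenerate → ¬ℓ.sub ≤ U := fun U hU hUn h => by
    refine hℓ.ne_bot (eq_bot_iff.2 ?_)
    rw [← (isCompl_orthogonal hω.isRefl hUn).inf_eq_bot]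
    exact le_inf h (hperp U hU)
  have hins : ∀ L B, StarData ω L B → tot L ⊔ spanF B ≤ Y →
      StarData ω L (insert ℓ B) := fun L B h hle =>
    ⟨h.good, h.ne_top, by
      intro b hb
      rcases Finset.mem_insert.1 hb with rfl | hb
      · exact hℓ
      · exact h.isLine b hb, by
      intro b hb
      rcases Finset.mem_insert.1 hb with rfl | hb
      · exact hperp _ (le_sup_left.trans hle)
      · exact h.le b hb⟩
  have hle' : ∀ (L : List (Finset (Entry K V))) B, tot L ⊔ spanF B ≤ Y →
      tot L ⊔ spanF (insert ℓ B) ≤ Y := fun L B hle => by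
    rw [spanF_insert]
    exact sup_le (le_sup_left.trans hle) (sup_le hℓY (le_sup_right.trans hle))
  have hiso : ∀ L B, StarData ω L B → tot L ⊔ spanF B ≤ Y →
      (starWord ω L (insert ℓ B) ∈ isoWords ω ↔ starWord ω L B ∈ isoWords ω) := by
    intro L B h hle
    rw [starWord_mem_isoWords hω hn h, starWord_mem_isoWords hω hn (hins L B h hle)]
    refine and_congr_right fun _ => ⟨fun hi => hi.mono (spanF_mono (Finset.subset_insert _ _)),
      fun hi => ?_⟩
    have h1 := hperp _ (le_sup_right.trans hle)
    rw [Isotropic, spanF_insert, orthogonal_sup]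
    exact sup_le (le_inf (hℓ.isotropic hω) h1)
      (le_inf ((le_orthogonal_comm hω.isRefl).1 h1) hi)
  set T : Set (List (Finset (Entry K V)) × Finset (Entry K V)) := {t | StarData ω t.1 t.2 ∧
    tot t.1 ⊔ spanF t.2 ≤ Y ∧ starWord ω t.1 t.2 ∉ isoWords ω ∧ ℓ ∉ t.2} with hT
  have hmem : ∀ L B, StarData ω L B → tot L ⊔ spanF B ≤ Y → ℓ ∈ B →
      starWord ω L B ∈ isoWords ω ∨ ∃ t ∈ T, starWord ω t.1 (insert ℓ t.2) = starWord ω L B := by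
    intro L B h hle hB
    by_cases hi : starWord ω L B ∈ isoWords ω
    · exact Or.inl hi
    · have hle2 := (sup_le_sup_left (spanF_mono (Finset.erase_subset ℓ B)) (tot L)).trans hle
      refine Or.inr ⟨(L, B.erase ℓ), ⟨h.mono (Finset.erase_subset _ _), hle2, fun h' => ?_,
        Finset.notMem_erase _ _⟩, by rw [Finset.insert_erase hB]⟩
      rw [← hiso _ _ (h.mono (Finset.erase_subset _ _)) hle2, Finset.insert_erase hB] at h'
      exact hi h'
  refine relAcyclic_of_pairing (T := T) (i₀ := fun t => starWord ω t.1 t.2)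
    (i₁ := fun t => starWord ω t.1 (insert ℓ t.2)) (fun _ => 0) ?_ Set.subset_union_right ?_ ?_
    (isClosedUnder_isoWords hω hn) ?_ ?_ ?_ ?_ ?_ (diff_diff hω.isRefl)
  · rintro w (⟨⟨L, B, h, rfl⟩ | hw, hle⟩ | hw)
    · rw [lineSpan_starWord hω hn h] at hle
      by_cases hB : ℓ ∈ B
      · exact (hmem L B h hle hB).imp_right Or.inr
      · by_cases hi : starWord ω L B ∈ isoWords ω
        · exact Or.inl hi
        · exact Or.inr (Or.inl ⟨(L, B), ⟨h, hle, hi, hB⟩, rfl⟩)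
    · rw [lineSpan_of_good hw.1, hw.2, top_le_iff] at hle
      exact absurd hle hYtop
    · exact Or.inl hw
  · rintro ⟨L, B⟩ ⟨h, hle, _⟩
    exact Or.inl ⟨Or.inl ⟨_, _, h, rfl⟩, (lineSpan_starWord hω hn h).le.trans hle⟩
  · rintro ⟨L, B⟩ ⟨h, hle, _⟩
    exact Or.inl ⟨Or.inl ⟨_, _, hins _ _ h hle, rfl⟩,
      (lineSpan_starWord hω hn (hins _ _ h hle)).le.trans (hle' _ _ hle)⟩
  · rintro ⟨L, B⟩ ⟨h, _⟩ ⟨L', B'⟩ ⟨h', _⟩ heq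
    obtain ⟨h1, h2⟩ := h.starWord_inj hω hn h' heq
    exact Prod.ext h1 h2
  · rintro ⟨L, B⟩ ⟨h, hle, _, hB⟩ ⟨L', B'⟩ ⟨h', hle', _, hB'⟩ heq
    obtain ⟨h1, h2⟩ := (hins _ _ h hle).starWord_inj hω hn (hins _ _ h' hle') heq
    exact Prod.ext h1 (by
      dsimp only at hB hB' h2
      rw [← Finset.erase_insert hB, h2, Finset.erase_insert hB'])
  · rintro ⟨L, B⟩ ⟨h, hle, _, hB⟩ ⟨L', B'⟩ ⟨h', hle', _, hB'⟩ heq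
    obtain ⟨h1, h2⟩ := h.starWord_inj hω hn (hins _ _ h' hle') heq
    dsimp only at h2 hB
    exact hB (h2 ▸ Finset.mem_insert_self _ _)
  · exact fun t ht => ht.2.2.1
  · rintro ⟨L, B⟩ ⟨h, hle, hi, hB⟩
    dsimp only at hB hle h
    have h' := hins _ _ h hle
    have hle2 := hle' _ _ hle
    have key := diff_append_insert_erase (k := k) hω.isRefl h'.good
      (fun b hb => h'.lt hω hn hb) (S := {i | i ∈ isoWords ω ∨
        (∃ t' ∈ T, starWord ω t'.1 (insert ℓ t'.2) = i) ∨
        ∃ t' ∈ T, 0 < 0 ∧ starWord ω t'.1 t'.2 = i})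
      ?_ (Finset.mem_insert_self ℓ B) ?_ ?_ ?_
    · rw [Finset.erase_insert hB] at key
      exact key
    · intro L' hL' hL
      rw [starWord_congr hL]
      exact (hmem L' _ (h'.congr hL' hL) (hL.symm ▸ hle2) (Finset.mem_insert_self _ _)).imp_right
        Or.inl
    · intro b _ hne
      exact (hmem L _ (h'.mono (Finset.erase_subset b _))
        ((sup_le_sup_left (spanF_mono (Finset.erase_subset _ _)) _).trans hle2)
        (Finset.mem_erase.2 ⟨hne.symm, Finset.mem_insert_self _ _⟩)).imp_right Or.inl
    · intro h2
      refine absurd (h'.le ℓ (Finset.mem_insert_self _ _)) (hnot _ ?_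
        (nondegenerate_star hω hn h.good))
      exact h2.symm.le.trans (le_sup_right.trans hle2)
    · intro X hX hX0 hXs hXn
      have hXY : X ≤ Y := by
        refine le_trans ?_ (le_sup_right.trans hle2)
        conv_lhs => rw [← hX]
        exact spanF_mono fun a ha => (mem_inside.1 ha).1
      rw [starWord_split L hX]
      refine (hmem _ _ (h'.split hω hX hX0 hXs hXn) ?_ ?_).imp_right Or.inl
      · rw [tot_snoc, hX, sup_assoc, StarData.span_split hω hX hXn]
        exact hle2
      · refine Finset.mem_image.2 ⟨ℓ, mem_outside.2 ⟨Finset.mem_insert_self _ _,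
          hnot X hXY hXn⟩, Entry.ext ?_⟩
        exact projPerp_of_le_orthogonal hω.isRefl hXn (hperp X hXY)

omit hn [Nontrivial V] in
theorem tot_ne_of_good_snoc {L : List (Finset (Entry K V))} {B : Finset (Entry K V)}
    (h : Good ω (L ++ [B])) : tot L ≠ tot (L ++ [B]) := fun heq => by
  rw [good_snoc] at h
  rw [tot_snoc, left_eq_sup] at heq
  refine h.2.1.spanF_ne_bot (eq_bot_iff.2 ?_)
  rw [← (isCompl_orthogonal hω.isRefl (nondegenerate_tot hω.isRefl h.1)).inf_eq_bot]
  exact le_inf heq h.2.2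

/-- The words whose lines span a given nonzero symplectic subspace contribute nothing: the
operation of turning the lines of the last factor into a factor of their own pairs them off. -/
theorem relAcyclic_of_nondegenerate {Y : Submodule K V} (hY : (ω.restrict Y).Nondegenerate)
    (hY0 : Y ≠ ⊥) : RelAcyclic (diff ω : Words k (Entry K V) →ₗ[k] _)
      ({w | w ∈ starWords ω ∪ totalWords ω ∧ lineSpan w ≤ Y} ∪ isoWords ω)
      ({w | w ∈ starWords ω ∪ totalWords ω ∧ lineSpan w < Y} ∪ isoWords ω) := by
  classical
  set T : Set (List (Finset (Entry K V)) × Finset (Entry K V)) := {t | StarData ω t.1 t.2 ∧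
    tot t.1 ⊔ spanF t.2 = Y ∧ t.2.Nonempty} with hT
  have hgood : ∀ L B, (L, B) ∈ T → Good ω (L ++ [B]) ∧ tot (L ++ [B]) = Y := by
    rintro L B ⟨h, hLB, hB⟩
    dsimp only at hLB hB h
    refine ⟨good_snoc.2 ⟨h.good, ⟨h.isLine, hB, ?_⟩, h.spanF_le⟩, by rw [tot_snoc, hLB]⟩
    exact nondegenerate_of_sup hω.isRefl h.spanF_le (hLB.symm ▸ hY)
  have hne : ∀ L B, (L, B) ∈ T → tot L ≠ Y := fun L B h h' => by
    have := tot_ne_of_good_snoc hω (hgood L B h).1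
    rw [(hgood L B h).2] at this
    exact this h'
  have hstar : ∀ L B, (L, B) ∈ T → Y ≠ ⊤ → StarData ω (L ++ [B]) ∅ := fun L B h h' =>
    ⟨(hgood L B h).1, (hgood L B h).2.symm ▸ h', by simp, by simp⟩
  have hT' : ∀ L B, Good ω (L ++ [B]) → tot (L ++ [B]) = Y → (L, B) ∈ T := by
    intro L B h h'
    have h1 := tot_ne_of_good_snoc hω h
    rw [good_snoc] at h
    refine ⟨⟨h.1, ?_, h.2.1.isLine, SymplecticSharbly.spanF_le.1 h.2.2⟩, tot_snoc.symm.trans h',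
      h.2.1.nonempty⟩
    intro ht
    refine h1 ?_
    rw [tot_snoc, ht, top_sup_eq]
  have hi₀ : ∀ L B, (L, B) ∈ T → (if Y = ⊤ then L ++ [B] else starWord ω (L ++ [B]) ∅) ∈
      starWords ω ∪ totalWords ω ∧
      lineSpan (if Y = ⊤ then L ++ [B] else starWord ω (L ++ [B]) ∅) = Y := by
    intro L B h
    obtain ⟨h1, h2⟩ := hgood L B h
    split_ifs with hYt
    · exact ⟨Or.inr ⟨h1, h2.trans hYt⟩, by rw [lineSpan_of_good h1, h2]⟩
    · refine ⟨Or.inl ⟨_, _, hstar L B h hYt, rfl⟩, ?_⟩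
      rw [lineSpan_starWord hω hn (hstar L B h hYt), h2, spanF_empty, sup_bot_eq]
  have hmem : ∀ L B, StarData ω L B → tot L ⊔ spanF B ≤ Y → tot L ≠ Y →
      starWord ω L B ∈ {w | w ∈ starWords ω ∪ totalWords ω ∧ lineSpan w < Y} ∪ isoWords ω ∨
        ∃ t ∈ T, starWord ω t.1 t.2 = starWord ω L B := by
    intro L B h hle hLY
    rcases hle.eq_or_lt with heq | hlt
    · refine Or.inr ⟨(L, B), ⟨h, heq, ?_⟩, rfl⟩
      rw [Finset.nonempty_iff_ne_empty]
      rintro rfl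
      rw [spanF_empty, sup_bot_eq] at heq
      exact hLY heq
    · exact Or.inl (Or.inl ⟨Or.inl ⟨L, B, h, rfl⟩, (lineSpan_starWord hω hn h).trans_lt hlt⟩)
  refine relAcyclic_of_pairing (T := T)
    -- The partner arises by splitting the lines from the orthogonal complement, or by omitting the
    -- complement if it is spanned by the lines, i.e. if the lines span `V`.
    (i₀ := fun t => if Y = ⊤ then t.1 ++ [t.2] else starWord ω (t.1 ++ [t.2]) ∅)
    (i₁ := fun t => starWord ω t.1 t.2) (fun _ => 0) ?_ ?_ ?_ ?_ ?_ ?_ ?_ ?_ ?_ ?_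
    (diff_diff hω.isRefl)
  · rintro w (⟨hwK, hle⟩ | hw)
    · rcases hle.eq_or_lt with heq | hlt
      · rcases hwK with ⟨L, B, h, rfl⟩ | hw
        · rw [lineSpan_starWord hω hn h] at heq
          by_cases hB : B.Nonempty
          · exact Or.inr (Or.inr ⟨(L, B), ⟨h, heq, hB⟩, rfl⟩)
          · rw [Finset.not_nonempty_iff_eq_empty] at hB
            subst hB
            rw [spanF_empty, sup_bot_eq] at heq
            rcases List.eq_nil_or_concat' L with rfl | ⟨L', B', rfl⟩
            · exact absurd heq.symm hY0
            · refine Or.inr (Or.inl ⟨(L', B'), hT' _ _ h.good heq, ?_⟩)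
              simp only [if_neg (heq ▸ h.ne_top : Y ≠ ⊤)]
        · rw [lineSpan_of_good hw.1] at heq
          rcases List.eq_nil_or_concat' w with rfl | ⟨L', B', rfl⟩
          · exact absurd heq.symm hY0
          · refine Or.inr (Or.inl ⟨(L', B'), hT' _ _ hw.1 heq, ?_⟩)
            simp only [if_pos (heq.symm.trans hw.2)]
      · exact Or.inl (Or.inl ⟨hwK, hlt⟩)
    · exact Or.inl (Or.inr hw)
  · exact Set.union_subset_union_left _ fun w hw => ⟨hw.1, hw.2.le⟩
  · rintro ⟨L, B⟩ h
    exact Or.inl ⟨(hi₀ L B h).1, (hi₀ L B h).2.le⟩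
  · rintro ⟨L, B⟩ h
    exact Or.inl ⟨Or.inl ⟨_, _, h.1, rfl⟩, ((lineSpan_starWord hω hn h.1).trans h.2.1).le⟩
  · refine IsClosedUnder.union (fun w hw => ?_) (isClosedUnder_isoWords hω hn)
    refine Finsupp.supported_mono ?_ (diff_mem_lineSpan_le hω hn hw.1)
    exact fun j hj => ⟨hj.1, hj.2.trans_lt hw.2⟩
  · rintro ⟨L, B⟩ h ⟨L', B'⟩ h' heq
    dsimp only at heq
    have : L ++ [B] = L' ++ [B'] := by
      split_ifs at heq with hYt
      · exact heq
      · exact ((hstar L B h hYt).starWord_inj hω hn (hstar L' B' h' hYt) heq).1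
    obtain ⟨h1, h2⟩ := List.append_inj' this rfl
    exact Prod.ext h1 (List.singleton_inj.1 h2)
  · rintro ⟨L, B⟩ ⟨h, _⟩ ⟨L', B'⟩ ⟨h', _⟩ heq
    obtain ⟨h1, h2⟩ := h.starWord_inj hω hn h' heq
    exact Prod.ext h1 h2
  · rintro ⟨L, B⟩ h ⟨L', B'⟩ h' heq
    dsimp only at heq
    split_ifs at heq with hYt
    · exact h'.1.starWord_notMem hω hn (heq ▸ (hgood L B h).1)
    · obtain ⟨_, h2⟩ := (hstar L B h hYt).starWord_inj hω hn h'.1 heq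
      exact h'.2.2.ne_empty h2.symm
  · rintro ⟨L, B⟩ h (h' | h')
    · exact h'.2.ne (hi₀ L B h).2
    · dsimp only at h'
      split_ifs at h' with hYt
      · obtain ⟨B', hB', _, heq⟩ := h'
        exact (starData_nil hB').starWord_notMem hω hn (heq.symm ▸ (hgood L B h).1)
      · rw [starWord_mem_isoWords hω hn (hstar L B h hYt)] at h'
        simp at h'
  · rintro ⟨L, B⟩ ht
    obtain ⟨h, hLB, hB⟩ := id ht
    dsimp only at h hLB hB
    have h0 : ∀ L', Good ω L' → tot L' = tot L → L' ++ [insert (star ω L) B] ∈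
        {i | i ∈ {w | w ∈ starWords ω ∪ totalWords ω ∧ lineSpan w < Y} ∪ isoWords ω ∨
          (∃ t' ∈ T, starWord ω t'.1 t'.2 = i) ∨ ∃ t' ∈ T, 0 < 0 ∧
          (if Y = ⊤ then t'.1 ++ [t'.2] else starWord ω (t'.1 ++ [t'.2]) ∅) = i} := by
      intro L' hL' hL
      rw [starWord_congr hL]
      exact (hmem L' B (h.congr hL' hL) (by rw [hL, hLB]) (hL.symm ▸ hne L B ht)).imp_right Or.inl
    have h1 : ∀ b ∈ B, L ++ [insert (star ω L) (B.erase b)] ∈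
        {i | i ∈ {w | w ∈ starWords ω ∪ totalWords ω ∧ lineSpan w < Y} ∪ isoWords ω ∨
          (∃ t' ∈ T, starWord ω t'.1 t'.2 = i) ∨ ∃ t' ∈ T, 0 < 0 ∧
          (if Y = ⊤ then t'.1 ++ [t'.2] else starWord ω (t'.1 ++ [t'.2]) ∅) = i} := fun b _ =>
      (hmem L _ (h.mono (Finset.erase_subset b B)) ((sup_le_sup_left (spanF_mono
        (Finset.erase_subset b B)) _).trans hLB.le) (hne L B ht)).imp_right Or.inl
    have h3 : ∀ X, spanF (inside X B) = X → X ≠ ⊥ → X < (star ω L).sub →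
        (ω.restrict X).Nondegenerate → X ≠ spanF B →
        L ++ [inside X B, insert ⟨ω.orthogonal X ⊓ (star ω L).sub⟩ (projOutside ω X B)] ∈
        {i | i ∈ {w | w ∈ starWords ω ∪ totalWords ω ∧ lineSpan w < Y} ∪ isoWords ω ∨
          (∃ t' ∈ T, starWord ω t'.1 t'.2 = i) ∨ ∃ t' ∈ T, 0 < 0 ∧
          (if Y = ⊤ then t'.1 ++ [t'.2] else starWord ω (t'.1 ++ [t'.2]) ∅) = i} := by
      intro X hX hX0 hXs hXn hXB
      have h' := h.split hω hX hX0 hXs hXn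
      have hsp := StarData.span_split hω hX hXn
      rw [starWord_split L hX]
      refine Or.inr (Or.inl ⟨(_, _), ⟨h', ?_, ?_⟩, rfl⟩)
      · change tot (L ++ [inside X B]) ⊔ spanF (projOutside ω X B) = Y
        rw [tot_snoc, hX, sup_assoc, hsp, hLB]
      · change (projOutside ω X B).Nonempty
        rw [Finset.nonempty_iff_ne_empty]
        intro h0
        rw [h0, spanF_empty, sup_bot_eq] at hsp
        exact hXB hsp
    -- The complement of the total span may be omitted exactly if all lines together span `V`.
    have hYs : Y = ⊤ ↔ spanF B = (star ω L).sub := by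
      have hc := isCompl_orthogonal hω.isRefl (nondegenerate_tot hω.isRefl h.good)
      constructor
      · rintro rfl
        have := sup_inf_orthogonal hω.isRefl (nondegenerate_tot hω.isRefl h.good) h.spanF_le
        rw [hLB, top_inf_eq] at this
        exact this.symm
      · intro h2
        rw [← hLB, h2]
        exact hc.sup_eq_top
    by_cases hYt : Y = ⊤
    · simp only [if_pos hYt] at h0 h1 h3 ⊢
      exact diff_append_insert_omit hω.isRefl h.good (fun b hb => h.lt hω hn hb) h0 h1 (hYs.1 hYt)
        fun X hX hX0 hXs hXn => h3 X hX hX0 hXs hXn ((hYs.1 hYt).symm ▸ hXs.ne)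
    · simp only [if_neg hYt] at h0 h1 h3 ⊢
      have key := diff_append_insert_split (k := k) hω.isRefl h.good (fun b hb => h.lt hω hn hb)
        h0 h1 (fun h2 => hYt (hYs.2 h2)) (spanF_ne_bot h.isLine hB)
        (nondegenerate_of_sup hω.isRefl h.spanF_le (hLB.symm ▸ hY)) h3
      have heq : L ++ [B, {⟨ω.orthogonal (spanF B) ⊓ (star ω L).sub⟩}] =
          starWord ω (L ++ [B]) ∅ := by
        rw [starWord, star, star, tot_snoc, orthogonal_sup, inf_comm]
        simp
      rw [heq] at key
      exact key

/-- The complex of all words `starWord ω L B` and of the good words with total span `V` is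
equivalent to its part given by sets of lines with isotropic span. -/
theorem relAcyclic_isoWords : RelAcyclic (diff ω : Words k (Entry K V) →ₗ[k] _)
    (starWords ω ∪ totalWords ω) (isoWords ω) := by
  have h := relAcyclic_of_filtration (D := (diff ω : Words k (Entry K V) →ₗ[k] _))
    (fun Y : Submodule K V => Module.finrank K Y)
    (fun X Y h => Submodule.finrank_lt_finrank_of_lt h) lineSpan
    (P := starWords ω ∪ totalWords ω) (Q := isoWords ω)
    (fun w hw => diff_mem_lineSpan_le hω hn hw) (isClosedUnder_isoWords hω hn)
    (diff_diff hω.isRefl) (fun Y hlt => ?_) (r := Module.finrank K V + 1) (I := Set.univ)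
    isLowerSet_univ (fun Y _ => Nat.lt_succ_of_le (Submodule.finrank_le Y))
  · have heq : {i | i ∈ starWords ω ∪ totalWords ω ∧ lineSpan i ∈ (Set.univ : Set (Submodule K V))} ∪
        isoWords ω = starWords ω ∪ totalWords ω := by
      refine Set.Subset.antisymm (Set.union_subset (fun i hi => hi.1) isoWords_subset)
        fun i hi => Or.inl ⟨hi, trivial⟩
    rwa [heq] at h
  · by_cases hY : (ω.restrict Y).Nondegenerate
    · by_cases hY0 : Y = ⊥
      -- Over `Y = 0` there is only the word `{V}`, which belongs to `isoWords`.
      · subst hY0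
        refine fun x hx _ => ⟨0, zero_mem _, ?_⟩
        rw [map_zero, sub_zero]
        refine Finsupp.supported_mono (Set.union_subset ?_ Set.subset_union_right) hx
        rintro w ⟨⟨L, B, h, rfl⟩ | hw, hle⟩
        · rw [lineSpan_starWord hω hn h, le_bot_iff, sup_eq_bot_iff] at hle
          obtain rfl := eq_nil_of_tot_eq_bot h.good hle.1
          exact Or.inr ⟨B, h.isLine, by rw [hle.2]; exact bot_le, rfl⟩
        · rw [lineSpan_of_good hw.1, hw.2, top_le_iff] at hle
          exact absurd hle bot_ne_top
      · exact relAcyclic_of_nondegenerate hω hn hY hY0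
    -- Over a degenerate `Y`, the words below `Y` and those up to `Y` both contribute nothing.
    · exact RelAcyclic.cancel (relAcyclic_of_degenerate hω hn hY) hlt
        (Set.union_subset_union_left _ fun i hi => ⟨hi.1, hi.2.le⟩) Set.subset_union_right
        (diff_diff hω.isRefl)

end LineSpan

/-! ### Lines and chains of isotropic subspaces -/

section Mixed

variable {k : Type*} [CommRing k] {K V : Type*} [Field K] [AddCommGroup V] [Module K V]

/-- A set of nonzero subspaces with isotropic span that consists of a chain and of lines contained
in each member of the chain. -/
structure MixedData (ω : LinearMap.BilinForm K V) (τ : Finset (Entry K V)) : Prop where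
  isotropic : Isotropic ω (spanF τ)
  ne_bot : ∀ a ∈ τ, a.sub ≠ ⊥
  comparable : ∀ a ∈ τ, ∀ b ∈ τ, (a.IsLine ∧ b.IsLine) ∨ a.sub ≤ b.sub ∨ b.sub ≤ a.sub

/-- The set of subspaces is a chain. -/
def IsChainSet (τ : Finset (Entry K V)) : Prop := ∀ a ∈ τ, ∀ b ∈ τ, a.sub ≤ b.sub ∨ b.sub ≤ a.sub

/-- The words with a single factor that consists of `V` and of isotropic subspaces as in
`MixedData`. -/
def mixedWords (ω : LinearMap.BilinForm K V) : Set (List (Finset (Entry K V))) :=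
  {w | ∃ τ, MixedData ω τ ∧ starWord ω [] τ = w}

/-- The words with a single factor that consists of `V` and of a chain of nonzero isotropic
subspaces. -/
def chainWords (ω : LinearMap.BilinForm K V) : Set (List (Finset (Entry K V))) :=
  {w | ∃ τ, MixedData ω τ ∧ IsChainSet τ ∧ starWord ω [] τ = w}

variable {ω : LinearMap.BilinForm K V}

theorem MixedData.mono {τ τ' : Finset (Entry K V)} (h : MixedData ω τ) (h' : τ' ⊆ τ) :
    MixedData ω τ' :=
  ⟨h.isotropic.mono (spanF_mono h'), fun a ha => h.ne_bot a (h' ha),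
    fun a ha b hb => h.comparable a (h' ha) b (h' hb)⟩

theorem mixedData_of_isLine {B : Finset (Entry K V)} (hB : ∀ b ∈ B, b.IsLine)
    (hi : Isotropic ω (spanF B)) : MixedData ω B :=
  ⟨hi, fun a ha => (hB a ha).ne_bot, fun a ha b hb => Or.inl ⟨hB a ha, hB b hb⟩⟩

theorem isoWords_subset_mixedWords : isoWords ω ⊆ mixedWords ω := by
  rintro _ ⟨B, hB, hi, rfl⟩
  exact ⟨B, mixedData_of_isLine hB hi, rfl⟩

theorem chainWords_subset_mixedWords : chainWords ω ⊆ mixedWords ω := by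
  rintro _ ⟨τ, h, _, rfl⟩
  exact ⟨τ, h, rfl⟩

theorem star_nil_sub : (star ω ([] : List (Finset (Entry K V)))).sub = ⊤ := orthogonal_bot

open Classical in
/-- The smallest member of the chain in a set of subspaces as in `MixedData`. -/
def bottom (τ : Finset (Entry K V)) : Submodule K V :=
  (τ.filter fun a => ¬a.IsLine).inf Entry.sub

theorem bottom_insert {τ : Finset (Entry K V)} {a : Entry K V} (ha : a.IsLine) :
    bottom (insert a τ) = bottom τ := by
  classical
  rw [bottom, Finset.filter_insert, if_neg (not_not.2 ha), bottom]

theorem bottom_erase {τ : Finset (Entry K V)} {a : Entry K V} (ha : a.IsLine) :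
    bottom (τ.erase a) = bottom τ := by
  classical
  rw [bottom, Finset.filter_erase, Finset.erase_eq_of_notMem, bottom]
  simp [ha]

open Classical in
/-- The span of the lines in a set of subspaces. -/
def linesSpan (τ : Finset (Entry K V)) : Entry K V := ⟨spanF (τ.filter Entry.IsLine)⟩

theorem linesSpan_insert {τ : Finset (Entry K V)} {a : Entry K V} (ha : ¬a.IsLine) :
    linesSpan (insert a τ) = linesSpan τ := by
  classical
  rw [linesSpan, Finset.filter_insert, if_neg ha, linesSpan]

theorem linesSpan_erase {τ : Finset (Entry K V)} {a : Entry K V} (ha : ¬a.IsLine) :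
    linesSpan (τ.erase a) = linesSpan τ := by
  classical
  rw [linesSpan, Finset.filter_erase, Finset.erase_eq_of_notMem, linesSpan]
  simp [ha]

theorem le_linesSpan {τ : Finset (Entry K V)} {a : Entry K V} (ha : a ∈ τ) (ha' : a.IsLine) :
    a.sub ≤ (linesSpan τ).sub := by
  classical
  exact le_spanF (Finset.mem_filter.2 ⟨ha, ha'⟩)

theorem linesSpan_le {τ : Finset (Entry K V)} : (linesSpan τ).sub ≤ spanF τ :=
  by
  classical
  exact spanF_mono (Finset.filter_subset _ _)

variable [FiniteDimensional K V]

theorem MixedData.exists_bottom {τ : Finset (Entry K V)} (h : MixedData ω τ)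
    (h' : ∃ a ∈ τ, ¬a.IsLine) : ∃ a ∈ τ, ¬a.IsLine ∧ a.sub = bottom τ := by
  classical
  obtain ⟨a, ha, hmin⟩ := Finset.exists_min_image (τ.filter fun a => ¬a.IsLine)
    (fun a => Module.finrank K a.sub) (by
      obtain ⟨a, ha, ha'⟩ := h'
      exact ⟨a, Finset.mem_filter.2 ⟨ha, ha'⟩⟩)
  obtain ⟨ha1, ha2⟩ := Finset.mem_filter.1 ha
  refine ⟨a, ha1, ha2, le_antisymm (Finset.le_inf fun b hb => ?_) (Finset.inf_le ha)⟩
  rcases h.comparable a ha1 b (Finset.mem_filter.1 hb).1 with h1 | h1 | h1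
  · exact absurd h1.1 ha2
  · exact h1
  · exact (Submodule.eq_of_le_of_finrank_le h1 (hmin b hb)).symm.le

theorem MixedData.le_of_isLine {τ : Finset (Entry K V)} (h : MixedData ω τ) {a b : Entry K V}
    (ha : a ∈ τ) (hb : b ∈ τ) (ha' : a.IsLine) (hb' : ¬b.IsLine) : a.sub ≤ b.sub := by
  rcases h.comparable a ha b hb with h1 | h1 | h1
  · exact absurd h1.2 hb'
  · exact h1
  · refine absurd ?_ hb'
    have h2 := Submodule.finrank_mono h1
    have h3 : Module.finrank K a.sub = 1 := ha'
    have h4 : Module.finrank K b.sub ≠ 0 := fun h0 =>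
      h.ne_bot b hb (Submodule.finrank_eq_zero.1 h0)
    change Module.finrank K b.sub = 1
    omega

omit [FiniteDimensional K V] in
theorem MixedData.exists_isLine_of_not_isChainSet {τ : Finset (Entry K V)} (h : MixedData ω τ)
    (h' : ¬IsChainSet τ) : ∃ a ∈ τ, ∃ b ∈ τ, a.IsLine ∧ b.IsLine ∧ a ≠ b := by
  simp only [IsChainSet, not_forall] at h'
  obtain ⟨a, ha, b, hb, hab⟩ := h'
  have h1 := (h.comparable a ha b hb).resolve_right hab
  refine ⟨a, ha, b, hb, h1.1, h1.2, ?_⟩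
  rintro rfl
  exact hab (Or.inl le_rfl)

theorem MixedData.not_isLine_linesSpan {τ : Finset (Entry K V)} (h : MixedData ω τ)
    (h' : ¬IsChainSet τ) : ¬(linesSpan τ).IsLine := fun hl => by
  obtain ⟨a, ha, b, hb, ha', hb', hne⟩ := h.exists_isLine_of_not_isChainSet h'
  have h1 : ∀ c ∈ τ, c.IsLine → c = linesSpan τ := fun c hc hc' =>
    Entry.ext (Submodule.eq_of_le_of_finrank_eq (le_linesSpan hc hc') (hc'.trans hl.symm))
  exact hne ((h1 a ha ha').trans (h1 b hb hb').symm)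

theorem MixedData.insert_linesSpan {τ : Finset (Entry K V)} (h : MixedData ω τ)
    (h' : ¬IsChainSet τ) : MixedData ω (insert (linesSpan τ) τ) := by
  have h0 : (linesSpan τ).sub ≠ ⊥ := fun h0 => by
    obtain ⟨a, ha, _, _, ha', _⟩ := h.exists_isLine_of_not_isChainSet h'
    exact h.ne_bot a ha (eq_bot_iff.2 (h0 ▸ le_linesSpan ha ha'))
  have h1 : ∀ a ∈ τ, a.sub ≤ (linesSpan τ).sub ∨ (linesSpan τ).sub ≤ a.sub := fun a ha => by
    by_cases ha' : a.IsLine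
    · exact Or.inl (le_linesSpan ha ha')
    · refine Or.inr (spanF_le.2 fun b hb => ?_)
      classical
      obtain ⟨hb1, hb2⟩ := Finset.mem_filter.1 hb
      exact h.le_of_isLine hb1 ha hb2 ha'
  refine ⟨?_, ?_, ?_⟩
  · rw [spanF_insert, sup_eq_right.2 linesSpan_le]
    exact h.isotropic
  · intro a ha
    rcases Finset.mem_insert.1 ha with rfl | ha
    · exact h0
    · exact h.ne_bot a ha
  · intro a ha b hb
    rcases Finset.mem_insert.1 ha with rfl | ha <;> rcases Finset.mem_insert.1 hb with rfl | hb
    · exact Or.inr (Or.inl le_rfl)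
    · exact Or.inr (h1 b hb).symm
    · exact Or.inr (h1 a ha)
    · exact h.comparable a ha b hb

theorem MixedData.insert_lineIn {τ : Finset (Entry K V)} (h : MixedData ω τ)
    (h' : ∃ a ∈ τ, ¬a.IsLine) :
    (lineIn (bottom τ)).IsLine ∧ MixedData ω (insert (lineIn (bottom τ)) τ) := by
  classical
  obtain ⟨c, hc, hc', hcb⟩ := h.exists_bottom h'
  have h0 : bottom τ ≠ ⊥ := hcb ▸ h.ne_bot c hc
  have hl := isLine_lineIn h0
  have h1 : ∀ a ∈ τ, ¬a.IsLine → (lineIn (bottom τ)).sub ≤ a.sub := fun a ha ha' =>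
    (lineIn_le h0).trans (Finset.inf_le (Finset.mem_filter.2 ⟨ha, ha'⟩))
  refine ⟨hl, ?_, ?_, ?_⟩
  · rw [spanF_insert, sup_eq_right.2 ((h1 c hc hc').trans (le_spanF hc))]
    exact h.isotropic
  · intro a ha
    rcases Finset.mem_insert.1 ha with rfl | ha
    · exact hl.ne_bot
    · exact h.ne_bot a ha
  · have h2 : ∀ a ∈ τ, ((lineIn (bottom τ)).IsLine ∧ a.IsLine) ∨
        (lineIn (bottom τ)).sub ≤ a.sub := fun a ha => by
      by_cases ha' : a.IsLine
      · exact Or.inl ⟨hl, ha'⟩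
      · exact Or.inr (h1 a ha ha')
    intro a ha b hb
    rcases Finset.mem_insert.1 ha with rfl | ha <;> rcases Finset.mem_insert.1 hb with rfl | hb
    · exact Or.inr (Or.inl le_rfl)
    · exact (h2 b hb).imp_right Or.inl
    · exact (h2 a ha).imp And.symm Or.inr
    · exact h.comparable a ha b hb

variable (hω : ω.IsAlt) (hn : (ω.restrict ⊤).Nondegenerate) [Nontrivial V]

include hω hn

theorem Isotropic.ne_top {U : Submodule K V} (h : Isotropic ω U) : U ≠ ⊤ := by
  rintro rfl
  exact top_ne_bot (h.eq_bot hω.isRefl hn)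

theorem MixedData.lt {τ : Finset (Entry K V)} (h : MixedData ω τ) {a : Entry K V} (ha : a ∈ τ) :
    a.sub < (star ω ([] : List (Finset (Entry K V)))).sub := by
  rw [star_nil_sub]
  exact lt_top_iff_ne_top.2 ((h.isotropic.mono (le_spanF ha)).ne_top hω hn)

theorem MixedData.starWord_inj {τ τ' : Finset (Entry K V)} (h : MixedData ω τ)
    (h' : MixedData ω τ') (heq : starWord ω [] τ = starWord ω [] τ') : τ = τ' := by
  have h1 : star ω ([] : List (Finset (Entry K V))) ∉ τ := fun h1 => lt_irrefl _ (h.lt hω hn h1)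
  have h2 : star ω ([] : List (Finset (Entry K V))) ∉ τ' := fun h1 => lt_irrefl _ (h'.lt hω hn h1)
  rw [← Finset.erase_insert h1, ← Finset.erase_insert h2, List.singleton_inj.1 heq]

omit hn [Nontrivial V] in
/-- A set of subspaces with isotropic span cannot be split. -/
theorem MixedData.not_split {τ : Finset (Entry K V)} (h : MixedData ω τ) {X : Submodule K V}
    (hX : spanF (inside X τ) = X) (hX0 : X ≠ ⊥) (hXn : (ω.restrict X).Nondegenerate) : False := by
  refine hX0 ((h.isotropic.mono ?_).eq_bot hω.isRefl hXn)
  rw [← hX]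
  exact spanF_mono fun a ha => (mem_inside.1 ha).1

theorem MixedData.diff_mem {τ : Finset (Entry K V)} (h : MixedData ω τ)
    {S : Set (List (Finset (Entry K V)))} (h1 : ∀ b ∈ τ, starWord ω [] (τ.erase b) ∈ S) :
    diff ω (Finsupp.single (starWord ω [] τ) (1 : k)) ∈
      Finsupp.supported k k (S ∪ {starWord ω [] τ}) := by
  have hg : Good ω ([] : List (Finset (Entry K V))) := trivial
  refine diff_append_insert_mem hω.isRefl hg (fun b hb => h.lt hω hn hb) ?_ ?_ ?_ ?_
  · intro L' hL' hL
    obtain rfl := eq_nil_of_tot_eq_bot hL' hL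
    exact Or.inr rfl
  · exact fun b hb => Or.inl (h1 b hb)
  · exact fun h2 => absurd (h2.trans star_nil_sub) (h.isotropic.ne_top hω hn)
  · exact fun X hX hX0 _ hXn => (h.not_split hω hX hX0 hXn).elim

theorem MixedData.diff_erase {τ : Finset (Entry K V)} (h : MixedData ω τ) {a : Entry K V}
    (ha : a ∈ τ) {S : Set (List (Finset (Entry K V)))} (h0 : starWord ω [] τ ∈ S)
    (h1 : ∀ b ∈ τ, b ≠ a → starWord ω [] (τ.erase b) ∈ S) :
    ∃ e : ℕ, diff ω (Finsupp.single (starWord ω [] τ) (1 : k)) -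
      (-1 : k) ^ e • Finsupp.single (starWord ω [] (τ.erase a)) 1 ∈ Finsupp.supported k k S := by
  have hg : Good ω ([] : List (Finset (Entry K V))) := trivial
  refine diff_append_insert_erase hω.isRefl hg (fun b hb => h.lt hω hn hb) ?_ ha h1 ?_ ?_
  · intro L' hL' hL
    obtain rfl := eq_nil_of_tot_eq_bot hL' hL
    exact h0
  · exact fun h2 => absurd (h2.trans star_nil_sub) (h.isotropic.ne_top hω hn)
  · exact fun X hX hX0 _ hXn => (h.not_split hω hX hX0 hXn).elim

theorem isClosedUnder_mixedWords :
    IsClosedUnder (diff ω : Words k (Entry K V) →ₗ[k] _) (mixedWords ω) := by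
  rintro _ ⟨τ, h, rfl⟩
  refine Finsupp.supported_mono (Set.union_subset subset_rfl ?_) (h.diff_mem hω hn fun b _ =>
    (⟨_, h.mono (Finset.erase_subset b τ), rfl⟩ : _ ∈ mixedWords ω))
  rintro _ rfl
  exact ⟨τ, h, rfl⟩

theorem isClosedUnder_chainWords :
    IsClosedUnder (diff ω : Words k (Entry K V) →ₗ[k] _) (chainWords ω) := by
  rintro _ ⟨τ, h, hc, rfl⟩
  refine Finsupp.supported_mono (Set.union_subset subset_rfl ?_) (h.diff_mem hω hn fun b _ =>
    (⟨_, h.mono (Finset.erase_subset b τ), fun a ha b hb => hc a (Finset.mem_of_mem_erase ha) b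
      (Finset.mem_of_mem_erase hb), rfl⟩ : _ ∈ chainWords ω))
  rintro _ rfl
  exact ⟨τ, h, hc, rfl⟩

/-- Adding a line in the smallest member of the chain pairs off the words in which the chain is
not empty. -/
theorem relAcyclic_mixedWords_isoWords : RelAcyclic (diff ω : Words k (Entry K V) →ₗ[k] _)
    (mixedWords ω) (isoWords ω) := by
  classical
  -- The line changes only if the smallest member of the chain is omitted, which makes the chain
  -- shorter. The filtration is the length of the chain.
  let ℓ : Finset (Entry K V) → Entry K V := fun τ => lineIn (bottom τ)
  set T : Set (Finset (Entry K V)) := {τ | MixedData ω τ ∧ (∃ a ∈ τ, ¬a.IsLine) ∧ ℓ τ ∉ τ} with hT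
  have hℓ : ∀ τ ∈ T, (ℓ τ).IsLine ∧ MixedData ω (insert (ℓ τ) τ) :=
    fun τ h => h.1.insert_lineIn h.2.1
  have hℓi : ∀ τ ∈ T, ℓ (insert (ℓ τ) τ) = ℓ τ := fun τ h => by
    simp only [ℓ, bottom_insert (hℓ τ h).1]
  have hmem : ∀ τ, MixedData ω τ → starWord ω [] τ ∈ isoWords ω ∨ τ ∈ T ∨
      ∃ τ' ∈ T, insert (ℓ τ') τ' = τ := by
    intro τ h
    by_cases hl : ∃ a ∈ τ, ¬a.IsLine
    · by_cases hmem : ℓ τ ∈ τ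
      · have hli := (h.insert_lineIn hl).1
        have hℓe : ℓ (τ.erase (ℓ τ)) = ℓ τ := by
          simp only [ℓ, bottom_erase hli]
        refine Or.inr (Or.inr ⟨τ.erase (ℓ τ), ⟨h.mono (Finset.erase_subset _ _), ?_, ?_⟩, ?_⟩)
        · obtain ⟨a, ha, ha'⟩ := hl
          exact ⟨a, Finset.mem_erase.2 ⟨fun h' => ha' (h' ▸ hli), ha⟩, ha'⟩
        · rw [hℓe]
          exact Finset.notMem_erase _ _
        · rw [hℓe, Finset.insert_erase hmem]
      · exact Or.inr (Or.inl ⟨h, hl, hmem⟩)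
    · push Not at hl
      exact Or.inl ⟨τ, hl, h.isotropic, rfl⟩
  refine relAcyclic_of_pairing (T := T) (i₀ := fun τ => starWord ω [] τ)
    (i₁ := fun τ => starWord ω [] (insert (ℓ τ) τ))
    (fun τ => (τ.filter fun a => ¬a.IsLine).card) ?_ isoWords_subset_mixedWords ?_ ?_
    (isClosedUnder_isoWords hω hn) ?_ ?_ ?_ ?_ ?_ (diff_diff hω.isRefl)
  · rintro _ ⟨τ, h, rfl⟩
    rcases hmem τ h with h' | h' | ⟨τ', h', rfl⟩
    · exact Or.inl h'
    · exact Or.inr (Or.inl ⟨τ, h', rfl⟩)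
    · exact Or.inr (Or.inr ⟨τ', h', rfl⟩)
  · exact fun τ h => ⟨τ, h.1, rfl⟩
  · exact fun τ h => ⟨_, (hℓ τ h).2, rfl⟩
  · exact fun τ h τ' h' heq => h.1.starWord_inj hω hn h'.1 heq
  · intro τ h τ' h' heq
    have h1 := (hℓ τ h).2.starWord_inj hω hn (hℓ τ' h').2 heq
    have h2 : ℓ τ = ℓ τ' := by rw [← hℓi τ h, h1, hℓi τ' h']
    rw [← Finset.erase_insert h.2.2, h1, h2, Finset.erase_insert h'.2.2]
  · intro τ h τ' h' heq
    have h1 := h.1.starWord_inj hω hn (hℓ τ' h').2 heq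
    have h2 : ℓ τ = ℓ τ' := by rw [h1, hℓi τ' h']
    exact h.2.2 (by rw [h2, h1]; exact Finset.mem_insert_self _ _)
  · rintro τ h ⟨B, hB, hi, heq⟩
    have h1 := (mixedData_of_isLine hB hi).starWord_inj hω hn h.1 heq
    obtain ⟨a, ha, ha'⟩ := h.2.1
    exact ha' (hB a (h1 ▸ ha))
  · intro τ h
    have key := (hℓ τ h).2.diff_erase (k := k) hω hn (Finset.mem_insert_self (ℓ τ) τ)
      (S := {i | i ∈ isoWords ω ∨ (∃ τ' ∈ T, starWord ω [] (insert (ℓ τ') τ') = i) ∨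
        ∃ τ' ∈ T, (τ'.filter fun a => ¬a.IsLine).card < (τ.filter fun a => ¬a.IsLine).card ∧
          starWord ω [] τ' = i}) (Or.inr (Or.inl ⟨τ, h, rfl⟩)) ?_
    · rw [Finset.erase_insert h.2.2] at key
      exact key
    · intro b hb hbℓ
      have hbτ := (Finset.mem_insert.1 hb).resolve_left hbℓ
      rcases hmem _ ((hℓ τ h).2.mono (Finset.erase_subset b _)) with h' | h' | ⟨τ', h', heq⟩
      · exact Or.inl h'
      · refine Or.inr (Or.inr ⟨_, h', ?_, rfl⟩)
        have hbl : ¬b.IsLine := fun hbl => h'.2.2 (by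
          have : ℓ ((insert (ℓ τ) τ).erase b) = ℓ τ := by
            simp only [ℓ, bottom_erase hbl, bottom_insert (hℓ τ h).1]
          rw [this]
          exact Finset.mem_erase.2 ⟨hbℓ.symm, Finset.mem_insert_self _ _⟩)
        rw [Finset.filter_erase, Finset.filter_insert, if_neg (not_not.2 (hℓ τ h).1)]
        exact Finset.card_erase_lt_of_mem (Finset.mem_filter.2 ⟨hbτ, hbl⟩)
      · exact Or.inr (Or.inl ⟨τ', h', by rw [heq]⟩)

/-- Adding the span of the lines pairs off the words in which there are at least two lines. -/
theorem relAcyclic_mixedWords_chainWords : RelAcyclic (diff ω : Words k (Entry K V) →ₗ[k] _)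
    (mixedWords ω) (chainWords ω) := by
  classical
  set T : Set (Finset (Entry K V)) :=
    -- The span of the lines changes only if a line is omitted, so the number of lines can serve as
    -- filtration.
    {τ | MixedData ω τ ∧ ¬IsChainSet τ ∧ linesSpan τ ∉ τ} with hT
  have hU : ∀ τ ∈ T, ¬(linesSpan τ).IsLine ∧ MixedData ω (insert (linesSpan τ) τ) :=
    fun τ h => ⟨h.1.not_isLine_linesSpan h.2.1, h.1.insert_linesSpan h.2.1⟩
  have hUi : ∀ τ ∈ T, linesSpan (insert (linesSpan τ) τ) = linesSpan τ := fun τ h =>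
    linesSpan_insert (hU τ h).1
  have hmem : ∀ τ, MixedData ω τ → starWord ω [] τ ∈ chainWords ω ∨ τ ∈ T ∨
      ∃ τ' ∈ T, insert (linesSpan τ') τ' = τ := by
    intro τ h
    by_cases hc : IsChainSet τ
    · exact Or.inl ⟨τ, h, hc, rfl⟩
    · by_cases hmem : linesSpan τ ∈ τ
      · have hli := h.not_isLine_linesSpan hc
        have hUe : linesSpan (τ.erase (linesSpan τ)) = linesSpan τ := linesSpan_erase hli
        refine Or.inr (Or.inr ⟨τ.erase (linesSpan τ), ⟨h.mono (Finset.erase_subset _ _),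
          fun hc' => ?_, ?_⟩, ?_⟩)
        · obtain ⟨a, ha, b, hb, ha', hb', hne⟩ := h.exists_isLine_of_not_isChainSet hc
          have hle := hc' a (Finset.mem_erase.2 ⟨fun h' => hli (h' ▸ ha'), ha⟩) b
            (Finset.mem_erase.2 ⟨fun h' => hli (h' ▸ hb'), hb⟩)
          refine hne (Entry.ext ?_)
          rcases hle with hle | hle
          · exact Submodule.eq_of_le_of_finrank_eq hle (ha'.trans hb'.symm)
          · exact (Submodule.eq_of_le_of_finrank_eq hle (hb'.trans ha'.symm)).symm
        · rw [hUe]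
          exact Finset.notMem_erase _ _
        · rw [hUe, Finset.insert_erase hmem]
      · exact Or.inr (Or.inl ⟨h, hc, hmem⟩)
  refine relAcyclic_of_pairing (T := T) (i₀ := fun τ => starWord ω [] τ)
    (i₁ := fun τ => starWord ω [] (insert (linesSpan τ) τ))
    (fun τ => (τ.filter Entry.IsLine).card) ?_ chainWords_subset_mixedWords ?_ ?_
    (isClosedUnder_chainWords hω hn) ?_ ?_ ?_ ?_ ?_ (diff_diff hω.isRefl)
  · rintro _ ⟨τ, h, rfl⟩
    rcases hmem τ h with h' | h' | ⟨τ', h', rfl⟩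
    · exact Or.inl h'
    · exact Or.inr (Or.inl ⟨τ, h', rfl⟩)
    · exact Or.inr (Or.inr ⟨τ', h', rfl⟩)
  · exact fun τ h => ⟨τ, h.1, rfl⟩
  · exact fun τ h => ⟨_, (hU τ h).2, rfl⟩
  · exact fun τ h τ' h' heq => h.1.starWord_inj hω hn h'.1 heq
  · intro τ h τ' h' heq
    have h1 := (hU τ h).2.starWord_inj hω hn (hU τ' h').2 heq
    have h2 : linesSpan τ = linesSpan τ' := by rw [← hUi τ h, h1, hUi τ' h']
    rw [← Finset.erase_insert h.2.2, h1, h2, Finset.erase_insert h'.2.2]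
  · intro τ h τ' h' heq
    have h1 := h.1.starWord_inj hω hn (hU τ' h').2 heq
    have h2 : linesSpan τ = linesSpan τ' := by rw [h1, hUi τ' h']
    exact h.2.2 (by rw [h2, h1]; exact Finset.mem_insert_self _ _)
  · rintro τ h ⟨τ', h', hc, heq⟩
    exact h.2.1 (h'.starWord_inj hω hn h.1 heq ▸ hc)
  · intro τ h
    have key := (hU τ h).2.diff_erase (k := k) hω hn (Finset.mem_insert_self (linesSpan τ) τ)
      (S := {i | i ∈ chainWords ω ∨
        (∃ τ' ∈ T, starWord ω [] (insert (linesSpan τ') τ') = i) ∨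
        ∃ τ' ∈ T, (τ'.filter Entry.IsLine).card < (τ.filter Entry.IsLine).card ∧
          starWord ω [] τ' = i}) (Or.inr (Or.inl ⟨τ, h, rfl⟩)) ?_
    · rw [Finset.erase_insert h.2.2] at key
      exact key
    · intro b hb hbU
      have hbτ := (Finset.mem_insert.1 hb).resolve_left hbU
      rcases hmem _ ((hU τ h).2.mono (Finset.erase_subset b _)) with h' | h' | ⟨τ', h', heq⟩
      · exact Or.inl h'
      · refine Or.inr (Or.inr ⟨_, h', ?_, rfl⟩)
        have hbl : b.IsLine := by
          by_contra hbl
          refine h'.2.2 ?_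
          rw [linesSpan_erase hbl, hUi τ h]
          exact Finset.mem_erase.2 ⟨hbU.symm, Finset.mem_insert_self _ _⟩
        rw [Finset.filter_erase, Finset.filter_insert, if_neg (hU τ h).1]
        exact Finset.card_erase_lt_of_mem (Finset.mem_filter.2 ⟨hbτ, hbl⟩)
      · exact Or.inr (Or.inl ⟨τ', h', by rw [heq]⟩)

/-- The two complexes that are glued overlap exactly in the words of lines with isotropic span. -/
theorem starWords_inter_mixedWords :
    (starWords ω ∪ totalWords ω) ∩ mixedWords ω = isoWords ω := by
  refine Set.Subset.antisymm ?_ (Set.subset_inter isoWords_subset isoWords_subset_mixedWords)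
  rintro w ⟨⟨L, B, h, rfl⟩ | hw, τ, hτ, heq⟩
  · obtain ⟨h1, h2⟩ := List.append_inj' heq rfl
    subst h1
    have h3 : τ = B := by
      have h4 : star ω ([] : List (Finset (Entry K V))) ∉ τ := fun h4 => lt_irrefl _ (hτ.lt hω hn h4)
      rw [← Finset.erase_insert h4, ← Finset.erase_insert (h.notMem hω hn),
        List.singleton_inj.1 h2]
    exact ⟨B, h.isLine, h3 ▸ hτ.isotropic, rfl⟩
  · exfalso
    rw [← heq] at hw
    have h1 : (star ω ([] : List (Finset (Entry K V)))).IsLine :=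
      hw.1.1.isLine _ (Finset.mem_insert_self _ _)
    have h2 := h1.isotropic hω
    rw [star_nil_sub] at h2
    exact h2.ne_top hω hn rfl

/-- The words of the resolution are equivalent to the complex of all the words used to compare it
with the Tits building. -/
theorem relAcyclic_union_totalWords : RelAcyclic (diff ω : Words k (Entry K V) →ₗ[k] _)
    (starWords ω ∪ totalWords ω ∪ mixedWords ω) (totalWords ω) := by
  have h := (relAcyclic_mixedWords_isoWords (k := k) hω hn).excision
    ((Set.inter_comm _ _).trans (starWords_inter_mixedWords hω hn))
    (isClosedUnder_mixedWords hω hn) (isClosedUnder_starWords hω hn)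
  rw [Set.union_comm] at h
  exact h.trans (relAcyclic_totalWords hω hn) Set.subset_union_left Set.subset_union_right
    (diff_diff hω.isRefl)

/-- The chains of isotropic subspaces are equivalent to the whole complex. -/
theorem relAcyclic_union_chainWords : RelAcyclic (diff ω : Words k (Entry K V) →ₗ[k] _)
    (starWords ω ∪ totalWords ω ∪ mixedWords ω) (chainWords ω) :=
  ((relAcyclic_isoWords (k := k) hω hn).excision (starWords_inter_mixedWords hω hn)
    (isClosedUnder_starWords hω hn) (isClosedUnder_mixedWords hω hn)).trans
    (relAcyclic_mixedWords_chainWords hω hn) Set.subset_union_right chainWords_subset_mixedWords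
    (diff_diff hω.isRefl)

end Mixed

/-! ### Homology of equivalent complexes in complementary degrees -/

section Grading

variable {k : Type*} [CommRing k]

/-- The degree of a word of exterior products: a factor with `r` entries has degree `r - 1`. -/
def wordDegree {α : Type*} : List (Finset α) → ℤ
  | [] => 0
  | A :: L => (A.card - 1) + wordDegree L

theorem wordDegree_append {α : Type*} (L L' : List (Finset α)) :
    wordDegree (L ++ L') = wordDegree L + wordDegree L' := by
  induction L with
  | nil => simp [wordDegree]
  | cons A L ih => simp only [List.cons_append, wordDegree, ih]; ring

theorem diff_mem_wordDegree {K V : Type*} [Field K] [AddCommGroup V] [Module K V]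
    (ω : LinearMap.BilinForm K V) (L : List (Finset (Entry K V))) :
    diff ω (Finsupp.single L (1 : k)) ∈
      Finsupp.supported k k {L' | wordDegree L' = wordDegree L - 1} := by
  induction L with
  | nil =>
    rw [diff, deriv_nil]
    exact zero_mem _
  | cons A L ih =>
    rw [diff_cons]
    refine add_mem ?_ (Submodule.smul_mem _ _ ?_)
    · refine cat_mem_supported (S := {L' | wordDegree L' = A.card - 1 - 1}) (S' := {L})
        (letterDiff_mem ω (fun a ha _ => ?_) fun X _ hi => ?_) (single_mem_supported rfl) ?_
      · have := Finset.card_erase_add_one ha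
        simp only [Set.mem_ofPred_eq, wordDegree]
        omega
      · have h1 : (inside X A).card + (outside X A).card = A.card := by
          classical
          exact Finset.card_filter_add_card_filter_not _
        simp only [Set.mem_ofPred_eq, wordDegree, projOutside, Finset.card_image_of_injOn hi]
        omega
      · rintro u hu v rfl
        simp only [Set.mem_ofPred_eq, wordDegree_append, wordDegree] at hu ⊢
        rw [hu]
        ring
    · refine cat_mem_supported (S := {[A]}) (single_mem_supported rfl) ih ?_
      rintro u rfl v hv
      simp only [Set.mem_ofPred_eq, wordDegree_append, wordDegree] at hv ⊢
      rw [hv]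
      ring

variable {ι : Type*} {D : (ι →₀ k) →ₗ[k] (ι →₀ k)} {deg : ι → ℤ}

/-- For a differential that lowers the degree by one, the chain in the definition of relative
acyclicity may be chosen homogeneous. -/
theorem RelAcyclic.graded {P Q : Set ι} (h : RelAcyclic D P Q)
    (hdeg : ∀ i, D (Finsupp.single i 1) ∈ Finsupp.supported k k {j | deg j = deg i - 1}) {q : ℤ}
    {x : ι →₀ k} (hx : x ∈ Finsupp.supported k k {i | i ∈ P ∧ deg i = q})
    (hDx : D x ∈ Finsupp.supported k k Q) :
    ∃ y ∈ Finsupp.supported k k {i | i ∈ P ∧ deg i = q + 1},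
      x - D y ∈ Finsupp.supported k k {i | i ∈ Q ∧ deg i = q} := by
  classical
  obtain ⟨y, hy, hxy⟩ := h x (Finsupp.supported_mono (fun i hi => hi.1) hx) hDx
  refine ⟨y.filter fun i => deg i = q + 1, ?_, ?_⟩
  · rw [Finsupp.mem_supported'] at hy ⊢
    intro i hi
    by_cases hd : deg i = q + 1
    · rw [Finsupp.filter_apply_pos (fun i => deg i = q + 1) y hd]
      exact hy i fun h' => hi ⟨h', hd⟩
    · exact Finsupp.filter_apply_neg (fun i => deg i = q + 1) y hd
  · have h1 : D (y.filter fun i => deg i = q + 1) ∈ Finsupp.supported k k {i | deg i = q} := by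
      refine map_mem_of_supported (S := {i | deg i = q + 1}) D (fun i hi => ?_) ?_
      · have := hdeg i
        rwa [show deg i - 1 = q by rw [show deg i = q + 1 from hi]; ring] at this
      · rw [Finsupp.mem_supported']
        exact fun i hi => Finsupp.filter_apply_neg (fun i => deg i = q + 1) y hi
    have h2 : D (y.filter fun i => ¬deg i = q + 1) ∈ Finsupp.supported k k {i | deg i ≠ q} := by
      refine map_mem_of_supported (S := {i | deg i ≠ q + 1}) D (fun i hi => ?_) ?_
      · refine Finsupp.supported_mono ?_ (hdeg i)
        intro j hj hjq
        exact hi (by rw [Set.mem_ofPred_eq, hjq] at hj; linarith)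
      · rw [Finsupp.mem_supported']
        intro i hi
        exact Finsupp.filter_apply_neg (fun i => ¬deg i = q + 1) y hi
    have h3 : x - D (y.filter fun i => deg i = q + 1) =
        (x - D y) + D (y.filter fun i => ¬deg i = q + 1) := by
      have : D y = D (y.filter fun i => deg i = q + 1) +
          D (y.filter fun i => ¬deg i = q + 1) := by
        rw [← map_add, Finsupp.filter_add_filter_not]
      rw [this]
      abel
    rw [Finsupp.mem_supported']
    intro i hi
    by_cases hd : deg i = q
    · rw [h3, Finsupp.add_apply, apply_eq_zero_of_supported hxy fun h' => hi ⟨h', hd⟩,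
        apply_eq_zero_of_supported h2 fun h' => h' hd, add_zero]
    · rw [Finsupp.sub_apply, apply_eq_zero_of_supported hx fun h' => hd h'.2,
        apply_eq_zero_of_supported h1 hd, sub_zero]

theorem map_mem_deg
    (hdeg : ∀ i, D (Finsupp.single i 1) ∈ Finsupp.supported k k {j | deg j = deg i - 1}) {q : ℤ}
    {P : Set ι} (hP : IsClosedUnder D P) {x : ι →₀ k}
    (hx : x ∈ Finsupp.supported k k {i | i ∈ P ∧ deg i = q}) :
    D x ∈ Finsupp.supported k k {i | i ∈ P ∧ deg i = q - 1} := by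
  refine map_mem_of_supported D (fun i hi => ?_) hx
  have := mem_supported_inter (hP i hi.1) (hdeg i)
  rwa [hi.2] at this

/-- A complex spanned by basis vectors in `N` that contains two subcomplexes, spanned by the basis
vectors in `C` and in `T`, both of them equivalent to it, where `C` is concentrated in degrees
`≥ n` and `T` in degrees `≤ n`. -/
structure ComparisonData (D : (ι →₀ k) →ₗ[k] (ι →₀ k)) (deg : ι → ℤ) (n : ℤ) (N C T : Set ι) :
    Prop where
  diff_diff : ∀ x, D (D x) = 0
  diff_deg : ∀ i, D (Finsupp.single i 1) ∈ Finsupp.supported k k {j | deg j = deg i - 1}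
  closed_C : IsClosedUnder D C
  subset_C : C ⊆ N
  subset_T : T ⊆ N
  acyclic_C : RelAcyclic D N C
  acyclic_T : RelAcyclic D N T
  deg_C : ∀ i ∈ C, n ≤ deg i
  deg_T : ∀ i ∈ T, deg i ≤ n

namespace ComparisonData

variable {n : ℤ} {N C T : Set ι} (H : ComparisonData D deg n N C T) {q : ℤ} {x y t : ι →₀ k}

include H

theorem eq_zero_of_lt (hq : q < n) (hx : x ∈ Finsupp.supported k k {i | i ∈ C ∧ deg i = q}) :
    x = 0 := by
  have : {i | i ∈ C ∧ deg i = q} = ∅ := Set.eq_empty_of_forall_notMem fun i hi => by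
    have := H.deg_C i hi.1
    rw [hi.2] at this
    omega
  rw [this, Finsupp.supported_empty] at hx
  exact (Submodule.mem_bot k).1 hx

theorem eq_zero_of_gt (hq : n < q) (hx : x ∈ Finsupp.supported k k {i | i ∈ T ∧ deg i = q}) :
    x = 0 := by
  have : {i | i ∈ T ∧ deg i = q} = ∅ := Set.eq_empty_of_forall_notMem fun i hi => by
    have := H.deg_T i hi.1
    rw [hi.2] at this
    omega
  rw [this, Finsupp.supported_empty] at hx
  exact (Submodule.mem_bot k).1 hx

/-- A chain in `C` that bounds in the large complex bounds in `C`. -/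
theorem exact_of_boundary (hx : x ∈ Finsupp.supported k k {i | i ∈ C ∧ deg i = q})
    (hy : y ∈ Finsupp.supported k k {i | i ∈ N ∧ deg i = q + 1}) (hxy : x = D y) :
    ∃ z ∈ Finsupp.supported k k {i | i ∈ C ∧ deg i = q + 1}, x = D z := by
  obtain ⟨z, _, hyz⟩ := H.acyclic_C.graded H.diff_deg hy
    (hxy ▸ Finsupp.supported_mono (fun i hi => hi.1) hx)
  exact ⟨_, hyz, by rw [map_sub, H.diff_diff, sub_zero, hxy]⟩

/-- A cycle in `C` is homologous to one in `T`. -/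
theorem exists_chain (hx : x ∈ Finsupp.supported k k {i | i ∈ C ∧ deg i = q}) (hDx : D x = 0) :
    ∃ t ∈ Finsupp.supported k k {i | i ∈ T ∧ deg i = q},
      ∃ y ∈ Finsupp.supported k k {i | i ∈ N ∧ deg i = q + 1}, x - t = D y := by
  have hle : {i | i ∈ C ∧ deg i = q} ⊆ {i | i ∈ N ∧ deg i = q} :=
    fun i hi => ⟨H.subset_C hi.1, hi.2⟩
  obtain ⟨y, hy, hxy⟩ := H.acyclic_T.graded H.diff_deg (q := q) (Finsupp.supported_mono hle hx)
    (by rw [hDx]; exact zero_mem _)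
  exact ⟨_, hxy, y, hy, sub_sub_cancel _ _⟩

/-- Above degree `n`, the complex `C` is exact, because `T` vanishes there. -/
theorem exact_of_cycle (hq : n < q) (hx : x ∈ Finsupp.supported k k {i | i ∈ C ∧ deg i = q})
    (hDx : D x = 0) : ∃ z ∈ Finsupp.supported k k {i | i ∈ C ∧ deg i = q + 1}, x = D z := by
  obtain ⟨t, ht, y, hy, hxy⟩ := H.exists_chain hx hDx
  rw [H.eq_zero_of_gt hq ht, sub_zero] at hxy
  exact H.exact_of_boundary hx hy hxy

/-- In degree `n`, different chains in `T` are not homologous, because `T` vanishes above. -/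
theorem eq_zero_of_eq_diff (ht : t ∈ Finsupp.supported k k {i | i ∈ T ∧ deg i = n})
    (hy : y ∈ Finsupp.supported k k {i | i ∈ N ∧ deg i = n + 1}) (hty : t = D y) : t = 0 := by
  obtain ⟨z, _, hyz⟩ := H.acyclic_T.graded H.diff_deg hy
    (hty ▸ Finsupp.supported_mono (fun i hi => hi.1) ht)
  rw [hty, sub_eq_zero.1 (H.eq_zero_of_gt (lt_add_one n) hyz), H.diff_diff]

/-- A cycle in `T` is homologous to one in `C`. -/
theorem exists_preimage (ht : t ∈ Finsupp.supported k k {i | i ∈ T ∧ deg i = q}) (hDt : D t = 0) :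
    ∃ x ∈ Finsupp.supported k k {i | i ∈ C ∧ deg i = q},
      ∃ y ∈ Finsupp.supported k k {i | i ∈ N ∧ deg i = q + 1}, x - t = D y := by
  have hle : {i | i ∈ T ∧ deg i = q} ⊆ {i | i ∈ N ∧ deg i = q} :=
    fun i hi => ⟨H.subset_T hi.1, hi.2⟩
  obtain ⟨y, hy, hty⟩ := H.acyclic_C.graded H.diff_deg (q := q) (Finsupp.supported_mono hle ht)
    (by rw [hDt]; exact zero_mem _)
  exact ⟨_, hty, -y, neg_mem hy, by rw [map_neg]; abel⟩

theorem diff_eq_zero (hx : x ∈ Finsupp.supported k k {i | i ∈ C ∧ deg i = n}) : D x = 0 :=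
  H.eq_zero_of_lt (sub_one_lt n) (map_mem_deg H.diff_deg H.closed_C hx)

end ComparisonData

end Grading

/-! ### Entries of simple tensors -/

section Symbols

variable {K V : Type*} [Field K] [AddCommGroup V] [Module K V] (ω : LinearMap.BilinForm K V)

/-- The word whose factors are the sets of entries of the given lists. -/
def wordOf (L : List (List (Submodule K V))) : List (Finset (Entry K V)) :=
  L.map fun l => (l.map Entry.mk).toFinset

theorem mem_toFinset_map {l : List (Submodule K V)} {a : Entry K V} :
    a ∈ (l.map Entry.mk).toFinset ↔ a.sub ∈ l := by
  rw [List.mem_toFinset, List.mem_map]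
  exact ⟨by rintro ⟨X, hX, rfl⟩; exact hX, fun h => ⟨a.sub, h, rfl⟩⟩

theorem spanF_toFinset_map (l : List (Submodule K V)) :
    spanF (l.map Entry.mk).toFinset = spanOf l := by
  refine le_antisymm (spanF_le.2 fun a ha => ?_) (iSup₂_le fun X hX => ?_)
  · exact le_iSup₂_of_le a.sub (mem_toFinset_map.1 ha) le_rfl
  · exact le_spanF (a := ⟨X⟩) (mem_toFinset_map.2 hX)

theorem entry_mk_injective : Function.Injective (Entry.mk : Submodule K V → Entry K V) :=
  fun _ _ h => congrArg Entry.sub h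

theorem card_toFinset_map {l : List (Submodule K V)} (h : l.Nodup) :
    (l.map Entry.mk).toFinset.card = l.length := by
  rw [List.toFinset_card_of_nodup (h.map entry_mk_injective), List.length_map]

theorem tot_le {L : List (Finset (Entry K V))} {X : Submodule K V} :
    tot L ≤ X ↔ ∀ A ∈ L, spanF A ≤ X := by
  induction L with
  | nil => simp
  | cons A L ih => simp [ih]

theorem good_iff {ω : LinearMap.BilinForm K V} {L : List (Finset (Entry K V))} :
    Good ω L ↔ (∀ A ∈ L, IsBlock ω A) ∧
      L.Pairwise fun A B => spanF B ≤ ω.orthogonal (spanF A) := by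
  induction L with
  | nil => simp [Good]
  | cons A L ih =>
    rw [good_cons, ih, List.pairwise_cons, tot_le, List.forall_mem_cons]
    tauto

theorem finrank_spanF_le [FiniteDimensional K V] {A : Finset (Entry K V)}
    (h : ∀ a ∈ A, a.IsLine) : Module.finrank K (spanF A) ≤ A.card := by
  classical
  induction A using Finset.induction_on with
  | empty => simp
  | insert a s ha ih =>
    rw [spanF_insert, Finset.card_insert_of_notMem ha]
    have h1 := Submodule.finrank_add_le_finrank_add_finrank a.sub (spanF s)
    have h2 : Module.finrank K a.sub = 1 := h a (Finset.mem_insert_self _ _)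
    have h3 := ih fun b hb => h b (Finset.mem_insert_of_mem hb)
    omega

theorem finrank_tot [FiniteDimensional K V] (hω : ω.IsRefl) {L : List (Finset (Entry K V))}
    (h : Good ω L) :
    Module.finrank K (tot L) = (L.map fun A => Module.finrank K (spanF A)).sum := by
  induction L with
  | nil =>
    rw [tot_nil]
    exact finrank_bot K V
  | cons A L ih =>
    have h1 := Submodule.finrank_sup_add_finrank_inf_eq (spanF A) (tot L)
    have h2 : spanF A ⊓ tot L = ⊥ := by
      rw [eq_bot_iff, ← (isCompl_orthogonal hω h.1.nondegenerate).inf_eq_bot]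
      exact inf_le_inf_left _ h.2.1
    rw [h2, finrank_bot, ih h.2.2] at h1
    rw [tot_cons, List.map_cons, List.sum_cons]
    omega

theorem wordDegree_eq {α : Type*} (L : List (Finset α)) :
    wordDegree L = ((L.map Finset.card).sum : ℕ) - (L.length : ℤ) := by
  induction L with
  | nil => simp [wordDegree]
  | cons A L ih =>
    simp only [wordDegree, ih, List.map_cons, List.sum_cons, List.length_cons]
    push_cast
    ring

/-- The lists that are the entries of some simple tensor of degree `d`. -/
theorem exists_lists_eq_iff [FiniteDimensional K V] (hω : ω.IsRefl) {n d : ℕ}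
    (hV : Module.finrank K V = 2 * n) {L : List (List (Submodule K V))} :
    (∃ p : Σ x : Index ω n d, ∀ i, LineTuple (x.W i) (x.k i), lists ω p = L) ↔
      (∀ l ∈ L, l.Nodup) ∧ wordOf L ∈ totalWords ω ∧ wordDegree (wordOf L) = d + n := by
  constructor
  · rintro ⟨⟨x, s⟩, rfl⟩
    have hn : ∀ i, (List.ofFn (s i).line).Nodup := fun i => List.nodup_ofFn.2 (s i).injective
    have hsp : ∀ i, spanF ((List.ofFn (s i).line).map Entry.mk).toFinset = x.W i := fun i => by
      refine (spanF_toFinset_map _).trans (Eq.trans ?_ (s i).span)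
      refine le_antisymm (iSup₂_le fun X hX => ?_) (iSup_le fun j => ?_)
      · obtain ⟨j, rfl⟩ := (List.mem_ofFn' _ _).1 hX
        exact le_iSup _ j
      · exact le_iSup₂_of_le ((s i).line j) ((List.mem_ofFn' _ _).2 ⟨j, rfl⟩) le_rfl
    have hw : wordOf (lists ω ⟨x, s⟩) =
        List.ofFn fun i => ((List.ofFn (s i).line).map Entry.mk).toFinset := by
      rw [wordOf, lists, List.map_ofFn]
      rfl
    have hgood : Good ω (wordOf (lists ω ⟨x, s⟩)) := by
      rw [hw, good_iff]
      constructor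
      · intro A hA
        obtain ⟨i, rfl⟩ := (List.mem_ofFn' _ _).1 hA
        refine ⟨fun a ha => ?_, nonempty_of_spanF_ne_bot ?_, ?_⟩
        · obtain ⟨j, hj⟩ := (List.mem_ofFn' _ _).1 (mem_toFinset_map.1 ha)
          exact (congrArg (fun X : Submodule K V => Module.finrank K X) hj).symm.trans
            ((s i).isLine j)
        · rw [hsp]
          exact x.ne_bot i
        · rw [hsp]
          exact x.symplectic i
      · rw [List.pairwise_ofFn]
        intro i j hij
        rw [hsp, hsp]
        exact fun v hv w hw => x.perp i j hij.ne w hw v hv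
    have htot : tot (wordOf (lists ω ⟨x, s⟩)) = ⊤ := by
      rw [eq_top_iff, ← x.iSup_eq]
      refine iSup_le fun i => ?_
      rw [← hsp i]
      refine tot_le.1 le_rfl _ ?_
      rw [hw]
      exact (List.mem_ofFn' _ _).2 ⟨i, rfl⟩
    refine ⟨fun l hl => ?_, ⟨hgood, htot⟩, ?_⟩
    · obtain ⟨i, rfl⟩ := (List.mem_ofFn' _ _).1 hl
      exact hn i
    · have h1 := finrank_tot ω hω hgood
      rw [htot, finrank_top, hV, hw, List.map_ofFn, List.sum_ofFn] at h1
      have h2 : 2 * n = ∑ i, Module.finrank K (x.W i) := h1.trans <| Finset.sum_congr rfl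
        fun i _ => congrArg (fun X : Submodule K V => Module.finrank K X) (hsp i)
      have h3 : ((wordOf (lists ω ⟨x, s⟩)).map Finset.card).sum = 2 * n + ∑ i, x.k i := by
        rw [hw, List.map_ofFn, List.sum_ofFn, h2, ← Finset.sum_add_distrib]
        exact Finset.sum_congr rfl fun i _ =>
          (card_toFinset_map (hn i)).trans (List.length_ofFn.trans (s i).size_eq)
      have h4 : (wordOf (lists ω ⟨x, s⟩)).length = x.m := by rw [hw, List.length_ofFn]
      have := x.degree
      rw [wordDegree_eq, h3, h4]
      omega
  · rintro ⟨hn, ⟨hgood, htot⟩, hdeg⟩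
    have hmem : ∀ i : Fin L.length, ((L.get i).map Entry.mk).toFinset ∈ wordOf L := fun i =>
      List.mem_map.2 ⟨_, List.get_mem L i, rfl⟩
    obtain ⟨hb, hp⟩ := good_iff.1 hgood
    have hperp : ∀ i j : Fin L.length, i < j → spanOf (L.get j) ≤
        ω.orthogonal (spanOf (L.get i)) := fun i j hij => by
      rw [wordOf, List.pairwise_map] at hp
      have := List.pairwise_iff_get.1 hp i j hij
      rwa [spanF_toFinset_map, spanF_toFinset_map] at this
    have hperp' : ∀ i j : Fin L.length, i ≠ j → spanOf (L.get j) ≤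
        ω.orthogonal (spanOf (L.get i)) := fun i j hij => by
      rcases lt_or_gt_of_ne hij with h | h
      · exact hperp i j h
      · exact (le_orthogonal_comm hω).1 (hperp j i h)
    have hline : ∀ (i : Fin L.length), ∀ X ∈ L.get i, Module.finrank K X = 1 := fun i X hX =>
      (hb _ (hmem i)).isLine ⟨X⟩ (mem_toFinset_map.2 hX)
    have hk : ∀ i : Fin L.length, Module.finrank K (spanOf (L.get i)) ≤ (L.get i).length :=
      fun i => by
        have := finrank_spanF_le (hb _ (hmem i)).isLine
        rwa [spanF_toFinset_map, card_toFinset_map (hn _ (List.get_mem L i))] at this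
    have h1 := finrank_tot ω hω hgood
    rw [htot, finrank_top, hV] at h1
    have h2 : (wordOf L).map (fun A => Module.finrank K (spanF A)) =
        List.ofFn fun i : Fin L.length => Module.finrank K (spanOf (L.get i)) := by
      conv_lhs => rw [← List.ofFn_get L, wordOf, List.map_ofFn, List.map_ofFn]
      congr 1
      funext i
      exact congrArg (fun X : Submodule K V => Module.finrank K X) (spanF_toFinset_map _)
    have h3 : (wordOf L).map Finset.card =
        List.ofFn fun i : Fin L.length => (L.get i).length := by
      conv_lhs => rw [← List.ofFn_get L, wordOf, List.map_ofFn, List.map_ofFn]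
      congr 1
      funext i
      exact card_toFinset_map (hn _ (List.get_mem L i))
    rw [h2, List.sum_ofFn] at h1
    rw [wordDegree_eq, h3, List.sum_ofFn, wordOf, List.length_map] at hdeg
    refine ⟨⟨⟨L.length, fun i => spanOf (L.get i),
      fun i => (L.get i).length - Module.finrank K (spanOf (L.get i)), fun i => ?_, fun i => ?_,
      fun i j hij v hv w hw => hperp' i j hij hw v hv, ?_, ?_, ?_⟩,
      fun i => ⟨(L.get i).length, (L.get i).get, fun j => hline i _ (List.get_mem _ _),
        List.nodup_iff_injective_get.1 (hn _ (List.get_mem L i)), ?_, ?_⟩⟩, ?_⟩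
    · rw [← spanF_toFinset_map]
      exact (hb _ (hmem i)).spanF_ne_bot
    · rw [← spanF_toFinset_map]
      exact (hb _ (hmem i)).nondegenerate
    · intro i
      have h4 := (hb _ (hmem i)).nondegenerate
      rw [spanF_toFinset_map] at h4
      rw [disjoint_iff, eq_bot_iff, ← (isCompl_orthogonal hω h4).inf_eq_bot]
      exact inf_le_inf_left _ (iSup₂_le fun j hj => hperp' i j hj.symm)
    · rw [eq_top_iff, ← htot, tot_le]
      intro A hA
      obtain ⟨l, hl, rfl⟩ := List.mem_map.1 hA
      obtain ⟨i, rfl⟩ := List.get_of_mem hl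
      rw [spanF_toFinset_map]
      exact le_iSup (fun i => spanOf (L.get i)) i
    · have h5 : ∑ i : Fin L.length, (L.get i).length =
          ∑ i : Fin L.length, ((L.get i).length - Module.finrank K (spanOf (L.get i))) + 2 * n := by
        rw [h1, ← Finset.sum_add_distrib]
        exact Finset.sum_congr rfl fun i _ => (Nat.sub_add_cancel (hk i)).symm
      rw [h5] at hdeg
      omega
    · refine le_antisymm (iSup_le fun j => ?_) (iSup₂_le fun X hX => ?_)
      · exact le_iSup₂_of_le _ (List.get_mem _ j) le_rfl
      · obtain ⟨j, rfl⟩ := List.get_of_mem hX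
        exact le_iSup (fun j => (L.get i).get j) j
    · exact (Nat.add_sub_cancel' (hk i)).symm
    · rw [lists]
      simp only [List.ofFn_get]

end Symbols

/-! ### The differential in terms of lists of lines -/

section ListFormulas

variable {K V : Type*} [Field K] [AddCommGroup V] [Module K V]

theorem spanPart_wedge_of_eq {W : Submodule K V} {l : List (Entry K V)}
    (h : spanF l.toFinset = W) : spanPart W (wedge l : Ext ℤ (Entry K V)) = wedge l := by
  rcases wedge_eq_zero_or (k := ℤ) (l := l) with ⟨_, h'⟩ | ⟨_, c, h'⟩
  · rw [h', map_zero]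
  · rw [h', map_smul, spanPart_of_eq h]

theorem spanPart_wedge_of_ne {W : Submodule K V} {l : List (Entry K V)}
    (h : spanF l.toFinset ≠ W) : spanPart W (wedge l : Ext ℤ (Entry K V)) = 0 := by
  rcases wedge_eq_zero_or (k := ℤ) (l := l) with ⟨_, h'⟩ | ⟨_, c, h'⟩
  · rw [h', map_zero]
  · rw [h', map_smul, spanPart_of_ne h, smul_zero]

/-- The exterior product of a list of subspaces. -/
def wedgeOf (l : List (Submodule K V)) : Ext ℤ (Entry K V) := wedge (l.map Entry.mk)

open Classical in
theorem omitPart_wedgeOf {l : List (Submodule K V)} (hl : l.Nodup) :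
    omitPart (wedgeOf l) = ∑ i : Fin l.length, if spanOf (l.eraseIdx (i : ℕ)) = spanOf l then
      (-1 : ℤ) ^ (i : ℕ) • wedgeOf (l.eraseIdx (i : ℕ)) else 0 := by
  obtain ⟨c, hc⟩ := exists_wedge_eq (k := ℤ) (hl.map entry_mk_injective)
  have h1 : omitPart (wedgeOf l) = spanPart (spanOf l) (contract (wedgeOf l)) := by
    rw [wedgeOf, hc, map_smul, map_smul, map_smul, omitPart_single, spanF_toFinset_map]
  rw [h1, wedgeOf, contract_wedge, map_sum]
  refine Fintype.sum_equiv (finCongr (List.length_map _)) _ _ fun i => ?_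
  have h2 : (l.map Entry.mk).eraseIdx (i : ℕ) = (l.eraseIdx (i : ℕ)).map Entry.mk :=
    (List.eraseIdx_map _ _ _)
  rw [map_smul, h2, finCongr_apply, Fin.val_cast]
  split_ifs with h
  · rw [spanPart_wedge_of_eq ((spanF_toFinset_map _).trans h), wedgeOf]
  · rw [spanPart_wedge_of_ne fun h' => h ((spanF_toFinset_map _).symm.trans h'), smul_zero]

variable (ω : LinearMap.BilinForm K V)

open Classical in
/-- The entries of `l` contained in `X`. -/
def insideL (X : Submodule K V) (l : List (Submodule K V)) : List (Submodule K V) :=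
  l.filter fun a => a ≤ X

open Classical in
/-- The entries of `l` not contained in `X`. -/
def outsideL (X : Submodule K V) (l : List (Submodule K V)) : List (Submodule K V) :=
  l.filter fun a => ¬a ≤ X

open Classical in
theorem splitPart_wedgeOf {l : List (Submodule K V)} (hl : l.Nodup) :
    splitPart ω (wedgeOf l) = ∑ X ∈ splitSpans ω (l.map Entry.mk).toFinset,
      (-1 : ℤ) ^ ((insideL X l).length + inversions (fun a => a ≤ X) l) •
        wedgeOf (insideL X l) ⊗ₜ[ℤ] wedgeOf ((outsideL X l).map (projPerp ω X)) := by
  obtain ⟨c, hc⟩ := exists_wedge_eq (k := ℤ) (hl.map entry_mk_injective)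
  have h1 : splitPart ω (wedgeOf l) = ∑ X ∈ splitSpans ω (l.map Entry.mk).toFinset,
      TensorProduct.map parity LinearMap.id (splitAt ω X (wedgeOf l)) := by
    rw [wedgeOf, hc, map_smul, splitPart_single, Finset.smul_sum]
    exact Finset.sum_congr rfl fun X _ => by rw [map_smul, map_smul]
  have h2 : ∀ (p : Entry K V → Prop) (l : List (Submodule K V)),
      inversions p (l.map Entry.mk) = inversions (fun a => p ⟨a⟩) l := fun p l => by
    induction l with
    | nil => rfl
    | cons a l ih =>
      rw [List.map_cons, inversions, inversions, ih, List.filter_map, List.length_map]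
      rfl
  rw [h1]
  refine Finset.sum_congr rfl fun X _ => ?_
  rw [wedgeOf, splitAt, coprod_wedge, map_smul, TensorProduct.map_tmul, parity_wedge, h2,
    List.filter_map, List.filter_map, List.length_map, List.map_map, LinearMap.id_apply,
    TensorProduct.smul_tmul', smul_smul, ← pow_add, add_comm]
  rw [wedgeOf, wedgeOf, List.map_map, TensorProduct.smul_tmul']
  rfl

/-- The product of the exterior products of the given lists, as a word. -/
def wordProd : List (List (Submodule K V)) → Words ℤ (Entry K V)
  | [] => Finsupp.single [] 1
  | l :: L => cat (letter (wedgeOf l)) (wordProd L)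

theorem wordProd_append (L L' : List (List (Submodule K V))) :
    wordProd (L ++ L') = cat (wordProd L) (wordProd L') := by
  induction L with
  | nil => exact (nil_cat _).symm
  | cons l L ih => rw [List.cons_append, wordProd, ih, wordProd, cat_assoc]

theorem cat_nil {α : Type*} (x : Words ℤ α) : cat x (Finsupp.single [] (1 : ℤ)) = x := by
  induction x using Words.induction with
  | add x y hx hy => rw [map_add, LinearMap.add_apply, hx, hy]
  | smul c x hx => rw [map_smul, LinearMap.smul_apply, hx]
  | single u => rw [cat_single, List.append_nil]

theorem wordProd_singleton (l : List (Submodule K V)) : wordProd [l] = letter (wedgeOf l) :=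
  cat_nil _

/-- The differential is a derivation; its value on a product is the sum over the factors. -/
theorem diff_wordProd (L : List (List (Submodule K V))) : diff ω (wordProd L) =
    ∑ j : Fin L.length, (-1 : ℤ) ^ ((L.take (j : ℕ)).map fun l => l.length + 1).sum •
      cat (wordProd (L.take (j : ℕ))) (cat (letterDiff ω (wedgeOf (L.get j)))
        (wordProd (L.drop ((j : ℕ) + 1)))) := by
  induction L with
  | nil => exact deriv_nil _
  | cons l L ih =>
    have h1 : wordParity (letter (wedgeOf l)) = (-1 : ℤ) ^ (l.length + 1) • letter (wedgeOf l) := by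
      rw [wordParity_letter, wedgeOf, parity_wedge, List.length_map, map_smul, pow_succ,
        mul_neg_one, neg_smul]
    rw [wordProd, diff, deriv_cat, ← diff, ih, diff, deriv_letter, h1]
    refine Eq.trans ?_ (Fin.sum_univ_succ (n := L.length) _).symm
    congr 1
    · simp [wordProd]
    · rw [map_sum]
      refine Finset.sum_congr rfl fun j _ => ?_
      rw [map_smul, map_smul, LinearMap.smul_apply, smul_smul, ← pow_add, add_comm]
      simp only [Fin.val_succ, List.take_succ_cons, List.map_cons, List.sum_cons, wordProd,
        cat_assoc, List.drop_succ_cons]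
      rfl

/-- The exponent of the sign by which the product of exterior products has to be corrected:
the `i`-th factor, for `i = 0, 1, …`, contributes `i` times its degree. -/
def twist : List ℕ → ℕ
  | [] => 0
  | _ :: L => (L.map (· - 1)).sum + twist L

theorem twist_append (L L' : List ℕ) :
    twist (L ++ L') = twist L + twist L' + L.length * (L'.map (· - 1)).sum := by
  induction L with
  | nil => simp [twist]
  | cons r L ih =>
    simp only [List.cons_append, twist, ih, List.map_append, List.sum_append, List.length_cons]
    ring

/-- The element of the algebra of words that corresponds to a tensor product of symbols. -/
def cls (L : List (List (Submodule K V))) : Words ℤ (Entry K V) :=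
  (-1 : ℤ) ^ twist (L.map List.length) • wordProd L

theorem inversions_eq_card {α : Type*} (p : α → Prop) [DecidablePred p] (l : List α) :
    inversions p l = ((Finset.univ : Finset (Fin l.length × Fin l.length)).filter fun a =>
      ¬p (l.get a.1) ∧ p (l.get a.2) ∧ a.1 < a.2).card := by
  induction l with
  | nil => rfl
  | cons b l ih =>
    have h1 : (l.filter p).length = ∑ i : Fin l.length, if p (l.get i) then 1 else 0 := by
      rw [← List.countP_eq_length_filter]
      clear ih
      induction l with
      | nil => rfl
      | cons c l ih =>
        rw [List.countP_cons, ih]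
        refine Eq.trans ?_ (Fin.sum_univ_succ (n := l.length) _).symm
        rw [add_comm]
        simp
        rfl
    rw [inversions, ih, h1, Finset.card_filter, Finset.card_filter, Fintype.sum_prod_type,
      Fintype.sum_prod_type]
    refine Eq.trans ?_ (Fin.sum_univ_succ (n := l.length) _).symm
    rw [add_comm]
    congr 1
    · refine Eq.trans ?_ (Fin.sum_univ_succ (n := l.length) _).symm
      simp only [List.get_cons_zero, lt_irrefl, and_false, if_false, zero_add,
        Fin.succ_pos, and_true]
      by_cases h : p b <;> simp [h]
    · refine Finset.sum_congr rfl fun i _ => ?_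
      refine Eq.trans ?_ (Fin.sum_univ_succ (n := l.length) _).symm
      simp

open Classical in
/-- The permutation moving the entries contained in `X` to the front and the one moving the other
entries to the front: every pair of an entry contained in `X` and one that is not is inverted by
exactly one of them. -/
theorem inversions_add_shuffleInversions (X : Submodule K V) (l : List (Submodule K V)) :
    inversions (fun a => a ≤ X) l +
      shuffleInversions (Finset.univ.filter fun i : Fin l.length => ¬l.get i ≤ X) =
    (Finset.univ.filter fun i : Fin l.length => l.get i ≤ X).card *
      (Finset.univ.filter fun i : Fin l.length => ¬l.get i ≤ X).card := by
  rw [← Finset.card_product, inversions_eq_card, shuffleInversions, add_comm]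
  refine Eq.trans ?_ (Finset.card_filter_add_card_filter_not
    (fun a : Fin l.length × Fin l.length => a.1 < a.2))
  congr 1
  · congr 1
    ext a
    simp only [Finset.mem_filter, Finset.mem_univ, true_and, Finset.mem_product, not_not, and_assoc]
  · refine Finset.card_equiv (Equiv.prodComm _ _) fun a => ?_
    simp only [Finset.mem_filter, Finset.mem_univ, true_and, Finset.mem_product, Equiv.prodComm_apply,
      Prod.fst_swap, Prod.snd_swap, not_lt]
    constructor
    · rintro ⟨h1, h2, h3⟩
      exact ⟨⟨h2, h1⟩, h3.le⟩
    · rintro ⟨⟨h2, h1⟩, h3⟩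
      exact ⟨h1, h2, h3.lt_of_ne fun h => h1 (h ▸ h2)⟩

end ListFormulas

/-! ### Tensor products of symbols as words -/

section Comparison

variable {K V : Type*} [Field K] [AddCommGroup V] [Module K V]

/-- The word with given factors, as a multilinear map. -/
def lettersMultilinear (α : Type*) [LinearOrder α] :
    (m : ℕ) → MultilinearMap ℤ (fun _ : Fin m => Ext ℤ α) (Words ℤ α)
  | 0 => MultilinearMap.constOfIsEmpty ℤ _ (Finsupp.single [] 1)
  | m + 1 => LinearMap.uncurryLeft (M := fun _ : Fin (m + 1) => Ext ℤ α)
      { toFun := fun x => (cat (letter x)).compMultilinearMap (lettersMultilinear α m)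
        map_add' := fun x y => by ext; simp
        map_smul' := fun c x => by ext; simp }

theorem lettersMultilinear_wedgeOf {m : ℕ} (l : Fin m → List (Submodule K V)) :
    lettersMultilinear (Entry K V) m (fun i => wedgeOf (l i)) = wordProd (List.ofFn l) := by
  induction m with
  | zero => rfl
  | succ m ih =>
    rw [List.ofFn_succ, wordProd, ← ih]
    rfl

/-- The exterior product of lines, as a map on `Sh_k(W)`. -/
def shToExt (W : Submodule K V) (k : ℕ) : Sh W k →ₗ[ℤ] Ext ℤ (Entry K V) :=
  AddMonoidHom.toIntLinearMap <| LinearMap.toAddMonoidHom <| (sharblyRelations W k).liftQ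
    (Finsupp.linearCombination ℤ fun x : LineTuple W k => wedgeOf (List.ofFn x.line)) (by
      refine Submodule.span_le.2 ?_
      rintro _ ⟨x, σ, rfl⟩
      have h := wedge_ofFn_comp_perm (k := ℤ) (fun i => Entry.mk (x.line i)) σ
      have h' : wedgeOf (List.ofFn (x.perm σ).line) =
          (Equiv.Perm.sign σ : ℤ) • wedgeOf (List.ofFn x.line) := by
        rw [wedgeOf, wedgeOf, List.map_ofFn, List.map_ofFn]
        exact h
      change Finsupp.linearCombination ℤ _ _ = 0
      rw [map_sub, map_smul, Finsupp.linearCombination_single, Finsupp.linearCombination_single,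
        one_smul, one_smul, h', smul_smul, ← Units.val_mul, Int.units_mul_self, Units.val_one,
        one_smul, sub_self])

theorem shToExt_sharbly {W : Submodule K V} {k : ℕ} (x : LineTuple W k) :
    shToExt W k (sharbly x) = wedgeOf (List.ofFn x.line) := by
  change Finsupp.linearCombination ℤ _ (Finsupp.single x 1) = _
  rw [Finsupp.linearCombination_single, one_smul]

theorem sharbly_eq_smul_perm {W : Submodule K V} {k : ℕ} (x : LineTuple W k)
    (σ : Equiv.Perm (Fin x.size)) :
    sharbly x = (Equiv.Perm.sign σ : ℤ) • sharbly (x.perm σ) := by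
  have h : Finsupp.single x 1 - (Equiv.Perm.sign σ : ℤ) • Finsupp.single (x.perm σ) 1 ∈
    sharblyRelations W k := Submodule.subset_span ⟨x, σ, rfl⟩
  exact (Submodule.Quotient.eq _).2 h

variable (ω : LinearMap.BilinForm K V) {n d : ℕ}

/-- The embedding of the degree-`d` term in the algebra of words, which takes simple tensors to
`cls`. -/
def toWords (n d : ℕ) : Term ω n d →ₗ[ℤ] Words ℤ (Entry K V) := by
  classical
  exact DirectSum.toModule ℤ (Index ω n d) _ fun x =>
    (-1 : ℤ) ^ twist (List.ofFn fun i => Module.finrank K (x.W i) + x.k i) •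
      PiTensorProduct.lift ((lettersMultilinear (Entry K V) x.m).compLinearMap
        fun i => shToExt (x.W i) (x.k i))

theorem toWords_simpleTensor (x : Index ω n d) (s : ∀ i, LineTuple (x.W i) (x.k i)) :
    toWords ω n d (simpleTensor ω x s) = cls (lists ω ⟨x, s⟩) := by
  classical
  rw [simpleTensor, inclusion, toWords]
  refine (DirectSum.toModule_lof ℤ (M := fun x : Index ω n d =>
    ⨂[ℤ] i : Fin x.m, Sh (x.W i) (x.k i)) x _).trans ?_
  rw [LinearMap.smul_apply, PiTensorProduct.lift.tprod, MultilinearMap.compLinearMap_apply, cls]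
  congr 2
  · rw [lists, List.map_ofFn]
    congr 2
    funext i
    exact ((List.length_ofFn).trans (s i).size_eq).symm
  · simp only [shToExt_sharbly]
    exact lettersMultilinear_wedgeOf _

/-- The retraction of the algebra of words to the degree-`d` term: the factors of a word are
listed in increasing order. Words that do not occur in degree `d` go to `0`. -/
def ofWords (n d : ℕ) : Words ℤ (Entry K V) →ₗ[ℤ] Term ω n d :=
  Finsupp.linearCombination ℤ fun w => (-1 : ℤ) ^ twist (w.map Finset.card) •
    symbol ω (w.map fun A => (A.sort (· ≤ ·)).map Entry.sub)

/-- Simple tensors generate the terms. -/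
theorem Term.hom_ext {M : Type*} [AddCommGroup M] {f g : Term ω n d →ₗ[ℤ] M}
    (h : ∀ (x : Index ω n d) (s : ∀ i, LineTuple (x.W i) (x.k i)),
      f (simpleTensor ω x s) = g (simpleTensor ω x s)) : f = g := by
  classical
  refine DirectSum.linearMap_ext ℤ fun x => PiTensorProduct.ext ?_
  set f' := (f ∘ₗ inclusion ω x).compMultilinearMap (PiTensorProduct.tprod ℤ) with hf
  set g' := (g ∘ₗ inclusion ω x).compMultilinearMap (PiTensorProduct.tprod ℤ) with hg
  suffices h' : ∀ (t : Finset (Fin x.m)) (v : ∀ i, Sh (x.W i) (x.k i)),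
      (∀ i ∉ t, ∃ s, v i = sharbly s) → f' v = g' v from
    MultilinearMap.ext fun v => h' Finset.univ v fun i hi => absurd (Finset.mem_univ i) hi
  intro t
  induction t using Finset.induction_on with
  | empty =>
    intro v hv
    choose s hs using fun i => hv i (Finset.notMem_empty i)
    rw [funext hs]
    exact h x s
  | insert a t _ ih =>
    intro v hv
    have h1 : f'.toLinearMap v a = g'.toLinearMap v a := by
      refine Sh.hom_ext fun y => ih _ fun i hi => ?_
      by_cases hia : i = a
      · subst hia
        exact ⟨y, Function.update_self _ _ _⟩
      · rw [Function.update_of_ne hia]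
        exact hv i fun h' => (Finset.mem_insert.1 h').elim hia hi
    have h2 := LinearMap.congr_fun h1 (v a)
    rwa [MultilinearMap.toLinearMap_apply, MultilinearMap.toLinearMap_apply,
      Function.update_eq_self] at h2

theorem map_mk_map_sub (l : List (Entry K V)) : (l.map Entry.sub).map Entry.mk = l := by
  rw [List.map_map]
  exact List.map_id l

theorem wordOf_sort (w : List (Finset (Entry K V))) :
    wordOf (w.map fun A => (A.sort (· ≤ ·)).map Entry.sub) = w := by
  rw [wordOf, List.map_map]
  refine (List.map_congr_left fun A _ => ?_).trans (List.map_id w)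
  change (((A.sort (· ≤ ·)).map Entry.sub).map Entry.mk).toFinset = A
  rw [map_mk_map_sub, Finset.sort_toFinset]

theorem cls_sort (w : List (Finset (Entry K V))) :
    cls (w.map fun A => (A.sort (· ≤ ·)).map Entry.sub) =
      (-1 : ℤ) ^ twist (w.map Finset.card) • Finsupp.single w 1 := by
  rw [cls]
  congr 2
  · rw [List.map_map]
    congr 2
    funext A
    change ((A.sort (· ≤ ·)).map Entry.sub).length = _
    rw [List.length_map, Finset.length_sort]
  · induction w with
    | nil => rfl
    | cons A w ih =>
      rw [List.map_cons, wordProd, ih, wedgeOf, map_mk_map_sub, wedge_sort, letter_single,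
        cat_single, List.singleton_append]

variable {ω}

/-- Every symbol is, up to sign, one with sorted entries. -/
theorem LineTuple.exists_sorted {W : Submodule K V} {k : ℕ} (x : LineTuple W k) :
    ∃ (c : ℤ) (y : LineTuple W k), sharbly x = c • sharbly y ∧
      List.ofFn y.line =
        ((((List.ofFn x.line).map Entry.mk).toFinset).sort (· ≤ ·)).map Entry.sub := by
  set v : Fin x.size → Entry K V := fun i => ⟨x.line i⟩ with hv
  refine ⟨_, x.perm (Tuple.sort v), sharbly_eq_smul_perm _ _, ?_⟩
  have h1 : List.ofFn (v ∘ Tuple.sort v) =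
      ((List.ofFn x.line).map Entry.mk).toFinset.sort (· ≤ ·) := by
    have h2 : (List.ofFn (v ∘ Tuple.sort v)).toFinset = ((List.ofFn x.line).map Entry.mk).toFinset := by
      rw [List.map_ofFn]
      exact List.toFinset_eq_of_perm _ _ ((Tuple.sort v).ofFn_comp_perm v)
    have h3 : (List.ofFn (v ∘ Tuple.sort v)).Nodup := List.nodup_ofFn.2 <|
      (entry_mk_injective.comp x.injective).comp (Tuple.sort v).injective
    rw [← h2, eq_comm, List.toFinset_sort (r := (· ≤ ·)) h3]
    exact (List.sortedLE_ofFn_iff.2 (Tuple.monotone_sort v)).pairwise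
  rw [← h1, List.map_ofFn]
  rfl

theorem ofWords_toWords (t : Term ω n d) : ofWords ω n d (toWords ω n d t) = t := by
  have : ofWords ω n d ∘ₗ toWords ω n d = LinearMap.id := by
    refine Term.hom_ext ω fun x s => ?_
    change ofWords ω n d (toWords ω n d (simpleTensor ω x s)) = simpleTensor ω x s
    choose c y hc hy using fun i => (s i).exists_sorted
    have h1 : simpleTensor ω x s = (∏ i, c i) • simpleTensor ω x y := by
      rw [simpleTensor, simpleTensor]
      simp only [hc]
      rw [MultilinearMap.map_smul_univ, map_smul]
    have h2 : lists ω ⟨x, y⟩ = (wordOf (lists ω ⟨x, s⟩)).map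
        fun A => (A.sort (· ≤ ·)).map Entry.sub := by
      rw [wordOf, lists, lists, List.map_ofFn, List.map_ofFn]
      congr 1
      funext i
      exact hy i
    rw [h1, map_smul, map_smul, toWords_simpleTensor]
    congr 1
    rw [h2, cls_sort, map_smul, ofWords, Finsupp.linearCombination_single, one_smul, ← h2,
      symbol_lists, smul_smul, ← pow_add, ← two_mul, pow_mul]
    simp
  exact LinearMap.congr_fun this t

theorem toWords_injective : Function.Injective (toWords ω n d) :=
  Function.LeftInverse.injective ofWords_toWords

variable (ω n d) in
/-- The words that occur in degree `d`. -/
def termWords : Set (List (Finset (Entry K V))) :=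
  {w | w ∈ totalWords ω ∧ wordDegree w = d + n}

/-- The embedding `toWords` is onto the span of the words that occur in degree `d`. -/
theorem toWords_ofWords [FiniteDimensional K V] (hω : ω.IsRefl)
    (hV : Module.finrank K V = 2 * n) {x : Words ℤ (Entry K V)}
    (hx : x ∈ Finsupp.supported ℤ ℤ (termWords ω n d)) : toWords ω n d (ofWords ω n d x) = x := by
  refine sub_eq_zero.1 ?_
  refine (Submodule.mem_bot ℤ).1 <| map_mem_of_supported (N := ⊥)
    (toWords ω n d ∘ₗ ofWords ω n d - LinearMap.id) (fun w hw => ?_) hx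
  rw [Submodule.mem_bot]
  change toWords ω n d (ofWords ω n d (Finsupp.single w 1)) - Finsupp.single w 1 = 0
  obtain ⟨⟨y, s⟩, hp⟩ := (exists_lists_eq_iff ω (d := d) hω hV
    (L := w.map fun A => (A.sort (· ≤ ·)).map Entry.sub)).2 (by
      refine ⟨fun l hl => ?_, by rw [wordOf_sort]; exact hw⟩
      obtain ⟨A, _, rfl⟩ := List.mem_map.1 hl
      exact (A.sort_nodup _).map fun a b h => Entry.ext h)
  rw [ofWords, Finsupp.linearCombination_single, one_smul, map_smul, ← hp, symbol_lists,
    toWords_simpleTensor, hp, cls_sort, smul_smul, ← pow_add, ← two_mul, pow_mul]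
  simp

theorem exists_cls_eq {L : List (List (Submodule K V))} (h : ∀ l ∈ L, l.Nodup) :
    ∃ e : ℕ, cls L = (-1 : ℤ) ^ e • Finsupp.single (wordOf L) 1 := by
  have : ∃ e : ℕ, wordProd L = (-1 : ℤ) ^ e • Finsupp.single (wordOf L) 1 := by
    induction L with
    | nil => exact ⟨0, by simp [wordProd, wordOf]⟩
    | cons l L ih =>
      obtain ⟨e, he⟩ := ih fun l hl => h l (List.mem_cons_of_mem _ hl)
      obtain ⟨c, hc⟩ := exists_wedge_eq (k := ℤ) ((h l List.mem_cons_self).map entry_mk_injective)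
      refine ⟨c + e, ?_⟩
      rw [wordProd, he, wedgeOf, hc, map_smul, map_smul, map_smul, LinearMap.smul_apply,
        letter_single, cat_single, smul_smul, pow_add, mul_comm]
      rfl
  obtain ⟨e, he⟩ := this
  exact ⟨_, by rw [cls, he, smul_smul, ← pow_add]⟩

theorem cls_eq_zero {L : List (List (Submodule K V))} {l : List (Submodule K V)} (hl : l ∈ L)
    (h : ¬l.Nodup) : cls L = 0 := by
  obtain ⟨A, B, rfl⟩ := List.append_of_mem hl
  rw [cls, wordProd_append, wordProd, wedgeOf, wedge_eq_zero fun h' => h (h'.of_map _), map_zero,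
    map_zero, LinearMap.zero_apply, map_zero, smul_zero]

theorem toWords_mem [FiniteDimensional K V] (hω : ω.IsRefl)
    (hV : Module.finrank K V = 2 * n) (t : Term ω n d) :
    toWords ω n d t ∈ Finsupp.supported ℤ ℤ (termWords ω n d) := by
  have : (Finsupp.supported ℤ ℤ (termWords ω n d)).mkQ ∘ₗ toWords ω n d = 0 := by
    refine Term.hom_ext ω fun x s => (Submodule.Quotient.mk_eq_zero _).2 ?_
    have h := (exists_lists_eq_iff ω (d := d) hω hV).1 ⟨⟨x, s⟩, rfl⟩
    obtain ⟨e, he⟩ := exists_cls_eq h.1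
    rw [toWords_simpleTensor, he]
    exact Submodule.smul_mem _ _ (single_mem_supported h.2)
  exact (Submodule.Quotient.mk_eq_zero _).1 (LinearMap.congr_fun this t)

theorem toWords_symbol {L : List (List (Submodule K V))}
    (h : ∃ p : Σ x : Index ω n d, ∀ i, LineTuple (x.W i) (x.k i), lists ω p = L) :
    toWords ω n d (symbol ω L) = cls L := by
  obtain ⟨⟨x, s⟩, rfl⟩ := h
  rw [symbol_lists, toWords_simpleTensor]

theorem symbol_eq_zero {L : List (List (Submodule K V))}
    (h : ¬∃ p : Σ x : Index ω n d, ∀ i, LineTuple (x.W i) (x.k i), lists ω p = L) :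
    (symbol ω L : Term ω n d) = 0 := by
  rw [symbol, dif_neg h]

end Comparison

/-! ### The formula for the differential -/

section Formula

variable {K V : Type*} [Field K] [AddCommGroup V] [Module K V] {ω : LinearMap.BilinForm K V}
  {n d : ℕ} {A B : List (List (Submodule K V))} {l : List (Submodule K V)}

variable (ω n d) in
/-- The entries `L` are those of a simple tensor of degree `d`. -/
def IsSymbol (L : List (List (Submodule K V))) : Prop :=
  ∃ p : Σ x : Index ω n d, ∀ i, LineTuple (x.W i) (x.k i), lists ω p = L

theorem wordOf_append (L L' : List (List (Submodule K V))) :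
    wordOf (L ++ L') = wordOf L ++ wordOf L' := List.map_append

theorem wordOf_cons (l : List (Submodule K V)) (L : List (List (Submodule K V))) :
    wordOf (l :: L) = (l.map Entry.mk).toFinset :: wordOf L := rfl

theorem IsSymbol.finrank_eq_one {L : List (List (Submodule K V))} (h : IsSymbol ω n d L)
    (hl : l ∈ L) {X : Submodule K V} (hX : X ∈ l) : Module.finrank K X = 1 := by
  obtain ⟨⟨x, s⟩, rfl⟩ := h
  obtain ⟨i, rfl⟩ := (List.mem_ofFn' _ _).1 hl
  obtain ⟨j, rfl⟩ := (List.mem_ofFn' _ _).1 hX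
  exact (s i).isLine j

variable [FiniteDimensional K V]

/-- A factor of a symbol may be replaced by factors with the same total span. -/
theorem IsSymbol.replace (hω : ω.IsRefl) (hV : Module.finrank K V = 2 * n)
    (h : IsSymbol ω n (d + 1) (A ++ l :: B)) {M : List (List (Submodule K V))}
    (hM : ∀ m ∈ M, m.Nodup) (hg : Good ω (wordOf M)) (ht : tot (wordOf M) = spanOf l)
    (hd : wordDegree (wordOf M) + 2 = l.length) : IsSymbol ω n d (A ++ M ++ B) := by
  obtain ⟨h1, ⟨h2, h3⟩, h4⟩ := (exists_lists_eq_iff ω hω hV).1 h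
  refine (exists_lists_eq_iff ω hω hV).2 ⟨fun m hm => ?_, ⟨?_, ?_⟩, ?_⟩
  · rcases List.mem_append.1 hm with hm | hm
    · rcases List.mem_append.1 hm with hm | hm
      · exact h1 m (List.mem_append_left _ hm)
      · exact hM m hm
    · exact h1 m (List.mem_append_right _ (List.mem_cons_of_mem _ hm))
  · rw [wordOf_append, wordOf_cons, good_append, good_cons, tot_cons, spanF_toFinset_map, sup_le_iff] at h2
    rw [wordOf_append, wordOf_append, good_append, good_append, tot_append, ht]
    refine ⟨⟨h2.1, hg, h2.2.2.1⟩, h2.2.1.2.2, ?_⟩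
    rw [orthogonal_sup]
    exact le_inf h2.2.2.2 h2.2.1.2.1
  · rw [wordOf_append, wordOf_cons, tot_append, tot_cons, spanF_toFinset_map] at h3
    rw [wordOf_append, wordOf_append, tot_append, tot_append, ht, sup_assoc, h3]
  · rw [wordOf_append, wordOf_cons, wordDegree_append, wordDegree,
      card_toFinset_map (h1 l (List.mem_append_right _ List.mem_cons_self))] at h4
    rw [wordOf_append, wordOf_append, wordDegree_append, wordDegree_append]
    push_cast at h4
    omega

theorem IsSymbol.isBlock (hω : ω.IsRefl) (hV : Module.finrank K V = 2 * n)
    (h : IsSymbol ω n d (A ++ l :: B)) : IsBlock ω (l.map Entry.mk).toFinset ∧ l.Nodup := by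
  obtain ⟨h1, ⟨h2, -⟩, -⟩ := (exists_lists_eq_iff ω hω hV).1 h
  rw [wordOf_append, wordOf_cons, good_append, good_cons] at h2
  exact ⟨h2.2.1.1, h1 l (List.mem_append_right _ List.mem_cons_self)⟩

theorem IsSymbol.length_pos (hω : ω.IsRefl) (hV : Module.finrank K V = 2 * n)
    {L : List (List (Submodule K V))} (h : IsSymbol ω n d L) (hl : l ∈ L) : 0 < l.length := by
  obtain ⟨A, B, rfl⟩ := List.append_of_mem hl
  obtain ⟨a, ha⟩ := (h.isBlock hω hV).1.nonempty
  exact List.length_pos_of_mem (mem_toFinset_map.1 ha)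

theorem IsSymbol.eraseIdx (hω : ω.IsRefl) (hV : Module.finrank K V = 2 * n)
    (h : IsSymbol ω n (d + 1) (A ++ l :: B)) {i : ℕ} (hi : i < l.length)
    (hs : spanOf (l.eraseIdx i) = spanOf l) : IsSymbol ω n d (A ++ [l.eraseIdx i] ++ B) := by
  obtain ⟨hb, hn⟩ := h.isBlock hω hV
  have hn' : (l.eraseIdx i).Nodup := (List.eraseIdx_sublist l i).nodup hn
  have hspan : spanF ((l.eraseIdx i).map Entry.mk).toFinset = spanF (l.map Entry.mk).toFinset := by
    rw [spanF_toFinset_map, spanF_toFinset_map, hs]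
  refine h.replace hω hV (fun m hm => ?_) (good_singleton.2 ⟨fun a ha => ?_, ?_, ?_⟩) ?_ ?_
  · rwa [List.mem_singleton.1 hm]
  · exact hb.isLine a (mem_toFinset_map.2 ((List.eraseIdx_sublist l i).subset
      (mem_toFinset_map.1 ha)))
  · exact nonempty_of_spanF_ne_bot (hspan ▸ hb.spanF_ne_bot)
  · exact hspan ▸ hb.nondegenerate
  · change spanF _ ⊔ ⊥ = _
    rw [sup_bot_eq, hspan, spanF_toFinset_map]
  · change ((((l.eraseIdx i).map Entry.mk).toFinset.card : ℤ) - 1 + 0) + 2 = _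
    have := List.length_eraseIdx_add_one hi
    rw [card_toFinset_map hn']
    omega

omit [FiniteDimensional K V] in
theorem toFinset_insideL (X : Submodule K V) (l : List (Submodule K V)) :
    ((insideL X l).map Entry.mk).toFinset = inside X (l.map Entry.mk).toFinset := by
  classical
  ext a
  rw [mem_inside, mem_toFinset_map, mem_toFinset_map, insideL, List.mem_filter, decide_eq_true_eq]

omit [FiniteDimensional K V] in
theorem toFinset_outsideL (X : Submodule K V) (l : List (Submodule K V)) :
    (((outsideL X l).map (projPerp ω X)).map Entry.mk).toFinset =
      projOutside ω X (l.map Entry.mk).toFinset := by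
  classical
  ext a
  rw [projOutside, Finset.mem_image, mem_toFinset_map, List.mem_map]
  constructor
  · rintro ⟨b, hb, hab⟩
    rw [outsideL, List.mem_filter, decide_eq_true_eq] at hb
    exact ⟨⟨b⟩, mem_outside.2 ⟨mem_toFinset_map.2 hb.1, hb.2⟩, Entry.ext hab⟩
  · rintro ⟨b, hb, rfl⟩
    rw [mem_outside, mem_toFinset_map] at hb
    refine ⟨b.sub, ?_, rfl⟩
    rw [outsideL, List.mem_filter, decide_eq_true_eq]
    exact hb

omit [FiniteDimensional K V] in
theorem length_insideL_add (X : Submodule K V) (l : List (Submodule K V)) :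
    (insideL X l).length + (outsideL X l).length = l.length := by
  classical
  rw [insideL, outsideL]
  induction l with
  | nil => rfl
  | cons a l ih =>
    by_cases h : a ≤ X <;> simp [h] at ih ⊢ <;> omega

theorem IsSymbol.split (hω : ω.IsRefl) (hV : Module.finrank K V = 2 * n)
    (h : IsSymbol ω n (d + 1) (A ++ l :: B)) {X : Submodule K V}
    (hX : X ∈ splitSpans ω (l.map Entry.mk).toFinset)
    (hn : ((outsideL X l).map (projPerp ω X)).Nodup) :
    IsSymbol ω n d (A ++ [insideL X l, (outsideL X l).map (projPerp ω X)] ++ B) := by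
  classical
  obtain ⟨hb, hnl⟩ := h.isBlock hω hV
  have hw : wordOf [insideL X l, (outsideL X l).map (projPerp ω X)] =
      [inside X (l.map Entry.mk).toFinset, projOutside ω X (l.map Entry.mk).toFinset] := by
    rw [wordOf_cons, wordOf_cons, toFinset_insideL, toFinset_outsideL]
    rfl
  have hni : (insideL X l).Nodup := hnl.filter _
  have hg := good_split hω hb hX
  refine h.replace hω hV (fun m hm => ?_) (hw ▸ hg.1) ?_ ?_
  · rcases List.mem_pair.1 hm with rfl | rfl
    · exact hni
    · exact hn
  · rw [hw, hg.2, spanF_toFinset_map]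
  · rw [wordOf_cons, wordOf_cons, wordDegree, wordDegree, card_toFinset_map hni,
      card_toFinset_map hn, List.length_map]
    change _ + (_ + (0 : ℤ)) + 2 = _
    have := length_insideL_add X l
    omega

omit [FiniteDimensional K V] in
theorem neg_one_pow_eq_of_even {a b : ℕ} (h : Even (a + b)) : (-1 : ℤ) ^ a = (-1) ^ b := by
  rw [Nat.even_add] at h
  by_cases ha : Even a
  · rw [ha.neg_one_pow, (h.1 ha).neg_one_pow]
  · rw [(Nat.not_even_iff_odd.1 ha).neg_one_pow,
      (Nat.not_even_iff_odd.1 fun hb => ha (h.2 hb)).neg_one_pow]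

omit [FiniteDimensional K V] in
theorem twist_map_append (A M B : List (List (Submodule K V))) :
    twist ((A ++ M ++ B).map List.length) = twist (A.map List.length) +
      twist (M.map List.length) + twist (B.map List.length) +
      A.length * ((M.map topIndex).sum + rightExponent B) + M.length * rightExponent B := by
  have h : ∀ L : List (List (Submodule K V)),
      ((L.map List.length).map (· - 1)).sum = (L.map topIndex).sum := fun L => by
    rw [List.map_map]
    rfl
  rw [List.map_append, List.map_append, twist_append, twist_append, h, h, List.length_append,
    List.length_map, List.length_map, rightExponent]
  ring

omit [FiniteDimensional K V] in
theorem leftExponent_add_length (h : ∀ l ∈ A, 0 < l.length) :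
    (A.map fun l => l.length + 1).sum = leftExponent A + A.length := by
  induction A with
  | nil => rfl
  | cons l A ih =>
    have h1 := h l List.mem_cons_self
    have h2 := ih fun l hl => h l (List.mem_cons_of_mem _ hl)
    simp only [leftExponent, List.map_cons, List.sum_cons, List.length_cons, topIndex] at h2 ⊢
    omega

open Classical in
/-- The omit-terms of one factor. -/
theorem toWords_omitTerms_factor (hω : ω.IsRefl) (hV : Module.finrank K V = 2 * n)
    (h : IsSymbol ω n (d + 1) (A ++ l :: B)) :
    (∑ i : Fin l.length, if spanOf (l.eraseIdx (i : ℕ)) = spanOf l then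
      (-1 : ℤ) ^ (leftExponent A + (i : ℕ)) •
        toWords ω n d (symbol ω (A ++ [l.eraseIdx (i : ℕ)] ++ B)) else 0) =
    (-1 : ℤ) ^ (twist ((A ++ l :: B).map List.length) + (A.map fun l => l.length + 1).sum) •
      cat (wordProd A) (cat (letter (omitPart (wedgeOf l))) (wordProd B)) := by
  rw [omitPart_wedgeOf (h.isBlock hω hV).2]
  simp only [map_sum, LinearMap.sum_apply, Finset.smul_sum]
  refine Finset.sum_congr rfl fun i _ => ?_
  split_ifs with hs
  · have hS := h.eraseIdx hω hV i.2 hs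
    have hpos := hS.length_pos hω hV (l := l.eraseIdx (i : ℕ)) (by simp)
    have hlen := List.length_eraseIdx_add_one i.2
    rw [toWords_symbol hS, cls, wordProd_append, wordProd_append, wordProd_singleton, cat_assoc]
    simp only [map_smul, LinearMap.smul_apply, smul_smul, ← pow_add]
    congr 1
    refine neg_one_pow_eq_of_even ?_
    rw [← List.singleton_append (x := l) (l := B), ← List.append_assoc, twist_map_append, twist_map_append,
      leftExponent_add_length fun m hm => h.length_pos hω hV (List.mem_append_left _ hm)]
    simp only [List.map_cons, List.map_nil, List.sum_cons, List.sum_nil, List.length_singleton,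
      twist, topIndex]
    obtain ⟨r, hr⟩ : ∃ r, (l.eraseIdx (i : ℕ)).length = r + 1 := ⟨_, (Nat.sub_add_cancel hpos).symm⟩
    simp only [← hlen, hr, Nat.add_sub_cancel]
    refine ⟨leftExponent A + i + twist (A.map List.length) + twist (B.map List.length) +
      rightExponent B + A.length * (r + rightExponent B + 1), ?_⟩
    ring
  · simp

omit [FiniteDimensional K V] in
open Classical in
theorem remaining_filter (X : Submodule K V) (l : List (Submodule K V)) :
    remaining l (Finset.univ.filter fun i : Fin l.length => ¬l.get i ≤ X) = insideL X l := by
  have h : l = (List.finRange l.length).map l.get := (List.map_get_finRange l).symm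
  conv_rhs => rw [insideL, h, List.filter_map]
  rw [remaining]
  congr 1
  refine List.filter_congr fun i _ => ?_
  simp

omit [FiniteDimensional K V] in
open Classical in
theorem chosen_filter (X : Submodule K V) (l : List (Submodule K V)) :
    chosen l (Finset.univ.filter fun i : Fin l.length => ¬l.get i ≤ X) = outsideL X l := by
  have h : l = (List.finRange l.length).map l.get := (List.map_get_finRange l).symm
  conv_rhs => rw [outsideL, h, List.filter_map]
  rw [chosen]
  congr 1
  refine List.filter_congr fun i _ => ?_
  simp

omit [FiniteDimensional K V] in
theorem length_chosen (l : List (Submodule K V)) (S : Finset (Fin l.length)) :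
    (chosen l S).length = S.card := by
  rw [chosen, List.length_map, ← List.toFinset_card_of_nodup ((List.nodup_finRange _).filter _),
    List.toFinset_filter, List.toFinset_finRange]
  congr 1
  ext i
  simp

omit [FiniteDimensional K V] in
open Classical in
theorem length_insideL (X : Submodule K V) (l : List (Submodule K V)) :
    (insideL X l).length = (Finset.univ.filter fun i : Fin l.length => l.get i ≤ X).card := by
  have h1 := length_insideL_add X l
  rw [← chosen_filter, length_chosen] at h1
  have h2 := Finset.card_filter_add_card_filter_not (s := Finset.univ)
    (fun i : Fin l.length => l.get i ≤ X)
  rw [Finset.card_univ, Fintype.card_fin] at h2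
  omega

omit [FiniteDimensional K V] in
theorem spanOf_insideL (X : Submodule K V) (l : List (Submodule K V)) :
    spanOf (insideL X l) = spanF (inside X (l.map Entry.mk).toFinset) := by
  rw [← toFinset_insideL, spanF_toFinset_map]

open Classical in
/-- The split-terms of one factor. Only those sets of positions matter that contain all the
positions of lines not contained in `X`, and no others: the projection of a line contained in `X`
is the zero subspace. -/
theorem toWords_splitTerms_factor (hω : ω.IsRefl) (hV : Module.finrank K V = 2 * n)
    (h : IsSymbol ω n (d + 1) (A ++ l :: B)) :
    (∑ S : Finset (Fin l.length),
      if spanOf (remaining l S) ≠ ⊥ ∧ spanOf (remaining l S) ≠ spanOf l ∧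
        (ω.restrict (spanOf (remaining l S))).Nondegenerate then
      (-1 : ℤ) ^ (leftExponent A + (S.card - 1) * topIndex l + shuffleInversions S +
          rightExponent B) • toWords ω n d (symbol ω (A ++ [remaining l S,
            (chosen l S).map (projPerp ω (spanOf (remaining l S)))] ++ B)) else 0) =
    (-1 : ℤ) ^ (twist ((A ++ l :: B).map List.length) + (A.map fun l => l.length + 1).sum) •
      cat (wordProd A) (cat (letters₂ (splitPart ω (wedgeOf l))) (wordProd B)) := by
  obtain ⟨hb, hnl⟩ := h.isBlock hω hV
  rw [splitPart_wedgeOf ω hnl]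
  simp only [map_sum, LinearMap.sum_apply, Finset.smul_sum]
  refine (Finset.sum_of_injOn (fun X => Finset.univ.filter fun i : Fin l.length => ¬l.get i ≤ X)
    ?_ (fun _ _ => Finset.mem_coe.2 (Finset.mem_univ _)) ?_ ?_).symm
  · intro X hX Y hY hXY
    have hX' := (mem_splitSpans.1 (Finset.mem_coe.1 hX)).1
    have hY' := (mem_splitSpans.1 (Finset.mem_coe.1 hY)).1
    rw [← hX', ← hY', ← spanOf_insideL, ← spanOf_insideL, ← remaining_filter, ← remaining_filter]
    exact congrArg (fun S => spanOf (remaining l S)) hXY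
  · intro S _ hS
    rw [ite_eq_right_iff]
    intro hc
    set X := spanOf (remaining l S) with hXdef
    have hle : ∀ i, i ∉ S → l.get i ≤ X := fun i hi => by
      refine le_iSup₂_of_le (l.get i) ?_ le_rfl
      exact List.mem_map.2 ⟨i, List.mem_filter.2 ⟨List.mem_finRange i, by simpa using hi⟩, rfl⟩
    have hXs : X ∈ splitSpans ω (l.map Entry.mk).toFinset := by
      refine mem_splitSpans.2 ⟨le_antisymm (spanF_inside_le _ _) (iSup₂_le fun Y hY => ?_), hc.1,
        by rw [spanF_toFinset_map]; exact hc.2.1, hc.2.2⟩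
      obtain ⟨i, hi, rfl⟩ := List.mem_map.1 hY
      have hi' : i ∉ S := by simpa using (List.mem_filter.1 hi).2
      exact le_spanF (a := ⟨l.get i⟩) (mem_inside.2 ⟨mem_toFinset_map.2 (List.get_mem l i),
        hle i hi'⟩)
    obtain ⟨i, hi, hiX⟩ : ∃ i ∈ S, l.get i ≤ X := by
      by_contra! hcon
      refine hS ⟨X, hXs, ?_⟩
      ext i
      simp only [Finset.mem_filter, Finset.mem_univ, true_and]
      exact ⟨fun hi => by_contra fun h' => hi (hle i h'), hcon i⟩
    rw [symbol_eq_zero, map_zero, smul_zero]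
    intro h'
    have h1 : projPerp ω X (l.get i) ∈ (chosen l S).map (projPerp ω X) :=
      List.mem_map.2 ⟨_, List.mem_map.2 ⟨i, List.mem_filter.2
        ⟨List.mem_finRange i, by simpa using hi⟩, rfl⟩, rfl⟩
    have h2 := IsSymbol.finrank_eq_one (ω := ω) (n := n) (d := d) h' (by simp) h1
    rw [(projPerp_eq_bot_iff hω hc.2.2).2 hiX, finrank_bot] at h2
    exact zero_ne_one h2
  · intro X hX
    have hX' := mem_splitSpans.1 hX
    have hsp : spanOf (insideL X l) = X := (spanOf_insideL X l).trans hX'.1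
    have hgood := good_split hω hb hX
    have hr : 0 < (insideL X l).length := by
      obtain ⟨a, ha⟩ := hgood.1.1.nonempty
      rw [← toFinset_insideL] at ha
      exact List.length_pos_of_mem (mem_toFinset_map.1 ha)
    have hs : 0 < (outsideL X l).length := by
      obtain ⟨a, ha⟩ := hgood.1.2.2.1.nonempty
      rw [← toFinset_outsideL] at ha
      rw [← List.length_map (f := projPerp ω X)]
      exact List.length_pos_of_mem (mem_toFinset_map.1 ha)
    have hsym : toWords ω n d (symbol ω (A ++ [insideL X l,
        (outsideL X l).map (projPerp ω X)] ++ B)) =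
        cls (A ++ [insideL X l, (outsideL X l).map (projPerp ω X)] ++ B) := by
      -- If two projections coincide, both sides vanish: the symbol by convention, and the exterior product
      -- because of a repeated factor.
      by_cases hn : ((outsideL X l).map (projPerp ω X)).Nodup
      · exact toWords_symbol (h.split hω hV hX hn)
      · rw [cls_eq_zero (by simp) hn, symbol_eq_zero, map_zero]
        exact fun h' => hn (((exists_lists_eq_iff ω hω hV).1 h').1 _ (by simp))
    rw [remaining_filter, chosen_filter, hsp, if_pos, hsym, ← length_chosen, chosen_filter]
    · rw [cls, wordProd_append, wordProd_append, cat_assoc]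
      have hw : wordProd [insideL X l, (outsideL X l).map (projPerp ω X)] =
          letters₂ (wedgeOf (insideL X l) ⊗ₜ wedgeOf ((outsideL X l).map (projPerp ω X))) := by
        rw [letters₂_tmul, ← wordProd_singleton, ← wordProd_singleton, ← wordProd_append]
        rfl
      have hsm : ∀ (c : ℤ) (t : Ext ℤ (Entry K V) ⊗[ℤ] Ext ℤ (Entry K V)),
          letters₂ (c • t) = c • letters₂ t := fun c t => map_zsmul _ _ _
      rw [hw, hsm]
      simp only [map_smul, LinearMap.smul_apply, smul_smul, ← pow_add]
      congr 1
      refine neg_one_pow_eq_of_even ?_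
      have hinv := inversions_add_shuffleInversions X l
      rw [← length_insideL, ← length_chosen, chosen_filter] at hinv
      have hlen := length_insideL_add X l
      rw [← List.singleton_append (x := l) (l := B), ← List.append_assoc, twist_map_append,
        twist_map_append,
        leftExponent_add_length fun m hm => h.length_pos hω hV (List.mem_append_left _ hm)]
      simp only [List.map_cons, List.map_nil, List.sum_cons, List.sum_nil, List.length_cons,
        List.length_nil, List.length_map, twist, topIndex]
      obtain ⟨r, hr'⟩ : ∃ r, (insideL X l).length = r + 1 := ⟨_, (Nat.sub_add_cancel hr).symm⟩
      obtain ⟨s, hs'⟩ : ∃ s, (outsideL X l).length = s + 1 := ⟨_, (Nat.sub_add_cancel hs).symm⟩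
      rw [hr', hs'] at hinv
      simp only [← hlen, hr', hs', Nat.add_sub_cancel, show r + 1 + (s + 1) - 1 = r + s + 1 by omega]
      obtain ⟨e, he⟩ := Nat.even_mul_succ_self s
      generalize inversions (fun a => a ≤ X) l = u at *
      generalize shuffleInversions (Finset.univ.filter fun i : Fin l.length => ¬l.get i ≤ X) = v at *
      have h2 : Even ((u + v) + s * (r + s + 1) + s + (r + 1)) := by
        rw [hinv]
        refine ⟨r * s + r + s + 1 + e, ?_⟩
        linear_combination he
      obtain ⟨f, hf⟩ := h2
      refine ⟨leftExponent A + twist (A.map List.length) + twist (B.map List.length) +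
        A.length * (r + s + rightExponent B + 1) + 2 * rightExponent B + f, ?_⟩
      linear_combination hf
    · exact ⟨hX'.2.1, fun h' => hX'.2.2.1 (h'.trans (spanF_toFinset_map _).symm), hX'.2.2.2⟩

/-- The omit-terms and split-terms of a simple tensor add up to the differential of its word. -/
theorem toWords_omitTerms_add_splitTerms (hω : ω.IsRefl) (hV : Module.finrank K V = 2 * n)
    {L : List (List (Submodule K V))} (h : IsSymbol ω n (d + 1) L) :
    toWords ω n d (omitTerms ω L + splitTerms ω L) = diff ω (cls L) := by
  classical
  have hL : ∀ j : Fin L.length, L.take (j : ℕ) ++ L.get j :: L.drop ((j : ℕ) + 1) = L := fun j => by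
    conv_rhs => rw [← List.take_append_drop (j : ℕ) L, List.drop_eq_getElem_cons j.2]
    rfl
  rw [omitTerms, splitTerms, map_add, map_sum, map_sum, ← Finset.sum_add_distrib, cls, map_smul,
    diff_wordProd, Finset.smul_sum]
  refine Finset.sum_congr rfl fun j _ => ?_
  have hj : IsSymbol ω n (d + 1) (L.take (j : ℕ) ++ L.get j :: L.drop ((j : ℕ) + 1)) := by
    rw [hL]
    exact h
  have h1 := toWords_omitTerms_factor hω hV hj
  have h2 := toWords_splitTerms_factor hω hV hj
  rw [hL] at h1 h2
  rw [letterDiff_apply, map_add, LinearMap.add_apply, map_add, smul_add, smul_add, smul_smul,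
    smul_smul, ← pow_add, ← h1, ← h2, map_sum, map_sum]
  congr 1
  · refine Finset.sum_congr rfl fun i _ => ?_
    split_ifs
    · rw [map_smul]
    · rw [map_zero]
  · refine Finset.sum_congr rfl fun S _ => ?_
    split_ifs
    · rw [map_smul]
    · rw [map_zero]

omit [FiniteDimensional K V] in
variable (ω n d) in
/-- The differential on the terms of the resolution, as the restriction of the differential
on words. -/
def termDiff : Term ω n (d + 1) →ₗ[ℤ] Term ω n d :=
  ofWords ω n d ∘ₗ diff ω ∘ₗ toWords ω n (d + 1)

theorem termDiff_simpleTensor (hω : ω.IsRefl) (hV : Module.finrank K V = 2 * n)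
    (x : Index ω n (d + 1)) (s : ∀ i, LineTuple (x.W i) (x.k i)) :
    termDiff ω n d (simpleTensor ω x s) =
      omitTerms ω (lists ω ⟨x, s⟩) + splitTerms ω (lists ω ⟨x, s⟩) := by
  change ofWords ω n d (diff ω (toWords ω n (d + 1) (simpleTensor ω x s))) = _
  rw [toWords_simpleTensor, ← toWords_omitTerms_add_splitTerms hω hV ⟨⟨x, s⟩, rfl⟩,
    ofWords_toWords]

theorem toWords_termDiff (hω : ω.IsAlt) (hV : Module.finrank K V = 2 * n)
    (t : Term ω n (d + 1)) :
    toWords ω n d (termDiff ω n d t) = diff ω (toWords ω n (d + 1) t) := by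
  refine toWords_ofWords hω.isRefl hV ?_
  have h := map_mem_deg (diff_mem_wordDegree ω) (isClosedUnder_totalWords (k := ℤ) hω)
    (q := ((d + 1 : ℕ) : ℤ) + n) (toWords_mem hω.isRefl hV t)
  rwa [show ((d + 1 : ℕ) : ℤ) + n - 1 = d + n by push_cast; ring] at h

end Formula

/-! ### Chains of isotropic subspaces as words -/

section Chains

variable {K V : Type*} [Field K] [AddCommGroup V] [Module K V] {ω : LinearMap.BilinForm K V}
  {n m : ℕ}

theorem eraseIdx_ofFn {α : Type*} (f : Fin (m + 1) → α) (i : Fin (m + 1)) :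
    (List.ofFn f).eraseIdx (i : ℕ) = List.ofFn (f ∘ i.succAbove) := by
  refine List.ext_getElem ?_ fun j h1 h2 => ?_
  · rw [List.length_eraseIdx_of_lt (by simpa using Nat.lt_succ_iff.1 i.2), List.length_ofFn, List.length_ofFn,
      Nat.add_sub_cancel]
  · rw [List.getElem_eraseIdx, List.getElem_ofFn]
    rw [List.length_ofFn] at h2
    split_ifs with h
    · refine Eq.trans ?_ (List.getElem_ofFn _).symm
      exact congrArg f (Fin.succAbove_of_castSucc_lt i ⟨j, h2⟩ h).symm
    · rw [List.getElem_ofFn]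
      refine Eq.trans ?_ (List.getElem_ofFn _).symm
      exact congrArg f (Fin.succAbove_of_le_castSucc i ⟨j, h2⟩ (not_lt.1 h)).symm

/-- The members of a chain of isotropic subspaces. -/
def chainList (s : Chain (TitsPoset ω) m) : List (Submodule K V) := List.ofFn fun i => (s.1 i).1

/-- The set of entries of a chain of isotropic subspaces. -/
def chainSet (s : Chain (TitsPoset ω) m) : Finset (Entry K V) :=
  ((chainList s).map Entry.mk).toFinset

theorem mem_chainSet {s : Chain (TitsPoset ω) m} {a : Entry K V} :
    a ∈ chainSet s ↔ ∃ i, (s.1 i).1 = a.sub :=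
  mem_toFinset_map.trans (List.mem_ofFn' _ _)

theorem nodup_chainList (s : Chain (TitsPoset ω) m) : (chainList s).Nodup :=
  List.nodup_ofFn.2 (Subtype.val_injective.comp s.2.injective)

theorem isChainSet_chainSet (s : Chain (TitsPoset ω) m) : IsChainSet (chainSet s) := by
  intro a ha b hb
  obtain ⟨i, hi⟩ := mem_chainSet.1 ha
  obtain ⟨j, hj⟩ := mem_chainSet.1 hb
  rw [← hi, ← hj]
  exact (le_total i j).imp (fun h => s.2.monotone h) fun h => s.2.monotone h

theorem mixedData_chainSet (s : Chain (TitsPoset ω) m) : MixedData ω (chainSet s) := by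
  refine ⟨?_, fun a ha => ?_, fun a ha b hb => Or.inr (isChainSet_chainSet s a ha b hb)⟩
  · cases m with
    | zero =>
      have : chainSet s = ∅ := rfl
      rw [this, spanF_empty]
      exact bot_le
    | succ m =>
      have h1 : Isotropic ω (s.1 (Fin.last m)).1 :=
        fun v hv w hw => (s.1 (Fin.last m)).2.2 w hw v hv
      refine h1.mono (spanF_le.2 fun a ha => ?_)
      obtain ⟨i, hi⟩ := mem_chainSet.1 ha
      rw [← hi]
      exact s.2.monotone (Fin.le_last i)
  · obtain ⟨i, hi⟩ := mem_chainSet.1 ha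
    rw [← hi]
    exact (s.1 i).2.1

theorem chainSet_injective :
    Function.Injective (chainSet : Chain (TitsPoset ω) m → Finset (Entry K V)) := by
  intro s t h
  refine Subtype.ext ((StrictMono.range_inj s.2 t.2).1 ?_)
  have h1 : ∀ s : Chain (TitsPoset ω) m, Set.range s.1 = {U | (⟨U.1⟩ : Entry K V) ∈ chainSet s} :=
    fun s => by
      ext U
      rw [Set.mem_ofPred_eq, mem_chainSet]
      exact exists_congr fun i => Subtype.ext_iff
  rw [h1, h1, h]

/-- Every chain of nonzero isotropic subspaces can be listed in increasing order. -/
theorem exists_chainSet_eq [FiniteDimensional K V] {τ : Finset (Entry K V)} (h : MixedData ω τ)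
    (hc : IsChainSet τ) : ∃ s : Chain (TitsPoset ω) τ.card, chainSet s = τ := by
  set e : Fin τ.card ≃ τ := τ.equivFin.symm
  set f : Fin τ.card → ℕ := fun i => Module.finrank K (e i).1.sub
  set σ := Tuple.sort f
  have hiso : ∀ i, ∀ v ∈ (e (σ i)).1.sub, ∀ w ∈ (e (σ i)).1.sub, ω v w = 0 := fun i v hv w hw =>
    (h.isotropic.mono (le_spanF (e (σ i)).2)) hw v hv
  have hmono : StrictMono fun i => (⟨(e (σ i)).1.sub, h.ne_bot _ (e (σ i)).2, hiso i⟩ :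
      TitsPoset ω) := by
    intro i j hij
    have h1 : f (σ i) ≤ f (σ j) := Tuple.monotone_sort f hij.le
    have h2 : (e (σ i)).1.sub ≠ (e (σ j)).1.sub := fun h' =>
      hij.ne (σ.injective (e.injective (Subtype.ext (Entry.ext h'))))
    change (e (σ i)).1.sub < (e (σ j)).1.sub
    rcases hc _ (e (σ i)).2 _ (e (σ j)).2 with h3 | h3
    · exact h3.lt_of_ne h2
    · exact absurd (Submodule.eq_of_le_of_finrank_le h3 h1) h2.symm
  let s : Chain (TitsPoset ω) τ.card := ⟨_, hmono⟩
  refine ⟨s, ?_⟩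
  ext a
  rw [mem_chainSet]
  constructor
  · rintro ⟨i, hi⟩
    have : (e (σ i)).1 = a := Entry.ext hi
    exact this ▸ (e (σ i)).2
  · intro ha
    refine ⟨σ.symm (e.symm ⟨a, ha⟩), ?_⟩
    change (e (σ (σ.symm (e.symm ⟨a, ha⟩)))).1.sub = a.sub
    rw [Equiv.apply_symm_apply, Equiv.apply_symm_apply]

variable (ω) in
open Classical in
/-- The word of a chain of isotropic subspaces: a single factor consisting of `V` and the members
of the chain. If `V = 0`, there is only the empty chain, and its word is the empty word. -/
def chainToWords (m : ℕ) : ChainGroup (TitsPoset ω) m →ₗ[ℤ] Words ℤ (Entry K V) :=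
  Finsupp.linearCombination ℤ fun s =>
    if Nontrivial V then letter (wedgeOf (⊤ :: chainList s)) else Finsupp.single [] 1

theorem chainToWords_single [Nontrivial V] (s : Chain (TitsPoset ω) m) :
    chainToWords ω m (Finsupp.single s 1) = letter (wedgeOf (⊤ :: chainList s)) := by
  rw [chainToWords, Finsupp.linearCombination_single, one_smul, if_pos ‹Nontrivial V›]

variable [FiniteDimensional K V] [Nontrivial V] (hω : ω.IsAlt) (hn : (ω.restrict ⊤).Nondegenerate)

include hω hn

theorem nodup_top_cons (s : Chain (TitsPoset ω) m) : (⊤ :: chainList s).Nodup := by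
  refine List.nodup_cons.2 ⟨fun h => ?_, nodup_chainList s⟩
  have h1 := (mixedData_chainSet s).lt hω hn (a := ⟨⊤⟩) (mem_toFinset_map.2 h)
  rw [star_nil_sub] at h1
  exact lt_irrefl _ h1

omit [Nontrivial V] [FiniteDimensional K V] hω hn in
theorem toFinset_top_cons (s : Chain (TitsPoset ω) m) :
    [((⊤ :: chainList s).map Entry.mk).toFinset] = starWord ω [] (chainSet s) := by
  have h1 : star ω ([] : List (Finset (Entry K V))) = ⟨⊤⟩ := Entry.ext star_nil_sub
  rw [starWord, h1, List.map_cons, List.toFinset_cons]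
  rfl

theorem exists_chainToWords_single (s : Chain (TitsPoset ω) m) : ∃ u : ℤˣ,
    chainToWords ω m (Finsupp.single s 1) = u • Finsupp.single (starWord ω [] (chainSet s)) 1 := by
  obtain ⟨c, hc⟩ := exists_wedge_eq (k := ℤ) ((nodup_top_cons hω hn s).map entry_mk_injective)
  refine ⟨(-1) ^ c, ?_⟩
  rw [chainToWords_single, wedgeOf, hc, map_smul, letter_single, toFinset_top_cons, Units.smul_def]
  simp

theorem chainToWords_injective : Function.Injective (chainToWords ω m) := by
  choose u hu using exists_chainToWords_single (m := m) hω hn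
  have h1 : LinearIndependent ℤ fun s : Chain (TitsPoset ω) m =>
      Finsupp.single (starWord ω [] (chainSet s)) (1 : ℤ) :=
    (Finsupp.linearIndependent_single_one ℤ (List (Finset (Entry K V)))).comp
      (fun s : Chain (TitsPoset ω) m => starWord ω [] (chainSet s)) fun s t h =>
        chainSet_injective ((mixedData_chainSet s).starWord_inj hω hn (mixedData_chainSet t) h)
  have h2 := h1.units_smul u
  have h3 : chainToWords ω m = Finsupp.linearCombination ℤ (u • fun s : Chain (TitsPoset ω) m =>
      Finsupp.single (starWord ω [] (chainSet s)) (1 : ℤ)) := by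
    refine Finsupp.lhom_ext' fun s => LinearMap.ext_ring ?_
    change chainToWords ω m (Finsupp.single s 1) = Finsupp.linearCombination ℤ _ (Finsupp.single s 1)
    rw [hu, Finsupp.linearCombination_single, one_smul]
    rfl
  rw [h3]
  exact h2

theorem wordDegree_starWord {τ : Finset (Entry K V)} (h : MixedData ω τ) :
    wordDegree (starWord ω [] τ) = τ.card := by
  have h1 : star ω ([] : List (Finset (Entry K V))) ∉ τ := fun h1 => lt_irrefl _ (h.lt hω hn h1)
  change (((insert (star ω []) τ).card : ℤ) - 1) + 0 = _
  rw [Finset.card_insert_of_notMem h1]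
  push_cast
  ring

omit [FiniteDimensional K V] [Nontrivial V] hω hn in
theorem card_chainSet (s : Chain (TitsPoset ω) m) : (chainSet s).card = m := by
  rw [chainSet, card_toFinset_map (nodup_chainList s), chainList, List.length_ofFn]

theorem range_chainToWords : LinearMap.range (chainToWords ω m) =
    Finsupp.supported ℤ ℤ {w | w ∈ chainWords ω ∧ wordDegree w = m} := by
  refine le_antisymm ?_ fun x hx => ?_
  · rintro _ ⟨c, rfl⟩
    refine map_mem_of_supported (S := Set.univ) (chainToWords ω m) (fun s _ => ?_)
      ((Finsupp.supported_univ (R := ℤ) (M := ℤ)).symm ▸ Submodule.mem_top)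
    obtain ⟨u, hu⟩ := exists_chainToWords_single hω hn s
    rw [hu, Units.smul_def]
    have hs := mixedData_chainSet s
    refine Submodule.smul_mem _ _ (single_mem_supported ⟨⟨_, hs, isChainSet_chainSet s, rfl⟩, ?_⟩)
    rw [wordDegree_starWord hω hn hs, card_chainSet]
  · refine map_mem_of_supported LinearMap.id (fun w hw => ?_) hx
    obtain ⟨⟨τ, h, hc, rfl⟩, hd⟩ := hw
    rw [wordDegree_starWord hω hn h] at hd
    obtain rfl : τ.card = m := by exact_mod_cast hd
    obtain ⟨s, hs⟩ := exists_chainSet_eq h hc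
    obtain ⟨u, hu⟩ := exists_chainToWords_single hω hn s
    refine ⟨u⁻¹ • Finsupp.single s 1, ?_⟩
    rw [Units.smul_def, map_smul, hu, hs, ← Units.smul_def, inv_smul_smul]
    rfl

/-- The differential of the word of a chain is its simplicial boundary up to sign: the entry `V`
cannot be omitted, and there are no splittings. -/
theorem diff_chainToWords (c : ChainGroup (TitsPoset ω) (m + 1)) :
    diff ω (chainToWords ω (m + 1) c) = -chainToWords ω m (boundary (TitsPoset ω) m c) := by
  have : diff ω ∘ₗ chainToWords ω (m + 1) = -(chainToWords ω m ∘ₗ boundary (TitsPoset ω) m) := by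
    refine Finsupp.lhom_ext' fun s => LinearMap.ext_ring ?_
    change diff ω (chainToWords ω (m + 1) (Finsupp.single s 1)) =
      -chainToWords ω m (boundary (TitsPoset ω) m (Finsupp.single s 1))
    have hs := mixedData_chainSet s
    have h1 : splitSpans ω ((⊤ :: chainList s).map Entry.mk).toFinset = ∅ := by
      refine Finset.eq_empty_of_forall_notMem fun X hX => ?_
      rw [mem_splitSpans, spanF_toFinset_map] at hX
      have htop : spanOf (⊤ :: chainList s) = ⊤ :=
        eq_top_iff.2 (le_iSup₂_of_le ⊤ List.mem_cons_self le_rfl)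
      rw [htop] at hX
      refine hs.not_split hω (X := X) ?_ hX.2.1 hX.2.2.2
      refine le_antisymm (spanF_inside_le _ _) ?_
      conv_lhs => rw [← hX.1]
      refine spanF_le.2 fun a ha => le_spanF (mem_inside.2 ?_)
      rw [mem_inside, mem_toFinset_map, List.mem_cons] at ha
      refine ⟨?_, ha.2⟩
      rcases ha.1 with h | h
      · exact absurd (top_le_iff.1 (h ▸ ha.2)) hX.2.2.1
      · exact mem_toFinset_map.2 h
    have h2 : spanOf (chainList s) ≠ ⊤ := by
      rw [← spanF_toFinset_map]
      exact hs.isotropic.ne_top hω hn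
    classical
    rw [chainToWords_single, diff, deriv_letter, letterDiff_apply,
      splitPart_wedgeOf ω (nodup_top_cons hω hn s), h1, Finset.sum_empty, map_zero, add_zero,
      omitPart_wedgeOf (nodup_top_cons hω hn s), boundary, Finsupp.linearCombination_single,
      one_smul, map_sum, map_sum, ← Finset.sum_neg_distrib]
    have hlen : (chainList s).length = m + 1 := List.length_ofFn
    refine (Fin.sum_univ_succ (n := (chainList s).length) _).trans ?_
    have h3 : spanOf (⊤ :: chainList s) = ⊤ :=
        eq_top_iff.2 (le_iSup₂_of_le ⊤ List.mem_cons_self le_rfl)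
    rw [h3, if_neg (by simpa using h2), map_zero, zero_add]
    refine Fintype.sum_equiv (finCongr hlen) _ _ fun i => ?_
    have h4 : (⊤ :: chainList s).eraseIdx ((i.succ : Fin _) : ℕ) =
        ⊤ :: chainList (s.face (finCongr hlen i)) := by
      rw [Fin.val_succ, List.eraseIdx_cons_succ]
      congr 1
      exact eraseIdx_ofFn (fun i => (s.1 i).1) (finCongr hlen i)
    have h5 : spanOf (⊤ :: chainList (s.face (finCongr hlen i))) = ⊤ :=
        eq_top_iff.2 (le_iSup₂_of_le ⊤ List.mem_cons_self le_rfl)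
    rw [h4, if_pos h5, map_smul, map_smul, chainToWords_single, Fin.val_succ, pow_succ, mul_neg_one,
      neg_smul]
    rfl
  exact LinearMap.congr_fun this c

omit [Nontrivial V] hn in
/-- A nonzero symplectic subspace has dimension at least two, as lines are isotropic. -/
theorem two_le_finrank {A : Finset (Entry K V)} (h : IsBlock ω A) :
    2 ≤ Module.finrank K (spanF A) := by
  have h0 : Module.finrank K (spanF A) ≠ 0 := fun h0 =>
    h.spanF_ne_bot (Submodule.finrank_eq_zero.1 h0)
  have h1 : Module.finrank K (spanF A) ≠ 1 := fun h1 =>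
    h.spanF_ne_bot ((isotropic_of_finrank_eq_one hω h1).eq_bot hω.isRefl h.nondegenerate)
  omega

omit [Nontrivial V] hn in
/-- The words of the resolution have degree at least `n`, as a factor with span of dimension `r ≥ 2`
has degree at least `r - 1 ≥ r / 2`. -/
theorem le_wordDegree (hV : Module.finrank K V = 2 * n) {w : List (Finset (Entry K V))}
    (hw : w ∈ totalWords ω) : (n : ℤ) ≤ wordDegree w := by
  have h : ∀ w : List (Finset (Entry K V)), Good ω w →
      (Module.finrank K (tot w) : ℤ) ≤ 2 * wordDegree w := by
    intro w hw
    rw [finrank_tot ω hω.isRefl hw]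
    induction w with
    | nil => simp [wordDegree]
    | cons A w ih =>
      have h1 := two_le_finrank hω hw.1
      have h2 := finrank_spanF_le hw.1.isLine
      have h3 := ih hw.2.2
      rw [List.map_cons, List.sum_cons, wordDegree]
      push_cast at h3 ⊢
      linarith
  have h1 := h w hw.1
  rw [hw.2, finrank_top, hV] at h1
  push_cast at h1
  linarith

omit [Nontrivial V] in
theorem Isotropic.finrank_le (hV : Module.finrank K V = 2 * n) {U : Submodule K V}
    (h : Isotropic ω U) : Module.finrank K U ≤ n := by
  have h1 : LinearMap.BilinForm.orthogonal ω ⊤ = ⊥ := by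
    rw [eq_bot_iff]
    intro v hv
    have h2 := hn.2 ⟨v, trivial⟩ fun w => hv w.1 trivial
    exact congrArg Subtype.val h2
  have h2 := LinearMap.BilinForm.finrank_add_finrank_orthogonal hω.isRefl U
  rw [h1, inf_bot_eq, finrank_bot, hV] at h2
  have h3 := Submodule.finrank_mono h
  omega

omit [Nontrivial V] in
/-- A chain of nonzero isotropic subspaces has at most `n` members, whose dimensions increase from `1`
to at most `n`. -/
theorem chain_length_le (hV : Module.finrank K V = 2 * n) (s : Chain (TitsPoset ω) m) : m ≤ n := by
  cases m with
  | zero => exact Nat.zero_le _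
  | succ m =>
    have h1 : ∀ i : ℕ, ∀ hi : i < m + 1, i + 1 ≤ Module.finrank K (s.1 ⟨i, hi⟩).1 := by
      intro i
      induction i with
      | zero =>
        intro hi
        have := mt Submodule.finrank_eq_zero.1 (s.1 ⟨0, hi⟩).2.1
        omega
      | succ i ih =>
        intro hi
        have h2 : (s.1 ⟨i, by omega⟩).1 < (s.1 ⟨i + 1, hi⟩).1 := s.2 (Fin.mk_lt_mk.2 (Nat.lt_succ_self i))
        have := Submodule.finrank_lt_finrank_of_lt h2
        have := ih (by omega)
        omega
    have h3 : Isotropic ω (s.1 ⟨m, Nat.lt_succ_self m⟩).1 :=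
        fun v hv w hw => (s.1 _).2.2 w hw v hv
    exact (h1 m (Nat.lt_succ_self m)).trans (h3.finrank_le hω hn hV)

/-- For `V ≠ 0`, the complex of all words contains the resolution and the chains of the Tits building
as equivalent subcomplexes. -/
theorem comparisonData_of_nontrivial (hV : Module.finrank K V = 2 * n) :
    ComparisonData (diff ω : Words ℤ (Entry K V) →ₗ[ℤ] _) wordDegree n
      (starWords ω ∪ totalWords ω ∪ mixedWords ω) (totalWords ω) (chainWords ω) where
  diff_diff := diff_diff hω.isRefl
  diff_deg := diff_mem_wordDegree ω
  closed_C := isClosedUnder_totalWords hω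
  subset_C := fun _ h => Or.inl (Or.inr h)
  subset_T := fun _ ⟨τ, h, _, h'⟩ => Or.inr ⟨τ, h, h'⟩
  acyclic_C := relAcyclic_union_totalWords hω hn
  acyclic_T := relAcyclic_union_chainWords hω hn
  deg_C := fun _ h => le_wordDegree hω hV h
  deg_T := by
    rintro _ ⟨τ, h, hc, rfl⟩
    rw [wordDegree_starWord hω hn h]
    obtain ⟨s, -⟩ := exists_chainSet_eq h hc
    exact_mod_cast chain_length_le hω hn hV s

end Chains

/-! ### The action of the symplectic group on words -/

section MapWords

variable {α : Type*} [LinearOrder α] (f : α → α)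

/-- The effect on words of a map on generators of the exterior algebra. -/
def mapWord : List (Finset α) → Words ℤ α
  | [] => Finsupp.single [] 1
  | A :: u => cat (letter (Ext.map f (Finsupp.single A 1))) (mapWord u)

/-- The endomorphism of the algebra of words induced by a map on generators of the exterior
algebra. -/
def mapWords : Words ℤ α →ₗ[ℤ] Words ℤ α := Finsupp.linearCombination ℤ (mapWord f)

theorem mapWords_single (u : List (Finset α)) : mapWords f (Finsupp.single u 1) = mapWord f u := by
  rw [mapWords, Finsupp.linearCombination_single, one_smul]

theorem mapWords_cat (x y : Words ℤ α) :
    mapWords f (cat x y) = cat (mapWords f x) (mapWords f y) := by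
  induction x using Words.induction with
  | add x x' hx hx' => simp only [map_add, LinearMap.add_apply, hx, hx']
  | smul c x hx => simp only [map_smul, LinearMap.smul_apply, hx]
  | single u =>
    induction y using Words.induction with
    | add x x' hx hx' => simp only [map_add, hx, hx']
    | smul c x hx => simp only [map_smul, hx]
    | single v =>
      rw [cat_single, mapWords_single, mapWords_single, mapWords_single]
      induction u with
      | nil => exact (nil_cat _).symm
      | cons A u ih => rw [List.cons_append, mapWord, mapWord, ih, cat_assoc]

theorem mapWords_letter (x : Ext ℤ α) : mapWords f (letter x) = letter (Ext.map f x) := by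
  have : mapWords f ∘ₗ letter = letter ∘ₗ Ext.map f := by
    refine Finsupp.lhom_ext' fun A => LinearMap.ext_ring ?_
    change mapWords f (letter (Finsupp.single A 1)) = letter (Ext.map f (Finsupp.single A 1))
    rw [letter_single, mapWords_single, mapWord, mapWord, cat_nil]
  exact LinearMap.congr_fun this x

theorem mapWords_letters₂ (z : Ext ℤ α ⊗[ℤ] Ext ℤ α) : mapWords f (letters₂ z) =
    letters₂ (TensorProduct.map (Ext.map f) (Ext.map f) z) := by
  induction z with
  | zero => simp
  | add x y hx hy => simp only [map_add, hx, hy]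
  | tmul x y =>
    rw [letters₂_tmul, mapWords_cat, mapWords_letter, mapWords_letter, TensorProduct.map_tmul,
      letters₂_tmul]

theorem parity_map (x : Ext ℤ α) : parity (Ext.map f x) = Ext.map f (parity x) := by
  induction x using Finsupp.induction_linear with
  | zero => simp
  | add x y hx hy => simp only [map_add, hx, hy]
  | single A c =>
    have h : Finsupp.single A c = c • wedge (A.sort (· ≤ ·)) := by simp [wedge_sort]
    rw [h]
    simp only [map_smul, Ext.map_wedge, parity_wedge, List.length_map]

variable {f} in
theorem exists_map_single (hf : Function.Injective f) (A : Finset α) :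
    ∃ e : ℕ, Ext.map f (Finsupp.single A (1 : ℤ)) = (-1 : ℤ) ^ e • Finsupp.single (A.image f) 1 := by
  obtain ⟨e, he⟩ := exists_wedge_eq (k := ℤ) ((A.sort_nodup (· ≤ ·)).map hf)
  refine ⟨e, ?_⟩
  have h : ((A.sort (· ≤ ·)).map f).toFinset = A.image f := by
    ext a
    simp
  rw [← wedge_sort, Ext.map_wedge, he, h]

/-- The word in which the map has been applied to every entry. -/
def imageWord (w : List (Finset α)) : List (Finset α) := w.map (Finset.image f)

variable {f} in
theorem exists_mapWords_single (hf : Function.Injective f) (w : List (Finset α)) :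
    ∃ e : ℕ, mapWords f (Finsupp.single w 1) = (-1 : ℤ) ^ e • Finsupp.single (imageWord f w) 1 := by
  rw [mapWords_single]
  induction w with
  | nil => exact ⟨0, by simp [mapWord, imageWord]⟩
  | cons A w ih =>
    obtain ⟨e, he⟩ := ih
    obtain ⟨c, hc⟩ := exists_map_single hf A
    refine ⟨c + e, ?_⟩
    rw [mapWord, he, hc, map_smul, map_smul, map_smul, LinearMap.smul_apply, letter_single,
      cat_single, smul_smul, pow_add, mul_comm]
    rfl

variable {f} in
theorem mapWords_mem_supported (hf : Function.Injective f) {S T : Set (List (Finset α))}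
    (h : ∀ w ∈ S, imageWord f w ∈ T) {x : Words ℤ α} (hx : x ∈ Finsupp.supported ℤ ℤ S) :
    mapWords f x ∈ Finsupp.supported ℤ ℤ T := by
  refine map_mem_of_supported (mapWords f) (fun w hw => ?_) hx
  obtain ⟨e, he⟩ := exists_mapWords_single hf w
  rw [he]
  exact Submodule.smul_mem _ _ (single_mem_supported (h w hw))

variable {f} in
theorem wordDegree_imageWord (hf : Function.Injective f) (w : List (Finset α)) :
    wordDegree (imageWord f w) = wordDegree w := by
  induction w with
  | nil => rfl
  | cons A w ih =>
    change ((A.image f).card : ℤ) - 1 + wordDegree (imageWord f w) = A.card - 1 + wordDegree w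
    rw [ih, Finset.card_image_of_injective _ hf]

end MapWords

section Action

variable {K V : Type*} [Field K] [AddCommGroup V] [Module K V] {ω : LinearMap.BilinForm K V}
  (g : Sp ω)

theorem moveSubspace_inv_moveSubspace (X : Submodule K V) :
    moveSubspace g⁻¹ (moveSubspace g X) = X := by
  rw [← moveSubspace_mul, inv_mul_cancel, moveSubspace_one]

theorem moveSubspace_moveSubspace_inv (X : Submodule K V) :
    moveSubspace g (moveSubspace g⁻¹ X) = X := by
  rw [← moveSubspace_mul, mul_inv_cancel, moveSubspace_one]

theorem moveSubspace_injective : Function.Injective (moveSubspace g) :=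
  Function.LeftInverse.injective (moveSubspace_inv_moveSubspace g)

theorem moveSubspace_le_iff {X Y : Submodule K V} :
    moveSubspace g X ≤ moveSubspace g Y ↔ X ≤ Y :=
  Submodule.map_le_map_iff_of_injective g.1.injective X Y

theorem moveSubspace_sup (X Y : Submodule K V) :
    moveSubspace g (X ⊔ Y) = moveSubspace g X ⊔ moveSubspace g Y := Submodule.map_sup _ _ _

theorem moveSubspace_inf (X Y : Submodule K V) :
    moveSubspace g (X ⊓ Y) = moveSubspace g X ⊓ moveSubspace g Y :=
  Submodule.map_inf _ g.1.injective

theorem moveSubspace_bot : moveSubspace g ⊥ = ⊥ := Submodule.map_bot _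

theorem moveSubspace_top : moveSubspace g ⊤ = ⊤ :=
  (Submodule.map_top _).trans (LinearEquiv.range g.1)

theorem moveSubspace_eq_bot {X : Submodule K V} : moveSubspace g X = ⊥ ↔ X = ⊥ := by
  rw [← moveSubspace_bot g, (moveSubspace_injective g).eq_iff, moveSubspace_bot]

theorem finrank_moveSubspace (X : Submodule K V) :
    Module.finrank K (moveSubspace g X) = Module.finrank K X := LinearEquiv.finrank_map_eq g.1 X

theorem orthogonal_moveSubspace (X : Submodule K V) :
    ω.orthogonal (moveSubspace g X) = moveSubspace g (ω.orthogonal X) := by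
  ext v
  constructor
  · intro h
    refine ⟨g⁻¹.1 v, fun w hw => ?_, ?_⟩
    · have h1 : ω (g.1 w) v = 0 := h (g.1 w) ⟨w, hw, rfl⟩
      have h2 := (g⁻¹).2 (g.1 w) v
      rw [← LinearEquiv.mul_apply, ← Subgroup.coe_mul, inv_mul_cancel] at h2
      exact h2.trans h1
    · change (g.1 * g⁻¹.1) v = v
      rw [← Subgroup.coe_mul, mul_inv_cancel]
      rfl
  · rintro ⟨v, hv, rfl⟩ _ ⟨w, hw, rfl⟩
    exact (g.2 w v).trans (hv w hw)

theorem nondegenerate_moveSubspace_iff {X : Submodule K V} :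
    (ω.restrict (moveSubspace g X)).Nondegenerate ↔ (ω.restrict X).Nondegenerate := by
  refine ⟨fun h => ?_, nondegenerate_moveSubspace g⟩
  have := nondegenerate_moveSubspace g⁻¹ h
  rwa [moveSubspace_inv_moveSubspace] at this

theorem projPerp_moveSubspace (X Y : Submodule K V) :
    projPerp ω (moveSubspace g X) (moveSubspace g Y) = moveSubspace g (projPerp ω X Y) := by
  rw [projPerp, projPerp, orthogonal_moveSubspace, ← moveSubspace_sup, ← moveSubspace_inf]

/-- The action of the symplectic group on entries. -/
def Entry.move (a : Entry K V) : Entry K V := ⟨moveSubspace g a.sub⟩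

theorem Entry.move_injective : Function.Injective (Entry.move g) := fun _ _ h =>
  Entry.ext (moveSubspace_injective g (congrArg Entry.sub h))

theorem map_wedgeOf (l : List (Submodule K V)) :
    Ext.map (Entry.move g) (wedgeOf l) = wedgeOf (l.map (moveSubspace g)) := by
  rw [wedgeOf, Ext.map_wedge, wedgeOf, List.map_map, List.map_map]
  rfl

theorem spanF_image (A : Finset (Entry K V)) :
    spanF (A.image (Entry.move g)) = moveSubspace g (spanF A) := by
  induction A using Finset.induction_on with
  | empty => exact (moveSubspace_bot g).symm
  | insert a A _ ih =>
    rw [Finset.image_insert, spanF_insert, spanF_insert, ih, moveSubspace_sup]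
    rfl

theorem spanOf_map (l : List (Submodule K V)) :
    spanOf (l.map (moveSubspace g)) = moveSubspace g (spanOf l) := by
  have h : ((l.map (moveSubspace g)).map Entry.mk).toFinset =
      ((l.map Entry.mk).toFinset).image (Entry.move g) := by
    ext a
    simp only [List.mem_toFinset, List.mem_map, Finset.mem_image]
    constructor
    · rintro ⟨_, ⟨b, hb, rfl⟩, rfl⟩
      exact ⟨_, ⟨b, hb, rfl⟩, rfl⟩
    · rintro ⟨_, ⟨b, hb, rfl⟩, rfl⟩
      exact ⟨_, ⟨b, hb, rfl⟩, rfl⟩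
  rw [← spanF_toFinset_map, ← spanF_toFinset_map, h, spanF_image]

theorem insideL_map (X : Submodule K V) (l : List (Submodule K V)) :
    insideL (moveSubspace g X) (l.map (moveSubspace g)) = (insideL X l).map (moveSubspace g) := by
  classical
  rw [insideL, insideL, List.filter_map]
  congr 1
  refine List.filter_congr fun Y _ => ?_
  simp [moveSubspace_le_iff]

theorem outsideL_map (X : Submodule K V) (l : List (Submodule K V)) :
    outsideL (moveSubspace g X) (l.map (moveSubspace g)) = (outsideL X l).map (moveSubspace g) := by
  classical
  rw [outsideL, outsideL, List.filter_map]
  congr 1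
  refine List.filter_congr fun Y _ => ?_
  simp [moveSubspace_le_iff]

theorem mem_splitSpans_map {X : Submodule K V} {l : List (Submodule K V)} :
    moveSubspace g X ∈ splitSpans ω ((l.map (moveSubspace g)).map Entry.mk).toFinset ↔
      X ∈ splitSpans ω (l.map Entry.mk).toFinset := by
  rw [mem_splitSpans, mem_splitSpans, ← spanOf_insideL, ← spanOf_insideL, insideL_map, spanOf_map,
    spanF_toFinset_map, spanF_toFinset_map, spanOf_map, (moveSubspace_injective g).eq_iff,
    (moveSubspace_injective g).ne_iff, Ne, moveSubspace_eq_bot, nondegenerate_moveSubspace_iff]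

open Classical in
theorem inversions_map (X : Submodule K V) (l : List (Submodule K V)) :
    inversions (fun a => a ≤ moveSubspace g X) (l.map (moveSubspace g)) =
      inversions (fun a => a ≤ X) l := by
  induction l with
  | nil => rfl
  | cons a l ih =>
    have h := congrArg List.length (insideL_map g X l)
    rw [insideL, insideL, List.length_map] at h
    rw [List.map_cons, inversions, inversions, ih, h]
    simp only [moveSubspace_le_iff]

/-- The symplectic group commutes with the formation of spans and of orthogonal projections, hence
with the differential. -/
theorem letterDiff_map (x : Ext ℤ (Entry K V)) :
    letterDiff ω (Ext.map (Entry.move g) x) = mapWords (Entry.move g) (letterDiff ω x) := by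
  classical
  have : letterDiff ω ∘ₗ Ext.map (Entry.move g) = mapWords (Entry.move g) ∘ₗ letterDiff ω := by
    refine Finsupp.lhom_ext' fun A => LinearMap.ext_ring ?_
    change letterDiff ω (Ext.map (Entry.move g) (Finsupp.single A 1)) =
      mapWords (Entry.move g) (letterDiff ω (Finsupp.single A 1))
    have hn : ((A.sort (· ≤ ·)).map Entry.sub).Nodup :=
      (A.sort_nodup _).map fun a b h => Entry.ext h
    have hA : Finsupp.single A (1 : ℤ) = wedgeOf ((A.sort (· ≤ ·)).map Entry.sub) := by
      rw [wedgeOf, map_mk_map_sub, wedge_sort]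
    generalize (A.sort (· ≤ ·)).map Entry.sub = l at hn hA
    have hn' : (l.map (moveSubspace g)).Nodup := hn.map (moveSubspace_injective g)
    rw [hA, map_wedgeOf, letterDiff_apply, letterDiff_apply, map_add, mapWords_letter,
      mapWords_letters₂]
    congr 2
    · rw [omitPart_wedgeOf hn', omitPart_wedgeOf hn, map_sum]
      refine Fintype.sum_equiv (finCongr (List.length_map _)) _ _ fun i => ?_
      rw [List.eraseIdx_map, spanOf_map, spanOf_map, finCongr_apply, Fin.val_cast]
      by_cases h : spanOf (l.eraseIdx (i : ℕ)) = spanOf l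
      · rw [if_pos h, if_pos (congrArg _ h), map_smul, map_wedgeOf]
      · rw [if_neg h, if_neg ((moveSubspace_injective g).ne h), map_zero]
    · rw [splitPart_wedgeOf ω hn', splitPart_wedgeOf ω hn, map_sum]
      refine (Finset.sum_nbij' (moveSubspace g) (moveSubspace g⁻¹)
        (fun X hX => (mem_splitSpans_map g).2 hX) (fun X hX => ?_)
        (fun X _ => moveSubspace_inv_moveSubspace g X)
        (fun X _ => moveSubspace_moveSubspace_inv g X) fun X _ => ?_).symm
      · rwa [← mem_splitSpans_map g, moveSubspace_moveSubspace_inv]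
      · have h1 : ((outsideL X l).map (moveSubspace g)).map (projPerp ω (moveSubspace g X)) =
            ((outsideL X l).map (projPerp ω X)).map (moveSubspace g) := by
          rw [List.map_map, List.map_map]
          exact List.map_congr_left fun Y _ => projPerp_moveSubspace g X Y
        rw [insideL_map, outsideL_map, inversions_map, h1, List.length_map, ← map_wedgeOf,
          ← map_wedgeOf, ← TensorProduct.map_tmul]
        exact map_zsmul _ _ _
  exact LinearMap.congr_fun this x

theorem diff_mapWords (x : Words ℤ (Entry K V)) :
    diff ω (mapWords (Entry.move g) x) = mapWords (Entry.move g) (diff ω x) := by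
  induction x using Words.induction with
  | add x y hx hy => simp only [map_add, hx, hy]
  | smul c x hx => simp only [map_smul, hx]
  | single u =>
    induction u with
    | nil =>
      rw [mapWords_single, mapWord, diff, deriv_nil, map_zero]
    | cons A u ih =>
      have h1 : Finsupp.single (A :: u) (1 : ℤ) =
        cat (letter (Finsupp.single A 1)) (Finsupp.single u 1) := by simp
      rw [h1, mapWords_cat, diff, deriv_cat, deriv_cat, ← diff, ih, mapWords_letter,
        wordParity_letter, wordParity_letter, parity_map, diff, deriv_letter, deriv_letter,
        letterDiff_map, map_add, mapWords_cat, mapWords_cat, map_neg (mapWords _), mapWords_letter]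

theorem tot_imageWord (w : List (Finset (Entry K V))) :
    tot (imageWord (Entry.move g) w) = moveSubspace g (tot w) := by
  induction w with
  | nil => exact (moveSubspace_bot g).symm
  | cons A w ih =>
    change spanF (A.image _) ⊔ tot (imageWord _ w) = _
    rw [ih, spanF_image, tot_cons, moveSubspace_sup]

variable {g}

theorem Entry.IsLine.move {a : Entry K V} (h : a.IsLine) : (a.move g).IsLine :=
  (finrank_moveSubspace g a.sub).trans h

theorem isLine_of_mem_image {A : Finset (Entry K V)} (h : ∀ a ∈ A, a.IsLine) :
    ∀ a ∈ A.image (Entry.move g), a.IsLine := fun a ha => by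
  obtain ⟨b, hb, rfl⟩ := Finset.mem_image.1 ha
  exact (h b hb).move

theorem good_imageWord {w : List (Finset (Entry K V))} (h : Good ω w) :
    Good ω (imageWord (Entry.move g) w) := by
  induction w with
  | nil => trivial
  | cons A w ih =>
    refine ⟨⟨isLine_of_mem_image h.1.isLine, h.1.nonempty.image _, ?_⟩, ?_, ih h.2.2⟩
    · rw [spanF_image]
      exact nondegenerate_moveSubspace g h.1.nondegenerate
    · change tot (imageWord _ w) ≤ ω.orthogonal (spanF (A.image _))
      rw [tot_imageWord, spanF_image, orthogonal_moveSubspace, moveSubspace_le_iff]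
      exact h.2.1

theorem imageWord_mem_totalWords {w : List (Finset (Entry K V))} (h : w ∈ totalWords ω) :
    imageWord (Entry.move g) w ∈ totalWords ω :=
  ⟨good_imageWord h.1, by rw [tot_imageWord, h.2, moveSubspace_top]⟩

theorem imageWord_starWord (L : List (Finset (Entry K V))) (B : Finset (Entry K V)) :
    imageWord (Entry.move g) (starWord ω L B) =
      starWord ω (imageWord (Entry.move g) L) (B.image (Entry.move g)) := by
  rw [imageWord, starWord, List.map_append, List.map_singleton, Finset.image_insert, starWord]
  congr 3
  refine Entry.ext ?_
  change _ = ω.orthogonal (tot (imageWord (Entry.move g) L))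
  rw [tot_imageWord, orthogonal_moveSubspace]
  rfl

theorem imageWord_mem_starWords {w : List (Finset (Entry K V))} (h : w ∈ starWords ω) :
    imageWord (Entry.move g) w ∈ starWords ω := by
  obtain ⟨L, B, h, rfl⟩ := h
  refine ⟨_, _, ⟨good_imageWord h.good, ?_, isLine_of_mem_image h.isLine, fun b hb => ?_⟩,
    (imageWord_starWord L B).symm⟩
  · rw [tot_imageWord, ← moveSubspace_top g, (moveSubspace_injective g).ne_iff]
    exact h.ne_top
  · obtain ⟨a, ha, rfl⟩ := Finset.mem_image.1 hb
    rw [tot_imageWord, orthogonal_moveSubspace]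
    exact (moveSubspace_le_iff g).2 (h.le a ha)

theorem imageWord_mem_mixedWords {w : List (Finset (Entry K V))} (h : w ∈ mixedWords ω) :
    imageWord (Entry.move g) w ∈ mixedWords ω := by
  obtain ⟨τ, h, rfl⟩ := h
  refine ⟨_, ⟨?_, fun a ha => ?_, fun a ha b hb => ?_⟩, (imageWord_starWord [] τ).symm⟩
  · rw [Isotropic, spanF_image, orthogonal_moveSubspace, moveSubspace_le_iff]
    exact h.isotropic
  · obtain ⟨a, ha', rfl⟩ := Finset.mem_image.1 ha
    exact moveSubspace_ne_bot g (h.ne_bot a ha')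
  · obtain ⟨a, ha', rfl⟩ := Finset.mem_image.1 ha
    obtain ⟨b, hb', rfl⟩ := Finset.mem_image.1 hb
    exact (h.comparable a ha' b hb').imp (And.imp Entry.IsLine.move Entry.IsLine.move)
      (Or.imp (moveSubspace_le_iff g).2 (moveSubspace_le_iff g).2)

variable (g) {n d m : ℕ}

theorem mapWords_wordProd (L : List (List (Submodule K V))) :
    mapWords (Entry.move g) (wordProd L) = wordProd (L.map (List.map (moveSubspace g))) := by
  induction L with
  | nil => rw [wordProd, mapWords_single, mapWord]; rfl
  | cons l L ih => rw [wordProd, mapWords_cat, mapWords_letter, map_wedgeOf, ih, List.map_cons, wordProd]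

theorem toWords_termRep (t : Term ω n d) :
    toWords ω n d (termRep ω n d g t) = mapWords (Entry.move g) (toWords ω n d t) := by
  have : toWords ω n d ∘ₗ termRep ω n d g = mapWords (Entry.move g) ∘ₗ toWords ω n d := by
    refine Term.hom_ext ω fun x s => ?_
    change toWords ω n d (termRep ω n d g (simpleTensor ω x s)) =
      mapWords (Entry.move g) (toWords ω n d (simpleTensor ω x s))
    have h : lists ω ⟨x.move g, fun i => (s i).move g rfl⟩ =
        (lists ω ⟨x, s⟩).map (List.map (moveSubspace g)) := by
      rw [lists, lists, List.map_ofFn]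
      congr 1
      funext i
      change _ = (List.ofFn (s i).line).map (moveSubspace g)
      rw [List.map_ofFn]
      rfl
    rw [termRep_simpleTensor, toWords_simpleTensor, toWords_simpleTensor, h, cls, cls, map_smul,
      mapWords_wordProd, List.map_map]
    congr 4
    funext l
    exact List.length_map _
  exact LinearMap.congr_fun this t

theorem chainToWords_chainRep (c : ChainGroup (TitsPoset ω) m) :
    chainToWords ω m (chainRep (TitsPoset ω) m (titsHom ω g) c) =
      mapWords (Entry.move g) (chainToWords ω m c) := by
  have : chainToWords ω m ∘ₗ chainRep (TitsPoset ω) m (titsHom ω g) =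
      mapWords (Entry.move g) ∘ₗ chainToWords ω m := by
    refine Finsupp.lhom_ext' fun s => LinearMap.ext_ring ?_
    change chainToWords ω m (Finsupp.mapDomain (Chain.map (titsHom ω g)) (Finsupp.single s 1)) =
      mapWords (Entry.move g) (chainToWords ω m (Finsupp.single s 1))
    rw [Finsupp.mapDomain_single, chainToWords, Finsupp.linearCombination_single,
      Finsupp.linearCombination_single, one_smul, one_smul]
    split_ifs
    · rw [mapWords_letter, map_wedgeOf, List.map_cons, moveSubspace_top, chainList, chainList,
        List.map_ofFn]
      rfl
    · rw [mapWords_single, mapWord]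
  exact LinearMap.congr_fun this c

end Action

/-! ### The augmentation -/

section Augmentation

variable {K V : Type*} [Field K] [AddCommGroup V] [Module K V] {ω : LinearMap.BilinForm K V}
  {n : ℕ}

/-- A complex of words that is invariant under the symplectic group and equivalent both to the
complex spanned by the words in `totalWords ω` and to the complex of chains of isotropic
subspaces. -/
structure Comparison (ω : LinearMap.BilinForm K V) (n : ℕ) (N T : Set (List (Finset (Entry K V)))) :
    Prop extends ComparisonData (diff ω : Words ℤ (Entry K V) →ₗ[ℤ] _) wordDegree n N
      (totalWords ω) T where
  invariant : ∀ g : Sp ω, ∀ w ∈ N, imageWord (Entry.move g) w ∈ N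
  injective : Function.Injective (chainToWords ω n)
  range_eq : LinearMap.range (chainToWords ω n) =
    Finsupp.supported ℤ ℤ {w | w ∈ T ∧ wordDegree w = n}
  mem_cycles : ∀ c, c ∈ cycles (TitsPoset ω) n ↔ diff ω (chainToWords ω n c) = 0
  isEmpty : IsEmpty (Chain (TitsPoset ω) (n + 1))

/-- If `V = 0`, the entry `V` of the words of chains would be zero; then both complexes are the one
spanned by the empty word. -/
theorem exists_comparison [FiniteDimensional K V] (hω : ω.IsAlt)
    (hn : (ω.restrict ⊤).Nondegenerate) (hV : Module.finrank K V = 2 * n) :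
    ∃ N T, Comparison ω n N T := by
  cases subsingleton_or_nontrivial V with
  | inr h =>
    obtain ⟨k, rfl⟩ : ∃ k, n = k + 1 := by
      have := Module.finrank_pos (R := K) (M := V)
      exact ⟨n - 1, by omega⟩
    refine ⟨_, _, comparisonData_of_nontrivial hω hn hV, fun g w hw => ?_,
      chainToWords_injective hω hn, range_chainToWords hω hn, fun c => ?_,
      ⟨fun s => absurd (chain_length_le hω hn hV s) (by omega)⟩⟩
    · rcases hw with (hw | hw) | hw
      · exact Or.inl (Or.inl (imageWord_mem_starWords hw))
      · exact Or.inl (Or.inr (imageWord_mem_totalWords hw))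
      · exact Or.inr (imageWord_mem_mixedWords hw)
    · rw [diff_chainToWords hω hn, neg_eq_zero,
        (chainToWords_injective hω hn).eq_iff' (map_zero _)]
      rfl
  | inl h =>
    obtain rfl : n = 0 := by
      have := Module.finrank_zero_of_subsingleton (R := K) (M := V)
      omega
    have hnil : ∀ w ∈ totalWords ω, w = [] := fun w hw =>
      eq_nil_of_tot_eq_bot hw.1 (Subsingleton.elim _ _)
    have hmem : [] ∈ totalWords ω := ⟨trivial, Subsingleton.elim _ _⟩
    have hj : ∀ s : Chain (TitsPoset ω) 0,
        chainToWords ω 0 (Finsupp.single s 1) = Finsupp.single [] 1 := fun s => by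
      rw [chainToWords, Finsupp.linearCombination_single, one_smul,
        if_neg (not_nontrivial_iff_subsingleton.2 h)]
    have hrefl : RelAcyclic (diff ω : Words ℤ (Entry K V) →ₗ[ℤ] _) (totalWords ω) (totalWords ω) :=
      fun x hx _ => ⟨0, zero_mem _, by rwa [map_zero, sub_zero]⟩
    let s₀ : Chain (TitsPoset ω) 0 := ⟨Fin.elim0, fun i => i.elim0⟩
    have hs₀ : ∀ s : Chain (TitsPoset ω) 0, s = s₀ := fun s =>
      Subtype.ext (funext fun i => i.elim0)
    have hc : ∀ c : ChainGroup (TitsPoset ω) 0, c = c s₀ • Finsupp.single s₀ 1 := fun c => by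
      ext s
      rw [hs₀ s]
      simp
    have hjc : ∀ c : ChainGroup (TitsPoset ω) 0,
        chainToWords ω 0 c = c s₀ • Finsupp.single [] 1 := fun c => by
      conv_lhs => rw [hc c, map_smul, hj]
    refine ⟨totalWords ω, totalWords ω, ⟨diff_diff hω.isRefl, diff_mem_wordDegree ω,
      isClosedUnder_totalWords hω, subset_rfl, subset_rfl, hrefl,
      hrefl, fun w hw => ?_, fun w hw => ?_⟩, fun g w hw => imageWord_mem_totalWords hw,
      fun c c' h => ?_, ?_, fun c => ?_, ⟨fun s => (s.1 0).2.1 (Subsingleton.elim _ _)⟩⟩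
    · rw [hnil w hw]
      simp [wordDegree]
    · rw [hnil w hw]
      simp [wordDegree]
    · rw [hjc, hjc] at h
      have h1 := DFunLike.congr_fun h []
      rw [hc c, hc c']
      congr 1
      simpa using h1
    · refine le_antisymm ?_ fun x hx => ?_
      · rintro _ ⟨c, rfl⟩
        rw [hjc]
        exact Submodule.smul_mem _ _ (single_mem_supported ⟨hmem, by simp [wordDegree]⟩)
      · refine map_mem_of_supported LinearMap.id (fun w hw => ?_) hx
        rw [hnil w hw.1]
        exact ⟨_, hj s₀⟩
    · rw [hjc, map_smul, diff, deriv_nil, smul_zero]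
      exact iff_of_true Submodule.mem_top rfl

variable {N T : Set (List (Finset (Entry K V)))} (H : Comparison ω n N T)
  [FiniteDimensional K V] (hω : ω.IsAlt) (hV : Module.finrank K V = 2 * n)

/-- The words in `N` of the degree that corresponds to degree `d` of the resolution. -/
def wordsIn (N : Set (List (Finset (Entry K V)))) (n d : ℕ) : Set (List (Finset (Entry K V))) :=
  {w | w ∈ N ∧ wordDegree w = d + n}

/-- The chain `z` of isotropic subspaces is homologous to the element `c` of degree `0` of the
resolution. -/
def Homologous (ω : LinearMap.BilinForm K V) (n : ℕ) (N : Set (List (Finset (Entry K V))))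
    (c : Term ω n 0) (z : ChainGroup (TitsPoset ω) n) : Prop :=
  ∃ y ∈ Finsupp.supported ℤ ℤ (wordsIn N n 1), toWords ω n 0 c - chainToWords ω n z = diff ω y

omit [FiniteDimensional K V] in
theorem wordsIn_one : wordsIn N n 1 = {w | w ∈ N ∧ wordDegree w = (n : ℤ) + 1} := by
  ext w
  change _ ∧ _ ↔ _ ∧ _
  rw [Nat.cast_one, add_comm]

omit [FiniteDimensional K V] in
theorem termWords_zero : termWords ω n 0 = {w | w ∈ totalWords ω ∧ wordDegree w = (n : ℤ)} := by
  ext w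
  change _ ∧ _ ↔ _ ∧ _
  rw [Nat.cast_zero, zero_add]

omit [FiniteDimensional K V] in
theorem Homologous.add {c c' : Term ω n 0} {z z' : ChainGroup (TitsPoset ω) n}
    (h : Homologous ω n N c z) (h' : Homologous ω n N c' z') :
    Homologous ω n N (c + c') (z + z') := by
  obtain ⟨y, hy, h⟩ := h
  obtain ⟨y', hy', h'⟩ := h'
  exact ⟨y + y', add_mem hy hy', by rw [map_add, map_add, map_add, ← h, ← h']; abel⟩

omit [FiniteDimensional K V] in
theorem Homologous.smul (a : ℤ) {c : Term ω n 0} {z : ChainGroup (TitsPoset ω) n}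
    (h : Homologous ω n N c z) : Homologous ω n N (a • c) (a • z) := by
  obtain ⟨y, hy, h⟩ := h
  exact ⟨a • y, Submodule.smul_mem _ _ hy, by rw [map_smul, map_smul, map_smul, ← h, smul_sub]⟩

include H

omit [FiniteDimensional K V] in
/-- There is at most one cycle of the Tits building homologous to a given element, as the building has
no simplices above dimension `n - 1`. -/
theorem Homologous.unique {c : Term ω n 0} {z z' : ChainGroup (TitsPoset ω) n}
    (h : Homologous ω n N c z) (h' : Homologous ω n N c z') : z = z' := by
  obtain ⟨y, hy, h⟩ := h
  obtain ⟨y', hy', h'⟩ := h'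
  rw [wordsIn_one] at hy hy'
  refine H.injective (sub_eq_zero.1 ?_)
  refine H.eq_zero_of_eq_diff (y := y' - y) ?_ (sub_mem hy' hy) ?_
  · rw [← H.range_eq]
    exact sub_mem ⟨z, rfl⟩ ⟨z', rfl⟩
  · rw [map_sub, ← h, ← h']
    abel

omit [FiniteDimensional K V] in
theorem Homologous.move (g : Sp ω) {c : Term ω n 0} {z : ChainGroup (TitsPoset ω) n}
    (h : Homologous ω n N c z) :
    Homologous ω n N (termRep ω n 0 g c) (chainRep (TitsPoset ω) n (titsHom ω g) z) := by
  obtain ⟨y, hy, h⟩ := h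
  have hm : ∀ w ∈ wordsIn N n 1, imageWord (Entry.move g) w ∈ wordsIn N n 1 := fun w hw =>
    ⟨H.invariant g w hw.1, (wordDegree_imageWord (Entry.move_injective g) w).trans hw.2⟩
  refine ⟨mapWords (Entry.move g) y, mapWords_mem_supported (Entry.move_injective g) hm hy, ?_⟩
  rw [toWords_termRep, chainToWords_chainRep, diff_mapWords, ← h, map_sub]

include hω hV

theorem exists_homologous (c : Term ω n 0) : ∃ z ∈ cycles (TitsPoset ω) n, Homologous ω n N c z := by
  have h1 := toWords_mem (d := 0) hω.isRefl hV c
  rw [termWords_zero] at h1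
  obtain ⟨t, ht, y, hy, h⟩ := H.exists_chain h1 (H.diff_eq_zero h1)
  rw [← H.range_eq] at ht
  obtain ⟨z, rfl⟩ := ht
  refine ⟨z, (H.mem_cycles z).2 ?_, y, by rwa [wordsIn_one], h⟩
  rw [← sub_sub_cancel (toWords ω n 0 c) (chainToWords ω n z), h, map_sub, H.diff_diff,
    H.diff_eq_zero h1, sub_zero]

theorem exists_homologous_of_mem_cycles {z : ChainGroup (TitsPoset ω) n}
    (hz : z ∈ cycles (TitsPoset ω) n) : ∃ c : Term ω n 0, Homologous ω n N c z := by
  have ht : chainToWords ω n z ∈ Finsupp.supported ℤ ℤ {w | w ∈ T ∧ wordDegree w = n} := by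
    rw [← H.range_eq]
    exact ⟨z, rfl⟩
  obtain ⟨x, hx, y, hy, h⟩ := H.exists_preimage ht ((H.mem_cycles z).1 hz)
  rw [← termWords_zero] at hx
  refine ⟨ofWords ω n 0 x, y, by rwa [wordsIn_one], ?_⟩
  rw [toWords_ofWords hω.isRefl hV hx, h]

theorem homologous_zero_iff {c : Term ω n 0} :
    Homologous ω n N c 0 ↔ c ∈ Set.range (termDiff ω n 0) := by
  constructor
  · rintro ⟨y, hy, h⟩
    rw [map_zero, sub_zero] at h
    have h1 := toWords_mem (d := 0) hω.isRefl hV c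
    rw [termWords_zero] at h1
    rw [wordsIn_one] at hy
    obtain ⟨z, hz, hcz⟩ := H.exact_of_boundary h1 hy h
    have hz' : z ∈ Finsupp.supported ℤ ℤ (termWords ω n 1) := by
      change z ∈ Finsupp.supported ℤ ℤ (wordsIn (totalWords ω) n 1)
      rwa [wordsIn_one]
    refine ⟨ofWords ω n 1 z, toWords_injective ?_⟩
    rw [toWords_termDiff hω hV, toWords_ofWords hω.isRefl hV hz', hcz]
  · rintro ⟨c', rfl⟩
    have hle : termWords ω n 1 ⊆ wordsIn N n 1 := fun w hw => ⟨H.subset_C hw.1, hw.2⟩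
    refine ⟨toWords ω n 1 c', Finsupp.supported_mono hle (toWords_mem hω.isRefl hV c'), ?_⟩
    rw [map_zero, sub_zero, toWords_termDiff hω hV]

/-- The resolution is exact in positive degrees. -/
theorem exact_termDiff (d : ℕ) : Function.Exact (termDiff ω n (d + 1)) (termDiff ω n d) := by
  intro x
  constructor
  · intro hx
    have h1 : toWords ω n (d + 1) x ∈
        Finsupp.supported ℤ ℤ {w | w ∈ totalWords ω ∧ wordDegree w = ((d + 1 : ℕ) : ℤ) + n} :=
      toWords_mem hω.isRefl hV x
    obtain ⟨z, hz, hxz⟩ := H.exact_of_cycle (by push_cast; omega) h1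
      (by rw [← toWords_termDiff hω hV, hx, map_zero])
    have hz' : z ∈ Finsupp.supported ℤ ℤ (termWords ω n (d + 1 + 1)) := by
      rw [show ((d + 1 : ℕ) : ℤ) + n + 1 = ((d + 1 + 1 : ℕ) : ℤ) + n by push_cast; ring] at hz
      exact hz
    refine ⟨ofWords ω n (d + 1 + 1) z, toWords_injective ?_⟩
    rw [toWords_termDiff hω hV, toWords_ofWords hω.isRefl hV hz', hxz]
  · rintro ⟨y, rfl⟩
    refine toWords_injective ?_
    rw [toWords_termDiff hω hV, toWords_termDiff hω hV, diff_diff hω.isRefl, map_zero]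

omit H [FiniteDimensional K V] hω hV in
theorem termDiff_termRep [FiniteDimensional K V] (hω : ω.IsAlt)
    (hV : Module.finrank K V = 2 * n) (g : Sp ω) {d : ℕ} (x : Term ω n (d + 1)) :
    termDiff ω n d (termRep ω n (d + 1) g x) = termRep ω n d g (termDiff ω n d x) := by
  refine toWords_injective ?_
  rw [toWords_termDiff hω hV, toWords_termRep, diff_mapWords, toWords_termRep,
    toWords_termDiff hω hV]

/-- The augmentation of the resolution sends an element of degree `0` to the class of the unique
cycle of the Tits building homologous to it. -/
theorem exists_augmentation : ∃ ε : Term ω n 0 →ₗ[ℤ] Steinberg ω n,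
    (∀ (g : Sp ω) c, ε (termRep ω n 0 g c) = steinbergRep ω n g (ε c)) ∧
      Function.Surjective ε ∧ Function.Exact (termDiff ω n 0) ε := by
  choose z hz hcz using exists_homologous H hω hV
  have hu : ∀ {c z'}, Homologous ω n N c z' → z c = z' := fun h => Homologous.unique H (hcz _) h
  let ζ : Term ω n 0 →ₗ[ℤ] cycles (TitsPoset ω) n :=
    { toFun := fun c => ⟨z c, hz c⟩
      map_add' := fun c c' => Subtype.ext (hu ((hcz c).add (hcz c')))
      map_smul' := fun a c => Subtype.ext (hu ((hcz c).smul a)) }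
  have hb : (boundaries (TitsPoset ω) n).submoduleOf (cycles (TitsPoset ω) n) = ⊥ := by
    rw [eq_bot_iff]
    rintro ⟨_, _⟩ ⟨b, rfl⟩
    have := H.isEmpty
    rw [Submodule.mem_bot]
    refine Subtype.ext ?_
    change boundary (TitsPoset ω) n b = 0
    rw [Subsingleton.elim b 0, map_zero]
  refine ⟨((boundaries (TitsPoset ω) n).submoduleOf (cycles (TitsPoset ω) n)).mkQ ∘ₗ ζ,
    fun g c => ?_, ?_, fun c => ?_⟩
  · have : ζ (termRep ω n 0 g c) = (chainRep (TitsPoset ω) n).subrepresentation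
        (cycles (TitsPoset ω) n) (cycles_le (TitsPoset ω) n) (titsHom ω g) (ζ c) :=
      Subtype.ext (hu (Homologous.move H g (hcz c)))
    change Submodule.Quotient.mk (ζ (termRep ω n 0 g c)) = _
    rw [this]
    rfl
  · refine (Submodule.mkQ_surjective _).comp fun z' => ?_
    obtain ⟨c, hc⟩ := exists_homologous_of_mem_cycles H hω hV z'.2
    exact ⟨c, Subtype.ext (hu hc)⟩
  · rw [← homologous_zero_iff H hω hV]
    change Submodule.Quotient.mk (ζ c) = 0 ↔ _
    rw [Submodule.Quotient.mk_eq_zero, hb, Submodule.mem_bot]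
    constructor
    · intro h
      have h1 : z c = 0 := congrArg Subtype.val h
      exact h1 ▸ hcz c
    · exact fun h => Subtype.ext (hu h)

end Augmentation

/-! ### Projectivity of signed permutation representations -/

section SignedPermutation

variable {G ι M : Type*} [Group G] [MulAction G ι] [AddCommGroup M] [Module ℚ M]

/-- A chosen representative of the orbit of `i`. -/
def orbitRep (G : Type*) {ι : Type*} [Group G] [MulAction G ι] (i : ι) : ι :=
  Quotient.out (Quotient.mk (MulAction.orbitRel G ι) i)

theorem orbitRep_smul (h : G) (i : ι) : orbitRep G (h • i) = orbitRep G i :=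
  congrArg Quotient.out (Quotient.sound (s := MulAction.orbitRel G ι) ⟨h, rfl⟩)

theorem exists_smul_orbitRep (i : ι) : ∃ g : G, g • orbitRep G i = i :=
  MulAction.mem_orbit_symm.1 (Quotient.mk_out (s := MulAction.orbitRel G ι) i)

/-- A rational representation whose group permutes a basis up to signs, with finite stabilizers,
is projective: the canonical surjection from the free module on that basis is split by averaging
over the finitely many `g` that carry the chosen representative of an orbit to a given basis
vector. -/
theorem projective_of_signed_permutation (ρ : Representation ℚ G M) (b : Module.Basis ι ℚ M)
    (hb : ∀ g i, ∃ e : ℕ, ρ g (b i) = (-1 : ℚ) ^ e • b (g • i))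
    (hfin : ∀ i j : ι, {g : G | g • i = j}.Finite) :
    Module.Projective (MonoidAlgebra ℚ G) ρ.asModule := by
  classical
  -- The free module on `ι`, the `ℚ`-linear map `u` that takes `b i` to its generator, and the
  -- coset `T i` of elements that move the chosen representative to `i`.
  let F := ι →₀ MonoidAlgebra ℚ G
  let u : M →ₗ[ℚ] F := b.constr ℚ fun i => Finsupp.single i 1
  let T : ι → Finset G := fun i => (hfin (orbitRep G i) i).toFinset
  have memT : ∀ i g, g ∈ T i ↔ g • orbitRep G i = i := fun i g => by simp [T]
  have hT : ∀ (h : G) i, T (h • i) = (T i).map (mulLeftEmbedding h) := fun h i => by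
    ext g
    rw [memT, orbitRep_smul, Finset.mem_map]
    constructor
    · intro hg
      refine ⟨h⁻¹ * g, (memT _ _).2 ?_, by simp⟩
      rw [mul_smul, hg, inv_smul_smul]
    · rintro ⟨g, hg, rfl⟩
      rw [mulLeftEmbedding_apply, mul_smul, (memT _ _).1 hg]
  -- The average of the conjugates `g u g⁻¹` for `g ∈ T i`. As `T (h i) = h T i`, conjugation with `h`
  -- takes the average for `i` to the one for `h i`; the signs need not be made explicit.
  let A : ι → M →ₗ[ℚ] F := fun i => ((T i).card : ℚ)⁻¹ •
    ∑ g ∈ T i,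
      (Module.toModuleEnd ℚ F (MonoidAlgebra.single g (1 : ℚ)) : F →ₗ[ℚ] F) ∘ₗ u ∘ₗ ρ g⁻¹
  have hA : ∀ i m, A i m = ((T i).card : ℚ)⁻¹ •
      ∑ g ∈ T i, (MonoidAlgebra.single g (1 : ℚ)) • u (ρ g⁻¹ m) := fun i m => by
    simp [A]
  let σ : M →ₗ[ℚ] F := b.constr ℚ fun i => A i (b i)
  have hσ : ∀ i, σ (b i) = A i (b i) := fun i => b.constr_basis ℚ _ i
  have hAh : ∀ (h : G) i m, A (h • i) (ρ h m) = MonoidAlgebra.single h (1 : ℚ) • A i m := by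
    intro h i m
    rw [hA, hA, hT, Finset.card_map, Finset.sum_map, smul_comm (MonoidAlgebra.single h (1 : ℚ)),
      Finset.smul_sum (r := MonoidAlgebra.single h (1 : ℚ))]
    refine congrArg (((T i).card : ℚ)⁻¹ • ·) (Finset.sum_congr rfl fun g _ => ?_)
    rw [mulLeftEmbedding_apply, smul_smul, MonoidAlgebra.single_mul_single, one_mul, mul_inv_rev,
      map_mul, Module.End.mul_apply, ← Module.End.mul_apply (ρ h⁻¹), ← map_mul, inv_mul_cancel,
      map_one, Module.End.one_apply]
  have hσh : ∀ (h : G) m, σ (ρ h m) = MonoidAlgebra.single h (1 : ℚ) • σ m := by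
    intro h m
    have : σ ∘ₗ ρ h =
        (Module.toModuleEnd ℚ F (MonoidAlgebra.single h (1 : ℚ)) : F →ₗ[ℚ] F) ∘ₗ σ := by
      refine b.ext fun i => ?_
      change σ (ρ h (b i)) = MonoidAlgebra.single h (1 : ℚ) • σ (b i)
      obtain ⟨e, he⟩ := hb h i
      rw [hσ, ← hAh, he, LinearMap.map_smul, LinearMap.map_smul, hσ]
    exact LinearMap.congr_fun this m
  let s : ρ.asModule →ₗ[MonoidAlgebra ℚ G] F :=
    MonoidAlgebra.equivariantOfLinearOfComm (σ ∘ₗ ρ.asModuleEquiv.toLinearMap) fun g v => by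
      rw [Representation.single_smul, one_smul]
      exact hσh g (ρ.asModuleEquiv v)
  let π : F →ₗ[MonoidAlgebra ℚ G] ρ.asModule :=
    Finsupp.linearCombination _ fun i => ρ.asModuleEquiv.symm (b i)
  have hπu : ∀ m, π (u m) = ρ.asModuleEquiv.symm m := by
    intro m
    have : π.restrictScalars ℚ ∘ₗ u = ρ.asModuleEquiv.symm.toLinearMap := by
      refine b.ext fun i => ?_
      change π (u (b i)) = ρ.asModuleEquiv.symm (b i)
      rw [show u (b i) = Finsupp.single i 1 from b.constr_basis ℚ _ i]
      exact (Finsupp.linearCombination_single _ _ _).trans (one_smul _ _)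
    exact LinearMap.congr_fun this m
  have hπσ : ∀ m, π (σ m) = ρ.asModuleEquiv.symm m := by
    intro m
    have : π.restrictScalars ℚ ∘ₗ σ = ρ.asModuleEquiv.symm.toLinearMap := by
      refine b.ext fun i => ?_
      change (π.restrictScalars ℚ) (σ (b i)) = ρ.asModuleEquiv.symm (b i)
      have hcard : ((T i).card : ℚ) ≠ 0 := by
        obtain ⟨g, hg⟩ := exists_smul_orbitRep (G := G) i
        exact Nat.cast_ne_zero.2 (Finset.card_ne_zero_of_mem ((memT i g).2 hg))
      rw [hσ, hA, map_smul, map_sum, Finset.sum_congr rfl (g := fun _ =>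
        ρ.asModuleEquiv.symm (b i)), Finset.sum_const, ← Nat.cast_smul_eq_nsmul ℚ, smul_smul,
        inv_mul_cancel₀ hcard, one_smul]
      intro g _
      change π (_ • _) = _
      rw [map_smul, hπu, Representation.single_smul, one_smul, LinearEquiv.apply_symm_apply]
      change ρ g (ρ g⁻¹ (b i)) = b i
      rw [← Module.End.mul_apply, ← map_mul, mul_inv_cancel, map_one, Module.End.one_apply]
    exact LinearMap.congr_fun this m
  refine Module.Projective.of_split s π (LinearMap.ext fun v => ?_)
  exact hπσ (ρ.asModuleEquiv v)

end SignedPermutation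

/-! ### Finiteness of stabilizers -/

section Stabilizers

variable {R K V : Type*} [CommRing R] [IsDomain R] [IsPrincipalIdealRing R] [Field K] [Algebra R K]
  [IsFractionRing R K] [AddCommGroup V] [Module K V] {n : ℕ} {ω : LinearMap.BilinForm K V}
  {b : Module.Basis (Fin n ⊕ Fin n) K V}

omit [IsDomain R] [IsPrincipalIdealRing R] in
theorem matrixHom_injective : Function.Injective (matrixHom R b) := fun A B h => by
  have h1 : Matrix.toLin b b (A.1.map (algebraMap R K)) =
      Matrix.toLin b b (B.1.map (algebraMap R K)) :=
    LinearMap.ext fun v => LinearEquiv.congr_fun h v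
  exact Subtype.ext (Matrix.map_injective (IsFractionRing.injective R K)
    ((Matrix.toLin b b).injective h1))

/-- An eigenvalue of a matrix over `R` is integral over `R`, hence lies in `R`, which is
integrally closed. -/
theorem mem_range_algebraMap_of_eigenvector (A : Matrix.symplecticGroup (Fin n) R) {v : V}
    (hv : v ≠ 0) {c : K} (h : matrixHom R b A v = c • v) : ∃ r : R, algebraMap R K r = c := by
  refine IsIntegrallyClosed.isIntegral_iff.1 ⟨A.1.charpoly, Matrix.charpoly_monic _, ?_⟩
  have : FiniteDimensional K V := b.finiteDimensional_of_finite
  have h1 : Module.End.HasEigenvalue (Matrix.toLin b b (A.1.map (algebraMap R K))) c :=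
    Module.End.hasEigenvalue_of_hasEigenvector
      ⟨Module.End.mem_eigenspace_iff.2 h, hv⟩
  have h2 := (Module.End.hasEigenvalue_iff_isRoot_charpoly _ _).1 h1
  rw [Matrix.charpoly_toLin, Matrix.charpoly_map, Polynomial.IsRoot, Polynomial.eval_map] at h2
  exact h2

/-- An eigenvalue of a matrix in `Sp_{2n}(R)` is a unit of `R`, since its inverse is an eigenvalue of
the inverse matrix. -/
theorem exists_unit_of_eigenvector (A : Matrix.symplecticGroup (Fin n) R) {v : V}
    (hv : v ≠ 0) {c : K} (h : matrixHom R b A v = c • v) :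
    ∃ u : Rˣ, algebraMap R K u = c := by
  have hA : matrixHom R b A⁻¹ (matrixHom R b A v) = v := by
    rw [← LinearEquiv.mul_apply, ← map_mul, inv_mul_cancel, map_one, LinearEquiv.coe_one, id]
  have hc : c ≠ 0 := by
    rintro rfl
    rw [zero_smul] at h
    exact hv (by rw [← hA, h, map_zero])
  obtain ⟨r, hr⟩ := mem_range_algebraMap_of_eigenvector A hv h
  obtain ⟨r', hr'⟩ := mem_range_algebraMap_of_eigenvector A⁻¹ hv (c := c⁻¹) (by
    nth_rw 2 [← hA]
    rw [h, map_smul, inv_smul_smul₀ hc])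
  have h1 : r * r' = 1 := IsFractionRing.injective R K (by
    rw [map_mul, hr, hr', map_one, mul_inv_cancel₀ hc])
  exact ⟨⟨r, r', h1, by rw [mul_comm, h1]⟩, hr⟩

variable (hb : IsSymplecticBasis ω b) [Finite Rˣ]

theorem finite_setOf_fixing {E : Finset (Entry K V)} (hE : ∀ a ∈ E, a.IsLine)
    (hE' : spanF E = ⊤) :
    {g : Matrix.symplecticGroup (Fin n) R | ∀ a ∈ E, a.move (spHom R hb g) = a}.Finite := by
  have hv : ∀ a : E, ∃ v : V, v ≠ 0 ∧ a.1.sub = Submodule.span K {v} := fun a => by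
    obtain ⟨v, hv0, hv⟩ := finrank_eq_one_iff'.1 (hE a a.2)
    refine ⟨v, fun h => hv0 (Subtype.ext h), le_antisymm (fun x hx => ?_) ?_⟩
    · obtain ⟨c, hc⟩ := hv ⟨x, hx⟩
      exact Submodule.mem_span_singleton.2 ⟨c, congrArg Subtype.val hc⟩
    · exact (Submodule.span_singleton_le_iff_mem _ _).2 v.2
  choose v hv0 hv using hv
  have hspan : Submodule.span K (Set.range v) = ⊤ := by
    refine top_le_iff.1 (hE'.symm.le.trans (Finset.sup_le fun a ha => ?_))
    rw [hv ⟨a, ha⟩]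
    exact Submodule.span_mono (Set.singleton_subset_iff.2 ⟨_, rfl⟩)
  -- A linear map that fixes the lines is determined by the images of the chosen generators, which are
  -- multiples of these generators by units of `R`.
  refine Set.Finite.of_injOn (f := fun g (a : E) => matrixHom R b g (v a))
    (t := {f | ∀ a, f a ∈ Set.range fun u : Rˣ => algebraMap R K u • v a})
    (fun g hg a => ?_) (fun g _ g' _ h => ?_) (Set.Finite.pi' fun a => Set.finite_range _)
  · have h1 : moveSubspace (spHom R hb g) a.1.sub = a.1.sub := congrArg Entry.sub (hg a a.2)
    have h2 : matrixHom R b g (v a) ∈ a.1.sub := by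
      rw [← h1]
      exact ⟨v a, by rw [hv]; exact Submodule.mem_span_singleton_self _, rfl⟩
    rw [hv] at h2
    obtain ⟨c, hc⟩ := Submodule.mem_span_singleton.1 h2
    obtain ⟨u, rfl⟩ := exists_unit_of_eigenvector g (hv0 a) hc.symm
    exact ⟨u, hc⟩
  · refine matrixHom_injective (b := b) (LinearEquiv.toLinearMap_injective
      (LinearMap.ext_on_range hspan fun a => congrFun h a))

theorem finite_setOf_moving {E E' : Finset (Entry K V)} (hE : ∀ a ∈ E, a.IsLine)
    (hE' : spanF E = ⊤) :
    {g : Matrix.symplecticGroup (Fin n) R | ∀ a ∈ E, a.move (spHom R hb g) ∈ E'}.Finite := by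
  have hmul : ∀ (g h : Matrix.symplecticGroup (Fin n) R) (a : Entry K V),
      a.move (spHom R hb (g * h)) = (a.move (spHom R hb h)).move (spHom R hb g) := fun g h a => by
    rw [map_mul]
    exact congrArg Entry.mk (moveSubspace_mul _ _ _)
  -- There are only finitely many maps from `E` to `E'`, and the elements inducing a given one form a
  -- coset of the subgroup that fixes all lines in `E`.
  refine Set.Finite.of_finite_fibers
    (f := fun g (a : E) => a.1.move (spHom R hb g)) ?_ fun f hf => ?_
  · refine (Set.Finite.pi' (t := fun _ : E => (E' : Set (Entry K V)))
      fun _ => E'.finite_toSet).subset ?_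
    rintro _ ⟨g, hg, rfl⟩ a
    exact hg a a.2
  · obtain ⟨g₀, -, rfl⟩ := hf
    refine ((finite_setOf_fixing hb hE hE').image (g₀ * ·)).subset ?_
    rintro g ⟨-, hg⟩
    refine ⟨g₀⁻¹ * g, fun a ha => ?_, mul_inv_cancel_left _ _⟩
    have h1 : a.move (spHom R hb g) = a.move (spHom R hb g₀) := congrFun hg ⟨a, ha⟩
    rw [hmul, h1, ← hmul, inv_mul_cancel, map_one]
    exact congrArg Entry.mk (moveSubspace_one _)

/-- The set of all entries of all factors of a word. -/
def entries (w : List (Finset (Entry K V))) : Finset (Entry K V) := w.toFinset.sup id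

theorem mem_entries {w : List (Finset (Entry K V))} {a : Entry K V} :
    a ∈ entries w ↔ ∃ A ∈ w, a ∈ A := by
  simp [entries, Finset.mem_sup]

/-- Lines spanning `V` are moved into a given finite set by only finitely many elements of
`Sp_{2n}(R)`: an element fixing all of them is determined by its eigenvalues, which are units
of `R`. -/
theorem finite_setOf_imageWord_eq {w w' : List (Finset (Entry K V))} (hw : w ∈ totalWords ω) :
    {g : Matrix.symplecticGroup (Fin n) R |
      imageWord (Entry.move (spHom R hb g)) w = w'}.Finite := by
  refine (finite_setOf_moving hb (E := entries w) (E' := entries w') (fun a ha => ?_) ?_).subset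
    fun g hg a ha => ?_
  · obtain ⟨A, hA, ha⟩ := mem_entries.1 ha
    exact ((good_iff.1 hw.1).1 A hA).isLine a ha
  · refine top_le_iff.1 (hw.2.symm.le.trans (tot_le.2 fun A hA => Finset.sup_mono fun a ha => ?_))
    exact mem_entries.2 ⟨A, hA, ha⟩
  · obtain ⟨A, hA, ha⟩ := mem_entries.1 ha
    rw [← show _ = w' from hg]
    exact mem_entries.2 ⟨_, List.mem_map_of_mem hA, Finset.mem_image_of_mem _ ha⟩

end Stabilizers

/-! ### Projectivity of the terms -/

section Projective

variable {K V : Type*} [Field K] [AddCommGroup V] [Module K V] [FiniteDimensional K V] {n d : ℕ}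
  {ω : LinearMap.BilinForm K V} (hω : ω.IsRefl) (hV : Module.finrank K V = 2 * n)

variable (d) in
/-- The degree-`d` term is free on the words that occur in it: a `ℤ`-basis consists of the simple
tensors whose factors have sorted entries, up to sign. -/
def termBasis : Module.Basis (termWords ω n d) ℤ (Term ω n d) :=
  .ofRepr <| LinearEquiv.ofBijective
    ((toWords ω n d).codRestrict _ (toWords_mem hω hV))
    ⟨fun _ _ h => toWords_injective (congrArg Subtype.val h), fun x =>
      ⟨ofWords ω n d x, Subtype.ext (toWords_ofWords hω hV x.2)⟩⟩ ≪≫ₗ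
    Finsupp.supportedEquivFinsupp (termWords ω n d)

theorem toWords_termBasis (w : termWords ω n d) :
    toWords ω n d (termBasis d hω hV w) = Finsupp.single w.1 1 := by
  have h : ((toWords ω n d).codRestrict _ (toWords_mem hω hV)) (termBasis d hω hV w) =
      (Finsupp.supportedEquivFinsupp (termWords ω n d)).symm (Finsupp.single w 1) := by
    rw [LinearEquiv.eq_symm_apply]
    exact (termBasis d hω hV).repr_self w
  have h' := congrArg Subtype.val h
  rwa [Finsupp.supportedEquivFinsupp_symm_single] at h'

/-- The symplectic group permutes the words that occur in degree `d`. -/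
@[reducible] def wordAction {G : Type*} [Group G] (φ : G →* Sp ω) :
    MulAction G (termWords ω n d) where
  smul g w := ⟨imageWord (Entry.move (φ g)) w.1, imageWord_mem_totalWords w.2.1, by
    rw [wordDegree_imageWord (Entry.move_injective _), w.2.2]⟩
  one_smul w := Subtype.ext <| by
    have h : Entry.move (φ 1) = id := funext fun a => by
      rw [map_one]
      exact congrArg Entry.mk (moveSubspace_one _)
    change imageWord (Entry.move (φ 1)) w.1 = w.1
    rw [imageWord, h, show Finset.image (id : Entry K V → Entry K V) = id from
      funext fun A => Finset.image_id, List.map_id]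
  mul_smul g g' w := Subtype.ext <| by
    have h : Entry.move (φ (g * g')) = Entry.move (φ g) ∘ Entry.move (φ g') := funext fun a => by
      rw [map_mul]
      exact congrArg Entry.mk (moveSubspace_mul _ _ _)
    change imageWord (Entry.move (φ (g * g'))) w.1 =
      imageWord (Entry.move (φ g)) (imageWord (Entry.move (φ g')) w.1)
    rw [imageWord, imageWord, imageWord, List.map_map, h]
    exact congrArg (fun f => w.1.map f) (funext fun A => (Finset.image_image).symm)

include hω hV in
/-- If `R` has finitely many units, the terms of the resolution become projective over `ℚ`. -/
theorem projective_ratRep {R : Type*} [CommRing R] [IsDomain R] [IsPrincipalIdealRing R]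
    [Algebra R K] [IsFractionRing R K] [Finite Rˣ] {b : Module.Basis (Fin n ⊕ Fin n) K V}
    (hb : IsSymplecticBasis ω b) (d : ℕ) :
    Module.Projective (MonoidAlgebra ℚ (Matrix.symplecticGroup (Fin n) R))
      (ratRep ((termRep ω n d).comp (spHom R hb))).asModule := by
  let := wordAction (n := n) (d := d) (spHom R hb)
  refine projective_of_signed_permutation _ ((termBasis d hω hV).baseChange ℚ)
    (fun g w => ?_) fun w w' => ?_
  · obtain ⟨e, he⟩ := exists_mapWords_single (Entry.move_injective (spHom R hb g)) w.1
    refine ⟨e, ?_⟩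
    have h1 : termRep ω n d (spHom R hb g) (termBasis d hω hV w) =
        (-1 : ℤ) ^ e • termBasis d hω hV (g • w) := by
      refine toWords_injective ?_
      rw [toWords_termRep, toWords_termBasis, he, map_zsmul, toWords_termBasis]
      rfl
    rw [Module.Basis.baseChange_apply, Module.Basis.baseChange_apply]
    change (1 : ℚ) ⊗ₜ[ℤ] termRep ω n d (spHom R hb g) (termBasis d hω hV w) = _
    rw [h1, TensorProduct.tmul_smul, ← Int.cast_smul_eq_zsmul ℚ, Int.cast_pow, Int.cast_neg,
      Int.cast_one]
  · refine (finite_setOf_imageWord_eq hb (w' := w'.1) w.2.1).subset fun g hg => ?_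
    exact congrArg Subtype.val (show g • w = w' from hg)

end Projective

/-! ### Symplectic bases -/

section SymplecticBasis

variable {K V : Type*} [Field K] [AddCommGroup V] [Module K V] {n : ℕ}
  {ω : LinearMap.BilinForm K V} {b : Module.Basis (Fin n ⊕ Fin n) K V}

/-- The form in coordinates with respect to a symplectic basis. -/
theorem IsSymplecticBasis.apply_eq (hb : IsSymplecticBasis ω b) (x y : V) :
    ω x y = ∑ i, (b.repr x (Sum.inl i) * b.repr y (Sum.inr i) -
      b.repr x (Sum.inr i) * b.repr y (Sum.inl i)) := by
  conv_lhs => rw [← b.sum_repr x, ← b.sum_repr y]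
  simp only [Fintype.sum_sum_type, map_add, map_sum, map_smul, LinearMap.add_apply,
    LinearMap.sum_apply, LinearMap.smul_apply, hb.inl_inl, hb.inr_inr, hb.inl_inr, hb.inr_inl,
    smul_eq_mul, mul_zero, Finset.sum_const_zero, zero_add, add_zero, mul_ite, mul_one, mul_neg,
    Finset.sum_ite_eq', Finset.mem_univ, if_true, Finset.sum_neg_distrib, Finset.sum_sub_distrib]
  rw [neg_add_eq_sub]
  simp only [mul_comm]

theorem IsSymplecticBasis.isAlt (hb : IsSymplecticBasis ω b) : ω.IsAlt := fun x => by
  rw [hb.apply_eq]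
  exact Finset.sum_eq_zero fun i _ => by rw [mul_comm, sub_self]

theorem IsSymplecticBasis.nondegenerate (hb : IsSymplecticBasis ω b) :
    (ω.restrict ⊤).Nondegenerate := by
  have key : ∀ x : V, (∀ i, ω x (b i) = 0) → x = 0 := by
    intro x hx
    refine b.ext_elem fun i => ?_
    rw [map_zero, Finsupp.zero_apply]
    rcases i with i | i
    · simpa [hb.apply_eq, Finsupp.single_apply] using hx (Sum.inr i)
    · simpa [hb.apply_eq, Finsupp.single_apply] using hx (Sum.inl i)
  constructor
  · intro x hx
    exact Subtype.ext (key x fun i => hx ⟨b i, Submodule.mem_top⟩)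
  · intro x hx
    refine Subtype.ext (key x fun i => ?_)
    exact hb.isAlt.isRefl _ _ (hx ⟨b i, Submodule.mem_top⟩)

theorem finrank_eq_of_basis (b : Module.Basis (Fin n ⊕ Fin n) K V) :
    Module.finrank K V = 2 * n := by
  rw [Module.finrank_eq_card_basis b, Fintype.card_sum, Fintype.card_fin, two_mul]

end SymplecticBasis

end SymplecticSharbly

end

open SymplecticSharbly in
theorem mainTheorem1 {R K V : Type*} [CommRing R] [IsDomain R] [IsPrincipalIdealRing R]
    [Field K] [Algebra R K] [IsFractionRing R K] [AddCommGroup V] [Module K V]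
    (n : ℕ) (ω : LinearMap.BilinForm K V) (b : Module.Basis (Fin n ⊕ Fin n) K V)
    (hb : IsSymplecticBasis ω b) :
    ∃ (D : ∀ d : ℕ, Representation.IntertwiningMap
        ((termRep ω n (d + 1)).comp (spHom R hb)) ((termRep ω n d).comp (spHom R hb)))
      (ε : Representation.IntertwiningMap
        ((termRep ω n 0).comp (spHom R hb)) ((steinbergRep ω n).comp (spHom R hb))),
      (∀ (d : ℕ) (x : Index ω n (d + 1)) (s : ∀ i, LineTuple (x.W i) (x.k i)),
        D d (simpleTensor ω x s) =
          omitTerms ω (lists ω ⟨x, s⟩) + splitTerms ω (lists ω ⟨x, s⟩)) ∧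
      Function.Surjective ε ∧
      Function.Exact (D 0) ε ∧
      (∀ d : ℕ, Function.Exact (D (d + 1)) (D d)) ∧
      (Finite Rˣ →
        (∀ d : ℕ, Module.Projective (MonoidAlgebra ℚ (Matrix.symplecticGroup (Fin n) R))
          (ratRep ((termRep ω n d).comp (spHom R hb))).asModule) ∧
        Function.Surjective (ε.toLinearMap.baseChange ℚ) ∧
        Function.Exact ((D 0).toLinearMap.baseChange ℚ) (ε.toLinearMap.baseChange ℚ) ∧
        ∀ d : ℕ, Function.Exact ((D (d + 1)).toLinearMap.baseChange ℚ)
          ((D d).toLinearMap.baseChange ℚ)) := by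
  have := b.finiteDimensional_of_finite
  have hω := hb.isAlt
  have hV := finrank_eq_of_basis b
  obtain ⟨N, T, H⟩ := exists_comparison hω hb.nondegenerate hV
  obtain ⟨ε, hε, hsurj, hexact⟩ := exists_augmentation H hω hV
  have hD := exact_termDiff H hω hV
  refine ⟨fun d => ⟨termDiff ω n d, fun g => LinearMap.ext fun x =>
      termDiff_termRep hω hV (spHom R hb g) x⟩,
    ⟨ε, fun g => LinearMap.ext fun c => hε (spHom R hb g) c⟩,
    fun d x s => termDiff_simpleTensor hω.isRefl hV x s, hsurj, hexact, hD, fun _ =>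
    ⟨projective_ratRep hω.isRefl hV hb, LinearMap.lTensor_surjective ℚ hsurj,
      Module.Flat.lTensor_exact ℚ hexact, fun d => Module.Flat.lTensor_exact ℚ (hD d)⟩⟩
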